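/- **Setting.** Let $t_i\in\mathbb C$ ($i\in I$, $I$ finite, $|I|\ge 2$) be distinct points with multiplicities $n_i\ge 1$, and put $\mathbb C[\varepsilon_i]=\mathbb C[X]/(X^{n_i})$, $m+1=\sum_i n_i$. Let $c^{(i)}_j\in\mathbb C$ ($0\le j<n_i$) satisfy $\operatorname{Im}c^{(i)}_0\in\mathbb Z$, $\sum_i c_0^{(i)}=0$ and $c^{(i)}_{n_i-1}\ne 0$ whenever $n_i\ge 2$; put $\chi_i(\sum_j b_j\varepsilon_i^j)=\sqrt{-1}\,\operatorname{Re}\sum_j c^{(i)}_jb_j$. Write $\mathbf u_i=\sum_{j<n_i}u_i^{(j)}\varepsilon_i^j$. Let $\mathcal H$ be the Hilbert space of square-integrable half-densities on $\mathbb P^{m-1}$, i.e. of functions $\psi((\mathbf u_i)_i)$ on $\mathbb C^{m+1}$ that are invariant under $\mathbf u_i\mapsto \mathbf u_i+b$ ($b\in\mathbb C$), satisfy $\psi(z\mathbf u)=|z|^{-m}\psi(\mathbf u)$ for $z\in\mathbb C^\times$, and are locally square-integrable off the line $\{\mathbf u_i=b\ \forall i\}$. For $x\in\mathbb C\setminus\{t_i\}$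 let $$H_x\psi(\mathbf u)=\prod_i|t_i-x|^{n_i}e^{-\frac12\chi_i(\log(t_i+\varepsilon_i-x))}\int_{\mathbb C}\psi\Big(\Big(\tfrac{t_i+\varepsilon_i-x}{s-\mathbf u_i}\Big)_i\Big)\frac{e^{\sum_i\chi_i(\log(s-\mathbf u_i))}}{\prod_i|s-u_i^{(0)}|^{2n_i}}\,ds\,d\bar s .$$ The choice of the logarithms of $t_i-x$ affects $H_x$ only by a sign (not at all if all $\operatorname{Im}c_0^{(i)}$ are even). A function $\beta_k$ on $\mathbb C\setminus\{t_i\}$ is a joint eigenvalue if its joint eigenspace $\mathcal H_k=\{\psi\in\mathcal H: H_x\psi=\beta_k(x)\psi\ \forall x\ne t_i\}$ is nonzero. Let $\mathbb C[\varepsilon_i]\otimes\mathfrak{sl}_2$ act on functions of $\mathbf u_i$ by the holomorphic derivative of the right action $$\rho(g)f(z)=f\big(\tfrac{Az+B}{Cz+D}\big)\left|\tfrac{\det g_0}{(C_0z_0+D_0)^2}\right|^{n_i}e^{\chi_i(\log(Cz+D)-\frac12\log\det g)},\qquad g=\begin{pmatrix}A&B\\C&D\end{pmatrix}.$$ For $a\in\{e,f,h\}$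 put $a(x)=\sum_i\sum_{j<n_i}\frac{\varepsilon_i^ja}{(x-t_i)^{j+1}}$, and let $G(x)$ be the differential operator that is the image of $e(x)f(x)+\frac14h(x)^2+\frac12h'(x)$ (products being reversed, since the action is a right action). Let $G_i^{(j)}$ be the coefficients in $G(x)=\sum_{i}\sum_{j\ge0}\frac{G_i^{(j)}}{(x-t_i)^{j+1}}$. **Statement.** The operator $G_i^{(j)}$ acts on smooth functions as a number $l_i^{(j)}$ for $n_i\le j<2n_i$ and as $0$ for $j\ge 2n_i$, and $l_i^{(2n_i-1)}\neq0$ if $n_i\ge2$. For every joint eigenvalue $\beta_k$ there are numbers $\mu_{i,j,k}$ ($j<n_i$) such that $G_i^{(j)}\psi=\mu_{i,j,k}\psi$ in the sense of distributions (off the line $\{\mathbf u_i=b\ \forall i\}$) for all $\psi\in\mathcal H_k$, and, on every open subset of $\mathbb C\setminus\{t_i\}$ on which the normalizing factor of $H_x$ is continuous, $\beta_k$ is $C^\infty$ and satisfies $$L(\mu_k)\beta_k=0,\qquad L(\mu_k)=\partial_x^2-\sum_i\sum_{j=n_i}^{2n_i-1}\frac{l_i^{(j)}}{(x-t_i)^{j+1}}-\sum_i\sum_{j<n_i}\frac{\mu_{i,j,k}}{(x-t_i)^{j+1}},$$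 where $\partial_x=\frac12(\partial_{\operatorname{Re}x}-\sqrt{-1}\,\partial_{\operatorname{Im}x})$. Thus $L(\mu_k)$ is an $SL_2$-oper (it has no $\partial_x$ term), with a pole of order exactly $2n_i\ge4$, i.e. an irregular singularity, at every $t_i$ with $n_i\ge2$. -/

import Mathlib

open MeasureTheory
open scoped ContDiff PowerSeries

noncomputable section

namespace WildHecke

/-! ### Coordinates

The finite marked points are `t i` (`i : ι`), with multiplicities `n i`.  The ring
`ℂ[ε_i] = ℂ[X]/(X ^ n i)` is handled through representatives in `ℂ⟦X⟧`, of which only the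
coefficients of index `< n i` are ever used. -/

/-- Index set of the coordinates `u_i^{(j)}`, `0 ≤ j < n i`. -/
abbrev Coord {ι : Type*} (n : ι → ℕ) : Type _ := (i : ι) × Fin (n i)

/-- The space of all tuples `(𝐮_i)_i`, `𝐮_i = ∑_j u_i^{(j)} ε_i^j ∈ ℂ[ε_i]`. -/
abbrev Cfg {ι : Type*} (n : ι → ℕ) : Type _ := Coord n → ℂ

variable {ι : Type*} [Fintype ι] {n : ι → ℕ}

/-- The element `𝐮_i = ∑_j u_i^{(j)} ε_i^j`. -/
def block (u : Cfg n) (i : ι) : ℂ⟦X⟧ :=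
  PowerSeries.mk fun j => if h : j < n i then u ⟨i, ⟨j, h⟩⟩ else 0

/-- The element `t_i + ε_i - x`. -/
def pointSub (t : ι → ℂ) (x : ℂ) (i : ι) : ℂ⟦X⟧ :=
  PowerSeries.C (t i - x) + PowerSeries.X

/-- The element `s - 𝐮_i`. -/
def lineSub (s : ℂ) (u : Cfg n) (i : ι) : ℂ⟦X⟧ :=
  PowerSeries.C s - block u i

/-- Coefficients of `log a` for `a ∈ ℂ[ε]` with nonzero constant term `a₀`, where `ℓ` is a chosen
logarithm of `a₀`:  `log a = ℓ + log (1 + (a / a₀ - 1))`. -/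
def epsLog (ℓ : ℂ) (a : ℂ⟦X⟧) (j : ℕ) : ℂ :=
  if j = 0 then ℓ
  else PowerSeries.coeff j
    ((PowerSeries.log ℂ).subst (PowerSeries.C (PowerSeries.constantCoeff a)⁻¹ * a - 1))

/-- The real-linear functional `χ (∑ b_j ε^j) = i Re ∑_{j < m} c_j b_j` on `ℂ[X]/(X ^ m)`. -/
def chi (m : ℕ) (c : ℕ → ℂ) (b : ℕ → ℂ) : ℂ :=
  Complex.I * (((∑ j ∈ Finset.range m, c j * b j).re : ℝ) : ℂ)

/-! ### Hecke operators -/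

/-- The tuple `((t_i + ε_i - x) / (s - 𝐮_i))_i`. -/
def moved (t : ι → ℂ) (x s : ℂ) (u : Cfg n) : Cfg n :=
  fun p => PowerSeries.coeff p.2.val (pointSub t x p.1 * (lineSub s u p.1)⁻¹)

/-- The modified Hecke operator
`ψ ↦ ∫ ψ((t_i + ε_i - x)/(s - 𝐮_i)) exp(∑ χ_i(log(s - 𝐮_i))) ∏ |s - u_i^{(0)}|^{-2 n_i} ds`,
for Lebesgue measure on `ℂ`.  The integrand does not depend on the logarithm of
`s - u_i^{(0)}` as soon as the numbers `Im (c i 0)` are integers. -/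
def modHecke (t : ι → ℂ) (c : ι → ℕ → ℂ) (x : ℂ) (ψ : Cfg n → ℂ) (u : Cfg n) : ℂ :=
  ∫ s : ℂ, ψ (moved t x s u) *
    (Complex.exp (∑ i, chi (n i) (c i)
        (epsLog (Complex.log (PowerSeries.constantCoeff (lineSub s u i))) (lineSub s u i))) /
      ((∏ i, ‖PowerSeries.constantCoeff (lineSub s u i)‖ ^ (2 * n i) : ℝ) : ℂ))

variable (n) in
/-- The scalar `∏ |t_i - x|^{n_i} exp(-½ χ_i(log(t_i + ε_i - x)))`, where `Λ i x` is the chosen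
logarithm of `t_i - x`. -/
def prefactor (t : ι → ℂ) (c : ι → ℕ → ℂ) (Λ : ι → ℂ → ℂ) (x : ℂ) : ℂ :=
  ∏ i, (((‖t i - x‖ ^ n i : ℝ) : ℂ) *
    Complex.exp (-(1 / 2) * chi (n i) (c i) (epsLog (Λ i x) (pointSub t x i))))

/-- The Hecke operator `H_x`. -/
def hecke (t : ι → ℂ) (c : ι → ℕ → ℂ) (Λ : ι → ℂ → ℂ) (x : ℂ) (ψ : Cfg n → ℂ) (u : Cfg n) : ℂ :=
  prefactor n t c Λ x * modHecke t c x ψ u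

/-! ### The Hilbert space -/

/-- Simultaneous translation of all the `𝐮_i` by the constant `b`. -/
def shift (b : ℂ) (u : Cfg n) : Cfg n :=
  fun p => u p + if p.2.val = 0 then b else 0

variable (n) in
/-- The line `{(b, …, b)}`; its complement modulo translations and dilations is the compact
projective space `ℙ^{m-1}`, where `m + 1 = ∑ n_i`. -/
def diagonal : Set (Cfg n) := Set.range fun b : ℂ => shift b (0 : Cfg n)

/-- Membership in the space `ℋ` of square-integrable half-densities on `ℙ^{m-1}`, `m + 1 = ∑ n_i`:
translation-invariant functions, homogeneous of degree `-m`, which are square-integrable on the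
quotient.  As the quotient of `Cfg n ∖ diagonal n` is compact, the latter means
locally square-integrable on `Cfg n ∖ diagonal n`.  Functions are not identified
when they agree almost everywhere. -/
structure MemH (ψ : Cfg n → ℂ) : Prop where
  measurable : Measurable ψ
  shift_eq : ∀ (b : ℂ) (u : Cfg n), ψ (shift b u) = ψ u
  smul_eq : ∀ (z : ℂ) (u : Cfg n), z ≠ 0 →
    ψ (z • u) = ((‖z‖ ^ (-(((∑ i, n i : ℕ) : ℤ) - 1)) : ℝ) : ℂ) * ψ u
  memLp : ∀ K : Set (Cfg n), IsCompact K → K ⊆ (diagonal n)ᶜ → MemLp ψ 2 (volume.restrict K)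

/-- `ψ` lies in the joint eigenspace of the operators `H_x`, `x ≠ t_i`, with eigenvalues `β x`. -/
def InEigenspace (t : ι → ℂ) (c : ι → ℕ → ℂ) (Λ : ι → ℂ → ℂ) (β : ℂ → ℂ) (ψ : Cfg n → ℂ) : Prop :=
  MemH ψ ∧ ∀ x : ℂ, (∀ i, x ≠ t i) → ∀ᵐ u : Cfg n, hecke t c Λ x ψ u = β x * ψ u

variable (n) in
/-- `β` is a joint eigenvalue of the Hecke operators: its joint eigenspace is nonzero. -/
def IsJointEigenvalue (t : ι → ℂ) (c : ι → ℕ → ℂ) (Λ : ι → ℂ → ℂ) (β : ℂ → ℂ) : Prop :=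
  ∃ ψ : Cfg n → ℂ, InEigenspace t c Λ β ψ ∧ ¬ ψ =ᵐ[volume] 0

/-! ### Differential operators -/

/-- Operators on functions of the coordinates. -/
abbrev Op {ι : Type*} (n : ι → ℕ) : Type _ := (Cfg n → ℂ) → Cfg n → ℂ

variable [DecidableEq ι]

/-- The holomorphic derivative `∂ / ∂u_p = ½ (∂ / ∂(Re u_p) - i ∂ / ∂(Im u_p))`. -/
def dCoord (p : Coord n) (φ : Cfg n → ℂ) (u : Cfg n) : ℂ :=
  (1 / 2) * (fderiv ℝ φ u (Pi.single p 1) - Complex.I * fderiv ℝ φ u (Pi.single p Complex.I))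

/-- The first order holomorphic differential operator `∑_p coef p ∂_p + pot`. -/
structure FirstOrder {ι : Type*} (n : ι → ℕ) where
  coef : Coord n → Cfg n → ℂ
  pot : Cfg n → ℂ

/-- Action of `∑_p coef p ∂_p + pot` on functions. -/
def FirstOrder.act (D : FirstOrder n) : Op n :=
  fun φ u => ∑ p, D.coef p u * dCoord p φ u + D.pot u * φ u

/-- The formal transpose `φ ↦ -∑_p ∂_p (coef p φ) + pot φ`. -/
def FirstOrder.transpose (D : FirstOrder n) : Op n :=
  fun φ u => -∑ p, dCoord p (fun v => D.coef p v * φ v) u + D.pot u * φ u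

/-- The `ℂ`-linear functional `b ↦ -m b₀ + (i/2) ∑_{j < m} c_j b_j` on `ℂ[X]/(X ^ m)`: the
holomorphic derivative at `b = 0` of `|exp(-b₀)|^{2m} exp(χ(b))`. -/
def dchi (m : ℕ) (c : ℕ → ℂ) (b : ℂ⟦X⟧) : ℂ :=
  -(m : ℂ) * PowerSeries.constantCoeff b +
    Complex.I / 2 * ∑ j ∈ Finset.range m, c j * PowerSeries.coeff j b

/-- The action of `ε_i^a X`, `X = (α, β; γ, -α) ∈ sl₂`, on the `i`-th factor: the holomorphic
derivative `d/dw` at `w = 0` of `ρ(1 + w ε_i^a X)`, where, for `g = (A, B; C, D)` over `ℂ[ε_i]`,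
`ρ(g) f (z) = f((A z + B)/(C z + D)) |det g₀/(C₀ z₀ + D₀)²|^{n_i} exp(χ_i(log(C z + D) - ½ log det g))`.
It is the vector field `ε^a (β + 2 α z - γ z²)` plus the function `dchi (ε^a (γ z - α))`,
where `z = 𝐮_i`.  As `ρ` is a right action, this is an antihomomorphism of Lie algebras. -/
def slAct (c : ι → ℕ → ℂ) (α β γ : ℂ) (i : ι) (a : ℕ) : FirstOrder n where
  coef p u := if p.1 = i then
      PowerSeries.coeff p.2.val (PowerSeries.X ^ a *
        (PowerSeries.C β + PowerSeries.C (2 * α) * block u i - PowerSeries.C γ * block u i ^ 2))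
    else 0
  pot u := dchi (n i) (c i)
    (PowerSeries.X ^ a * (PowerSeries.C γ * block u i - PowerSeries.C α))

/-- `ε_i^a e`, `e = (0, 1; 0, 0)`. -/
def opE (c : ι → ℕ → ℂ) (i : ι) (a : ℕ) : FirstOrder n := slAct c 0 1 0 i a

/-- `ε_i^a f`, `f = (0, 0; 1, 0)`. -/
def opF (c : ι → ℕ → ℂ) (i : ι) (a : ℕ) : FirstOrder n := slAct c 0 0 1 i a

/-- `ε_i^a h`, `h = (1, 0; 0, -1)`. -/
def opH (c : ι → ℕ → ℂ) (i : ι) (a : ℕ) : FirstOrder n := slAct c 1 0 0 i a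

/-- `A(x) = ∑_{i, a} A_{i,a} / (x - t_i)^{a+1}`. -/
def genOp (t : ι → ℂ) (A : ι → ℕ → Op n) (x : ℂ) : Op n :=
  fun φ u => ∑ i, ∑ a ∈ Finset.range (n i), A i a φ u / (x - t i) ^ (a + 1)

/-- `A'(x) = -∑_{i, a} (a + 1) A_{i,a} / (x - t_i)^{a+2}`. -/
def genOpDeriv (t : ι → ℂ) (A : ι → ℕ → Op n) (x : ℂ) : Op n :=
  fun φ u => -∑ i, ∑ a ∈ Finset.range (n i), ((a : ℂ) + 1) * A i a φ u / (x - t i) ^ (a + 2)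

/-- The generating function `G(x)`: the image of `e(x) f(x) + ¼ h(x)² + ½ h'(x)`.  Products are
reversed, because `slAct` comes from a right action. -/
def gaudinGen (t : ι → ℂ) (c : ι → ℕ → ℂ) (x : ℂ) : Op n :=
  fun φ u =>
    genOp t (fun i a => (opF c i a).act) x (genOp t (fun i a => (opE c i a).act) x φ) u +
    1 / 4 * genOp t (fun i a => (opH c i a).act) x (genOp t (fun i a => (opH c i a).act) x φ) u +
    1 / 2 * genOpDeriv t (fun i a => (opH c i a).act) x φ u

/-- The coefficient of `(x - t_i)^{-(j+1)}` in the partial fraction expansion of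
`½ (E(x) F(x) + F(x) E(x)) + ¼ H(x)²`.  The first sum is the contribution of the `i`-th point alone;
the second one is the contribution of the pairs of different points, as
`(x - t_i)^{-(a+1)} (x - t_k)^{-(b+1)}` has the coefficient
`(-1)^(a-j) (a-j+b choose b) (t_i - t_k)^{-(a-j+b+1)}` for `j ≤ a`, and `0` for `j > a`. -/
def gaudinOf (t : ι → ℂ) (E F H : ι → ℕ → Op n) (i : ι) (j : ℕ) : Op n :=
  fun φ u =>
    (∑ a ∈ Finset.range (n i), ∑ b ∈ Finset.range (n i),
      if a + b + 1 = j then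
        1 / 2 * (E i a (F i b φ) u + F i b (E i a φ) u) + 1 / 4 * H i a (H i b φ) u
      else 0) +
    ∑ k ∈ Finset.univ.erase i, ∑ a ∈ Finset.Ico j (n i), ∑ b ∈ Finset.range (n k),
      (-1) ^ (a - j) * (Nat.choose (a - j + b) b : ℂ) / (t i - t k) ^ (a - j + b + 1) *
        (E i a (F k b φ) u + F i a (E k b φ) u + 1 / 2 * H i a (H k b φ) u)

/-- The differential operator `G_i^{(j)}`. -/
def gaudin (t : ι → ℂ) (c : ι → ℕ → ℂ) (i : ι) (j : ℕ) : Op n :=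
  gaudinOf t (fun i a => (opE c i a).act) (fun i a => (opF c i a).act)
    (fun i a => (opH c i a).act) i j

/-- The formal transpose of `G_i^{(j)}`.  (The transpose reverses products, which
leaves the symmetric expression `gaudinOf` unchanged; operators at different points commute.) -/
def gaudinTranspose (t : ι → ℂ) (c : ι → ℕ → ℂ) (i : ι) (j : ℕ) : Op n :=
  gaudinOf t (fun i a => (opE c i a).transpose) (fun i a => (opF c i a).transpose)
    (fun i a => (opH c i a).transpose) i j

/-- `G_i^{(j)} ψ = μ ψ` in the sense of distributions on the complement of the diagonal line. -/
def DistribEigen (t : ι → ℂ) (c : ι → ℕ → ℂ) (i : ι) (j : ℕ) (ψ : Cfg n → ℂ) (μ : ℂ) : Prop :=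
  ∀ φ : Cfg n → ℂ, ContDiff ℝ ∞ φ → HasCompactSupport φ → tsupport φ ⊆ (diagonal n)ᶜ →
    ∫ u, ψ u * gaudinTranspose t c i j φ u = μ * ∫ u, ψ u * φ u

/-! ### The oper -/

/-- The holomorphic derivative `∂_x = ½ (∂ / ∂(Re x) - i ∂ / ∂(Im x))` of a function of
`x : ℂ` which need not be holomorphic. -/
def dHol (f : ℂ → ℂ) (x : ℂ) : ℂ :=
  (1 / 2) * (fderiv ℝ f x 1 - Complex.I * fderiv ℝ f x Complex.I)

variable (n) in
/-- The `SL₂`-oper `∂_x² - ∑_i ∑_{n_i ≤ j < 2 n_i} l_i^{(j)} / (x - t_i)^{j+1}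
- ∑_i ∑_{j < n_i} μ_{i,j} / (x - t_i)^{j+1}` (no first order term), applied to `f`. -/
def oper (t : ι → ℂ) (l μ : ι → ℕ → ℂ) (f : ℂ → ℂ) (x : ℂ) : ℂ :=
  dHol (dHol f) x -
    (∑ i, ∑ j ∈ Finset.Ico (n i) (2 * n i), l i j / (x - t i) ^ (j + 1)) * f x -
    (∑ i, ∑ j ∈ Finset.range (n i), μ i j / (x - t i) ^ (j + 1)) * f x

end WildHecke

end

/-! Write K_c(v) for the weight `kerWeight c v`, and w = s - (t_i + ε_i - x)/v_i for the tuple `mob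
t x s v`. In the Hecke integral, put v = s - u and then apply the involution v ↦ (t_i + ε_i -
x)/v_i. For a joint eigenfunction ψ and a test function φ off the diagonal this gives β(x) ∫ ψ φ =
A(x) P_φ(x), with P_φ(x) = ∬ ψ(v) K_{-c}(v) φ(w) dv ds, where A is the normalizing factor formed
with -c (`integral_modHecke_mul`, `eigenvalue_mul`). The dependence on x now sits in an explicit
kernel, although ψ is only measurable.

Differentiating A φ(w) in x inserts the operator h(x)/2 - s e(x). Differentiating K φ(w) along the
simultaneous translations v ↦ v + b inserts f(x) + s h(x) - s² e(x). With [h(x), e(x)] = 2 e'(x) for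
the operators in use, the second x-derivative of A φ(w) is A (G(x) φ)(w) minus A times (f(x) + s
h(x) - s² e(x)) e(x) φ at w (`kernel_equation`). Multiplied by K, the subtracted term is a
translation derivative, and it disappears on integration against the translation invariant ψ.
Formally, ∂²(A P_φ) = A P_{G φ}. The eigenvalue identity applied to G(x) φ turns the right side into
the eigenvalue times ∫ ψ G(x) φ. Fixing ψ₀, φ₀ with ∫ ψ₀ φ₀ = 1, the function γ = A P_{φ₀}, which is
β up to sign, satisfies ∂²γ = q γ with q(x) = ∫ ψ₀ G(x) φ₀, a rational function with poles at the
t_i (`pairCoeff`).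

Two analytic facts make this rigorous. The double integral converges absolutely and locally
uniformly in x: a weighted arithmetic-geometric inequality, with a weight built from two marked
points, reduces it to the integral of 1/(|q| |q-1| |q-a|) over the plane (`lintegral_kernel_le`).
The equation is proved in integrated form against a parametrix of ∂², a cut-off multiple of z / conj
z (`weak_equation`, `isParametrix_cutKer`). Convolution with this kernel gains one derivative, so
weak solutions are smooth (`IsWeakSolution.regularity`).

For any other ψ in the eigenspace and any φ, the same argument gives γ · (∫ ψ G(x) φ - q(x) ∫ ψ φ) =
0. The function γ is nonzero at some point: for x = X → ∞ a rescaling of v shows that, with N = ∑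
n_i, the s-integrand is about X^{-(N-1)} |s|^{-2} for 1 ≪ |s| ≪ X, which contributes X^{-(N-1)} log
X, whereas the remaining s contribute O(X^{-(N-1)}) (`exists_lintegral_compl_le`,
`exists_pairing_ne_zero`). On an open set with γ ≠ 0, uniqueness of partial fractions separates the
coefficients, whence μ_{i,j} = ∫ ψ₀ G_i^{(j)} φ₀ with G formed from -c. This is the distributional
statement, because transposing G_i^{(j)} amounts to replacing c by -c (`gaudinTranspose_eq`).

For j ≥ n_i only the point i contributes to G_i^{(j)}, and the Casimir combination loses its
derivatives: its symbol is z·z - 1·z² (`sum_ite_add_eq_of_le`). The resulting number is even in c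
(`gaudinScalar_neg`), so the coefficients found with -c are the l_i^{(j)}. -/

noncomputable section

set_option linter.unusedSectionVars false

namespace WildHecke

open PowerSeries (C C_inv HasSubst X X_pow_dvd_iff coeff coeff_C coeff_C_mul coeff_X_pow
  coeff_X_pow_mul' coeff_derivative coeff_inv coeff_mul coeff_mul_X_pow' coeff_one
  constantCoeff constantCoeff_C constantCoeff_inv derivative mk
  subst subst_X subst_add subst_mul)
open PowerSeries renaming coeff_zero_eq_constantCoeff_apply → coeff_zero_apply,
  mul_inv_cancel → mul_inv_self, inv_mul_cancel → inv_mul_self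
open scoped Real
open Finset (Ico mem_insert_of_mem mem_insert_self mem_range mem_univ mul_sum prod_congr
  prod_inv_distrib prod_mul_distrib prod_pos prod_pow prod_pow_eq_pow_sum range range_mono
  sum_add_distrib sum_bij' sum_comm sum_comm' sum_congr sum_div sum_eq_single sum_eq_zero
  sum_insert sum_ite_eq' sum_mul sum_neg_distrib sum_range_succ sum_range_succ' sum_sigma
  sum_sub_distrib sum_subset univ)
open Complex (I I_im I_mul_I I_re I_sq add_re conjCLE conjCLE_apply exp exp_add
  exp_eq_exp_iff_exists_int exp_log exp_ne_zero exp_sum exp_zero finrank_real_complex log mul_im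
  mul_re neg_re norm_conj norm_exp norm_ofNat norm_real ofRealCLM ofReal_exp ofReal_one
  ofReal_prod ofReal_zero one_re reCLM re_add_im re_ofReal_mul re_sum real_smul slitPlane
  volume_ball)
open ENNReal (add_lt_top mul_lt_top ofReal ofReal_add ofReal_le_ofReal ofReal_lt_top ofReal_mul
  ofReal_ne_top ofReal_pow toReal_mono toReal_ofReal)
open Metric (ball closedBall closedBall_subset_ball isClosed_closedBall isOpen_ball mem_ball
  mem_closedBall)
open Set (EqOn Icc Iio InjOn Ioi indicator_of_mem)
open Function (Injective notMem_support support uncurry_def)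
open Real (norm_of_nonneg rpow_neg)
open ContinuousLinearMap (toSpanSingleton toSpanSingleton_apply)
open Filter (Eventually)

variable {ι : Type*} [Fintype ι] [DecidableEq ι] {n : ι → ℕ} {t : ι → ℂ} {c : ι → ℕ → ℂ}
  {φ ψ f : Cfg n → ℂ} {i k : ι} {x z : ℂ} {r R : ℝ} {j m : ℕ} {a b : ℂ⟦X⟧}

section

/-! ### Power series modulo `X ^ m` -/

/-- Congruence of power series modulo `X ^ m`. -/
def PSCongr (m : ℕ) (a b : ℂ⟦X⟧) : Prop := (X : ℂ⟦X⟧) ^ m ∣ a - b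

theorem PSCongr.coeff_eq (h : PSCongr m a b) (hj : j < m) : coeff j a = coeff j b := by
  have := X_pow_dvd_iff.1 h j hj
  rwa [map_sub, sub_eq_zero] at this

theorem psCongr_iff : PSCongr m a b ↔ ∀ j < m, coeff j a = coeff j b := by
  simp only [PSCongr, X_pow_dvd_iff, map_sub, sub_eq_zero]

theorem PSCongr.refl (a : ℂ⟦X⟧) : PSCongr m a a := by simp [PSCongr]

theorem PSCongr.symm (h : PSCongr m a b) : PSCongr m b a := by
  unfold PSCongr at *; rwa [← neg_sub, dvd_neg]

theorem PSCongr.trans {d : ℂ⟦X⟧} (h : PSCongr m a b) (h' : PSCongr m b d) : PSCongr m a d := by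
  have := dvd_add h h'
  rwa [sub_add_sub_cancel] at this

theorem PSCongr.add {d e : ℂ⟦X⟧} (h : PSCongr m a b) (h' : PSCongr m d e) :
    PSCongr m (a + d) (b + e) := by
  have := dvd_add h h'
  unfold PSCongr; convert! this using 1; ring

theorem PSCongr.mul {d e : ℂ⟦X⟧} (h : PSCongr m a b) (h' : PSCongr m d e) :
    PSCongr m (a * d) (b * e) := by
  have := dvd_add (dvd_mul_of_dvd_left h d) (dvd_mul_of_dvd_right h' b)
  unfold PSCongr; convert! this using 1; ring

theorem PSCongr.neg (h : PSCongr m a b) : PSCongr m (-a) (-b) := by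
  unfold PSCongr at *
  rw [neg_sub_neg, ← neg_sub]
  exact (dvd_neg.2 h)

theorem PSCongr.constantCoeff_eq (hm : 1 ≤ m) (h : PSCongr m a b) :
    constantCoeff a = constantCoeff b := by
  simpa using h.coeff_eq (j := 0) hm

/-- No invertibility is assumed: a series with zero constant term has inverse 0, and for m ≥ 1
congruent series have the same constant term. -/
theorem PSCongr.inv (hm : 1 ≤ m) (h : PSCongr m a b) : PSCongr m a⁻¹ b⁻¹ := by
  have h0 := h.constantCoeff_eq hm
  by_cases ha : constantCoeff a = 0
  · rw [PowerSeries.inv_eq_zero.2 ha, PowerSeries.inv_eq_zero.2 (h0 ▸ ha)]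
    exact PSCongr.refl _
  · have hb : constantCoeff b ≠ 0 := h0 ▸ ha
    have h1 := mul_inv_self a ha
    have h2 := mul_inv_self b hb
    have : a⁻¹ - b⁻¹ = (b - a) * (a⁻¹ * b⁻¹) := by linear_combination a⁻¹ * (-h2) + b⁻¹ * h1
    unfold PSCongr
    rw [this]
    exact dvd_mul_of_dvd_left h.symm _

theorem coeff_C_mul_eq (z : ℂ) (a : ℂ⟦X⟧) (j : ℕ) : coeff j (C z * a) = z * coeff j a := by
  simp

/-! ### The non-constant part of the logarithm -/

/-- The coefficients of positive index of `log a`. -/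
def logTail (a : ℂ⟦X⟧) : ℂ⟦X⟧ := mk fun j =>
    if j = 0 then 0 else coeff (j - 1) (derivative ℂ a * a⁻¹) / j

@[simp] theorem coeff_zero_logTail (a : ℂ⟦X⟧) : constantCoeff (logTail a) = 0 := by
  rw [← coeff_zero_apply]; simp [logTail]

theorem coeff_logTail (a : ℂ⟦X⟧) (hj : j ≠ 0) : coeff j (logTail a) =
      coeff (j - 1) (derivative ℂ a * a⁻¹) / j := by
  simp [logTail, hj]

/-- Chain rule: the derivative of log (1 + X) is the geometric series, and substituting a - 1 into
(1 + X) · (geometric series) = 1 identifies its value with the inverse of a. -/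
theorem derivative_log_subst (ha : constantCoeff a = 1) :
    derivative ℂ ((PowerSeries.log ℂ).subst (a - 1)) = derivative ℂ a * a⁻¹ := by
  have hs : HasSubst (a - 1) := HasSubst.of_constantCoeff_zero' (by simp [ha])
  rw [PowerSeries.derivative_subst hs, PowerSeries.deriv_log]
  have h1 : ((1 : ℂ⟦X⟧) + X) * mk (fun n => algebraMap ℚ ℂ ((-1 : ℚ) ^ n)) = 1 := by
    ext j
    rcases j with _ | j
    · simp [add_mul]
    · simp [add_mul, PowerSeries.coeff_succ_X_mul, pow_succ, coeff_one]
  have h2 := congrArg (subst (a - 1)) h1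
  rw [subst_mul hs, subst_add hs, subst_X hs] at h2
  have h3 : subst (a - 1) (1 : ℂ⟦X⟧) = 1 := by
    rw [← PowerSeries.coe_substAlgHom hs, map_one]
  rw [h3, add_sub_cancel] at h2
  have ha' : constantCoeff a ≠ 0 := by rw [ha]; exact one_ne_zero
  have h4 := inv_mul_self a ha'
  rw [map_sub, PowerSeries.derivative_one, sub_zero]
  linear_combination (derivative ℂ a * a⁻¹) * h2 - derivative ℂ a * subst (a - 1)
      (mk (fun n => algebraMap ℚ ℂ ((-1 : ℚ) ^ n))) * h4

/-- Scaling a to constant term 1 leaves the logarithmic derivative unchanged. The logarithm defined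
by substitution is thereby replaced by the termwise integral of a'/a, which is easier to
differentiate in parameters. -/
theorem epsLog_eq (ha : constantCoeff a ≠ 0) (ℓ : ℂ) (j : ℕ) :
    epsLog ℓ a j = if j = 0 then ℓ else coeff j (logTail a) := by
  unfold epsLog
  split_ifs with hj
  · rfl
  obtain ⟨k, rfl⟩ := Nat.exists_eq_succ_of_ne_zero hj
  rw [coeff_logTail a hj]
  set z := (constantCoeff a)⁻¹
  have hz : z ≠ 0 := inv_ne_zero ha
  have h1 : constantCoeff (C z * a) = 1 := by simp [z, ha]
  have h2 := congrArg (coeff k) (derivative_log_subst h1)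
  have h3 : derivative ℂ (C z * a) * (C z * a)⁻¹ = derivative ℂ a * a⁻¹ := by
    have e1 := mul_inv_self (C z * a) (by rw [h1]; exact one_ne_zero)
    have e2 := mul_inv_self a ha
    rw [Derivation.leibniz, PowerSeries.derivative_C]
    simp only [smul_eq_mul, mul_zero, add_zero]
    linear_combination derivative ℂ a * a⁻¹ * e1 - C z * derivative ℂ a * (C z * a)⁻¹ * e2
  rw [h3, coeff_derivative] at h2
  have hk : ((k : ℂ) + 1) ≠ 0 := by exact_mod_cast Nat.succ_ne_zero k
  simp only [Nat.succ_eq_add_one, Nat.add_sub_cancel, Nat.cast_add, Nat.cast_one]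
  rw [eq_div_iff hk, h2]

/-- The logarithmic derivative is additive. The constant terms have been dropped, so no choice of
branch enters. -/
theorem logTail_mul (ha : constantCoeff a ≠ 0)
    (hb : constantCoeff b ≠ 0) : logTail (a * b) = logTail a + logTail b := by
  have hab : constantCoeff (a * b) ≠ 0 := by simp [ha, hb]
  have h : derivative ℂ (a * b) * (a * b)⁻¹ = derivative ℂ a * a⁻¹ + derivative ℂ b * b⁻¹ := by
    rw [Derivation.leibniz, PowerSeries.mul_inv_rev]
    have e1 := mul_inv_self a ha
    have e2 := mul_inv_self b hb
    simp only [smul_eq_mul]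
    linear_combination derivative ℂ b * b⁻¹ * e1 + derivative ℂ a * a⁻¹ * e2
  ext j
  rcases eq_or_ne j 0 with rfl | hj
  · simp
  · rw [map_add, coeff_logTail _ hj, coeff_logTail _ hj, coeff_logTail _ hj, h, map_add, add_div]

theorem logTail_C (z : ℂ) : logTail (C z) = 0 := by
  ext j
  rcases eq_or_ne j 0 with rfl | hj
  · simp
  · rw [coeff_logTail _ hj]; simp

/-- Differentiation loses one degree of precision, and the index shift from j - 1 to j in the
integration of a'/a restores it. -/
theorem PSCongr.logTail (hm : 1 ≤ m) (h : PSCongr m a b) : PSCongr m (logTail a) (logTail b) := by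
  rw [psCongr_iff]
  intro j hj
  rcases eq_or_ne j 0 with rfl | hj0
  · simp
  rw [coeff_logTail _ hj0, coeff_logTail _ hj0]
  have hd : PSCongr (m - 1) (PowerSeries.derivative ℂ a) (PowerSeries.derivative ℂ b) := by
    rw [psCongr_iff]
    intro k hk
    rw [coeff_derivative, coeff_derivative, h.coeff_eq (by omega)]
  have hi : PSCongr (m - 1) a⁻¹ b⁻¹ := by
    rw [psCongr_iff]
    intro k hk
    exact (h.inv hm).coeff_eq (by omega)
  rw [(hd.mul hi).coeff_eq (by omega)]

/-! ### Coefficientwise differentiation -/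

section Deriv

variable {E : Type*} [NormedAddCommGroup E] [NormedSpace ℂ E] {P Q P' Q' : E → ℂ⟦X⟧} {e : E}

/-- `P` is coefficientwise holomorphically differentiable at `e` with derivative `P'`. -/
def HasPSDerivAt (P : E → ℂ⟦X⟧) (P' : E → ℂ⟦X⟧) (e : E) : Prop :=
  ∀ j, ∃ L : E →L[ℂ] ℂ, (∀ h, L h = coeff j (P' h)) ∧ HasFDerivAt (fun y => coeff j (P y)) L e

theorem HasPSDerivAt.congr_deriv (h : HasPSDerivAt P P' e)
    (h' : ∀ x, P' x = P'' x) : HasPSDerivAt P P'' e := by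
  intro j
  obtain ⟨L, h1, h2⟩ := h j
  exact ⟨L, fun x => by rw [h1, h'], h2⟩

theorem HasPSDerivAt.congr_of_eventuallyEq (h : HasPSDerivAt P P' e)
    (h' : Q =ᶠ[nhds e] P) : HasPSDerivAt Q P' e := by
  intro j
  obtain ⟨L, h1, h2⟩ := h j
  exact ⟨L, h1, h2.congr_of_eventuallyEq (h'.fun_comp _)⟩

theorem hasPSDerivAt_const (a : ℂ⟦X⟧) (e : E) : HasPSDerivAt (fun _ => a) (fun _ => 0) e :=
  fun _ => ⟨0, fun _ => by simp, hasFDerivAt_const _ _⟩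

theorem HasPSDerivAt.add (h : HasPSDerivAt P P' e)
    (h' : HasPSDerivAt Q Q' e) : HasPSDerivAt (fun y => P y + Q y) (fun x => P' x + Q' x) e := by
  intro j
  obtain ⟨L, h1, h2⟩ := h j
  obtain ⟨L', h1', h2'⟩ := h' j
  exact ⟨L + L', fun x => by simp [h1, h1'], by simpa using h2.fun_add h2'⟩

theorem HasPSDerivAt.neg (h : HasPSDerivAt P P' e) :
    HasPSDerivAt (fun y => -P y) (fun x => -P' x) e := by
  intro j
  obtain ⟨L, h1, h2⟩ := h j
  exact ⟨-L, fun x => by simp [h1], by simpa using h2.fun_neg⟩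

theorem HasPSDerivAt.sub (h : HasPSDerivAt P P' e)
    (h' : HasPSDerivAt Q Q' e) : HasPSDerivAt (fun y => P y - Q y) (fun x => P' x - Q' x) e := by
  simpa only [sub_eq_add_neg] using h.add h'.neg

theorem HasPSDerivAt.mul (h : HasPSDerivAt P P' e) (h' : HasPSDerivAt Q Q' e) :
    HasPSDerivAt (fun y => P y * Q y) (fun x => P' x * Q e + P e * Q' x) e := by
  intro j
  choose L h1 h2 using h
  choose L' h1' h2' using h'
  refine ⟨∑ p ∈ Finset.HasAntidiagonal.antidiagonal j,
    (coeff p.1 (P e) • L' p.2 + coeff p.2 (Q e) • L p.1), fun x => ?_, ?_⟩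
  · simp only [_root_.sum_apply, map_add, coeff_mul,
      _root_.add_apply, _root_.smul_apply, h1, h1', smul_eq_mul, ← sum_add_distrib]
    exact sum_congr rfl fun p _ => by ring
  · simp only [coeff_mul]
    exact HasFDerivAt.fun_sum fun p _ => (h2 p.1).mul (h2' p.2)

theorem HasPSDerivAt.continuousAt (h : HasPSDerivAt P P' e) (j : ℕ) :
    ContinuousAt (fun y => coeff j (P y)) e := by
  obtain ⟨L, -, h2⟩ := h j
  exact h2.continuousAt

theorem HasPSDerivAt.eventually_ne (h : HasPSDerivAt P P' e)
    (h0 : constantCoeff (P e) ≠ 0) : ∀ᶠ y in nhds e, constantCoeff (P y) ≠ 0 := by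
  have := h.continuousAt 0
  simp only [coeff_zero_apply] at this
  exact this.eventually_ne h0

/-- The recursion for the coefficients of an inverse divides only by the constant coefficient, so
strong induction on the index applies. -/
theorem HasPSDerivAt.inv_differentiable (h : HasPSDerivAt P P' e)
    (h0 : constantCoeff (P e) ≠ 0) (j : ℕ) : DifferentiableAt ℂ (fun y => coeff j (P y)⁻¹) e := by
  have hd : ∀ k, DifferentiableAt ℂ (fun y => coeff k (P y)) e := fun k => by
    obtain ⟨L, -, h2⟩ := h k
    exact h2.differentiableAt
  have hc : DifferentiableAt ℂ (fun y => (constantCoeff (P y))⁻¹) e := by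
    have := hd 0
    simp only [coeff_zero_apply] at this
    exact this.fun_inv h0
  induction j using Nat.strong_induction_on with
  | _ j ih =>
    rcases eq_or_ne j 0 with rfl | hj
    · simpa [coeff_inv] using hc
    · simp only [coeff_inv j, if_neg hj]
      refine hc.neg.mul (DifferentiableAt.fun_sum fun p _ => ?_)
      split_ifs with hp
      · exact (hd _).mul (ih _ hp)
      · exact differentiableAt_const _

/-- Once differentiability is known, the derivative is forced by differentiating P P⁻¹ = 1, valid in
a whole neighbourhood of the point. -/
theorem HasPSDerivAt.inv (h : HasPSDerivAt P P' e) (h0 : constantCoeff (P e) ≠ 0) :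
    HasPSDerivAt (fun y => (P y)⁻¹) (fun x => -(P' x * (P e)⁻¹ ^ 2)) e := by
  have hd := h.inv_differentiable h0
  set Q' : E → ℂ⟦X⟧ := fun x =>
    mk fun j => fderiv ℂ (fun y => coeff j (P y)⁻¹) e x with hQ'
  have hQ : HasPSDerivAt (fun y => (P y)⁻¹) Q' e :=
    fun j => ⟨_, fun x => by simp [hQ'], (hd j).hasFDerivAt⟩
  have h1 := h.mul hQ
  have h2 : HasPSDerivAt (fun y => P y * (P y)⁻¹) (fun _ => 0) e := by
    refine (hasPSDerivAt_const 1 e).congr_of_eventuallyEq ?_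
    filter_upwards [h.eventually_ne h0] with y hy using mul_inv_self _ hy
  refine hQ.congr_deriv fun x => ?_
  have h3 : P' x * (P e)⁻¹ + P e * Q' x = 0 := by
    ext j
    obtain ⟨L, a1, a2⟩ := h1 j
    obtain ⟨L', b1, b2⟩ := h2 j
    rw [← a1, a2.unique b2, b1]
  have h4 := mul_inv_self _ h0
  linear_combination (P e)⁻¹ * h3 - Q' x * h4

theorem HasPSDerivAt.derivative (h : HasPSDerivAt P P' e) :
    HasPSDerivAt (fun y => PowerSeries.derivative ℂ (P y))
      (fun x => PowerSeries.derivative ℂ (P' x)) e := by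
  intro j
  obtain ⟨L, h1, h2⟩ := h (j + 1)
  refine ⟨((j : ℂ) + 1) • L, fun x => ?_, ?_⟩
  · simp [h1, coeff_derivative, mul_comm]
  · simp only [coeff_derivative]
    exact h2.mul_const _

/-- The variation of log P is P'/P; its constant coefficient is removed because `logTail` omits that
of the logarithm. -/
theorem HasPSDerivAt.logTail (h : HasPSDerivAt P P' e) (h0 : constantCoeff (P e) ≠ 0) :
    HasPSDerivAt (fun y => logTail (P y)) (fun x => P' x * (P e)⁻¹ -
      C (constantCoeff (P' x * (P e)⁻¹))) e := by
  intro j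
  rcases eq_or_ne j 0 with rfl | hj
  · refine ⟨0, fun x => by simp, ?_⟩
    simp only [coeff_zero_apply, coeff_zero_logTail]
    exact hasFDerivAt_const _ _
  · obtain ⟨k, rfl⟩ := Nat.exists_eq_succ_of_ne_zero hj
    obtain ⟨L, h1, h2⟩ := (h.derivative.mul (h.inv h0)) k
    have hk : ((k : ℂ) + 1) ≠ 0 := by exact_mod_cast Nat.succ_ne_zero k
    refine ⟨((k : ℂ) + 1)⁻¹ • L, fun x => ?_, ?_⟩
    -- The product rule terms recombine into the formal derivative of P'/P, so dividing by k + 1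
    -- recovers the coefficient of index k + 1 of P'/P itself.
    · have e1 : PowerSeries.derivative ℂ (P' x) * (P e)⁻¹ +
          PowerSeries.derivative ℂ (P e) * -(P' x * (P e)⁻¹ ^ 2) =
          PowerSeries.derivative ℂ (P' x * (P e)⁻¹) := by
        rw [Derivation.leibniz, PowerSeries.derivative_inv']
        simp only [smul_eq_mul]; ring
      simp only [_root_.smul_apply, h1, e1, coeff_derivative, map_sub,
        coeff_C, if_neg hj, smul_eq_mul]
      rw [sub_zero]; field_simp
    · simp only [coeff_logTail _ hj]
      have := h2.mul_const ((k : ℂ) + 1)⁻¹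
      simpa [div_eq_mul_inv] using this

end Deriv

end

/-! ### Blocks of coordinates and series depending smoothly on them -/

section Ops

theorem coeff_block (u : Cfg n) (i : ι) (j : ℕ) :
    coeff j (block u i) = if h : j < n i then u ⟨i, ⟨j, h⟩⟩ else 0 := by
  simp [block]

theorem coeff_block_fin (u : Cfg n) (p : Coord n) : coeff p.2.val (block u p.1) = u p := by
  simp [coeff_block]

theorem hasPSDerivAt_block (u : Cfg n) (i : ι) :
    HasPSDerivAt (fun v : Cfg n => block v i) (fun h => block h i) u := by
  intro j
  simp only [coeff_block]
  split_ifs with h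
  · exact ⟨ContinuousLinearMap.proj ⟨i, ⟨j, h⟩⟩, fun _ => rfl, hasFDerivAt_apply _ _⟩
  · exact ⟨0, fun _ => rfl, hasFDerivAt_const _ _⟩

/-- All coefficients of `P` are smooth functions. -/
def PSSmooth {E : Type*} [NormedAddCommGroup E] [NormedSpace ℝ E] (P : E → ℂ⟦X⟧) : Prop :=
  ∀ j, ContDiff ℝ ∞ fun e => coeff j (P e)

theorem psSmooth_block (i : ι) : PSSmooth fun v : Cfg n => block v i := by
  intro j
  simp only [coeff_block]
  split_ifs with h
  · exact contDiff_apply ℝ ℂ _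
  · exact contDiff_const

section

variable {E : Type*} [NormedAddCommGroup E] [NormedSpace ℝ E] {P Q : E → ℂ⟦X⟧}

theorem psSmooth_const (a : ℂ⟦X⟧) : PSSmooth fun _ : E => a := fun _ => contDiff_const

theorem PSSmooth.add
    (hP : PSSmooth P) (hQ : PSSmooth Q) : PSSmooth fun e => P e + Q e := fun j => by
  simp only [map_add]; exact (hP j).add (hQ j)

theorem PSSmooth.sub
    (hP : PSSmooth P) (hQ : PSSmooth Q) : PSSmooth fun e => P e - Q e := fun j => by
  simp only [map_sub]; exact (hP j).sub (hQ j)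

theorem PSSmooth.mul
    (hP : PSSmooth P) (hQ : PSSmooth Q) : PSSmooth fun e => P e * Q e := fun j => by
  simp only [coeff_mul]
  exact ContDiff.sum fun p _ => (hP _).mul (hQ _)

end

theorem block_single (i k : ι) (q : Fin (n k)) : block (Pi.single (⟨k, q⟩ : Coord n) (1 : ℂ)) i =
      if k = i then (X : ℂ⟦X⟧) ^ q.val else 0 := by
  ext j
  rw [coeff_block]
  split_ifs with h1 h2 h2
  · subst h2
    rw [coeff_X_pow, Pi.single_apply]
    congr 1
    simp [Fin.ext_iff]
  · rw [Pi.single_apply, if_neg, map_zero]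
    rintro h
    exact h2 (congrArg Sigma.fst h).symm
  · subst h2
    rw [coeff_X_pow, if_neg (by omega)]
  · simp

/-! ### The holomorphic coordinate derivatives -/

/-- For a complex linear L the direction i contributes i times the direction 1, so the two halves of
the Wirtinger derivative agree. -/
theorem dCoord_of_hasFDerivAt {L : Cfg n →L[ℂ] ℂ} {u : Cfg n}
    (h : HasFDerivAt f L u) (p : Coord n) : dCoord p f u = L (Pi.single p 1) := by
  have h1 : HasFDerivAt f (L.restrictScalars ℝ) u := h.restrictScalars ℝ
  unfold dCoord
  rw [h1.fderiv]
  have h2 : (Pi.single p I : Cfg n) = I • Pi.single p 1 := by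
    rw [← Pi.single_smul]; simp
  simp only [ContinuousLinearMap.coe_restrictScalars', h2, map_smul, smul_eq_mul]
  linear_combination (-1 / 2 * L (Pi.single p 1)) * I_sq

theorem dCoord_coeff {P P' : Cfg n → ℂ⟦X⟧} {u : Cfg n} (h : HasPSDerivAt P P' u) (p : Coord n)
    (j : ℕ) : dCoord p (fun v => coeff j (P v)) u = coeff j (P' (Pi.single p 1)) := by
  obtain ⟨L, h1, h2⟩ := h j
  rw [dCoord_of_hasFDerivAt h2, h1]

theorem ContDiff.dCoord (hf : ContDiff ℝ ∞ f) (p : Coord n) : ContDiff ℝ ∞ (dCoord p f) := by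
  have h : ContDiff ℝ ∞ (fderiv ℝ f) := hf.fderiv_right (by simp)
  exact contDiff_const.mul ((h.clm_apply contDiff_const).sub
    (contDiff_const.mul (h.clm_apply contDiff_const)))

theorem dCoord_const (p : Coord n) (z : ℂ) (u : Cfg n) : dCoord p (fun _ => z) u = 0 := by
  simp [dCoord]

theorem dCoord_add {g : Cfg n → ℂ} {u : Cfg n} (hf : DifferentiableAt ℝ f u)
    (hg : DifferentiableAt ℝ g u) (p : Coord n) :
    dCoord p (fun v => f v + g v) u = dCoord p f u + dCoord p g u := by
  unfold dCoord
  rw [fderiv_fun_add hf hg]; simp only [_root_.add_apply]; ring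

theorem dCoord_mul {g : Cfg n → ℂ} {u : Cfg n} (hf : DifferentiableAt ℝ f u)
    (hg : DifferentiableAt ℝ g u) (p : Coord n) :
    dCoord p (fun v => f v * g v) u = dCoord p f u * g u + f u * dCoord p g u := by
  unfold dCoord
  rw [fderiv_fun_mul hf hg]
  simp only [_root_.add_apply, _root_.smul_apply, smul_eq_mul]; ring

theorem dCoord_const_mul {u : Cfg n} (hf : DifferentiableAt ℝ f u) (z : ℂ)
    (p : Coord n) : dCoord p (fun v => z * f v) u = z * dCoord p f u := by
  rw [dCoord_mul (differentiableAt_const _) hf, dCoord_const]; ring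

theorem dCoord_sum {κ : Type*} (s : Finset κ) {f : κ → Cfg n → ℂ} {u : Cfg n}
    (hf : ∀ k ∈ s, DifferentiableAt ℝ (f k) u) (p : Coord n) :
    dCoord p (fun v => ∑ k ∈ s, f k v) u = ∑ k ∈ s, dCoord p (f k) u := by
  unfold dCoord
  rw [fderiv_fun_sum hf]
  simp only [_root_.sum_apply]
  rw [mul_sum, ← sum_sub_distrib, mul_sum]

theorem dCoord_comm (hf : ContDiff ℝ ∞ f) (p q : Coord n) (u : Cfg n) :
    dCoord p (dCoord q f) u = dCoord q (dCoord p f) u := by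
  have h2le : (2 : WithTop ℕ∞) ≤ ∞ := by exact WithTop.coe_le_coe.2 (le_top : (2 : ℕ∞) ≤ ⊤)
  have h11 : (1 : WithTop ℕ∞) + 1 ≤ ∞ := by rw [one_add_one_eq_two]; exact h2le
  have h1 : ∀ v w : Cfg n, fderiv ℝ (fun x => fderiv ℝ f x v) u w =
      fderiv ℝ (fderiv ℝ f) u w v := fun v w => by
    have hd : DifferentiableAt ℝ (fderiv ℝ f) u :=
      ((hf.fderiv_right (m := 1) h11).differentiable (by simp)).differentiableAt
    rw [fderiv_clm_apply hd (differentiableAt_const v)]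
    simp
  have hs : ∀ v w : Cfg n, fderiv ℝ (fderiv ℝ f) u w v = fderiv ℝ (fderiv ℝ f) u v w :=
    fun v w => (hf.contDiffAt.isSymmSndFDerivAt (by simpa using h2le)).eq w v
  have hd : ∀ v, DifferentiableAt ℝ (fun x => fderiv ℝ f x v) u := fun v =>
    (((hf.fderiv_right (m := 1) h11).clm_apply contDiff_const).differentiable
      (by simp)).differentiableAt
  have h2 : ∀ (p : Coord n) (w : Cfg n), fderiv ℝ (dCoord p f) u w =
      (1 / 2) * (fderiv ℝ (fderiv ℝ f) u w (Pi.single p 1) -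
        I * fderiv ℝ (fderiv ℝ f) u w (Pi.single p I)) := fun p w => by
    have : dCoord p f = fun x => (1 / 2 : ℂ) * (fderiv ℝ f x (Pi.single p 1) -
      I * fderiv ℝ f x (Pi.single p I)) := rfl
    rw [this, fderiv_const_mul ((hd _).fun_sub ((hd _).const_mul _)),
      fderiv_fun_sub (hd _) ((hd _).const_mul _), fderiv_const_mul (hd _)]
    simp only [_root_.smul_apply, _root_.sub_apply, smul_eq_mul, h1]
  unfold dCoord at h2 ⊢
  rw [h2, h2, h2, h2, hs (Pi.single p 1), hs (Pi.single p I),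
    hs (Pi.single p 1) (Pi.single q I), hs (Pi.single p I) (Pi.single q I)]
  ring

/-! ### First order operators -/

/-- The vector field part of a first order operator. -/
def FirstOrder.vec (D : FirstOrder n) : Op n := fun φ u => ∑ p, D.coef p u * dCoord p φ u

/-- First order operators with smooth coefficients. -/
structure FirstOrder.IsSmooth (D : FirstOrder n) : Prop where
  coef : ∀ p, ContDiff ℝ ∞ (D.coef p)
  pot : ContDiff ℝ ∞ D.pot

theorem FirstOrder.act_eq (D : FirstOrder n) (φ : Cfg n → ℂ) (u : Cfg n) :
    D.act φ u = D.vec φ u + D.pot u * φ u := rfl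

theorem ContDiff.diffAt (hf : ContDiff ℝ ∞ f) (u : Cfg n) :
    DifferentiableAt ℝ f u := (hf.differentiable (by simp)).differentiableAt

theorem FirstOrder.IsSmooth.act {D : FirstOrder n} (hD : D.IsSmooth)
    (hφ : ContDiff ℝ ∞ φ) : ContDiff ℝ ∞ (D.act φ) :=
  (ContDiff.sum fun p _ => (hD.coef p).mul (ContDiff.dCoord hφ p)).add (hD.pot.mul hφ)

theorem FirstOrder.act_sum {κ : Type*} (D : FirstOrder n) (s : Finset κ) (w : κ → ℂ)
    {f : κ → Cfg n → ℂ} (hf : ∀ k, ContDiff ℝ ∞ (f k)) (u : Cfg n) :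
    D.act (fun v => ∑ k ∈ s, w k * f k v) u = ∑ k ∈ s, w k * D.act (f k) u := by
  simp only [FirstOrder.act]
  have h : ∀ p, dCoord p (fun v => ∑ k ∈ s, w k * f k v) u = ∑ k ∈ s, w k * dCoord p (f k) u := by
    intro p
    rw [dCoord_sum s (fun k _ => (ContDiff.diffAt (hf k) u).const_mul _)]
    exact sum_congr rfl fun k _ => dCoord_const_mul (ContDiff.diffAt (hf k) u) _ _
  simp only [h, mul_sum, mul_add, sum_add_distrib]
  rw [sum_comm]
  congr 1
  · exact sum_congr rfl fun k _ => sum_congr rfl fun p _ => by ring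
  · exact sum_congr rfl fun k _ => by ring

theorem FirstOrder.act_act {D D' : FirstOrder n} (hD' : D'.IsSmooth)
    (hφ : ContDiff ℝ ∞ φ) (u : Cfg n) : D.act (D'.act φ) u =
      ∑ p, ∑ q, D.coef p u * D'.coef q u * dCoord p (dCoord q φ) u +
      ∑ q, D.vec (D'.coef q) u * dCoord q φ u + D.vec D'.pot u * φ u +
      D'.pot u * D.vec φ u + D.pot u * D'.vec φ u + D.pot u * D'.pot u * φ u := by
  have h : ∀ p, dCoord p (D'.act φ) u =
      ∑ q, (dCoord p (D'.coef q) u * dCoord q φ u + D'.coef q u * dCoord p (dCoord q φ) u) +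
      (dCoord p D'.pot u * φ u + D'.pot u * dCoord p φ u) := by
    intro p
    have e : D'.act φ = fun v => (∑ q, D'.coef q v * dCoord q φ v) + D'.pot v * φ v := rfl
    rw [e, dCoord_add (ContDiff.diffAt (ContDiff.sum fun q _ =>
        (hD'.coef q).mul (ContDiff.dCoord hφ q)) u) (ContDiff.diffAt (hD'.pot.mul hφ) u),
      dCoord_sum _ (fun q _ => ContDiff.diffAt ((hD'.coef q).mul (ContDiff.dCoord hφ q)) u),
      dCoord_mul (ContDiff.diffAt hD'.pot u) (ContDiff.diffAt hφ u)]
    congr 1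
    exact sum_congr rfl fun q _ =>
      dCoord_mul (ContDiff.diffAt (hD'.coef q) u) (ContDiff.diffAt (ContDiff.dCoord hφ q) u) p
  rw [FirstOrder.act_eq]
  simp only [FirstOrder.vec, h, FirstOrder.act_eq]
  simp only [mul_add, sum_add_distrib, mul_sum, sum_mul]
  rw [sum_comm (f := fun p q => D.coef p u * (dCoord p (D'.coef q) u * dCoord q φ u))]
  have e1 : ∀ p q, D.coef p u * (D'.coef q u * dCoord p (dCoord q φ) u) =
    D.coef p u * D'.coef q u * dCoord p (dCoord q φ) u := fun p q => by ring
  have e2 : ∀ p q, D.coef p u * (dCoord p (D'.coef q) u * dCoord q φ u) =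
    D.coef p u * dCoord p (D'.coef q) u * dCoord q φ u := fun p q => by ring
  have e3 : ∀ p, D.coef p u * (dCoord p D'.pot u * φ u) =
    D.coef p u * dCoord p D'.pot u * φ u := fun p => by ring
  have e4 : ∀ p, D.coef p u * (D'.pot u * dCoord p φ u) =
    D'.pot u * (D.coef p u * dCoord p φ u) := fun p => by ring
  simp only [e1, e2, e3, e4]
  ring

/-- The second order parts cancel because the holomorphic derivatives commute; what is left is the
bracket of the vector fields together with the derivatives of the potentials. -/
theorem FirstOrder.commutator {D D' : FirstOrder n} (hD : D.IsSmooth) (hD' : D'.IsSmooth)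
    (hφ : ContDiff ℝ ∞ φ) (u : Cfg n) : D.act (D'.act φ) u - D'.act (D.act φ) u =
      ∑ q, (D.vec (D'.coef q) u - D'.vec (D.coef q) u) * dCoord q φ u +
      (D.vec D'.pot u - D'.vec D.pot u) * φ u := by
  rw [FirstOrder.act_act hD' hφ, FirstOrder.act_act hD hφ]
  have e : ∑ p, ∑ q, D'.coef p u * D.coef q u * dCoord p (dCoord q φ) u =
      ∑ p, ∑ q, D.coef p u * D'.coef q u * dCoord p (dCoord q φ) u := by
    rw [sum_comm]
    exact sum_congr rfl fun p _ => sum_congr rfl fun q _ => by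
      rw [dCoord_comm hφ q p]; ring
  rw [e]
  simp only [sub_mul, sum_sub_distrib]
  ring

/-! ### The operators `slAct` -/

/-- The polynomial `β + 2 α z - γ z²`. -/
def sl2Field (α β γ : ℂ) (z : ℂ⟦X⟧) : ℂ⟦X⟧ := C β + C (2 * α) * z - C γ * z ^ 2

/-- The derivative `2 α - 2 γ z`. -/
def sl2FieldDeriv (α γ : ℂ) (z : ℂ⟦X⟧) : ℂ⟦X⟧ := C (2 * α) - C (2 * γ) * z

theorem slAct_coef (c : ι → ℕ → ℂ) (α β γ : ℂ) (i : ι) (a : ℕ) (p : Coord n) (u : Cfg n) :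
    (slAct c α β γ i a).coef p u = if p.1 = i then
      coeff p.2.val (X ^ a * sl2Field α β γ (block u i)) else 0 := rfl

theorem slAct_pot (c : ι → ℕ → ℂ) (α β γ : ℂ) (i : ι) (a : ℕ) (u : Cfg n) :
    (slAct c α β γ i a).pot u = dchi (n i) (c i)
      (X ^ a * (C γ * block u i - C α)) := rfl

theorem psSmooth_sl2Field (α β γ : ℂ) (i : ι) (a : ℕ) :
    PSSmooth fun u : Cfg n => X ^ a * sl2Field α β γ (block u i) := by
  simp only [sl2Field, pow_two]
  exact (psSmooth_const _).mul (((psSmooth_const _).add ((psSmooth_const _).mul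
    (psSmooth_block i))).sub ((psSmooth_const _).mul ((psSmooth_block i).mul (psSmooth_block i))))

theorem contDiff_dchi {E : Type*} [NormedAddCommGroup E] [NormedSpace ℝ E] {P : E → ℂ⟦X⟧}
    (hP : PSSmooth P) (m : ℕ) (c : ℕ → ℂ) : ContDiff ℝ ∞ fun e => dchi m c (P e) := by
  have h0 := hP 0
  simp only [coeff_zero_apply] at h0
  exact (contDiff_const.mul h0).add (contDiff_const.mul
    (ContDiff.sum fun j _ => contDiff_const.mul (hP j)))

theorem slAct_isSmooth (c : ι → ℕ → ℂ) (α β γ : ℂ) (i : ι) (a : ℕ) :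
    (slAct (n := n) c α β γ i a).IsSmooth where
  coef p := by
    have : (slAct (n := n) c α β γ i a).coef p = fun u => if p.1 = i then
      coeff p.2.val (X ^ a * sl2Field α β γ (block u i)) else 0 := rfl
    rw [this]
    split_ifs
    · exact psSmooth_sl2Field α β γ i a _
    · exact contDiff_const
  pot := contDiff_dchi ((psSmooth_const _).mul (((psSmooth_const _).mul
    (psSmooth_block i)).sub (psSmooth_const _))) _ _

theorem sum_coord_block (i : ι) (f : Coord n → ℂ) :
    (∑ p : Coord n, if p.1 = i then f p else 0) = ∑ q : Fin (n i), f ⟨i, q⟩ := by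
  rw [Fintype.sum_sigma]
  rw [sum_eq_single i]
  · simp
  · intro k _ hk; simp [hk]
  · simp

theorem slAct_vec (c : ι → ℕ → ℂ) (α β γ : ℂ) (i : ι) (a : ℕ) (φ : Cfg n → ℂ) (u : Cfg n) :
    (slAct c α β γ i a).vec φ u = ∑ q : Fin (n i),
      coeff q.val (X ^ a * sl2Field α β γ (block u i)) * dCoord ⟨i, q⟩ φ u := by
  simp only [FirstOrder.vec, slAct_coef, ite_mul, zero_mul]
  exact sum_coord_block (n := n) i (fun p => coeff p.2.val
    (X ^ a * sl2Field α β γ (block u i)) * dCoord p φ u)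

/-- A field V on a block changes a series whose derivative is h ↦ W h by W V. Only coefficients of V
of index at most j reach X ^ j, so keeping m > j coordinates loses nothing. -/
theorem sum_coeff_mul_X_pow (V W : ℂ⟦X⟧) (hj : j < m) :
    ∑ q : Fin m, coeff q.val V * coeff j (W * X ^ q.val) = coeff j (W * V) := by
  rw [Fin.sum_univ_eq_sum_range (fun q => coeff q V * coeff j (W * X ^ q))]
  rw [mul_comm W V, coeff_mul, Finset.Nat.sum_antidiagonal_eq_sum_range_succ_mk]
  simp only [coeff_mul_X_pow']
  rw [← sum_subset (range_mono (Nat.succ_le_of_lt hj))]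
  · refine sum_congr rfl fun q hq => ?_
    rw [if_pos (Nat.lt_succ_iff.1 (mem_range.1 hq))]
  · intro q _ hq
    rw [if_neg (fun h => hq (mem_range.2 (Nat.lt_succ_of_le h))), mul_zero]

theorem slAct_vec_coeff (c : ι → ℕ → ℂ) (α β γ : ℂ) (i k : ι) (a : ℕ) {P : Cfg n → ℂ⟦X⟧}
    {W : ℂ⟦X⟧} {u : Cfg n} (hP : HasPSDerivAt P (fun h => W * block h k) u) (hj : j < n k) :
    (slAct c α β γ i a).vec (fun v => coeff j (P v)) u = if i = k then
        coeff j (W * (X ^ a * sl2Field α β γ (block u i))) else 0 := by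
  rw [slAct_vec]
  simp only [dCoord_coeff hP, block_single]
  split_ifs with h
  · subst h
    exact sum_coeff_mul_X_pow _ _ hj
  · simp

theorem dCoord_dchi {P P' : Cfg n → ℂ⟦X⟧} {u : Cfg n} (h : HasPSDerivAt P P' u) (p : Coord n)
    (m : ℕ) (c : ℕ → ℂ) : dCoord p (fun v => dchi m c (P v)) u = dchi m c (P' (Pi.single p 1)) := by
  choose L h1 h2 using h
  have h0 : HasFDerivAt (fun v => constantCoeff (P v)) (L 0) u := by
    simpa only [coeff_zero_apply] using h2 0
  have := (h0.const_mul (-(m : ℂ))).fun_add ((HasFDerivAt.fun_sum (u := range m)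
    (fun j _ => (h2 j).const_mul (c j))).const_mul (I / 2))
  have e := dCoord_of_hasFDerivAt this p
  unfold dchi
  rw [e]
  simp [h1, _root_.sum_apply]

theorem dchi_sum {κ : Type*} (s : Finset κ) (m : ℕ) (c : ℕ → ℂ) (w : κ → ℂ) (b : κ → ℂ⟦X⟧) :
    ∑ k ∈ s, w k * dchi m c (b k) = dchi m c (∑ k ∈ s, C (w k) * b k) := by
  simp only [dchi, map_sum, map_mul, coeff_C_mul, mul_add, sum_add_distrib,
    constantCoeff_C, mul_sum]
  congr 1
  · exact sum_congr rfl fun k _ => by ring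
  · rw [sum_comm]
    exact sum_congr rfl fun k _ => sum_congr rfl fun p _ => by ring

theorem dchi_congr (hm : 1 ≤ m) (c : ℕ → ℂ) (h : PSCongr m a b) : dchi m c a = dchi m c b := by
  unfold dchi
  rw [h.constantCoeff_eq hm]
  congr 2
  exact sum_congr rfl fun j hj => by rw [h.coeff_eq (mem_range.1 hj)]

theorem slAct_vec_dchi (hn : ∀ i, 1 ≤ n i) (c : ι → ℕ → ℂ) (α β γ : ℂ) (i k : ι) (a : ℕ)
    {P : Cfg n → ℂ⟦X⟧} {W : ℂ⟦X⟧} {u : Cfg n} (hP : HasPSDerivAt P (fun h => W * block h k) u) :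
    (slAct c α β γ i a).vec (fun v => dchi (n k) (c k) (P v)) u = if i = k then
        dchi (n k) (c k) (W * (X ^ a * sl2Field α β γ (block u i))) else 0 := by
  rw [slAct_vec]
  simp only [dCoord_dchi hP, block_single]
  split_ifs with h
  · subst h
    rw [dchi_sum]
    refine dchi_congr (hn i) _ (psCongr_iff.2 fun j hj => ?_)
    rw [map_sum, ← sum_coeff_mul_X_pow _ _ hj]
    exact sum_congr rfl fun q _ => by rw [coeff_C_mul]
  · simp [dchi]

theorem hasPSDerivAt_sl2Field (α β γ : ℂ) (k : ι) (b : ℕ) (u : Cfg n) :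
    HasPSDerivAt (fun v : Cfg n => X ^ b * sl2Field α β γ (block v k))
      (fun h => X ^ b * sl2FieldDeriv α γ (block u k) * block h k) u := by
  have hz := hasPSDerivAt_block u k
  have := (hasPSDerivAt_const (X ^ b) u).mul
    (((hasPSDerivAt_const (C β) u).add
      ((hasPSDerivAt_const (C (2 * α)) u).mul hz)).sub
      ((hasPSDerivAt_const (C γ) u).mul (hz.mul hz)))
  simp only [sl2Field, pow_two]
  refine this.congr_deriv fun x => ?_
  simp only [sl2FieldDeriv, map_mul, map_ofNat]
  ring

theorem hasPSDerivAt_slPot (α γ : ℂ) (k : ι) (b : ℕ) (u : Cfg n) :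
    HasPSDerivAt (fun v : Cfg n => X ^ b * (C γ * block v k - C α))
      (fun h => X ^ b * C γ * block h k) u := by
  refine ((hasPSDerivAt_const (X ^ b) u).mul
    (((hasPSDerivAt_const (C γ) u).mul (hasPSDerivAt_block u k)).sub
      (hasPSDerivAt_const (C α) u))).congr_deriv fun x => ?_
  ring

/-- The coefficients and the potential attached to one point depend only on the block of that point,
which the other vector field does not move. -/
theorem slAct_commutator_of_ne (hn : ∀ i, 1 ≤ n i) (c : ι → ℕ → ℂ) (α β γ α' β' γ' : ℂ)
    (hik : i ≠ k) (a b : ℕ) (hφ : ContDiff ℝ ∞ φ) (u : Cfg n) :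
    (slAct c α β γ i a).act ((slAct c α' β' γ' k b).act φ) u =
      (slAct c α' β' γ' k b).act ((slAct c α β γ i a).act φ) u := by
  rw [← sub_eq_zero, FirstOrder.commutator (slAct_isSmooth ..) (slAct_isSmooth ..) hφ]
  have key : ∀ (α β γ α' β' γ' : ℂ) {i k : ι} (_ : i ≠ k) (a b : ℕ),
      (∀ q, (slAct c α β γ i a).vec ((slAct c α' β' γ' k b).coef q) u = 0) ∧
      (slAct c α β γ i a).vec (slAct c α' β' γ' k b).pot u = 0 := by
    intro α β γ α' β' γ' i k hik a b
    refine ⟨fun q => ?_, ?_⟩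
    · obtain ⟨k', q⟩ := q
      by_cases hk : k' = k
      · subst hk
        have : (slAct (n := n) c α' β' γ' k' b).coef ⟨k', q⟩ = fun v => coeff q.val
          (X ^ b * sl2Field α' β' γ' (block v k')) := by
            ext v; rw [slAct_coef, if_pos rfl]
        rw [this, slAct_vec_coeff c α β γ i k' a (hasPSDerivAt_sl2Field α' β' γ' k' b u) q.2,
          if_neg hik]
      · have : (slAct (n := n) c α' β' γ' k b).coef ⟨k', q⟩ = fun v => 0 := by
            ext v; rw [slAct_coef, if_neg hk]
        rw [this, slAct_vec]
        simp [dCoord_const]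
    · have : (slAct (n := n) c α' β' γ' k b).pot = fun v => dchi (n k) (c k)
        (X ^ b * (C γ' * block v k - C α')) := rfl
      rw [this, slAct_vec_dchi hn c α β γ i k a (hasPSDerivAt_slPot α' γ' k b u), if_neg hik]
  obtain ⟨h1, h2⟩ := key α β γ α' β' γ' hik a b
  obtain ⟨h3, h4⟩ := key α' β' γ' α β γ hik.symm b a
  simp [h1, h2, h3, h4]

/-- Both products carry the factor ε^(a+b), so the bracket is that of the quadratic vector fields in
one variable z multiplied by ε^(a+b), and likewise for the potentials. -/
theorem slAct_commutator_same (hn : ∀ i, 1 ≤ n i) (c : ι → ℕ → ℂ) (α β γ α' β' γ' : ℂ)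
    (i : ι) (a b : ℕ) (hφ : ContDiff ℝ ∞ φ) (u : Cfg n) :
    (slAct c α β γ i a).act ((slAct c α' β' γ' i b).act φ) u -
      (slAct c α' β' γ' i b).act ((slAct c α β γ i a).act φ) u =
    ∑ q : Fin (n i), coeff q.val (X ^ (a + b) *
      (sl2FieldDeriv α' γ' (block u i) * sl2Field α β γ (block u i) -
        sl2FieldDeriv α γ (block u i) * sl2Field α' β' γ' (block u i))) * dCoord ⟨i, q⟩ φ u +
    dchi (n i) (c i) (X ^ (a + b) * (C γ' * sl2Field α β γ (block u i) -
      C γ * sl2Field α' β' γ' (block u i))) * φ u := by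
  rw [FirstOrder.commutator (slAct_isSmooth ..) (slAct_isSmooth ..) hφ]
  have key : ∀ (α β γ α' β' γ' : ℂ) (a b : ℕ),
      (∀ q : Coord n, (slAct c α β γ i a).vec ((slAct c α' β' γ' i b).coef q) u =
        if q.1 = i then coeff q.2.val (X ^ b *
          sl2FieldDeriv α' γ' (block u i) * (X ^ a * sl2Field α β γ (block u i)))
        else 0) ∧ (slAct c α β γ i a).vec (slAct c α' β' γ' i b).pot u = dchi (n i) (c i)
        (X ^ b * C γ' * (X ^ a * sl2Field α β γ (block u i))) := by
    intro α β γ α' β' γ' a b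
    refine ⟨fun q => ?_, ?_⟩
    · obtain ⟨k', q⟩ := q
      by_cases hk : k' = i
      · subst hk
        have : (slAct (n := n) c α' β' γ' k' b).coef ⟨k', q⟩ = fun v => coeff q.val
          (X ^ b * sl2Field α' β' γ' (block v k')) := by
            ext v; rw [slAct_coef, if_pos rfl]
        rw [this, slAct_vec_coeff c α β γ k' k' a (hasPSDerivAt_sl2Field α' β' γ' k' b u) q.2]
      · have : (slAct (n := n) c α' β' γ' i b).coef ⟨k', q⟩ = fun v => 0 := by
            ext v; rw [slAct_coef, if_neg hk]
        rw [this, slAct_vec, if_neg hk]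
        simp [dCoord_const]
    · have : (slAct (n := n) c α' β' γ' i b).pot = fun v => dchi (n i) (c i)
        (X ^ b * (C γ' * block v i - C α')) := rfl
      rw [this, slAct_vec_dchi hn c α β γ i i a (hasPSDerivAt_slPot α' γ' i b u), if_pos rfl]
  obtain ⟨h1, h2⟩ := key α β γ α' β' γ' a b
  obtain ⟨h3, h4⟩ := key α' β' γ' α β γ b a
  simp only [h1, h2, h3, h4]
  congr 1
  · rw [← sum_coord_block (n := n) i (fun p => coeff p.2.val
      (X ^ (a + b) * (sl2FieldDeriv α' γ' (block u i) * sl2Field α β γ (block u i) -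
        sl2FieldDeriv α γ (block u i) * sl2Field α' β' γ' (block u i))) * dCoord p φ u)]
    refine sum_congr rfl fun q _ => ?_
    split_ifs with h
    · rw [← map_sub]; congr 2; ring
    · ring
  · congr 1
    have : ∀ x y, dchi (n i) (c i) x - dchi (n i) (c i) y = dchi (n i) (c i) (x - y) := by
      intro x y
      simp only [dchi, map_sub, mul_sub, sum_sub_distrib]; ring
    rw [this]; congr 1; ring

/-- The sign is opposite to [h, e] = 2 e, since operators coming from a right action compose in the
reverse order. -/
theorem opH_opE_comm (hn : ∀ i, 1 ≤ n i) (c : ι → ℕ → ℂ) (i : ι) (a b : ℕ) (hφ : ContDiff ℝ ∞ φ)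
    (u : Cfg n) : (opH c i a).act ((opE c i b).act φ) u - (opE c i b).act ((opH c i a).act φ) u =
      -2 * (opE c i (a + b)).act φ u := by
  rw [opH, opE, slAct_commutator_same hn c 1 0 0 0 1 0 i a b hφ, FirstOrder.act_eq,
    opE, slAct_vec, slAct_pot, mul_add, mul_sum]
  congr 1
  · refine sum_congr rfl fun q _ => ?_
    rw [← mul_assoc]; congr 1
    rw [← coeff_C_mul_eq]; congr 1
    simp [sl2Field, sl2FieldDeriv]; ring
  · simp [dchi]

theorem opE_opF_comm (hn : ∀ i, 1 ≤ n i) (c : ι → ℕ → ℂ) (i : ι) (a b : ℕ) (hφ : ContDiff ℝ ∞ φ)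
    (u : Cfg n) : (opE c i a).act ((opF c i b).act φ) u - (opF c i b).act ((opE c i a).act φ) u =
      -(opH c i (a + b)).act φ u := by
  rw [opF, opE, slAct_commutator_same hn c 0 1 0 0 0 1 i a b hφ, FirstOrder.act_eq,
    opH, slAct_vec, slAct_pot, neg_add, ← sum_neg_distrib]
  congr 1
  · refine sum_congr rfl fun q _ => ?_
    rw [← neg_mul, ← map_neg]; congr 2
    simp [sl2Field, sl2FieldDeriv]
  · rw [← neg_mul]; congr 1
    simp [dchi, sl2Field]; ring

/-- This is ε_i ^ n_i = 0. It lets brackets of indices a and b be used without asking whether a + b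
< n_i. -/
theorem op_act_eq_zero (hn : ∀ i, 1 ≤ n i) (c : ι → ℕ → ℂ) (α β γ : ℂ) (i : ι) {a : ℕ}
    (ha : n i ≤ a) (φ : Cfg n → ℂ) (u : Cfg n) : (slAct c α β γ i a).act φ u = 0 := by
  rw [FirstOrder.act_eq, slAct_vec, slAct_pot]
  have h0 : ∀ (b : ℂ⟦X⟧), PSCongr (n i) (X ^ a * b) 0 := fun b => by
    unfold PSCongr
    rw [sub_zero]
    exact dvd_mul_of_dvd_left (pow_dvd_pow _ ha) _
  rw [dchi_congr (hn i) _ (h0 _), sum_eq_zero]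
  · simp [dchi]
  · intro q _
    rw [(h0 _).coeff_eq q.2]; simp

end Ops

/-! ### Finite sums and partial fractions -/

/-- An index k < m has k + 1 representations a + b, all with a, b < m, and g vanishes beyond. This
multiplicity is the factor a + 1 in the derivative of a generating function. -/
theorem sum_range_add_eq {g : ℕ → ℂ} (m : ℕ) (hg : ∀ k, m ≤ k → g k = 0) :
    ∑ a ∈ range m, ∑ b ∈ range m, g (a + b) = ∑ k ∈ range m, ((k : ℂ) + 1) * g k := by
  have h1 : ∀ k ∈ range m, ((k : ℂ) + 1) * g k = ∑ _a ∈ range (k + 1), g k := by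
    intro k _; simp
  rw [sum_congr rfl h1, sum_comm' (s := range m)
    (t := fun k => range (k + 1)) (t' := range m) (s' := fun a => Ico a m)]
  · refine sum_congr rfl fun a ha => ?_
    have ha := mem_range.1 ha
    rw [Finset.sum_Ico_eq_sum_range]
    refine (sum_subset (range_mono (Nat.sub_le _ _)) fun b _ hb => ?_).symm
    exact hg _ (by simp at hb; omega)
  · intro k a; simp; omega

/-- The principal part at `y = 0` of `1 / (y ^ (a + 1) (y + d) ^ (b + 1))`. -/
def principalPart (a b : ℕ) (d y : ℂ) : ℂ := ∑ j ∈ range (a + 1),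
    (-1) ^ (a - j) * (Nat.choose (a - j + b) b : ℂ) / d ^ (a - j + b + 1) / y ^ (j + 1)

theorem principalPart_zero_left (b : ℕ) (d y : ℂ) :
    principalPart 0 b d y = 1 / d ^ (b + 1) / y := by
  simp [principalPart]

theorem principalPart_succ_zero (a : ℕ) (d y : ℂ) :
    principalPart (a + 1) 0 d y = 1 / d * (1 / y ^ (a + 2) - principalPart a 0 d y) := by
  unfold principalPart
  rw [sum_range_succ]
  have : ∀ j ∈ range (a + 1),
      (-1 : ℂ) ^ (a + 1 - j) * (Nat.choose (a + 1 - j + 0) 0 : ℂ) / d ^ (a + 1 - j + 0 + 1) /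
        y ^ (j + 1) = -(1 / d) * ((-1) ^ (a - j) * (Nat.choose (a - j + 0) 0 : ℂ) /
          d ^ (a - j + 0 + 1) / y ^ (j + 1)) := by
    intro j hj
    have : a + 1 - j = (a - j) + 1 := by have := mem_range.1 hj; omega
    rw [this]
    simp only [Nat.choose_zero_right, pow_succ, add_zero]
    simp only [div_eq_mul_inv, mul_inv]; ring
  rw [sum_congr rfl this, ← mul_sum]
  simp only [Nat.sub_self, pow_zero, add_zero, Nat.choose_self, Nat.cast_one, zero_add, pow_one]
  simp only [div_eq_mul_inv]; ring

/-- Pascal's rule for the binomial coefficients, arranged to match the recursion that lowers one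
exponent of y^(a+1) (y+d)^(b+1) at a time. -/
theorem principalPart_succ_succ (a b : ℕ) (d y : ℂ) : principalPart (a + 1) (b + 1) d y =
      1 / d * (principalPart (a + 1) b d y - principalPart a (b + 1) d y) := by
  unfold principalPart
  rw [sum_range_succ, sum_range_succ (n := a + 1)]
  have : ∀ j ∈ range (a + 1),
      (-1 : ℂ) ^ (a + 1 - j) * (Nat.choose (a + 1 - j + (b + 1)) (b + 1) : ℂ) /
        d ^ (a + 1 - j + (b + 1) + 1) / y ^ (j + 1) =
      1 / d * ((-1 : ℂ) ^ (a + 1 - j) * (Nat.choose (a + 1 - j + b) b : ℂ) /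
        d ^ (a + 1 - j + b + 1) / y ^ (j + 1)) - 1 / d *
        ((-1 : ℂ) ^ (a - j) * (Nat.choose (a - j + (b + 1)) (b + 1) : ℂ) /
        d ^ (a - j + (b + 1) + 1) / y ^ (j + 1)) := by
    intro j hj
    have e : a + 1 - j = (a - j) + 1 := by have := mem_range.1 hj; omega
    rw [e]
    generalize a - j = k
    have e2 : Nat.choose (k + 1 + (b + 1)) (b + 1) =
        Nat.choose (k + 1 + b) b + Nat.choose (k + (b + 1)) (b + 1) := by
      rw [show k + 1 + (b + 1) = (k + 1 + b) + 1 by ring, Nat.choose_succ_succ]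
      congr 2; ring
    rw [e2, show k + 1 + (b + 1) + 1 = (k + b + 2) + 1 by ring,
      show k + 1 + b + 1 = k + b + 2 by ring, show k + (b + 1) + 1 = k + b + 2 by ring]
    push_cast
    simp only [div_eq_mul_inv, pow_succ, mul_inv]; ring
  rw [sum_congr rfl this, sum_sub_distrib, ← mul_sum, ← mul_sum]
  simp only [Nat.sub_self, pow_zero, zero_add, Nat.choose_self, Nat.cast_one, one_mul]
  simp only [div_eq_mul_inv, pow_succ, mul_inv]; ring

/-- From 1/(y z) = (1/d)(1/y - 1/z) the product satisfies a recursion in both exponents, and double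
induction matches it with that of the principal parts. At the second pole the roles are exchanged,
with y = z + (-d), whence the sign. -/
theorem one_div_eq_principalPart {y d : ℂ} (hy : y ≠ 0) (hz : z ≠ 0) (hd : d ≠ 0)
    (h : z = y + d) (a b : ℕ) :
    1 / (y ^ (a + 1) * z ^ (b + 1)) = principalPart a b d y + principalPart b a (-d) z := by
  have h00 : 1 / (y * z) = 1 / d * (1 / y - 1 / z) := by field_simp; rw [h]; ring
  have hrec : ∀ a b, 1 / (y ^ (a + 1) * z ^ (b + 1)) =
      1 / d * (1 / (y ^ (a + 1) * z ^ b) - 1 / (y ^ a * z ^ (b + 1))) := by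
    intro a b
    have : 1 / (y ^ (a + 1) * z ^ (b + 1)) = 1 / (y * z) * (1 / (y ^ a * z ^ b)) := by
      rw [pow_succ, pow_succ, div_mul_div_comm, one_mul]; congr 1; ring
    rw [this, h00, mul_assoc, sub_mul, div_mul_div_comm, div_mul_div_comm, one_mul]
    congr 3 <;> ring
  have hdn : (1 : ℂ) / -d = -(1 / d) := by rw [div_neg]
  induction a generalizing b with
  | zero =>
    induction b with
    | zero => simp only [principalPart_zero_left, zero_add, pow_one, h00, hdn]; ring
    | succ b ihb =>
      rw [hrec, principalPart_zero_left, principalPart_succ_zero]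
      rw [zero_add, pow_zero, one_mul] at *
      rw [ihb, principalPart_zero_left, hdn]
      simp only [div_eq_mul_inv, pow_succ, mul_inv]; ring
  | succ a iha =>
    induction b with
    | zero =>
      rw [hrec, principalPart_zero_left, principalPart_succ_zero, pow_zero, mul_one, iha,
        principalPart_zero_left]
      simp only [div_eq_mul_inv, pow_succ, mul_inv, inv_neg]; ring
    | succ b ihb =>
      rw [hrec, ihb, iha, principalPart_succ_succ, principalPart_succ_succ, hdn]; ring

section Expansion

/-- A product of poles at different points splits into a principal part at each of them. The part of
the term (i, k) at t_k is credited to the point k, which produces the symmetric expression T i a k b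
+ T k b i a. -/
theorem sum_partial_fractions (n : ι → ℕ) {t : ι → ℂ} (ht : Injective t) {x : ℂ}
    (hx : ∀ i, x ≠ t i) (T : ι → ℕ → ι → ℕ → ℂ) : ∑ i, ∑ a ∈ range (n i), ∑ k, ∑ b ∈ range (n k),
      T i a k b / ((x - t i) ^ (a + 1) * (x - t k) ^ (b + 1)) = ∑ i, ∑ j ∈ range (2 * n i),
      ((∑ a ∈ range (n i), ∑ b ∈ range (n i), if a + b + 1 = j then T i a i b else 0) +
      ∑ k ∈ univ.erase i, ∑ a ∈ Ico j (n i), ∑ b ∈ range (n k),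
        (-1) ^ (a - j) * (Nat.choose (a - j + b) b : ℂ) / (t i - t k) ^ (a - j + b + 1) *
          (T i a k b + T k b i a)) / (x - t i) ^ (j + 1) := by
  have hy : ∀ i, x - t i ≠ 0 := fun i => sub_ne_zero.2 (hx i)
  have hd : ∀ i k, i ≠ k → t i - t k ≠ 0 := fun i k h => sub_ne_zero.2 fun e => h (ht e)
  -- reorganize the left side
  have hL : ∀ i, ∑ a ∈ range (n i), ∑ k, ∑ b ∈ range (n k),
      T i a k b / ((x - t i) ^ (a + 1) * (x - t k) ^ (b + 1)) =
      ∑ a ∈ range (n i), ∑ b ∈ range (n i), T i a i b / (x - t i) ^ (a + b + 2) +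
      ∑ k ∈ univ.erase i, ∑ a ∈ range (n i), ∑ b ∈ range (n k),
        T i a k b * (principalPart a b (t i - t k) (x - t i) +
          principalPart b a (t k - t i) (x - t k)) := by
    intro i
    rw [sum_comm, ← Finset.add_sum_erase _ _ (mem_univ i)]
    congr 1
    · exact sum_congr rfl fun a _ => sum_congr rfl fun b _ => by
        rw [← pow_add]; congr 2; ring
    · refine sum_congr rfl fun k hk => sum_congr rfl fun a _ =>
        sum_congr rfl fun b _ => ?_
      have hne : i ≠ k := (Finset.ne_of_mem_erase hk).symm
      have := one_div_eq_principalPart (hy i) (hy k) (hd i k hne) (by ring) a b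
      rw [neg_sub] at this
      rw [← this, mul_one_div]
  simp only [hL, sum_add_distrib, mul_add, add_div]
  have hdiag : ∀ i, ∑ a ∈ range (n i), ∑ b ∈ range (n i), T i a i b / (x - t i) ^ (a + b + 2) =
      ∑ j ∈ range (2 * n i), (∑ a ∈ range (n i), ∑ b ∈ range (n i),
        if a + b + 1 = j then T i a i b else 0) / (x - t i) ^ (j + 1) := by
    intro i
    simp only [sum_div]
    rw [sum_comm (s := range (2 * n i))]
    refine sum_congr rfl fun a ha => ?_
    rw [sum_comm (s := range (2 * n i))]
    refine sum_congr rfl fun b hb => ?_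
    have ha := mem_range.1 ha
    have hb := mem_range.1 hb
    rw [sum_eq_single (a + b + 1)]
    · rw [if_pos rfl]
    · intro j _ hj; rw [if_neg (Ne.symm hj), zero_div]
    · intro h; exact absurd (mem_range.2 (by omega)) h
  -- Stated for arbitrary coefficients because it is used both for T and for T with its two points
  -- exchanged.
  have hoff : ∀ U : ι → ℕ → ι → ℕ → ℂ, ∀ i, ∑ k ∈ univ.erase i,
      ∑ a ∈ range (n i), ∑ b ∈ range (n k), U i a k b * principalPart a b (t i - t k) (x - t i) =
      ∑ j ∈ range (2 * n i), (∑ k ∈ univ.erase i, ∑ a ∈ Ico j (n i),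
        ∑ b ∈ range (n k), (-1) ^ (a - j) * (Nat.choose (a - j + b) b : ℂ) /
          (t i - t k) ^ (a - j + b + 1) * U i a k b) / (x - t i) ^ (j + 1) := by
    intro U i
    simp only [sum_div]
    rw [sum_comm (s := range (2 * n i))]
    refine sum_congr rfl fun k _ => ?_
    rw [sum_comm' (s := range (2 * n i)) (t := fun j => Ico j (n i))
      (t' := range (n i)) (s' := fun a => range (a + 1))
      (by intro j a; simp; omega)]
    refine sum_congr rfl fun a _ => ?_
    rw [sum_comm]
    refine sum_congr rfl fun b _ => ?_
    rw [principalPart, mul_sum]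
    exact sum_congr rfl fun j _ => by simp only [div_eq_mul_inv]; ring
  -- Exchanging the names of the two points turns the principal parts at t_k into principal parts at
  -- t_i.
  have hsw : ∑ i, ∑ k ∈ univ.erase i, ∑ a ∈ range (n i), ∑ b ∈ range (n k),
        T i a k b * principalPart b a (t k - t i) (x - t k) =
      ∑ i, ∑ k ∈ univ.erase i, ∑ a ∈ range (n i), ∑ b ∈ range (n k),
        T k b i a * principalPart a b (t i - t k) (x - t i) := by
    rw [sum_comm' (t' := univ) (s' := fun k => univ.erase k)
      (by intro i k; simp [eq_comm])]
    exact sum_congr rfl fun i _ => sum_congr rfl fun k _ => sum_comm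
  rw [hsw, sum_congr rfl fun i _ => hdiag i, sum_congr rfl fun i _ => hoff T i,
    sum_congr rfl fun i _ => hoff (fun i a k b => T k b i a) i]

/-! ### Generating functions of operators -/

theorem act_genOp (t : ι → ℂ) (x : ℂ) {D' : ι → ℕ → FirstOrder n}
    (hD' : ∀ i a, (D' i a).IsSmooth) (D : FirstOrder n) (hφ : ContDiff ℝ ∞ φ)
    (u : Cfg n) : D.act (genOp t (fun i a => (D' i a).act) x φ) u =
      ∑ k, ∑ b ∈ range (n k), D.act ((D' k b).act φ) u / (x - t k) ^ (b + 1) := by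
  have h := D.act_sum (univ.sigma fun i => range (n i))
    (fun p : (_ : ι) × ℕ => 1 / (x - t p.1) ^ (p.2 + 1))
    (f := fun p => (D' p.1 p.2).act φ) (fun p => (hD' p.1 p.2).act hφ) u
  rw [sum_sigma] at h
  have e : genOp t (fun i a => (D' i a).act) x φ = fun v =>
      ∑ p ∈ univ.sigma fun i => range (n i),
        1 / (x - t p.1) ^ (p.2 + 1) * (D' p.1 p.2).act φ v := by
    ext v
    rw [sum_sigma]
    exact sum_congr rfl fun i _ => sum_congr rfl fun a _ => by
      rw [one_div_mul_eq_div]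
  rw [e, h]
  exact sum_congr rfl fun i _ => sum_congr rfl fun a _ => by rw [one_div_mul_eq_div]

theorem genOp_genOp (t : ι → ℂ) (x : ℂ) (D : ι → ℕ → FirstOrder n) {D' : ι → ℕ → FirstOrder n}
    (hD' : ∀ i a, (D' i a).IsSmooth) (hφ : ContDiff ℝ ∞ φ) (u : Cfg n) :
    genOp t (fun i a => (D i a).act) x (genOp t (fun i a => (D' i a).act) x φ) u =
      ∑ i, ∑ a ∈ range (n i), ∑ k, ∑ b ∈ range (n k),
        (D i a).act ((D' k b).act φ) u / ((x - t i) ^ (a + 1) * (x - t k) ^ (b + 1)) := by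
  rw [genOp]
  refine sum_congr rfl fun i _ => sum_congr rfl fun a _ => ?_
  rw [act_genOp t x hD' (D i a) hφ u]
  simp only [sum_div, div_div]
  exact sum_congr rfl fun k _ => sum_congr rfl fun b _ => by
    rw [mul_comm ((x - t k) ^ (b + 1))]

/-- Operators at different points commute and brackets at one point depend on a + b only, so the
double sum of poles collapses to the shape of a derivative of a generating function. -/
theorem genOp_commutator (t : ι → ℂ) (x : ℂ) {D D' : ι → ℕ → FirstOrder n}
    (hD : ∀ i a, (D i a).IsSmooth) (hD' : ∀ i a, (D' i a).IsSmooth)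
    (hφ : ContDiff ℝ ∞ φ) (u : Cfg n) (Z : ι → ℕ → ℂ)
    (hne : ∀ i k a b, i ≠ k → (D i a).act ((D' k b).act φ) u = (D' k b).act ((D i a).act φ) u)
    (heq : ∀ i a b, (D i a).act ((D' i b).act φ) u - (D' i b).act ((D i a).act φ) u = Z i (a + b))
    (hZ : ∀ i k, n i ≤ k → Z i k = 0) :
    genOp t (fun i a => (D i a).act) x (genOp t (fun i a => (D' i a).act) x φ) u -
      genOp t (fun i a => (D' i a).act) x (genOp t (fun i a => (D i a).act) x φ) u =
      ∑ i, ∑ k ∈ range (n i), ((k : ℂ) + 1) * Z i k / (x - t i) ^ (k + 2) := by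
  rw [genOp_genOp t x D hD' hφ, genOp_genOp t x D' hD hφ]
  have hsw : ∑ i, ∑ a ∈ range (n i), ∑ k, ∑ b ∈ range (n k),
        (D' i a).act ((D k b).act φ) u / ((x - t i) ^ (a + 1) * (x - t k) ^ (b + 1)) =
      ∑ i, ∑ a ∈ range (n i), ∑ k, ∑ b ∈ range (n k),
        (D' k b).act ((D i a).act φ) u / ((x - t i) ^ (a + 1) * (x - t k) ^ (b + 1)) := by
    simp only [Finset.sum_sigma']
    refine sum_bij' (fun p _ => ⟨p.2.2.1, p.2.2.2, p.1, p.2.1⟩)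
      (fun p _ => ⟨p.2.2.1, p.2.2.2, p.1, p.2.1⟩) ?_ ?_ ?_ ?_ ?_
    · rintro ⟨i, a, k, b⟩ h; simp at h ⊢; exact ⟨h.2, h.1⟩
    · rintro ⟨i, a, k, b⟩ h; simp at h ⊢; exact ⟨h.2, h.1⟩
    · rintro ⟨i, a, k, b⟩ h; rfl
    · rintro ⟨i, a, k, b⟩ h; rfl
    · rintro ⟨i, a, k, b⟩ h; simp only; rw [mul_comm]
  rw [hsw, ← sum_sub_distrib]
  refine sum_congr rfl fun i _ => ?_
  rw [← sum_sub_distrib]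
  have h1 : ∀ a ∈ range (n i), (∑ k, ∑ b ∈ range (n k),
        (D i a).act ((D' k b).act φ) u / ((x - t i) ^ (a + 1) * (x - t k) ^ (b + 1)) -
      ∑ k, ∑ b ∈ range (n k),
        (D' k b).act ((D i a).act φ) u / ((x - t i) ^ (a + 1) * (x - t k) ^ (b + 1))) =
      ∑ b ∈ range (n i), Z i (a + b) / (x - t i) ^ (a + b + 2) := by
    intro a _
    rw [← sum_sub_distrib, sum_eq_single i]
    · rw [← sum_sub_distrib]
      refine sum_congr rfl fun b _ => ?_
      rw [← sub_div, heq, ← pow_add]; congr 2; ring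
    · intro k _ hk
      rw [← sum_sub_distrib]
      exact sum_eq_zero fun b _ => by rw [hne i k a b hk.symm, sub_self]
    · simp
  rw [sum_congr rfl h1, sum_range_add_eq (g := fun k => Z i k / (x - t i) ^ (k + 2)) _
    fun k hk => by rw [hZ i k hk, zero_div]]
  exact sum_congr rfl fun k _ => by rw [mul_div_assoc]

theorem opE_isSmooth (c : ι → ℕ → ℂ) (i : ι) (a : ℕ) : (opE (n := n) c i a).IsSmooth :=
  slAct_isSmooth ..

theorem opF_isSmooth (c : ι → ℕ → ℂ) (i : ι) (a : ℕ) : (opF (n := n) c i a).IsSmooth :=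
  slAct_isSmooth ..

theorem opH_isSmooth (c : ι → ℕ → ℂ) (i : ι) (a : ℕ) : (opH (n := n) c i a).IsSmooth :=
  slAct_isSmooth ..

theorem genOp_opH_opE (hn : ∀ i, 1 ≤ n i) (t : ι → ℂ) (c : ι → ℕ → ℂ) (x : ℂ)
    (hφ : ContDiff ℝ ∞ φ) (u : Cfg n) :
    genOp t (fun i a => (opH c i a).act) x (genOp t (fun i a => (opE c i a).act) x φ) u -
      genOp t (fun i a => (opE c i a).act) x (genOp t (fun i a => (opH c i a).act) x φ) u =
      2 * genOpDeriv t (fun i a => (opE c i a).act) x φ u := by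
  rw [genOp_commutator t x (opH_isSmooth c) (opE_isSmooth c) hφ u
    (fun i k => -2 * (opE c i k).act φ u)
    (fun i k a b hik => slAct_commutator_of_ne hn c _ _ _ _ _ _ hik a b hφ u)
    (fun i a b => opH_opE_comm hn c i a b hφ u)
    (fun i k hk => by rw [opE, op_act_eq_zero hn c _ _ _ i hk, mul_zero])]
  rw [genOpDeriv, mul_neg, mul_sum, ← sum_neg_distrib]
  refine sum_congr rfl fun i _ => ?_
  rw [mul_sum, ← sum_neg_distrib]
  exact sum_congr rfl fun k _ => by ring

theorem genOp_opE_opF (hn : ∀ i, 1 ≤ n i) (t : ι → ℂ) (c : ι → ℕ → ℂ) (x : ℂ)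
    (hφ : ContDiff ℝ ∞ φ) (u : Cfg n) :
    genOp t (fun i a => (opE c i a).act) x (genOp t (fun i a => (opF c i a).act) x φ) u -
      genOp t (fun i a => (opF c i a).act) x (genOp t (fun i a => (opE c i a).act) x φ) u =
      genOpDeriv t (fun i a => (opH c i a).act) x φ u := by
  rw [genOp_commutator t x (opE_isSmooth c) (opF_isSmooth c) hφ u
    (fun i k => -(opH c i k).act φ u)
    (fun i k a b hik => slAct_commutator_of_ne hn c _ _ _ _ _ _ hik a b hφ u)
    (fun i a b => opE_opF_comm hn c i a b hφ u)
    (fun i k hk => by rw [opH, op_act_eq_zero hn c _ _ _ i hk, neg_zero])]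
  rw [genOpDeriv, ← sum_neg_distrib]
  refine sum_congr rfl fun i _ => ?_
  rw [← sum_neg_distrib]
  exact sum_congr rfl fun k _ => by ring

/-- The term h'(x)/2 is exactly what symmetrizes the product: since e(x) f(x) - f(x) e(x) = h'(x)
for these operators in the order of application, F E + h'/2 equals (E F + F E)/2. The rest is the
partial fraction expansion of a symmetric double sum. -/
theorem gaudinGen_eq_sum (hn : ∀ i, 1 ≤ n i) (ht : Injective t)
    (c : ι → ℕ → ℂ) (hx : ∀ i, x ≠ t i) (hφ : ContDiff ℝ ∞ φ) (u : Cfg n) :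
    gaudinGen t c x φ u = ∑ i, ∑ j ∈ range (2 * n i), gaudin t c i j φ u / (x - t i) ^ (j + 1) := by
  set T : ι → ℕ → ι → ℕ → ℂ := fun i a k b =>
    1 / 2 * ((opE c i a).act ((opF c k b).act φ) u + (opF c i a).act ((opE c k b).act φ) u) +
      1 / 4 * (opH c i a).act ((opH c k b).act φ) u with hT
  have h1 : gaudinGen t c x φ u = ∑ i, ∑ a ∈ range (n i), ∑ k, ∑ b ∈ range (n k),
      T i a k b / ((x - t i) ^ (a + 1) * (x - t k) ^ (b + 1)) := by
    have hc := genOp_opE_opF hn t c x hφ u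
    have : gaudinGen t c x φ u = 1 / 2 * (genOp t (fun i a => (opE c i a).act) x
            (genOp t (fun i a => (opF c i a).act) x φ) u + genOp t (fun i a => (opF c i a).act) x
            (genOp t (fun i a => (opE c i a).act) x φ) u) +
        1 / 4 * genOp t (fun i a => (opH c i a).act) x
            (genOp t (fun i a => (opH c i a).act) x φ) u := by
      rw [gaudinGen]; linear_combination -(1 / 2) * hc
    rw [this, genOp_genOp t x _ (opF_isSmooth c) hφ, genOp_genOp t x _ (opE_isSmooth c) hφ,
      genOp_genOp t x _ (opH_isSmooth c) hφ]
    simp only [mul_sum, ← sum_add_distrib]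
    exact sum_congr rfl fun i _ => sum_congr rfl fun a _ =>
      sum_congr rfl fun k _ => sum_congr rfl fun b _ => by rw [hT]; ring
  rw [h1, sum_partial_fractions n ht hx T]
  refine sum_congr rfl fun i _ => sum_congr rfl fun j _ => ?_
  congr 1
  rw [gaudin, gaudinOf]
  congr 1
  -- At a single point the sum over a + b + 1 = j is symmetric in a and b, which converts F_a E_b
  -- into the order F_b E_a used in `gaudinOf`.
  · have hs : ∀ f : ℕ → ℕ → ℂ, ∑ a ∈ range (n i), ∑ b ∈ range (n i),
        (if a + b + 1 = j then f a b else 0) = ∑ a ∈ range (n i), ∑ b ∈ range (n i),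
        (if a + b + 1 = j then f b a else 0) := by
      intro f
      rw [sum_comm]
      exact sum_congr rfl fun a _ => sum_congr rfl fun b _ => by rw [add_comm a b]
    have e1 : ∀ a b, (if a + b + 1 = j then T i a i b else 0) =
        (if a + b + 1 = j then 1 / 2 * (opE c i a).act ((opF c i b).act φ) u +
          1 / 4 * (opH c i a).act ((opH c i b).act φ) u else 0) +
        (if a + b + 1 = j then 1 / 2 * (opF c i a).act ((opE c i b).act φ) u else 0) := by
      intro a b; rw [hT]; split_ifs <;> ring
    simp only [e1, sum_add_distrib]
    rw [hs fun a b => 1 / 2 * (opF c i a).act ((opE c i b).act φ) u]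
    simp only [← sum_add_distrib]
    exact sum_congr rfl fun a _ => sum_congr rfl fun b _ => by
      split_ifs <;> ring
  · refine sum_congr rfl fun k hk => sum_congr rfl fun a _ =>
      sum_congr rfl fun b _ => ?_
    have hki : k ≠ i := Finset.ne_of_mem_erase hk
    congr 1
    simp only [hT]
    rw [show (opE c k b).act ((opF c i a).act φ) u = (opF c i a).act ((opE c k b).act φ) u from
        slAct_commutator_of_ne hn c _ _ _ _ _ _ hki b a hφ u,
      show (opF c k b).act ((opE c i a).act φ) u = (opE c i a).act ((opF c k b).act φ) u from
        slAct_commutator_of_ne hn c _ _ _ _ _ _ hki b a hφ u,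
      show (opH c k b).act ((opH c i a).act φ) u = (opH c i a).act ((opH c k b).act φ) u from
        slAct_commutator_of_ne hn c _ _ _ _ _ _ hki b a hφ u]
    ring

/-! ### Transposes -/

/-- The linearization of the field on the block is multiplication by a power series, which is
triangular with constant diagonal. Each of the n_i coordinates therefore contributes the same
constant coefficient. -/
theorem slAct_div (c : ι → ℕ → ℂ) (α β γ : ℂ) (i : ι) (a : ℕ) (u : Cfg n) :
    ∑ p, dCoord p ((slAct c α β γ i a).coef p) u =
      n i * constantCoeff (X ^ a * sl2FieldDeriv α γ (block u i)) := by
  have h : ∀ p : Coord n, dCoord p ((slAct c α β γ i a).coef p) u = if p.1 = i then constantCoeff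
        (X ^ a * sl2FieldDeriv α γ (block u i)) else 0 := by
    rintro ⟨k, q⟩
    by_cases hk : k = i
    · subst hk
      have : (slAct (n := n) c α β γ k a).coef ⟨k, q⟩ = fun v => coeff q.val
          (X ^ a * sl2Field α β γ (block v k)) := by
        ext v; rw [slAct_coef, if_pos rfl]
      rw [this, dCoord_coeff (hasPSDerivAt_sl2Field α β γ k a u), block_single, if_pos rfl,
        if_pos rfl, coeff_mul_X_pow', if_pos le_rfl, Nat.sub_self,
        coeff_zero_apply]
    · have : (slAct (n := n) c α β γ i a).coef ⟨k, q⟩ = fun v => 0 := by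
        ext v; rw [slAct_coef, if_neg hk]
      rw [this, dCoord_const, if_neg hk]
  simp only [h]
  rw [sum_coord_block (n := n) i fun _ => constantCoeff
        (X ^ a * sl2FieldDeriv α γ (block u i))]
  simp

/-- This is where half-densities matter: the divergence is -2 n_i times the constant coefficient of
ε^a (γ z - α), so it changes -n_i into n_i in the potential. Up to a global sign, only c is
reversed. -/
theorem slAct_transpose (c : ι → ℕ → ℂ) (α β γ : ℂ) (i : ι) (a : ℕ) (hφ : ContDiff ℝ ∞ φ)
    (u : Cfg n) : (slAct c α β γ i a).transpose φ u = -(slAct (-c) α β γ i a).act φ u := by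
  have hs := slAct_isSmooth (n := n) c α β γ i a
  rw [FirstOrder.transpose, FirstOrder.act]
  have h : ∀ p, dCoord p (fun v => (slAct c α β γ i a).coef p v * φ v) u =
      dCoord p ((slAct c α β γ i a).coef p) u * φ u + (slAct c α β γ i a).coef p u * dCoord p φ u :=
    fun p => dCoord_mul (ContDiff.diffAt (hs.coef p) u) (ContDiff.diffAt hφ u) p
  simp only [h, sum_add_distrib]
  rw [← sum_mul, slAct_div]
  have hc : ∀ p, (slAct (-c) α β γ i a).coef p u = (slAct c α β γ i a).coef p u := fun p => rfl
  simp only [hc]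
  have hp : (slAct c α β γ i a).pot u - n i * constantCoeff
      (X ^ a * sl2FieldDeriv α γ (block u i)) = -(slAct (-c) α β γ i a).pot u := by
    simp only [slAct_pot, dchi, sl2FieldDeriv, Pi.neg_apply, neg_mul, sum_neg_distrib,
      map_mul, map_sub, constantCoeff_C]
    ring
  linear_combination φ u * hp

theorem slAct_transpose_transpose (c : ι → ℕ → ℂ) (α β γ α' β' γ' : ℂ) (i k : ι) (a b : ℕ)
    (hφ : ContDiff ℝ ∞ φ) (u : Cfg n) :
    (slAct c α β γ i a).transpose ((slAct c α' β' γ' k b).transpose φ) u =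
      (slAct (-c) α β γ i a).act ((slAct (-c) α' β' γ' k b).act φ) u := by
  have h1 : (slAct c α' β' γ' k b).transpose φ =
      fun v => ∑ _p ∈ ({0} : Finset ℕ), (-1 : ℂ) * (slAct (-c) α' β' γ' k b).act φ v := by
    ext v; rw [slAct_transpose _ _ _ _ _ _ hφ]; simp
  have hs : ContDiff ℝ ∞ ((slAct (-c) α' β' γ' k b).act φ) := (slAct_isSmooth ..).act hφ
  rw [h1, slAct_transpose _ _ _ _ _ _ (ContDiff.sum fun _ _ => contDiff_const.mul hs)]
  rw [FirstOrder.act_sum _ _ (fun _ => (-1 : ℂ)) (fun _ => hs)]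
  simp

/-- The signs of the two factors cancel in every quadratic term. Distributional statements for c
thus become statements about `gaudin t (-c)` applied to test functions. -/
theorem gaudinTranspose_eq (t : ι → ℂ) (c : ι → ℕ → ℂ) (i : ι) (j : ℕ)
    (hφ : ContDiff ℝ ∞ φ) (u : Cfg n) : gaudinTranspose t c i j φ u = gaudin t (-c) i j φ u := by
  simp only [gaudinTranspose, gaudin, gaudinOf, opE, opF, opH,
    slAct_transpose_transpose _ _ _ _ _ _ _ _ _ _ _ hφ]

/-! ### The scalars `l_i^{(j)}` -/

/-- The hypothesis on J gives p, q ≤ J, so every term of the convolution computing the coefficient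
of A B occurs in the sum. The answer depends on A and B only through their product, and this is what
makes the upper Casimir coefficients scalar. -/
theorem sum_coeff_mul_coeff {p q J : ℕ} (hp : p < m) (hq : q < m) (hJ : m ≤ J + 1) (A B : ℂ⟦X⟧) :
    (∑ a ∈ range m, ∑ b ∈ range m, if a + b = J then
      coeff p (X ^ a * A) * coeff q (X ^ b * B) else 0) = coeff (p + q) (X ^ J * (A * B)) := by
  have h1 : ∀ a ∈ range m, (∑ b ∈ range m, if a + b = J then
      coeff p (X ^ a * A) * coeff q (X ^ b * B) else 0) =
      if a ≤ p ∧ J ≤ a + q then coeff (p - a) A * coeff (q + a - J) B else 0 := by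
    intro a ha
    have ha := mem_range.1 ha
    by_cases h : a ≤ p ∧ J ≤ a + q
    · rw [if_pos h, sum_eq_single (J - a)]
      · rw [if_pos (by omega), coeff_X_pow_mul', coeff_X_pow_mul', if_pos h.1, if_pos (by omega)]
        congr 3; omega
      · intro b _ hb; rw [if_neg (by omega)]
      · intro hb; simp at hb; omega
    · rw [if_neg h]
      refine sum_eq_zero fun b _ => ?_
      split_ifs with hb
      · rw [coeff_X_pow_mul', coeff_X_pow_mul']
        by_cases h2 : a ≤ p
        · rw [if_neg (show ¬ b ≤ q by omega), mul_zero]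
        · rw [if_neg h2, zero_mul]
      · rfl
  rw [sum_congr rfl h1, coeff_X_pow_mul']
  split_ifs with h
  · rw [coeff_mul, Finset.Nat.sum_antidiagonal_eq_sum_range_succ_mk, ← Finset.sum_filter]
    refine sum_bij' (fun a _ => p - a) (fun l _ => p - l) ?_ ?_ ?_ ?_ ?_
    · intro a ha; simp at ha ⊢; omega
    · intro l hl; simp at hl ⊢; omega
    · intro a ha; simp at ha ⊢; omega
    · intro l hl; simp at hl ⊢; omega
    · intro a ha; simp at ha ⊢; left; congr 2; omega
  · exact sum_eq_zero fun a _ => if_neg (by omega)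

/-- The number by which `G_i^{(j)}` acts for `j ≥ n_i`. -/
def gaudinScalar (n : ι → ℕ) (c : ι → ℕ → ℂ) (i : ι) (j : ℕ) : ℂ :=
  ∑ a ∈ range (n i), ∑ b ∈ range (n i), if a + b + 1 = j then
    1 / 2 * dchi (n i) (c i) (X ^ (a + b)) +
      1 / 4 * (dchi (n i) (c i) (X ^ a) * dchi (n i) (c i) (X ^ b))
  else 0

theorem slAct_act_slAct_act (hn : ∀ i, 1 ≤ n i) (c : ι → ℕ → ℂ) (α β γ α' β' γ' : ℂ) (i : ι)
    (a b : ℕ) (hφ : ContDiff ℝ ∞ φ) (u : Cfg n) :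
    (slAct c α β γ i a).act ((slAct c α' β' γ' i b).act φ) u = ∑ p : Fin (n i), ∑ q : Fin (n i),
        coeff p.val (X ^ a * sl2Field α β γ (block u i)) *
        coeff q.val (X ^ b * sl2Field α' β' γ' (block u i)) * dCoord ⟨i, p⟩ (dCoord ⟨i, q⟩ φ) u +
      ∑ q : Fin (n i), (coeff q.val (X ^ (a + b) *
          (sl2FieldDeriv α' γ' (block u i) * sl2Field α β γ (block u i))) +
        (slAct c α' β' γ' i b).pot u * coeff q.val (X ^ a * sl2Field α β γ (block u i)) +
        (slAct c α β γ i a).pot u * coeff q.val (X ^ b * sl2Field α' β' γ' (block u i))) *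
            dCoord ⟨i, q⟩ φ u + (dchi (n i) (c i) (X ^ (a + b) *
          (C γ' * sl2Field α β γ (block u i))) +
        (slAct c α β γ i a).pot u * (slAct c α' β' γ' i b).pot u) * φ u := by
  have hs : (slAct c α' β' γ' i b).act φ = fun v =>
      (∑ q : Fin (n i), coeff q.val
        (X ^ b * sl2Field α' β' γ' (block v i)) * dCoord ⟨i, q⟩ φ v) +
      (slAct c α' β' γ' i b).pot v * φ v := by
    ext v; rw [FirstOrder.act_eq, slAct_vec]
  have hd : ∀ p : Fin (n i), dCoord ⟨i, p⟩ ((slAct c α' β' γ' i b).act φ) u =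
      ∑ q : Fin (n i), (coeff q.val (X ^ b *
        sl2FieldDeriv α' γ' (block u i) * X ^ p.val) * dCoord ⟨i, q⟩ φ u +
        coeff q.val (X ^ b * sl2Field α' β' γ' (block u i)) * dCoord ⟨i, p⟩ (dCoord ⟨i, q⟩ φ) u) +
      (dchi (n i) (c i) (X ^ b * C γ' * X ^ p.val) * φ u +
        (slAct c α' β' γ' i b).pot u * dCoord ⟨i, p⟩ φ u) := by
    intro p
    have hc : ∀ q : Fin (n i), ContDiff ℝ ∞ fun v : Cfg n => coeff q.val
        (X ^ b * sl2Field α' β' γ' (block v i)) := fun q => psSmooth_sl2Field α' β' γ' i b _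
    have hp : ContDiff ℝ ∞ (slAct (n := n) c α' β' γ' i b).pot := (slAct_isSmooth ..).pot
    rw [hs, dCoord_add (ContDiff.diffAt (ContDiff.sum fun q _ =>
        (hc q).mul (ContDiff.dCoord hφ _)) u) (ContDiff.diffAt (hp.mul hφ) u),
      dCoord_sum _ (fun q _ => ContDiff.diffAt ((hc q).mul (ContDiff.dCoord hφ _)) u),
      dCoord_mul (ContDiff.diffAt hp u) (ContDiff.diffAt hφ u)]
    have e2 : dCoord ⟨i, p⟩ (slAct c α' β' γ' i b).pot u =
        dchi (n i) (c i) (X ^ b * C γ' * X ^ p.val) := by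
      have : (slAct (n := n) c α' β' γ' i b).pot = fun v => dchi (n i) (c i)
        (X ^ b * (C γ' * block v i - C α')) := rfl
      rw [this, dCoord_dchi (hasPSDerivAt_slPot α' γ' i b u), block_single, if_pos rfl]
    rw [e2]
    congr 1
    refine sum_congr rfl fun q _ => ?_
    rw [dCoord_mul (ContDiff.diffAt (hc q) u) (ContDiff.diffAt (ContDiff.dCoord hφ _) u),
      dCoord_coeff (hasPSDerivAt_sl2Field α' β' γ' i b u), block_single, if_pos rfl]
  rw [FirstOrder.act_eq, slAct_vec]
  simp only [hd]
  rw [hs]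
  simp only [mul_add, add_mul, mul_sum, sum_add_distrib]
  have k1 : ∀ q : Fin (n i), coeff q.val (X ^ (a + b) *
          (sl2FieldDeriv α' γ' (block u i) * sl2Field α β γ (block u i))) = ∑ p : Fin (n i),
        coeff p.val (X ^ a * sl2Field α β γ (block u i)) * coeff q.val (X ^ b *
            sl2FieldDeriv α' γ' (block u i) * X ^ p.val) := by
    intro q
    rw [sum_coeff_mul_X_pow _ _ q.2]
    congr 1; ring
  have k2 : dchi (n i) (c i) (X ^ (a + b) * (C γ' * sl2Field α β γ (block u i))) = ∑ p : Fin (n i),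
        coeff p.val (X ^ a * sl2Field α β γ (block u i)) *
          dchi (n i) (c i) (X ^ b * C γ' * X ^ p.val) := by
    rw [dchi_sum]
    refine dchi_congr (hn i) _ (psCongr_iff.2 fun j hj => ?_)
    rw [map_sum]
    simp only [coeff_C_mul]
    rw [sum_coeff_mul_X_pow _ _ hj]
    congr 1; ring
  simp only [k1, k2, sum_mul]
  rw [sum_comm (f := fun (q p : Fin (n i)) =>
    coeff p.val (X ^ a * sl2Field α β γ (block u i)) * coeff q.val (X ^ b *
            sl2FieldDeriv α' γ' (block u i) * X ^ p.val) * dCoord ⟨i, q⟩ φ u)]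
  simp only [← mul_assoc]
  have k3 : ∀ p : Fin (n i), coeff p.val
      (X ^ a * sl2Field α β γ (block u i)) * (slAct c α' β' γ' i b).pot u =
      (slAct c α' β' γ' i b).pot u * coeff p.val
      (X ^ a * sl2Field α β γ (block u i)) := fun p => mul_comm _ _
  simp only [k3]
  ring

/-- The sum of `f a b` over the pairs `a, b < m` with `a + b = J`. -/
def pairSum (m J : ℕ) (f : ℕ → ℕ → ℂ) : ℂ :=
  ∑ a ∈ range m, ∑ b ∈ range m, if a + b = J then f a b else 0

theorem pairSum_congr {J : ℕ} {f g : ℕ → ℕ → ℂ} (h : ∀ a b, a + b = J → f a b = g a b) :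
    pairSum m J f = pairSum m J g := sum_congr rfl fun a _ => sum_congr rfl fun b _ => by
    split_ifs with hab
    · exact h a b hab
    · rfl

theorem pairSum_add (m J : ℕ) (f g : ℕ → ℕ → ℂ) :
    pairSum m J (fun a b => f a b + g a b) = pairSum m J f + pairSum m J g := by
  simp only [pairSum, ← sum_add_distrib]
  exact sum_congr rfl fun a _ => sum_congr rfl fun b _ => by split_ifs <;> simp

theorem pairSum_sum_mul {κ : Type*} [Fintype κ] (m J : ℕ) (f : κ → ℕ → ℕ → ℂ) (d : κ → ℂ) :
    pairSum m J (fun a b => ∑ k, f k a b * d k) = ∑ k, pairSum m J (f k) * d k := by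
  simp only [pairSum, sum_mul]
  rw [sum_comm (s := univ)]
  refine sum_congr rfl fun a _ => ?_
  rw [sum_comm (s := univ)]
  exact sum_congr rfl fun b _ => by split_ifs <;> simp

theorem pairSum_mul (m J : ℕ) (f : ℕ → ℕ → ℂ) (d : ℂ) :
    pairSum m J (fun a b => f a b * d) = pairSum m J f * d := by
  simpa using pairSum_sum_mul (κ := Unit) m J (fun _ => f) (fun _ => d)

theorem dchi_eq_sum (hm : 1 ≤ m) (c : ℕ → ℂ) (b : ℂ⟦X⟧) : dchi m c b = ∑ p : Fin m, coeff p.val b *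
      ((if p.val = 0 then -(m : ℂ) else 0) + I / 2 * c p.val) := by
  rw [Fin.sum_univ_eq_sum_range (fun p => coeff p b *
    ((if p = 0 then -(m : ℂ) else 0) + I / 2 * c p))]
  simp only [mul_add, sum_add_distrib, dchi, mul_sum]
  congr 1
  · rw [sum_eq_single 0]
    · simp [mul_comm]
    · intro b _ hb; simp [hb]
    · intro h; simp at h; omega
  · exact sum_congr rfl fun p _ => by ring

/-- By `sum_coeff_mul_coeff` the symbols may be multiplied as series: the second order part becomes
z·z - 1·z² = 0, and the first order part z - z/2 - z/2 = 0 coming from products of fields with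
potentials. The derivatives of the fields cancel outright, so only products and derivatives of
potentials remain. -/
theorem sum_ite_add_eq_of_le (hn : ∀ i, 1 ≤ n i) (c : ι → ℕ → ℂ) (i : ι) (hj : n i ≤ j)
    (hφ : ContDiff ℝ ∞ φ) (u : Cfg n) : (∑ a ∈ range (n i), ∑ b ∈ range (n i), if a + b + 1 = j then
        1 / 2 * ((opE c i a).act ((opF c i b).act φ) u + (opF c i b).act ((opE c i a).act φ) u) +
          1 / 4 * (opH c i a).act ((opH c i b).act φ) u
      else 0) = gaudinScalar n c i j * φ u := by
  obtain ⟨J, rfl⟩ : ∃ J, j = J + 1 := ⟨j - 1, by have := hn i; omega⟩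
  simp only [gaudinScalar, Nat.add_right_cancel_iff]
  set z := block u i with hz
  set m := n i
  set lam : ℂ⟦X⟧ → ℂ := dchi m (c i) with hlam
  have hlneg : ∀ b, lam (-b) = -lam b := fun b => by simp [hlam, dchi]; ring
  have hl0 : lam 0 = 0 := by simp [hlam, dchi]
  have key : ∀ (p q : Fin m) (A B : ℂ⟦X⟧), pairSum m J (fun a b =>
      coeff p.val (X ^ a * A) * coeff q.val (X ^ b * B)) =
      coeff (p.val + q.val) (X ^ J * (A * B)) := fun p q A B => sum_coeff_mul_coeff p.2 q.2 hj A B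
  -- The terms are sorted by order, each written as a factor in ε^a times a factor in ε^b. The
  -- constant -1/2 is kept inside the series so that all first order terms are summed by the same
  -- formula.
  have step : ∀ a b, a + b = J →
      1 / 2 * ((opE c i a).act ((opF c i b).act φ) u + (opF c i b).act ((opE c i a).act φ) u) +
          1 / 4 * (opH c i a).act ((opH c i b).act φ) u = (∑ r : Fin m × Fin m,
        (coeff r.1.val (X ^ a * z) * coeff r.2.val (X ^ b * z) + coeff r.1.val (X ^ a * 1) *
            coeff r.2.val (X ^ b * -z ^ 2)) * dCoord ⟨i, r.1⟩ (dCoord ⟨i, r.2⟩ φ) u +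
      ∑ q : Fin m, (coeff q.val (X ^ a * 1) * lam (X ^ b * z) + (coeff q.val (X ^ a * z) *
            lam (X ^ b * C (-1 / 2)) + lam (X ^ a * C (-1 / 2)) *
            coeff q.val (X ^ b * z))) * dCoord ⟨i, q⟩ φ u) + (1 / 2 * lam (X ^ (a + b)) +
        1 / 4 * (lam (X ^ a) * lam (X ^ b))) * φ u := by
    intro a b hab
    have h1 := opE_opF_comm hn c i a b hφ u
    have hC : ∀ a, lam (X ^ a * C (-1 / 2)) = -1 / 2 * lam (X ^ a) := by
      intro a
      rw [mul_comm]
      simp only [hlam, dchi, coeff_C_mul, map_mul, constantCoeff_C, mul_sum, mul_add]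
      congr 1
      · ring
      · exact sum_congr rfl fun p _ => by ring
    have hE0 : ∀ a, (opE c i a).pot u = 0 := fun a => by
      rw [opE, slAct_pot]; simpa using hl0
    have hF0 : ∀ a, (opF c i a).pot u = lam (X ^ a * z) := fun a => by
      rw [opF, slAct_pot]; simp [hlam, m, hz]
    have hH0 : ∀ a, (opH c i a).pot u = -lam (X ^ a) := fun a => by
      rw [opH, slAct_pot, ← hlneg]; simp [hlam, m]
    have hE1 : sl2Field 0 1 0 z = 1 := by simp [sl2Field]
    have hF1 : sl2Field 0 0 1 z = -z ^ 2 := by simp [sl2Field]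
    have hH1 : sl2Field 1 0 0 z = 2 * z := by simp [sl2Field, map_ofNat C 2]
    have hF2 : sl2FieldDeriv 0 1 z = -2 * z := by simp [sl2FieldDeriv, map_ofNat C 2]
    have hH2 : sl2FieldDeriv 1 0 z = 2 := by simp [sl2FieldDeriv, map_ofNat C 2]
    have h2 : ∀ (k q : ℕ) (A : ℂ⟦X⟧), coeff q (X ^ k * (2 * A)) = 2 * coeff q (X ^ k * A) := by
      intro k q A
      rw [show X ^ k * (2 * A) = C 2 * (X ^ k * A) by
        rw [map_ofNat]; ring, coeff_C_mul]
    have hEF := slAct_act_slAct_act hn c 0 1 0 0 0 1 i a b hφ u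
    have hHH := slAct_act_slAct_act hn c 1 0 0 1 0 0 i a b hφ u
    have hHJ : (opH c i (a + b)).act φ u = ∑ q : Fin m,
        2 * coeff q.val (X ^ (a + b) * z) * dCoord ⟨i, q⟩ φ u - lam (X ^ (a + b)) * φ u := by
      rw [FirstOrder.act_eq, hH0, opH, slAct_vec, ← hz, hH1, neg_mul, ← sub_eq_add_neg]
      congr 1
      exact sum_congr rfl fun q _ => by rw [h2]
    rw [← hz, show dchi (n i) (c i) = lam from rfl] at hEF hHH
    change (opE c i a).act ((opF c i b).act φ) u = _ at hEF
    change (opH c i a).act ((opH c i b).act φ) u = _ at hHH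
    rw [show (slAct c 0 1 0 i a).pot u = 0 from hE0 a,
      show (slAct c 0 0 1 i b).pot u = _ from hF0 b, hE1, hF1, hF2] at hEF
    rw [show (slAct c 1 0 0 i a).pot u = _ from hH0 a,
      show (slAct c 1 0 0 i b).pot u = _ from hH0 b, hH1, hH2] at hHH
    rw [show (opF c i b).act ((opE c i a).act φ) u = (opE c i a).act ((opF c i b).act φ) u +
      (opH c i (a + b)).act φ u by linear_combination -h1, hEF, hHH, hHJ]
    have e3 : ∀ q : ℕ, coeff q (X ^ (a + b) * (-2 * z)) = -2 * coeff q (X ^ (a + b) * z) := by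
      intro q
      rw [show X ^ (a + b) * (-2 * z) = X ^ (a + b) * (2 * -z) by ring, h2, mul_neg, map_neg]; ring
    have e4 : ∀ q : ℕ, coeff q (X ^ (a + b) * (2 * (2 * z))) = 4 * coeff q (X ^ (a + b) * z) := by
      intro q; rw [h2, h2]; ring
    simp only [hC, e3, e4, h2, map_one, mul_one, map_zero, zero_mul, mul_zero, hl0,
      Fintype.sum_prod_type]
    have s2 : ∀ d : Fin m → Fin m → ℂ, ∑ p : Fin m, ∑ q : Fin m, (coeff p.val (X ^ a * z) *
            coeff q.val (X ^ b * z) + coeff p.val (X ^ a) * coeff q.val (X ^ b * -z ^ 2)) * d p q =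
        ∑ p : Fin m, ∑ q : Fin m, coeff p.val (X ^ a) * coeff q.val (X ^ b * -z ^ 2) * d p q +
        1 / 4 * ∑ p : Fin m, ∑ q : Fin m, 2 * coeff p.val (X ^ a * z) *
            (2 * coeff q.val (X ^ b * z)) * d p q := by
      intro d
      simp only [mul_sum, ← sum_add_distrib]
      exact sum_congr rfl fun p _ => sum_congr rfl fun q _ => by ring
    rw [s2]
    have s1 : ∀ (d : Fin m → ℂ) (x y w : ℂ), ∑ q : Fin m, (coeff q.val (X ^ a) * x +
          (coeff q.val (X ^ a * z) * (-1 / 2 * y) + -1 / 2 * w * coeff q.val (X ^ b * z))) * d q =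
        ∑ q : Fin m, (-2 * coeff q.val (X ^ (a + b) * z) + x * coeff q.val (X ^ a)) * d q +
        1 / 2 * ∑ q : Fin m, 2 * coeff q.val (X ^ (a + b) * z) * d q +
        1 / 4 * ∑ q : Fin m, (4 * coeff q.val (X ^ (a + b) * z) +
          -y * (2 * coeff q.val (X ^ a * z)) + -w * (2 * coeff q.val (X ^ b * z))) * d q := by
      intro d x y w
      simp only [mul_sum, ← sum_add_distrib]
      exact sum_congr rfl fun q _ => by ring
    rw [s1]
    simp only [add_zero]
    ring
  have hpair : ∀ f : ℕ → ℕ → ℂ, (∑ a ∈ range m, ∑ b ∈ range m,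
      if a + b = J then f a b else 0) = pairSum m J f := fun f => rfl
  rw [hpair, hpair, pairSum_congr step, pairSum_add, pairSum_mul, pairSum_add, pairSum_sum_mul,
    pairSum_sum_mul]
  have z1 : ∀ r : Fin m × Fin m, pairSum m J (fun a b =>
        coeff r.1.val (X ^ a * z) * coeff r.2.val (X ^ b * z) + coeff r.1.val (X ^ a * 1) *
            coeff r.2.val (X ^ b * -z ^ 2)) = 0 := by
    intro r
    rw [pairSum_add, key, key, ← map_add]
    have : X ^ J * (z * z) + X ^ J * (1 * -z ^ 2) = 0 := by ring
    rw [this, map_zero]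
  have hl : ∀ b, lam b = _ := fun b => dchi_eq_sum (hn i) (c i) b
  have k2 : ∀ (q : Fin m) (A B : ℂ⟦X⟧), pairSum m J (fun a b =>
      coeff q.val (X ^ a * A) * lam (X ^ b * B)) =
      ∑ p : Fin m, coeff (p.val + q.val) (X ^ J * (A * B)) *
        ((if p.val = 0 then -(m : ℂ) else 0) + I / 2 * c i p.val) := by
    intro q A B
    have : ∀ a b, coeff q.val (X ^ a * A) * lam (X ^ b * B) = ∑ p : Fin m, coeff q.val (X ^ a * A) *
        coeff p.val (X ^ b * B) * ((if p.val = 0 then -(m : ℂ) else 0) + I / 2 * c i p.val) := by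
      intro a b
      rw [hl, mul_sum]
      exact sum_congr rfl fun p _ => by ring
    simp only [this]
    rw [pairSum_sum_mul]
    exact sum_congr rfl fun p _ => by rw [key, add_comm q.val]
  have k3 : ∀ (q : Fin m) (A B : ℂ⟦X⟧), pairSum m J (fun a b =>
      lam (X ^ a * A) * coeff q.val (X ^ b * B)) =
      ∑ p : Fin m, coeff (p.val + q.val) (X ^ J * (A * B)) *
        ((if p.val = 0 then -(m : ℂ) else 0) + I / 2 * c i p.val) := by
    intro q A B
    have : ∀ a b, lam (X ^ a * A) * coeff q.val (X ^ b * B) = ∑ p : Fin m, coeff p.val (X ^ a * A) *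
        coeff q.val (X ^ b * B) * ((if p.val = 0 then -(m : ℂ) else 0) + I / 2 * c i p.val) := by
      intro a b
      rw [hl, sum_mul]
      exact sum_congr rfl fun p _ => by ring
    simp only [this]
    rw [pairSum_sum_mul]
    exact sum_congr rfl fun p _ => by rw [key]
  have z2 : ∀ q : Fin m, pairSum m J (fun a b => coeff q.val (X ^ a * 1) * lam (X ^ b * z) +
          (coeff q.val (X ^ a * z) * lam (X ^ b * C (-1 / 2)) + lam (X ^ a * C (-1 / 2)) *
            coeff q.val (X ^ b * z))) = 0 := by
    intro q
    rw [pairSum_add, pairSum_add, k2, k2, k3, ← sum_add_distrib, ← sum_add_distrib]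
    refine sum_eq_zero fun p _ => ?_
    rw [← add_mul, ← add_mul, ← map_add, ← map_add]
    have : X ^ J * (1 * z) + (X ^ J * (z * C (-1 / 2)) + X ^ J * (C (-1 / 2) * z)) = 0 := by
      have h : (C (-1 / 2 : ℂ)) + C (-1 / 2) = -1 := by
        rw [← map_add, ← map_one C, ← map_neg]; norm_num
      linear_combination X ^ J * z * h
    rw [this]; simp
  simp only [z1, z2, zero_mul, Finset.sum_const_zero, zero_add]

theorem gaudin_eq_scalar (hn : ∀ i, 1 ≤ n i) (t : ι → ℂ) (c : ι → ℕ → ℂ) (hj : n i ≤ j)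
    (hφ : ContDiff ℝ ∞ φ) (u : Cfg n) : gaudin t c i j φ u = gaudinScalar n c i j * φ u := by
  rw [gaudin, gaudinOf, sum_ite_add_eq_of_le hn c i hj hφ, Finset.Ico_eq_empty_of_le hj]
  simp

theorem gaudinScalar_eq_zero (c : ι → ℕ → ℂ) (hj : 2 * n i ≤ j) :
    gaudinScalar n c i j = 0 := sum_eq_zero fun a ha => sum_eq_zero fun b hb => by
    have := mem_range.1 ha
    have := mem_range.1 hb
    rw [if_neg (by omega)]

theorem dchi_X_pow (c : ℕ → ℂ) (a : ℕ) : dchi m c (X ^ a) =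
    (if a = 0 then -(m : ℂ) else 0) + if a < m then I / 2 * c a else 0 := by
  unfold dchi
  congr 1
  · rcases eq_or_ne a 0 with rfl | h
    · simp
    · simp [h]
  · simp only [coeff_X_pow, mul_ite, mul_one, mul_zero, sum_ite_eq', mem_range]

/-- Only a = b = n_i - 1 contributes. There ε^(a+b) = 0 because 2 n_i - 2 ≥ n_i, and the product of
potentials is (1/4)(i c/2)² = -c²/16, with c the top coefficient. -/
theorem gaudinScalar_top (hi : 2 ≤ n i) (hc : c i (n i - 1) ≠ 0) :
    gaudinScalar n c i (2 * n i - 1) ≠ 0 := by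
  have h : gaudinScalar n c i (2 * n i - 1) = -(c i (n i - 1)) ^ 2 / 16 := by
    rw [gaudinScalar, sum_eq_single (n i - 1)]
    · rw [sum_eq_single (n i - 1)]
      · rw [if_pos (by omega), dchi_X_pow, dchi_X_pow, if_neg (by omega), if_neg (by omega),
          if_neg (by omega), if_pos (by omega)]
        linear_combination (c i (n i - 1)) ^ 2 / 16 * I_sq
      · intro b hb hb'
        have := mem_range.1 hb
        rw [if_neg (by omega)]
      · intro h; simp at h; omega
    · intro a ha ha'
      refine sum_eq_zero fun b hb => ?_
      have := mem_range.1 ha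
      have := mem_range.1 hb
      rw [if_neg (by omega)]
    · intro h; simp at h; omega
  rw [h]
  simp [hc]

theorem pairSum_left_zero (m J : ℕ) (g : ℕ → ℂ) :
    pairSum m J (fun a b => if a = 0 then g b else 0) = if J < m then g J else 0 := by
  rcases Nat.eq_zero_or_pos m with rfl | hm
  · simp [pairSum]
  rw [pairSum, sum_eq_single 0]
  · simp only [zero_add, if_true, sum_ite_eq', mem_range]
  · intro a _ ha; simp [ha]
  · intro h; simp at h; omega

theorem pairSum_swap (m J : ℕ) (f : ℕ → ℕ → ℂ) :
    pairSum m J (fun a b => f b a) = pairSum m J f := by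
  rw [pairSum, sum_comm]
  exact sum_congr rfl fun a _ => sum_congr rfl fun b _ => by rw [add_comm]

theorem pairSum_const {J : ℕ} (h : J + 1 = m) (k : ℂ) : pairSum m J (fun _ _ => k) = m * k := by
  have : ∀ a ∈ range m, (∑ b ∈ range m, if a + b = J then k else 0) = k := by
    intro a ha
    have := mem_range.1 ha
    rw [sum_eq_single (J - a)]
    · rw [if_pos (by omega)]
    · intro b _ hb; rw [if_neg (by omega)]
    · intro h; simp at h; omega
  rw [pairSum, sum_congr rfl this]
  simp

/-- The part linear in c vanishes. For J = m - 1 the m pairs contribute multiples of c_J that are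
cancelled by the two cross terms with -m; for J ≥ m neither contribution exists. -/
theorem gaudinScalar_neg (hn : ∀ i, 1 ≤ n i) (c : ι → ℕ → ℂ) (hj : n i ≤ j) :
    gaudinScalar n (-c) i j = gaudinScalar n c i j := by
  have hi := hn i
  obtain ⟨J, rfl⟩ : ∃ J, j = J + 1 := ⟨j - 1, by omega⟩
  set m := n i with hm
  set d : ℕ → ℂ := fun a => if a < m then I / 2 * c i a else 0 with hd
  have hX : ∀ a, dchi m (c i) (X ^ a) = (if a = 0 then -(m : ℂ) else 0) + d a :=
    fun a => dchi_X_pow _ _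
  have hX' : ∀ a, dchi m ((-c) i) (X ^ a) = (if a = 0 then -(m : ℂ) else 0) - d a := by
    intro a
    rw [dchi_X_pow, sub_eq_add_neg]
    congr 1
    simp only [hd, Pi.neg_apply]
    split_ifs <;> ring
  have h1 : gaudinScalar n c i (J + 1) = pairSum m J fun a b =>
      1 / 2 * dchi m (c i) (X ^ (a + b)) +
      1 / 4 * (dchi m (c i) (X ^ a) * dchi m (c i) (X ^ b)) := by
    simp only [gaudinScalar, Nat.add_right_cancel_iff]; rfl
  have h2 : gaudinScalar n (-c) i (J + 1) = pairSum m J fun a b =>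
      (1 / 2 * dchi m (c i) (X ^ (a + b)) + 1 / 4 * (dchi m (c i) (X ^ a) * dchi m (c i) (X ^ b))) +
      ((-d J) + ((if a = 0 then (m : ℂ) / 2 * d b else 0) +
        (if b = 0 then (m : ℂ) / 2 * d a else 0))) := by
    have : gaudinScalar n (-c) i (J + 1) = pairSum m J fun a b =>
      1 / 2 * dchi m ((-c) i) (X ^ (a + b)) +
      1 / 4 * (dchi m ((-c) i) (X ^ a) * dchi m ((-c) i) (X ^ b)) := by
      simp only [gaudinScalar, Nat.add_right_cancel_iff]; rfl
    rw [this]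
    refine pairSum_congr fun a b hab => ?_
    rw [← hab]
    simp only [hX, hX']
    split_ifs <;> ring
  rw [h1, h2, pairSum_add, pairSum_add, pairSum_add, pairSum_add, pairSum_left_zero m J,
    pairSum_swap m J (fun a b => if a = 0 then (m : ℂ) / 2 * d b else 0), pairSum_left_zero m J]
  rcases Nat.lt_or_ge J m with hJ | hJ
  · rw [if_pos hJ, pairSum_const (by omega)]; ring
  · rw [if_neg (by omega)]
    have : d J = 0 := by simp [hd, hJ]
    rw [this]
    simp [pairSum]

end Expansion

/-! ### Holomorphic derivatives along curves -/

/-- `f` is real differentiable at `x` with holomorphic derivative `f'`. -/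
structure HasDHolAt (f : ℂ → ℂ) (f' : ℂ) (x : ℂ) : Prop where
  diff : DifferentiableAt ℝ f x
  eq : dHol f x = f'

theorem HasDHolAt.congr_of_eventuallyEq {f g : ℂ → ℂ} {f' : ℂ} (h : HasDHolAt f f' x)
    (hg : g =ᶠ[nhds x] f) : HasDHolAt g f' x :=
  ⟨h.diff.congr_of_eventuallyEq hg, by rw [← h.eq, dHol, dHol, hg.fderiv_eq]⟩

theorem hasDHolAt_const (z x : ℂ) : HasDHolAt (fun _ => z) 0 x :=
  ⟨differentiableAt_const _, by simp [dHol]⟩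

theorem HasDerivAt.hasDHolAt {f : ℂ → ℂ} {f' : ℂ} (h : HasDerivAt f f' x) : HasDHolAt f f' x := by
  have h1 : HasFDerivAt f ((toSpanSingleton ℂ f').restrictScalars ℝ) x :=
    h.hasFDerivAt.restrictScalars ℝ
  refine ⟨h1.differentiableAt, ?_⟩
  rw [dHol, h1.fderiv]
  simp only [ContinuousLinearMap.coe_restrictScalars', toSpanSingleton_apply, smul_eq_mul, one_mul]
  linear_combination (-1 / 2 * f') * I_sq

theorem HasDHolAt.add {f g : ℂ → ℂ} {f' g' : ℂ} (hf : HasDHolAt f f' x)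
    (hg : HasDHolAt g g' x) : HasDHolAt (fun z => f z + g z) (f' + g') x := by
  refine ⟨hf.diff.fun_add hg.diff, ?_⟩
  rw [← hf.eq, ← hg.eq, dHol, dHol, dHol, fderiv_fun_add hf.diff hg.diff]
  simp only [_root_.add_apply]; ring

theorem HasDHolAt.mul {f g : ℂ → ℂ} {f' g' : ℂ} (hf : HasDHolAt f f' x)
    (hg : HasDHolAt g g' x) : HasDHolAt (fun z => f z * g z) (f' * g x + f x * g') x := by
  refine ⟨hf.diff.fun_mul hg.diff, ?_⟩
  rw [← hf.eq, ← hg.eq, dHol, dHol, dHol, fderiv_fun_mul hf.diff hg.diff]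
  simp only [_root_.add_apply, _root_.smul_apply, smul_eq_mul]; ring

theorem HasDHolAt.const_mul {f : ℂ → ℂ} {f' : ℂ} (hf : HasDHolAt f f' x) (z : ℂ) :
    HasDHolAt (fun y => z * f y) (z * f') x := by
  simpa using (hasDHolAt_const z x).mul hf

theorem HasDHolAt.sum {κ : Type*} (s : Finset κ) {f : κ → ℂ → ℂ} {f' : κ → ℂ}
    (hf : ∀ k ∈ s, HasDHolAt (f k) (f' k) x) :
    HasDHolAt (fun z => ∑ k ∈ s, f k z) (∑ k ∈ s, f' k) x := by
  classical
  induction s using Finset.induction_on with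
  | empty => simpa using hasDHolAt_const 0 x
  | insert a s ha ih =>
    simp only [sum_insert ha]
    exact (hf a (mem_insert_self a s)).add
      (ih fun k hk => hf k (mem_insert_of_mem hk))

theorem HasDHolAt.prod {κ : Type*} (s : Finset κ) {f : κ → ℂ → ℂ} {f' : κ → ℂ}
    (hf : ∀ k ∈ s, HasDHolAt (f k) (f' k * f k x) x) :
    HasDHolAt (fun z => ∏ k ∈ s, f k z) ((∑ k ∈ s, f' k) * ∏ k ∈ s, f k x) x := by
  classical
  induction s using Finset.induction_on with
  | empty => simpa using hasDHolAt_const 1 x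
  | insert a s ha ih =>
    have h := (hf a (mem_insert_self a s)).mul
      (ih fun k hk => hf k (mem_insert_of_mem hk))
    simp only [Finset.prod_insert ha, sum_insert ha]
    convert! h using 1; ring

/-- The holomorphic derivative of Re F is F'/2 for holomorphic F; this is the source of the factors
1/2 in `dchi`. -/
theorem hasDHolAt_exp_re {F G : ℂ → ℂ} {F' G' : ℂ} (hF : HasDerivAt F F' x)
    (hG : HasDerivAt G G' x) : HasDHolAt (fun z => exp (((F z).re : ℂ) + I * ((G z).re : ℂ)))
      ((F' + I * G') / 2 * exp (((F x).re : ℂ) + I * ((G x).re : ℂ))) x := by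
  have key : ∀ {F : ℂ → ℂ} {F' : ℂ}, HasDerivAt F F' x →
      HasFDerivAt (fun z => ((F z).re : ℂ)) (ofRealCLM.comp (reCLM.comp
        ((toSpanSingleton ℂ F').restrictScalars ℝ))) x := fun h =>
    ofRealCLM.hasFDerivAt.comp x (reCLM.hasFDerivAt.comp x
      (h.hasFDerivAt.restrictScalars ℝ))
  have h := ((key hF).fun_add ((key hG).const_mul I)).cexp
  refine ⟨h.differentiableAt, ?_⟩
  rw [dHol, h.fderiv]
  simp only [_root_.smul_apply, _root_.add_apply, ContinuousLinearMap.comp_apply,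
    ContinuousLinearMap.coe_restrictScalars', toSpanSingleton_apply,
    Complex.reCLM_apply, Complex.ofRealCLM_apply, smul_eq_mul, one_mul, mul_re,
    I_re, I_im, zero_mul, zero_sub, one_mul]
  generalize exp _ = e
  have e1 : (F'.re : ℂ) + F'.im * I = F' := re_add_im F'
  have e2 : (G'.re : ℂ) + G'.im * I = G' := re_add_im G'
  push_cast
  linear_combination e / 2 * e1 + e / 2 * I * e2

/-! ### Branches of characters of the unit groups -/

/-- Logarithmic coefficients, with a chosen logarithm of the constant coefficient. -/
def logCoeff (ℓ : ℂ) (a : ℂ⟦X⟧) (j : ℕ) : ℂ := if j = 0 then ℓ else coeff j (logTail a)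

/-- A power of `|a₀|^{-2m} exp(χ(log a))`, for a chosen logarithm of `a₀`. -/
def branchExp (r : ℝ) (m : ℕ) (c : ℕ → ℂ) (ℓ : ℂ) (a : ℂ⟦X⟧) : ℂ :=
  exp (((r * (-(2 * m) * ℓ.re) : ℝ) : ℂ) + r * chi m c (logCoeff ℓ a))

theorem branchExp_eq (r : ℝ) (m : ℕ) (c : ℕ → ℂ) (ℓ : ℂ) (a : ℂ⟦X⟧) :
    branchExp r m c ℓ a = exp ((((r * (-(2 * m)) : ℂ) * ℓ).re : ℂ) +
      I * (((r : ℂ) * ∑ j ∈ range m, c j * logCoeff ℓ a j).re : ℂ)) := by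
  rw [branchExp, chi]
  congr 2
  · have : ((r * (-(2 * m)) : ℂ)) = ((r * (-(2 * m)) : ℝ) : ℂ) := by push_cast; ring
    rw [this, re_ofReal_mul]; congr 1; ring
  · rw [re_ofReal_mul]; push_cast; ring

/-- Half of the exponents -2m and i c gives the coefficients -m and i c / 2 of `dchi`, evaluated at
the logarithmic derivative of the curve. -/
theorem branchExp_hasDHolAt (r : ℝ) (m : ℕ) (c : ℕ → ℂ) {P P' : ℂ → ℂ⟦X⟧} {ℓ : ℂ → ℂ}
    (hP : HasPSDerivAt P P' x) (h0 : constantCoeff (P x) ≠ 0)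
    (hℓ : HasDerivAt ℓ (constantCoeff (P' 1) / constantCoeff (P x)) x) :
    HasDHolAt (fun z => branchExp r m c (ℓ z) (P z))
      (r * dchi m c (P' 1 * (P x)⁻¹) * branchExp r m c (ℓ x) (P x)) x := by
  set Z := P' 1 * (P x)⁻¹ with hZ
  have hZ0 : constantCoeff Z = constantCoeff (P' 1) / constantCoeff (P x) := by
    simp [hZ, div_eq_mul_inv]
  have hlog : ∀ j, HasDerivAt (fun z => logCoeff (ℓ z) (P z) j) (coeff j Z) x := by
    intro j
    rcases eq_or_ne j 0 with rfl | hj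
    · simpa [logCoeff, hZ0] using hℓ
    · obtain ⟨L, h1, h2⟩ := hP.logTail h0 j
      have := h2.hasDerivAt
      rw [h1] at this
      simpa [logCoeff, hj, coeff_C, ← hZ] using this
  have h := hasDHolAt_exp_re (hℓ.const_mul (r * (-(2 * m)) : ℂ))
    ((HasDerivAt.fun_sum (u := range m) fun j _ => (hlog j).const_mul (c j)).const_mul (r : ℂ))
  simp only [branchExp_eq]
  convert! h using 2
  rw [dchi, hZ0]; ring

theorem branchExp_contDiffAt (r : ℝ) (m : ℕ) (c : ℕ → ℂ) {P : ℂ → ℂ⟦X⟧} {P' : ℂ → ℂ → ℂ⟦X⟧}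
    {ℓ : ℂ → ℂ} (hP : ∀ᶠ z in nhds x, HasPSDerivAt P (P' z) z)
    (h0 : constantCoeff (P x) ≠ 0) (hℓ : ∀ᶠ z in nhds x, DifferentiableAt ℂ ℓ z) :
    ContDiffAt ℝ ∞ (fun z => branchExp r m c (ℓ z) (P z)) x := by
  have h0' := hP.self_of_nhds.eventually_ne h0
  have hlog : ∀ j, ContDiffAt ℝ ∞ (fun z => logCoeff (ℓ z) (P z) j) x := by
    intro j
    have : AnalyticAt ℂ (fun z => logCoeff (ℓ z) (P z) j) x := by
      rw [Complex.analyticAt_iff_eventually_differentiableAt]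
      filter_upwards [hP, hℓ, h0'] with z h1 h2 h3
      rcases eq_or_ne j 0 with rfl | hj
      · simpa [logCoeff] using h2
      · obtain ⟨L, -, h4⟩ := h1.logTail h3 j
        simpa [logCoeff, hj] using h4.differentiableAt
    exact (this.contDiffAt (n := ∞)).restrict_scalars ℝ
  have hℓ' : ContDiffAt ℝ ∞ ℓ x :=
    ((Complex.analyticAt_iff_eventually_differentiableAt.2 hℓ).contDiffAt (n := ∞)).restrict_scalars ℝ
  have hre : ∀ {f : ℂ → ℂ}, ContDiffAt ℝ ∞ f x → ContDiffAt ℝ ∞ (fun z => ((f z).re : ℂ)) x :=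
    fun hf => (ofRealCLM.contDiff.comp reCLM.contDiff).contDiffAt.comp x hf
  simp only [branchExp_eq]
  exact ((hre (contDiffAt_const.mul hℓ')).add (contDiffAt_const.mul (hre (contDiffAt_const.mul
    (ContDiffAt.sum fun j _ => contDiffAt_const.mul (hlog j)))))).cexp

/-- Changing ℓ by 2πi d changes the exponent by a multiple of 2πi, because Im c_0 is an integer.
This needs the full power r = 1; for r = -1/2 a sign survives. -/
theorem branchExp_congr (r : ℝ) (hm : 1 ≤ m) (c : ℕ → ℂ) (hc : ∃ k : ℤ, (c 0).im = k) (hr : r = 1)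
    {ℓ ℓ' : ℂ} (h : exp ℓ = exp ℓ') (a : ℂ⟦X⟧) : branchExp r m c ℓ a = branchExp r m c ℓ' a := by
  subst hr
  obtain ⟨k, hk⟩ := hc
  obtain ⟨d, hd⟩ := exp_eq_exp_iff_exists_int.1 h
  obtain ⟨m, rfl⟩ := Nat.exists_eq_succ_of_ne_zero (by omega : m ≠ 0)
  have hre : ℓ.re = ℓ'.re := by rw [hd]; simp
  rw [branchExp, branchExp, hre, exp_eq_exp_iff_exists_int]
  refine ⟨-(k * d), ?_⟩
  simp only [chi, sum_range_succ', logCoeff, if_true, Nat.succ_ne_zero, if_false,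
    add_re, re_sum, ofReal_one, one_mul]
  rw [show (c 0 * ℓ).re = (c 0 * ℓ').re - 2 * π * k * d by
    rw [hd, mul_add, add_re]
    simp [mul_re, hk]; ring]
  push_cast
  ring

/-- The character `a ↦ |a₀|^{-2m} exp(χ(log a))` on units. -/
def unitWeight (m : ℕ) (c : ℕ → ℂ) (a : ℂ⟦X⟧) : ℂ := (((‖constantCoeff a‖ ^ (2 * m))⁻¹ : ℝ) : ℂ) *
    exp (chi m c (logCoeff (log (constantCoeff a)) a))

theorem exp_mul_re_eq_norm_pow (m : ℕ) (ℓ : ℂ) :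
    Real.exp (-(2 * m) * ℓ.re) = (‖exp ℓ‖ ^ (2 * m))⁻¹ := by
  rw [norm_exp, ← Real.exp_nat_mul, ← Real.exp_neg]
  congr 1; push_cast; ring

theorem unitWeight_eq (hm : 1 ≤ m) (c : ℕ → ℂ) (hc : ∃ k : ℤ, (c 0).im = k) {ℓ : ℂ}
    (h : exp ℓ = constantCoeff a) : unitWeight m c a = branchExp 1 m c ℓ a := by
  have ha : constantCoeff a ≠ 0 := h ▸ exp_ne_zero ℓ
  rw [branchExp_congr 1 hm c hc rfl (ℓ' := log (constantCoeff a))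
    (by rw [exp_log ha, h]), branchExp, exp_add, unitWeight, one_mul,
    ← ofReal_exp, exp_mul_re_eq_norm_pow, exp_log ha]
  simp

theorem chi_norm_exp (m : ℕ) (c b : ℕ → ℂ) : ‖exp (chi m c b)‖ = 1 := by
  rw [chi, mul_comm, Complex.norm_exp_ofReal_mul_I]

theorem norm_unitWeight (m : ℕ) (c : ℕ → ℂ) (a : ℂ⟦X⟧) :
    ‖unitWeight m c a‖ = (‖constantCoeff a‖ ^ (2 * m))⁻¹ := by
  rw [unitWeight, norm_mul, chi_norm_exp, mul_one, norm_real, norm_of_nonneg]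
  positivity

/-- The principal logarithm jumps, but the weight does not depend on the branch. Near the point it
is computed with the logarithm of a quotient close to 1, which stays in the slit plane. -/
theorem unitWeight_curve_eventuallyEq {E : Type*} [NormedAddCommGroup E] [NormedSpace ℂ E]
    (hm : 1 ≤ m) (c : ℕ → ℂ) (hc : ∃ k : ℤ, (c 0).im = k) {P P' : E → ℂ⟦X⟧} {x : E}
    (hP : HasPSDerivAt P P' x) (h0 : constantCoeff (P x) ≠ 0) :
    (fun z => unitWeight m c (P z)) =ᶠ[nhds x] fun z => branchExp 1 m c
      (log (constantCoeff (P x)) + log (constantCoeff (P z) / constantCoeff (P x))) (P z) := by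
  filter_upwards [hP.eventually_ne h0] with z hz
  exact unitWeight_eq hm c hc (by
    rw [exp_add, exp_log h0, exp_log (div_ne_zero hz h0)]
    field_simp)

theorem log_branch_hasDerivAt {P P' : ℂ → ℂ⟦X⟧} (hP : HasPSDerivAt P P' z)
    (h0 : constantCoeff (P x) ≠ 0) (hs : constantCoeff (P z) / constantCoeff (P x) ∈ slitPlane)
    (ℓ : ℂ) : HasDerivAt (fun z => ℓ + log (constantCoeff (P z) / constantCoeff (P x)))
      (constantCoeff (P' 1) / constantCoeff (P z)) z := by
  obtain ⟨L, h1, h2⟩ := hP 0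
  have h3 : HasDerivAt (fun y => constantCoeff (P y))
      (constantCoeff (P' 1)) z := by
    have := h2.hasDerivAt
    rw [h1] at this
    simpa only [coeff_zero_apply] using this
  have h4 := ((h3.div_const (constantCoeff (P x))).clog hs).const_add ℓ
  refine h4.congr_deriv ?_
  have h5 : constantCoeff (P z) ≠ 0 := by
    rintro h; rw [h, zero_div] at hs; simp at hs
  field_simp

theorem log_branch_eventually {E : Type*} [NormedAddCommGroup E] [NormedSpace ℂ E]
    {P P' : E → ℂ⟦X⟧} {x : E} (hP : HasPSDerivAt P P' x)
    (h0 : constantCoeff (P x) ≠ 0) : ∀ᶠ z in nhds x,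
    constantCoeff (P z) / constantCoeff (P x) ∈ slitPlane := by
  have hc : ContinuousAt (fun y => constantCoeff (P y)) x := by
    simpa only [coeff_zero_apply] using hP.continuousAt 0
  refine (hc.div_const _).eventually (Complex.isOpen_slitPlane.mem_nhds ?_)
  change constantCoeff (P x) / constantCoeff (P x) ∈ _
  rw [div_self h0]; exact Complex.one_mem_slitPlane

theorem unitWeight_hasDHolAt (hm : 1 ≤ m) (c : ℕ → ℂ)
    (hc : ∃ k : ℤ, (c 0).im = k) {P P' : ℂ → ℂ⟦X⟧} (hP : HasPSDerivAt P P' x)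
    (h0 : constantCoeff (P x) ≠ 0) : HasDHolAt (fun z => unitWeight m c (P z))
      (dchi m c (P' 1 * (P x)⁻¹) * unitWeight m c (P x)) x := by
  have he := unitWeight_curve_eventuallyEq hm c hc hP h0
  have h1 := branchExp_hasDHolAt 1 m c hP h0
    (log_branch_hasDerivAt hP h0 (log_branch_eventually hP h0).self_of_nhds
      (log (constantCoeff (P x))))
  have h2 := h1.congr_of_eventuallyEq he
  have h3 := he.self_of_nhds
  beta_reduce at h3
  rw [← h3] at h2
  simpa using h2

theorem unitWeight_contDiffAt (hm : 1 ≤ m) (c : ℕ → ℂ) (hc : ∃ k : ℤ, (c 0).im = k) {P : ℂ → ℂ⟦X⟧}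
    {P' : ℂ → ℂ → ℂ⟦X⟧} (hP : ∀ᶠ z in nhds x, HasPSDerivAt P (P' z) z)
    (h0 : constantCoeff (P x) ≠ 0) : ContDiffAt ℝ ∞ (fun z => unitWeight m c (P z)) x := by
  refine (branchExp_contDiffAt 1 m c hP h0 ?_).congr_of_eventuallyEq
    (unitWeight_curve_eventuallyEq hm c hc hP.self_of_nhds h0)
  filter_upwards [hP, log_branch_eventually hP.self_of_nhds h0] with z h1 h2
  exact (log_branch_hasDerivAt h1 h0 h2 _).differentiableAt

theorem unitWeight_continuousAt {E : Type*} [NormedAddCommGroup E] [NormedSpace ℂ E] (hm : 1 ≤ m)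
    (c : ℕ → ℂ) (hc : ∃ k : ℤ, (c 0).im = k) {P P' : E → ℂ⟦X⟧} {x : E} (hP : HasPSDerivAt P P' x)
    (h0 : constantCoeff (P x) ≠ 0) : ContinuousAt (fun z => unitWeight m c (P z)) x := by
  refine ContinuousAt.congr ?_ (unitWeight_curve_eventuallyEq hm c hc hP h0).symm
  have hcc : ContinuousAt (fun y => constantCoeff (P y)) x := by
    simpa only [coeff_zero_apply] using hP.continuousAt 0
  have hℓ : ContinuousAt (fun z => log (constantCoeff (P x)) +
        log (constantCoeff (P z) / constantCoeff (P x))) x :=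
    continuousAt_const.add ((hcc.div_const _).clog (log_branch_eventually hP h0).self_of_nhds)
  have hlog : ∀ j, ContinuousAt (fun z => logCoeff (log (constantCoeff (P x)) +
        log (constantCoeff (P z) / constantCoeff (P x)))
        (P z) j) x := by
    intro j
    rcases eq_or_ne j 0 with rfl | hj
    · simpa [logCoeff] using hℓ
    · simpa [logCoeff, hj] using (hP.logTail h0).continuousAt j
  have hre : ∀ {f : E → ℂ}, ContinuousAt f x → ContinuousAt (fun z => ((f z).re : ℂ)) x :=
    fun hf => (Complex.continuous_ofReal.comp Complex.continuous_re).continuousAt.comp hf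
  simp only [branchExp_eq]
  exact ((hre (continuousAt_const.mul hℓ)).add (continuousAt_const.mul (hre
    (continuousAt_const.mul (tendsto_finsetSum _ fun j _ =>
      continuousAt_const.mul (hlog j)))))).cexp

theorem HasPSDerivAt.comp {E F : Type*} [NormedAddCommGroup E] [NormedSpace ℂ E]
    [NormedAddCommGroup F] [NormedSpace ℂ F] {P P' : F → ℂ⟦X⟧} {g : E → F} {g' : E →L[ℂ] F} {e : E}
    (h : HasPSDerivAt P P' (g e)) (hg : HasFDerivAt g g' e) :
    HasPSDerivAt (fun y => P (g y)) (fun y => P' (g' y)) e := fun j => by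
  obtain ⟨L, h1, h2⟩ := h j
  exact ⟨L.comp g', fun y => h1 _, h2.comp e hg⟩

/-! ### The kernel of the Hecke operators -/

/-- The constant coefficient of the `i`-th block. -/
def cc (v : Cfg n) (i : ι) : ℂ := constantCoeff (block v i)

/-- The tuple `(s - (t_i + ε_i - x) / 𝐯_i)_i`. -/
def mob (t : ι → ℂ) (x s : ℂ) (v : Cfg n) : Cfg n :=
  fun p => coeff p.2.val (C s - pointSub t x p.1 * (block v p.1)⁻¹)

/-- The weight `∏ |v_i|^{-2 n_i} exp(χ_i(log 𝐯_i))`. -/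
def kerWeight (c : ι → ℕ → ℂ) (v : Cfg n) : ℂ := ∏ i, unitWeight (n i) (c i) (block v i)

theorem block_ofCoeff (A : ι → ℂ⟦X⟧) (i : ι) :
    PSCongr (n i) (block (fun p : Coord n => coeff p.2.val (A p.1)) i) (A i) := by
  rw [psCongr_iff]
  intro j hj
  rw [coeff_block, dif_pos hj]

theorem block_mob (t : ι → ℂ) (x s : ℂ) (v : Cfg n) (i : ι) : PSCongr (n i) (block (mob t x s v) i)
      (C s - pointSub t x i * (block v i)⁻¹) :=
  block_ofCoeff (fun i => C s - pointSub t x i * (block v i)⁻¹) i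

theorem block_shift (hn : ∀ i, 1 ≤ n i) (b : ℂ) (v : Cfg n) (i : ι) :
    block (shift b v) i = block v i + C b := by
  ext j
  rw [coeff_block, map_add, coeff_block, coeff_C]
  rcases Nat.eq_zero_or_pos j with rfl | hj
  · have := hn i
    rw [dif_pos (by omega), dif_pos (by omega)]
    simp [shift]
  · by_cases h : j < n i <;> simp [h, shift, hj.ne']

theorem cc_shift (hn : ∀ i, 1 ≤ n i) (b : ℂ) (v : Cfg n) (i : ι) :
    cc (shift b v) i = cc v i + b := by
  simp [cc, block_shift hn]

theorem cc_mob (hn : ∀ i, 1 ≤ n i) (t : ι → ℂ) (x s : ℂ) (v : Cfg n) (i : ι) :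
    cc (mob t x s v) i = s - (t i - x) / cc v i := by
  rw [cc, (block_mob t x s v i).constantCoeff_eq (hn i)]
  simp [cc, pointSub, div_eq_mul_inv]

theorem norm_kerWeight (c : ι → ℕ → ℂ) (v : Cfg n) :
    ‖kerWeight c v‖ = (∏ i, ‖cc v i‖ ^ (2 * n i))⁻¹ := by
  rw [kerWeight, norm_prod, ← prod_inv_distrib]
  exact prod_congr rfl fun i _ => norm_unitWeight _ _ _

theorem kerWeight_eq_zero (hn : ∀ i, 1 ≤ n i) (c : ι → ℕ → ℂ) {v : Cfg n}
    (h : cc v i = 0) : kerWeight c v = 0 := by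
  rw [← norm_eq_zero, norm_kerWeight, inv_eq_zero, Finset.prod_eq_zero_iff]
  exact ⟨i, mem_univ i, by rw [h, norm_zero, zero_pow (by have := hn i; omega)]⟩

theorem hasPSDerivAt_pointSub (t : ι → ℂ) (x : ℂ) (i : ι) :
    HasPSDerivAt (fun y => pointSub t y i) (fun h => -C h) x := by
  intro j
  have hE : (fun y => coeff j (pointSub t y i)) = fun y =>
      coeff j (C (t i) + X) + (if j = 0 then (-1 : ℂ) else 0) * y := by
    funext y
    simp only [pointSub, map_add, coeff_C]
    split_ifs <;> ring
  refine ⟨toSpanSingleton ℂ (if j = 0 then (-1 : ℂ) else 0), fun h => ?_, ?_⟩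
  · simp only [toSpanSingleton_apply, map_neg, coeff_C, smul_eq_mul]
    split_ifs <;> ring
  · rw [hE]
    exact (((hasDerivAt_id x).const_mul (if j = 0 then (-1 : ℂ) else 0)).const_add _).hasFDerivAt.congr_fderiv
      (by ext; simp)

theorem hasPSDerivAt_block_shift (hn : ∀ i, 1 ≤ n i) (v : Cfg n) (b : ℂ) (i : ι) :
    HasPSDerivAt (fun y => block (shift y v) i) (fun h => C h) b := by
  intro j
  have hE : (fun y => coeff j (block (shift y v) i)) = fun y =>
      coeff j (block v i) + (if j = 0 then (1 : ℂ) else 0) * y := by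
    funext y
    rw [block_shift hn, map_add, coeff_C]
    split_ifs <;> ring
  refine ⟨toSpanSingleton ℂ (if j = 0 then (1 : ℂ) else 0), fun h => ?_, ?_⟩
  · simp only [toSpanSingleton_apply, coeff_C, smul_eq_mul]
    split_ifs <;> ring
  · rw [hE]
    exact (((hasDerivAt_id b).const_mul (if j = 0 then (1 : ℂ) else 0)).const_add _).hasFDerivAt.congr_fderiv
      (by ext; simp)

/-- The combination L w' - i L (i w') kills the antilinear part of L. Along a holomorphic curve the
chain rule therefore involves holomorphic coordinate derivatives only. -/
theorem dHol_dir (L : Cfg n →L[ℝ] ℂ) (w' : Cfg n) : 1 / 2 * (L w' - I * L (I • w')) =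
      ∑ p, 1 / 2 * (L (Pi.single p 1) - I * L (Pi.single p I)) * w' p := by
  have key : ∀ w : Cfg n, L w = ∑ p, ((w p).re * L (Pi.single p 1) +
      (w p).im * L (Pi.single p I)) := by
    intro w
    conv_lhs => rw [← Finset.univ_sum_single w, map_sum]
    refine sum_congr rfl fun p _ => ?_
    have : (Pi.single p (w p) : Cfg n) =
        (w p).re • (Pi.single p 1 : Cfg n) + (w p).im • (Pi.single p I : Cfg n) := by
      ext q
      rcases eq_or_ne q p with rfl | h
      · simp [re_add_im]
      · simp [h]
    rw [this, map_add, map_smul, map_smul]; simp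
  rw [key w', key, mul_sum, ← sum_sub_distrib, mul_sum]
  refine sum_congr rfl fun p _ => ?_
  simp only [Pi.smul_apply, smul_eq_mul, mul_re, mul_im, I_re,
    I_im, zero_mul, one_mul, zero_sub, zero_add]
  set A := L (Pi.single p 1)
  set B := L (Pi.single p I)
  have h := re_add_im (w' p)
  push_cast
  linear_combination (1 / 2 * (A - I * B)) * h + (1 / 2 * B * (w' p).im) * I_sq

theorem HasDHolAt.comp_curve {w : ℂ → Cfg n} {w' : Cfg n}
    (hf : DifferentiableAt ℝ f (w x)) (hw : ∀ p, HasDerivAt (fun z => w z p) (w' p) x) :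
    HasDHolAt (fun z => f (w z)) (∑ p, dCoord p f (w x) * w' p) x := by
  have hw1 : HasFDerivAt w ((toSpanSingleton ℂ w').restrictScalars ℝ) x := by
    refine HasFDerivAt.restrictScalars ℝ (hasFDerivAt_pi'.2 fun p => ?_)
    convert! (hw p).hasFDerivAt using 1
  have h := hf.hasFDerivAt.comp x hw1
  refine ⟨h.differentiableAt, ?_⟩
  have h2 : fderiv ℝ (fun z => f (w z)) x = _ := h.fderiv
  rw [dHol, h2]
  simp only [ContinuousLinearMap.comp_apply, ContinuousLinearMap.coe_restrictScalars',
    toSpanSingleton_apply, one_smul]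
  rw [dHol_dir]
  rfl

/-- Geometric series of -1/(t_i + ε_i - x) in ε_i. Hence a generating function ∑ ε^a a / (x -
t_i)^(a+1) acts as multiplication of the vector field by -(t_i + ε_i - x)⁻¹. -/
theorem psCongr_geom (t : ι → ℂ) (hx : x ≠ t i) (m : ℕ) :
    PSCongr m (∑ a ∈ range m, C (1 / (x - t i) ^ (a + 1)) * X ^ a)
      (-(pointSub t x i)⁻¹) := by
  have hd : x - t i ≠ 0 := sub_ne_zero.2 hx
  have h0 : constantCoeff (pointSub t x i) ≠ 0 := by
    simpa [pointSub, sub_eq_zero] using hx.symm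
  have key : ∀ m : ℕ, (∑ a ∈ range m, C (1 / (x - t i) ^ (a + 1)) * X ^ a) * pointSub t x i =
      -1 + C (1 / (x - t i) ^ m) * X ^ m := by
    intro m
    induction m with
    | zero => simp
    | succ m ih =>
      have e : C (1 / (x - t i) ^ (m + 1)) * pointSub t x i = -C (1 / (x - t i) ^ m) +
            C (1 / (x - t i) ^ (m + 1)) * X := by
        rw [pointSub, mul_add, ← map_mul, ← map_neg]
        congr 2
        field_simp; ring
      rw [sum_range_succ, add_mul, ih, show C (1 / (x - t i) ^ (m + 1)) * X ^ m * pointSub t x i =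
          C (1 / (x - t i) ^ (m + 1)) * pointSub t x i * X ^ m by ring, e]
      ring
  have e2 : (∑ a ∈ range m, C (1 / (x - t i) ^ (a + 1)) * X ^ a) = -(pointSub t x i)⁻¹ +
        C (1 / (x - t i) ^ m) * (pointSub t x i)⁻¹ * X ^ m := by
    have := congrArg (· * (pointSub t x i)⁻¹) (key m)
    simp only [mul_assoc, mul_inv_self _ h0, mul_one] at this
    rw [this]; ring
  rw [e2, psCongr_iff]
  intro j hj
  rw [map_add, coeff_mul_X_pow', if_neg (by omega), add_zero]

/-- A generating operator `α h(x) + β e(x) + γ f(x)` in terms of `-1 / (t_i + ε_i - x)`. -/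
theorem genOp_slAct (hn : ∀ i, 1 ≤ n i) (t : ι → ℂ) (c : ι → ℕ → ℂ) (hx : ∀ i, x ≠ t i)
    (α β γ : ℂ) (f : Cfg n → ℂ) (w : Cfg n) (Z : ι → ℂ⟦X⟧)
    (hZ : ∀ i, PSCongr (n i) (block w i) (Z i)) :
    genOp t (fun i a => (slAct c α β γ i a).act) x f w = (∑ p, dCoord p f w *
        coeff p.2.val (-(pointSub t x p.1)⁻¹ * sl2Field α β γ (Z p.1))) +
      (∑ i, dchi (n i) (c i) (-(pointSub t x i)⁻¹ * (C γ * Z i - C α))) * f w := by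
  have hF : ∀ i, PSCongr (n i) (sl2Field α β γ (block w i)) (sl2Field α β γ (Z i)) := by
    intro i
    simp only [sl2Field, sub_eq_add_neg, pow_two]
    exact ((PSCongr.refl _).add ((PSCongr.refl _).mul (hZ i))).add
      ((PSCongr.refl _).mul ((hZ i).mul (hZ i))).neg
  have hG : ∀ i, PSCongr (n i) (C γ * block w i - C α)
      (C γ * Z i - C α) := by
    intro i
    simp only [sub_eq_add_neg]
    exact ((PSCongr.refl _).mul (hZ i)).add (PSCongr.refl _)
  rw [genOp, Fintype.sum_sigma, sum_mul, ← sum_add_distrib]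
  refine sum_congr rfl fun i _ => ?_
  have h1 : ∀ a, (slAct c α β γ i a).act f w / (x - t i) ^ (a + 1) =
      (∑ q : Fin (n i), 1 / (x - t i) ^ (a + 1) * coeff q.val
        (X ^ a * sl2Field α β γ (block w i)) * dCoord ⟨i, q⟩ f w) +
      1 / (x - t i) ^ (a + 1) * dchi (n i) (c i) (X ^ a * (C γ * block w i - C α)) * f w := by
    intro a
    rw [FirstOrder.act_eq, slAct_vec, slAct_pot, add_div, sum_div]
    congr 1
    · exact sum_congr rfl fun q _ => by ring
    · ring
  simp only [h1]
  rw [sum_add_distrib, sum_comm, ← sum_mul, dchi_sum]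
  congr 1
  · refine sum_congr rfl fun q _ => ?_
    rw [← sum_mul, mul_comm]
    congr 1
    rw [← (((psCongr_geom t (hx i) (n i)).mul (hF i))).coeff_eq q.2, sum_mul, map_sum]
    refine sum_congr rfl fun a _ => ?_
    rw [mul_assoc, coeff_C_mul_eq]
  · congr 1
    refine dchi_congr (hn i) _ ?_
    refine PSCongr.trans ?_ ((psCongr_geom t (hx i) (n i)).mul (hG i))
    rw [sum_mul]
    simp only [mul_assoc]
    exact PSCongr.refl _

theorem genOp_slAct_linear (t : ι → ℂ) (c : ι → ℕ → ℂ) (x : ℂ) (α β γ : ℂ) (f : Cfg n → ℂ)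
    (w : Cfg n) : genOp t (fun i a => (slAct c α β γ i a).act) x f w =
      α * genOp t (fun i a => (opH c i a).act) x f w +
      β * genOp t (fun i a => (opE c i a).act) x f w +
      γ * genOp t (fun i a => (opF c i a).act) x f w := by
  simp only [genOp, mul_sum, ← sum_add_distrib]
  refine sum_congr rfl fun i _ => sum_congr rfl fun a _ => ?_
  have hact : (slAct c α β γ i a).act f w = α * (opH c i a).act f w + β * (opE c i a).act f w +
      γ * (opF c i a).act f w := by
    simp only [opH, opE, opF, FirstOrder.act_eq, slAct_vec, slAct_pot, mul_add, mul_sum]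
    have e : ∀ z : ℂ⟦X⟧, sl2Field α β γ z = C α * sl2Field 1 0 0 z +
        C β * sl2Field 0 1 0 z + C γ * sl2Field 0 0 1 z := by
      intro z; simp [sl2Field, map_mul]; ring
    have e2 : dchi (n i) (c i) (X ^ a * (C γ * block w i - C α)) = α * dchi (n i) (c i) (X ^ a *
          (C 0 * block w i - C 1)) + γ * dchi (n i) (c i) (X ^ a * (C 1 * block w i - C 0)) := by
      have := dchi_sum (univ : Finset (Fin 2)) (n i) (c i) ![α, γ]
        ![X ^ a * (C 0 * block w i - C 1), X ^ a * (C 1 * block w i - C 0)]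
      simp only [Fin.sum_univ_two, Matrix.cons_val_zero, Matrix.cons_val_one] at this
      rw [this]; congr 1; simp; ring
    have e3 : dchi (n i) (c i) (X ^ a * (C 0 * block w i - C 0)) = 0 := by simp [dchi]
    rw [e2, e3]
    simp only [e, mul_add, map_add]
    simp only [mul_left_comm _ (C _), coeff_C_mul_eq, add_mul, sum_add_distrib, mul_assoc]
    ring_nf
  rw [hact]; ring

/-! ### Derivatives of the kernel -/

theorem mob_hasDerivAt_x (t : ι → ℂ) (x s : ℂ) (v : Cfg n) (p : Coord n) :
    HasDerivAt (fun y => mob t y s v p)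
      (coeff p.2.val (block v p.1)⁻¹) x := by
  obtain ⟨L, h1, h2⟩ := ((hasPSDerivAt_const (C s) x).sub
    ((hasPSDerivAt_pointSub t x p.1).mul (hasPSDerivAt_const (block v p.1)⁻¹ x))) p.2.val
  have h3 := h2.hasDerivAt
  rw [h1] at h3
  simpa [mob] using h3

theorem mob_hasDerivAt_shift (hn : ∀ i, 1 ≤ n i) (t : ι → ℂ) (x s b : ℂ) (v : Cfg n) (p : Coord n)
    (hv : cc (shift b v) p.1 ≠ 0) : HasDerivAt (fun y => mob t x s (shift y v) p)
      (coeff p.2.val (pointSub t x p.1 * (block (shift b v) p.1)⁻¹ ^ 2)) b := by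
  obtain ⟨L, h1, h2⟩ := ((hasPSDerivAt_const (C s) b).sub
    ((hasPSDerivAt_const (pointSub t x p.1) b).mul
      ((hasPSDerivAt_block_shift hn v b p.1).inv hv))) p.2.val
  have h3 := h2.hasDerivAt
  rw [h1] at h3
  simpa [mob] using h3

theorem constantCoeff_pointSub (t : ι → ℂ) (x : ℂ) (i : ι) :
    constantCoeff (pointSub t x i) = t i - x := by simp [pointSub]

/-- For w = s - (t + ε - x)/v one has ∂_x w = 1/v = -(t + ε - x)⁻¹ (w - s), and w - s is the field
of h/2 - s e. The potential of h/2 is supplied by the logarithmic derivative of A. -/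
theorem hasDHolAt_comp_mob_x (hn : ∀ i, 1 ≤ n i) (t : ι → ℂ) (c : ι → ℕ → ℂ)
    (hx : ∀ i, x ≠ t i) (s : ℂ) (v : Cfg n) (hf : DifferentiableAt ℝ f (mob t x s v)) {A : ℂ → ℂ}
    (hA : HasDHolAt A ((∑ i, 1 / 2 * dchi (n i) (c i) (pointSub t x i)⁻¹) * A x) x) :
    HasDHolAt (fun y => A y * f (mob t y s v))
      (A x * (1 / 2 * genOp t (fun i a => (opH c i a).act) x f (mob t x s v) -
        s * genOp t (fun i a => (opE c i a).act) x f (mob t x s v))) x := by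
  have h1 := hA.mul (HasDHolAt.comp_curve hf (fun p => mob_hasDerivAt_x t x s v p))
  convert! h1 using 1
  have h2 := genOp_slAct hn t c hx (1 / 2) (-s) 0 f (mob t x s v) _ (block_mob t x s v)
  rw [genOp_slAct_linear] at h2
  have e1 : ∀ i, -(pointSub t x i)⁻¹ * sl2Field (1 / 2) (-s) 0
      (C s - pointSub t x i * (block v i)⁻¹) = (block v i)⁻¹ := by
    intro i
    have h0 : constantCoeff (pointSub t x i) ≠ 0 := by
      rw [constantCoeff_pointSub]; exact sub_ne_zero.2 (hx i).symm
    have := inv_mul_self _ h0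
    simp only [sl2Field, map_neg, map_zero, zero_mul, sub_zero]
    rw [show (2 * (1 / 2) : ℂ) = 1 by norm_num, map_one]
    linear_combination (block v i)⁻¹ * this
  have e2 : ∀ i, dchi (n i) (c i) (-(pointSub t x i)⁻¹ * (C 0 *
      (C s - pointSub t x i * (block v i)⁻¹) - C (1 / 2))) =
      1 / 2 * dchi (n i) (c i) (pointSub t x i)⁻¹ := by
    intro i
    have := dchi_sum {i} (n i) (c i) (fun _ => 1 / 2) fun i => (pointSub t x i)⁻¹
    rw [Finset.sum_singleton, Finset.sum_singleton] at this
    rw [this]; congr 1; rw [map_zero]; ring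
  simp only [e1, e2] at h2
  linear_combination A x * h2

theorem cc_eventually_ne (hn : ∀ i, 1 ≤ n i) {b : ℂ} {v : Cfg n}
    (hv : cc (shift b v) i ≠ 0) : ∀ᶠ y in nhds b, cc (shift y v) i ≠ 0 :=
  (hasPSDerivAt_block_shift hn v b i).eventually_ne hv

theorem unitWeight_shift_hasDHolAt (hn : ∀ i, 1 ≤ n i)
    (hc : ∀ i, ∃ k : ℤ, (c i 0).im = k) (v : Cfg n) {b : ℂ} (hv : ∀ i, cc (shift b v) i ≠ 0) :
    HasDHolAt (fun y => kerWeight c (shift y v))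
      ((∑ i, dchi (n i) (c i) (block (shift b v) i)⁻¹) * kerWeight c (shift b v)) b := by
  refine HasDHolAt.prod _ fun i _ => ?_
  simpa using unitWeight_hasDHolAt (hn i) (c i) (hc i) (hasPSDerivAt_block_shift hn v b i) (hv i)

/-- Under v ↦ v + b the tuple w moves with velocity (t + ε - x)/v² = -(t + ε - x)⁻¹ · (-(w - s)²),
and -(w - s)² is the field of f + s h - s² e. The logarithmic derivative 1/v of the weight is the
argument of its potential. -/
theorem hasDHolAt_kernel_shift_of_ne (hn : ∀ i, 1 ≤ n i) (t : ι → ℂ)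
    (hc : ∀ i, ∃ k : ℤ, (c i 0).im = k) (hx : ∀ i, x ≠ t i) (s : ℂ) (v : Cfg n) {b : ℂ}
    (hv : ∀ i, cc (shift b v) i ≠ 0) (hf : DifferentiableAt ℝ f (mob t x s (shift b v))) :
    HasDHolAt (fun y => kerWeight c (shift y v) * f (mob t x s (shift y v)))
      (kerWeight c (shift b v) * (genOp t (fun i a => (opF c i a).act) x f (mob t x s (shift b v)) +
        s * genOp t (fun i a => (opH c i a).act) x f (mob t x s (shift b v)) -
        s ^ 2 * genOp t (fun i a => (opE c i a).act) x f (mob t x s (shift b v)))) b := by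
  have h1 := (unitWeight_shift_hasDHolAt hn hc v hv).mul
    (HasDHolAt.comp_curve hf (fun p => mob_hasDerivAt_shift hn t x s b v p (hv p.1)))
  convert! h1 using 1
  have h2 := genOp_slAct hn t c hx s (-s ^ 2) 1 f (mob t x s (shift b v)) _
    (block_mob t x s (shift b v))
  rw [genOp_slAct_linear] at h2
  have e1 : ∀ i, -(pointSub t x i)⁻¹ * sl2Field s (-s ^ 2) 1
      (C s - pointSub t x i * (block (shift b v) i)⁻¹) =
      pointSub t x i * (block (shift b v) i)⁻¹ ^ 2 := by
    intro i
    have h0 : constantCoeff (pointSub t x i) ≠ 0 := by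
      rw [constantCoeff_pointSub]; exact sub_ne_zero.2 (hx i).symm
    have := inv_mul_self _ h0
    simp only [sl2Field, map_neg, map_one, map_pow, map_mul, map_ofNat C 2]
    linear_combination (pointSub t x i * (block (shift b v) i)⁻¹ ^ 2) * this
  have e2 : ∀ i, -(pointSub t x i)⁻¹ * (C 1 *
      (C s - pointSub t x i * (block (shift b v) i)⁻¹) - C s) = (block (shift b v) i)⁻¹ := by
    intro i
    have h0 : constantCoeff (pointSub t x i) ≠ 0 := by
      rw [constantCoeff_pointSub]; exact sub_ne_zero.2 (hx i).symm
    have := inv_mul_self _ h0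
    rw [map_one]
    linear_combination ((block (shift b v) i)⁻¹) * this
  simp only [e1, e2] at h2
  linear_combination kerWeight c (shift b v) * h2

/-! ### Continuity and smoothness of the kernel -/

theorem cc_eq (hn : ∀ i, 1 ≤ n i) (v : Cfg n) (i : ι) : cc v i = v ⟨i, ⟨0, hn i⟩⟩ := by
  rw [cc, ← coeff_zero_apply, coeff_block, dif_pos (show 0 < n i from hn i)]

theorem norm_cc_le (hn : ∀ i, 1 ≤ n i) (v : Cfg n) (i : ι) : ‖cc v i‖ ≤ ‖v‖ := by
  rw [cc_eq hn]; exact norm_le_pi_norm v _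

theorem continuous_cc (hn : ∀ i, 1 ≤ n i) (i : ι) : Continuous fun v : Cfg n => cc v i := by
  simp only [cc_eq hn]; fun_prop

theorem mob_continuousAt (t : ι → ℂ) (x s : ℂ) {v : Cfg n} (hv : ∀ i, cc v i ≠ 0) :
    ContinuousAt (fun y : ℂ × ℂ × Cfg n => mob t y.1 y.2.1 y.2.2) (x, s, v) := by
  refine continuousAt_pi.2 fun p => ?_
  have h1 := HasPSDerivAt.comp (P := fun y => pointSub t y p.1)
    (g := fun y : ℂ × ℂ × Cfg n => y.1) (e := (x, s, v)) (hasPSDerivAt_pointSub t x p.1)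
    hasFDerivAt_fst
  have h2 := HasPSDerivAt.comp (P := fun v : Cfg n => block v p.1)
    (g := fun y : ℂ × ℂ × Cfg n => y.2.2) (e := (x, s, v)) (hasPSDerivAt_block v p.1)
    ((hasFDerivAt_snd (p := (s, v))).comp (x, s, v) hasFDerivAt_snd)
  have h3 := (h1.mul (h2.inv (hv p.1))).continuousAt p.2.val
  simp only [mob, map_sub]
  refine ContinuousAt.sub ?_ h3
  simp only [coeff_C]
  split_ifs
  · fun_prop
  · fun_prop

theorem kerWeight_continuousAt (hn : ∀ i, 1 ≤ n i) (hc : ∀ i, ∃ k : ℤ, (c i 0).im = k) {v : Cfg n}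
    (hv : ∀ i, cc v i ≠ 0) : ContinuousAt (kerWeight c) v := tendsto_finsetProd _ fun i _ =>
    unitWeight_continuousAt (hn i) (c i) (hc i) (hasPSDerivAt_block v i) (hv i)

/-- Where some `𝐯_i` is not invertible, the kernel applied to a function of compact support
vanishes identically in a neighbourhood. -/
theorem kernel_eventually_zero (hn : ∀ i, 1 ≤ n i) (t : ι → ℂ) (c : ι → ℕ → ℂ)
    (s : ℂ) {v : Cfg n} (hx : x ≠ t i) (hv : cc v i = 0)
    (hf : HasCompactSupport f) : ∀ᶠ y : ℂ × ℂ × Cfg n in nhds (x, s, v),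
      kerWeight c y.2.2 * f (mob t y.1 y.2.1 y.2.2) = 0 := by
  obtain ⟨R, hR⟩ := hf.isCompact.isBounded.subset_closedBall (0 : Cfg n)
  have hc1 : Continuous fun y : ℂ × ℂ × Cfg n =>
      ‖t i - y.1‖ - (R + ‖y.2.1‖) * ‖cc y.2.2 i‖ := by
    have := continuous_cc hn i
    fun_prop
  -- If w lies in the support of f then |w| ≤ R, which forces |t_i - x| ≤ (R + |s|) |v_i|. The
  -- opposite strict inequality is open and holds where v_i = 0.
  have h0 : 0 < ‖t i - x‖ - (R + ‖s‖) * ‖cc v i‖ := by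
    rw [hv, norm_zero, mul_zero, sub_zero, norm_pos_iff, sub_ne_zero]; exact hx.symm
  filter_upwards [hc1.continuousAt.eventually (lt_mem_nhds h0)] with y hy
  by_cases h : cc y.2.2 i = 0
  · rw [kerWeight_eq_zero hn c h, zero_mul]
  · have : mob t y.1 y.2.1 y.2.2 ∉ tsupport f := by
      intro hm
      have h1 := (norm_cc_le hn _ i).trans (mem_closedBall_zero_iff.1 (hR hm))
      rw [cc_mob hn] at h1
      have h2 := norm_sub_norm_le ((t i - y.1) / cc y.2.2 i) y.2.1
      rw [norm_sub_rev] at h2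
      have h3 : ‖(t i - y.1) / cc y.2.2 i‖ ≤ R + ‖y.2.1‖ := by linarith
      rw [norm_div, div_le_iff₀ (norm_pos_iff.2 h)] at h3
      linarith
    rw [image_eq_zero_of_notMem_tsupport this, mul_zero]

theorem kernel_continuousAt (hn : ∀ i, 1 ≤ n i) (t : ι → ℂ) (hc : ∀ i, ∃ k : ℤ, (c i 0).im = k)
    (hx : ∀ i, x ≠ t i) (s : ℂ) (v : Cfg n) (hf : Continuous f) (hf' : HasCompactSupport f) :
    ContinuousAt (fun y : ℂ × ℂ × Cfg n => kerWeight c y.2.2 * f (mob t y.1 y.2.1 y.2.2))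
      (x, s, v) := by
  by_cases h : ∃ i, cc v i = 0
  · obtain ⟨i, hi⟩ := h
    exact (continuousAt_const (y := (0 : ℂ))).congr
      ((kernel_eventually_zero hn t c s (hx i) hi hf').mono fun _ h => h.symm)
  · push Not at h
    exact ((kerWeight_continuousAt hn hc h).comp (f := fun y : ℂ × ℂ × Cfg n => y.2.2)
      (x := (x, s, v)) (by fun_prop)).mul (hf.continuousAt.comp (mob_continuousAt t x s h))

theorem continuous_shift (v : Cfg n) : Continuous fun b : ℂ => shift b v := by
  refine continuous_pi fun p => ?_
  simp only [shift]
  split_ifs <;> fun_prop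

/-- Smoothness holds also at those b where the weight is singular: there the compact support of f
makes the kernel vanish identically nearby. -/
theorem kernel_shift_contDiff (hn : ∀ i, 1 ≤ n i) (t : ι → ℂ) (hc : ∀ i, ∃ k : ℤ, (c i 0).im = k)
    (hx : ∀ i, x ≠ t i) (s : ℂ) (v : Cfg n) (hf : ContDiff ℝ ∞ f) (hf' : HasCompactSupport f) :
    ContDiff ℝ ∞ fun b => kerWeight c (shift b v) * f (mob t x s (shift b v)) := by
  rw [contDiff_iff_contDiffAt]
  intro b
  by_cases h : ∃ i, cc (shift b v) i = 0
  · obtain ⟨i, hi⟩ := h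
    refine (contDiffAt_const (c := (0 : ℂ))).congr_of_eventuallyEq ?_
    have hcont : ContinuousAt (fun b => (x, s, shift b v)) b :=
      (continuous_const.prodMk (continuous_const.prodMk (continuous_shift v))).continuousAt
    exact hcont.eventually (kernel_eventually_zero hn t c s (hx i) hi hf')
  · push Not at h
    refine ContDiffAt.mul ?_ (hf.contDiffAt.comp b ?_)
    · exact contDiffAt_prod fun i _ => unitWeight_contDiffAt (hn i) (c i) (hc i)
        (Eventually.of_forall fun y => hasPSDerivAt_block_shift hn v y i) (h i)
    · refine contDiffAt_pi.2 fun p => ?_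
      have : AnalyticAt ℂ (fun y => mob t x s (shift y v) p) b := by
        rw [Complex.analyticAt_iff_eventually_differentiableAt]
        filter_upwards [cc_eventually_ne hn (h p.1)] with y hy
        exact (mob_hasDerivAt_shift hn t x s y v p hy).differentiableAt
      exact (this.contDiffAt (n := ∞)).restrict_scalars ℝ

theorem genOp_zero_of_notMem_tsupport (t : ι → ℂ) (D : ι → ℕ → FirstOrder n) (x : ℂ)
    {w : Cfg n} (hw : w ∉ tsupport f) : genOp t (fun i a => (D i a).act) x f w = 0 := by
  have h1 : f =ᶠ[nhds w] fun _ => 0 := notMem_tsupport_iff_eventuallyEq.1 hw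
  have h2 : ∀ p, dCoord p f w = 0 := by
    intro p
    simp [dCoord, h1.fderiv_eq]
  simp [genOp, FirstOrder.act, h2, h1.self_of_nhds]

/-- The first order operators `f(x) + s h(x) - s² e(x)` are the derivatives of the kernel along
the simultaneous translations. -/
theorem hasDHolAt_kernel_shift (hn : ∀ i, 1 ≤ n i) (t : ι → ℂ)
    (hc : ∀ i, ∃ k : ℤ, (c i 0).im = k) (hx : ∀ i, x ≠ t i) (s : ℂ) (v : Cfg n) (b : ℂ)
    (hf : ContDiff ℝ ∞ f) (hf' : HasCompactSupport f) :
    dHol (fun y => kerWeight c (shift y v) * f (mob t x s (shift y v))) b =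
      kerWeight c (shift b v) * (genOp t (fun i a => (opF c i a).act) x f (mob t x s (shift b v)) +
        s * genOp t (fun i a => (opH c i a).act) x f (mob t x s (shift b v)) -
        s ^ 2 * genOp t (fun i a => (opE c i a).act) x f (mob t x s (shift b v))) := by
  by_cases h : ∃ i, cc (shift b v) i = 0
  · obtain ⟨i, hi⟩ := h
    have hcont : ContinuousAt (fun b => (x, s, shift b v)) b :=
      (continuous_const.prodMk (continuous_const.prodMk (continuous_shift v))).continuousAt
    have h1 : (fun y => kerWeight c (shift y v) * f (mob t x s (shift y v))) =ᶠ[nhds b]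
        fun _ => 0 := hcont.eventually (kernel_eventually_zero hn t c s (hx i) hi hf')
    rw [((hasDHolAt_const 0 b).congr_of_eventuallyEq h1).eq, kerWeight_eq_zero hn c hi, zero_mul]
  · push Not at h
    exact (hasDHolAt_kernel_shift_of_ne hn t hc hx s v h (ContDiff.diffAt hf _)).eq

/-! ### The differential equation of the kernel -/

theorem mob_contDiff_x (t : ι → ℂ) (s : ℂ) (v : Cfg n) : ContDiff ℝ ∞ fun x => mob t x s v := by
  refine contDiff_pi.2 fun p => ?_
  have : Differentiable ℂ (fun y => mob t y s v p) :=
    fun x => (mob_hasDerivAt_x t x s v p).differentiableAt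
  exact (this.contDiff (n := ∞)).restrict_scalars ℝ

/-- `A` satisfies the first order equation of the factor `∏ |t_i - x|^{n_i} exp(-½ χ_i(log …))`. -/
def IsBranch (n : ι → ℕ) (t : ι → ℂ) (c : ι → ℕ → ℂ) (A : ℂ → ℂ) (x : ℂ) : Prop :=
  HasDHolAt A ((∑ i, 1 / 2 * dchi (n i) (c i) (pointSub t x i)⁻¹) * A x) x

theorem genOp_genOp' (t : ι → ℂ) (x : ℂ) (D : ι → ℕ → FirstOrder n) {D' : ι → ℕ → FirstOrder n}
    (hD' : ∀ i a, (D' i a).IsSmooth) (hφ : ContDiff ℝ ∞ φ) (u : Cfg n) :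
    genOp t (fun i a => (D i a).act) x (genOp t (fun i a => (D' i a).act) x φ) u =
      ∑ k, ∑ b ∈ range (n k),
        genOp t (fun i a => (D i a).act) x ((D' k b).act φ) u / (x - t k) ^ (b + 1) := by
  simp only [genOp, act_genOp t x hD' _ hφ]
  simp only [sum_div]
  have : ∀ i, ∑ a ∈ range (n i), ∑ k, ∑ b ∈ range (n k),
      (D i a).act ((D' k b).act φ) u / (x - t k) ^ (b + 1) / (x - t i) ^ (a + 1) =
      ∑ k, ∑ b ∈ range (n k), ∑ a ∈ range (n i),
      (D i a).act ((D' k b).act φ) u / (x - t i) ^ (a + 1) / (x - t k) ^ (b + 1) := by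
    intro i
    rw [sum_comm]
    refine sum_congr rfl fun k _ => ?_
    rw [sum_comm]
    exact sum_congr rfl fun b _ => sum_congr rfl fun a _ => div_right_comm _ _ _
  simp only [this]
  rw [sum_comm]
  exact sum_congr rfl fun k _ => sum_comm

theorem hasDHolAt_genOp_mob (hn : ∀ i, 1 ≤ n i) (t : ι → ℂ) (c : ι → ℕ → ℂ)
    (hx : ∀ i, x ≠ t i) (s : ℂ) (v : Cfg n) {D : ι → ℕ → FirstOrder n}
    (hD : ∀ i a, (D i a).IsSmooth) (hφ : ContDiff ℝ ∞ φ) {A : ℂ → ℂ} (hA : IsBranch n t c A x) :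
    HasDHolAt (fun y => A y * genOp t (fun i a => (D i a).act) y φ (mob t y s v))
      (A x * (1 / 2 * genOp t (fun i a => (opH c i a).act) x
          (genOp t (fun i a => (D i a).act) x φ) (mob t x s v) -
        s * genOp t (fun i a => (opE c i a).act) x
          (genOp t (fun i a => (D i a).act) x φ) (mob t x s v) +
        genOpDeriv t (fun i a => (D i a).act) x φ (mob t x s v))) x := by
  have h1 : ∀ i, ∀ a, HasDHolAt (fun y => A y * (D i a).act φ (mob t y s v) *
      (1 / (y - t i) ^ (a + 1))) _ x := fun i a =>
    (hasDHolAt_comp_mob_x hn t c hx s v (ContDiff.diffAt ((hD i a).act hφ) _) hA).mul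
      (g' := -((a : ℂ) + 1) / (x - t i) ^ (a + 2)) (by
        have hd : x - t i ≠ 0 := sub_ne_zero.2 (hx i)
        have := ((((hasDerivAt_id x).sub_const (t i)).pow (a + 1)).inv (pow_ne_zero _ hd))
        refine HasDerivAt.hasDHolAt ?_
        convert! this using 1
        · funext y; simp
        · simp only [id, Nat.add_sub_cancel]; push_cast
          rw [Pi.pow_apply]; field_simp; ring)
  have h2 := HasDHolAt.sum univ fun i _ =>
    HasDHolAt.sum (range (n i)) fun a _ => h1 i a
  convert! h2 using 1
  · funext y
    simp only [genOp, mul_sum]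
    exact sum_congr rfl fun i _ => sum_congr rfl fun a _ => by ring
  · rw [genOp_genOp' t x _ hD hφ, genOp_genOp' t x _ hD hφ, genOpDeriv]
    simp only [mul_sum, ← sum_add_distrib, ← sum_sub_distrib, ← sum_neg_distrib]
    exact sum_congr rfl fun i _ => sum_congr rfl fun a _ => by ring

/-- The second holomorphic derivative of the kernel in `x` is given by the Gaudin operators, up to
a derivative along the simultaneous translations. -/
theorem kernel_equation (hn : ∀ i, 1 ≤ n i) (t : ι → ℂ) (c : ι → ℕ → ℂ) (s : ℂ) (v : Cfg n)
    (hφ : ContDiff ℝ ∞ φ) {A : ℂ → ℂ} (hA : ∀ᶠ y in nhds x, (∀ i, y ≠ t i) ∧ IsBranch n t c A y) :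
    dHol (dHol fun y => A y * φ (mob t y s v)) x = A x * (gaudinGen t c x φ (mob t x s v) -
        (genOp t (fun i a => (opF c i a).act) x
          (genOp t (fun i a => (opE c i a).act) x φ) (mob t x s v) +
        s * genOp t (fun i a => (opH c i a).act) x
          (genOp t (fun i a => (opE c i a).act) x φ) (mob t x s v) -
        s ^ 2 * genOp t (fun i a => (opE c i a).act) x
          (genOp t (fun i a => (opE c i a).act) x φ) (mob t x s v))) := by
  obtain ⟨hx, hAx⟩ := hA.self_of_nhds
  have h1 : dHol (fun y => A y * φ (mob t y s v)) =ᶠ[nhds x] fun y =>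
      1 / 2 * (A y * genOp t (fun i a => (opH c i a).act) y φ (mob t y s v)) +
      (-s) * (A y * genOp t (fun i a => (opE c i a).act) y φ (mob t y s v)) := by
    filter_upwards [hA] with y hy
    rw [(hasDHolAt_comp_mob_x hn t c hy.1 s v (ContDiff.diffAt hφ _) hy.2).eq]; ring
  have h2 := (((hasDHolAt_genOp_mob hn t c hx s v (opH_isSmooth c) hφ hAx).const_mul (1 / 2)).add
    ((hasDHolAt_genOp_mob hn t c hx s v (opE_isSmooth c) hφ hAx).const_mul (-s))
      ).congr_of_eventuallyEq h1
  rw [h2.eq, gaudinGen]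
  -- After both derivatives are expanded, the terms linear in s differ from the claim by (s/2)([h,
  -- e] - 2 e') φ, which is zero.
  have h3 := genOp_opH_opE hn t c x hφ (mob t x s v)
  linear_combination (A x * s / 2) * h3

/-! ### Multiplicativity of the weights -/

theorem branchExp_mul (c : ℕ → ℂ) (ℓ ℓ' : ℂ) (ha : constantCoeff a ≠ 0) (hb : constantCoeff b ≠ 0) :
    branchExp 1 m c (ℓ + ℓ') (a * b) = branchExp 1 m c ℓ a * branchExp 1 m c ℓ' b := by
  have h : ∀ j, logCoeff (ℓ + ℓ') (a * b) j = logCoeff ℓ a j + logCoeff ℓ' b j := by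
    intro j
    unfold logCoeff
    split_ifs
    · rfl
    · rw [logTail_mul ha hb, map_add]
  rw [branchExp_eq, branchExp_eq, branchExp_eq, ← exp_add]
  congr 1
  simp only [h, mul_add, sum_add_distrib, add_re]
  push_cast
  ring

theorem unitWeight_mul (hm : 1 ≤ m) (c : ℕ → ℂ) (hc : ∃ k : ℤ, (c 0).im = k)
    (ha : constantCoeff a ≠ 0) (hb : constantCoeff b ≠ 0) :
    unitWeight m c (a * b) = unitWeight m c a * unitWeight m c b := by
  rw [unitWeight_eq hm c hc (exp_log ha), unitWeight_eq hm c hc (exp_log hb),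
    ← branchExp_mul c _ _ ha hb]
  refine unitWeight_eq hm c hc ?_
  rw [exp_add, exp_log ha, exp_log hb, map_mul]

theorem chi_neg (m : ℕ) (c b : ℕ → ℂ) : chi m (-c) b = -chi m c b := by
  rw [chi, chi, ← mul_neg, ← Complex.ofReal_neg, ← neg_re, ← sum_neg_distrib]
  simp only [Pi.neg_apply, neg_mul]

theorem unitWeight_neg_mul (m : ℕ) (c : ℕ → ℂ) (a : ℂ⟦X⟧) : unitWeight m (-c) a * unitWeight m c a =
      (((‖constantCoeff a‖ ^ (4 * m))⁻¹ : ℝ) : ℂ) := by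
  rw [unitWeight, unitWeight, mul_mul_mul_comm, ← exp_add, chi_neg, neg_add_cancel,
    exp_zero, mul_one, ← Complex.ofReal_mul, ← mul_inv, ← pow_add]
  congr 4; ring

theorem unitWeight_congr (hm : 1 ≤ m) (c : ℕ → ℂ) (h : PSCongr m a b) :
    unitWeight m c a = unitWeight m c b := by
  rw [unitWeight, unitWeight, h.constantCoeff_eq hm]
  congr 2
  rw [chi, chi]
  congr 3
  refine sum_congr rfl fun j hj => ?_
  unfold logCoeff
  rw [(h.logTail hm).coeff_eq (mem_range.1 hj)]

theorem chi_epsLog (c : ℕ → ℂ) (ha : constantCoeff a ≠ 0) (ℓ : ℂ) :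
    chi m c (epsLog ℓ a) = chi m c (logCoeff ℓ a) := by
  congr 1; funext j; exact epsLog_eq ha ℓ j

/-- On a scalar only the numbers c_0 enter, and they sum to zero. The unitary parts cancel, leaving
the homogeneity of a density. -/
theorem prod_unitWeight_C (hn : ∀ i, 1 ≤ n i) (c : ι → ℕ → ℂ) (hsum : ∑ i, c i 0 = 0) (z : ℂ) :
    ∏ i, unitWeight (n i) (c i) (C z) = (((‖z‖ ^ (2 * ∑ i, n i))⁻¹ : ℝ) : ℂ) := by
  simp only [unitWeight, constantCoeff_C]
  rw [prod_mul_distrib, ← exp_sum]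
  have h : ∀ i, chi (n i) (c i) (logCoeff (log z) (C z)) = I * ((c i 0 * log z).re : ℂ) := by
    intro i
    rw [chi, sum_eq_single 0]
    · simp [logCoeff]
    · intro j _ hj; simp [logCoeff, hj, logTail_C]
    · intro h; exact absurd (mem_range.2 (hn i)) h
  simp only [h]
  rw [← mul_sum, ← Complex.ofReal_sum, ← re_sum, ← sum_mul, hsum, zero_mul,
    Complex.zero_re, ofReal_zero, mul_zero, exp_zero, mul_one,
    ← ofReal_prod, prod_inv_distrib, prod_pow_eq_pow_sum, mul_sum]

/-! ### The quotient map -/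

/-- The tuple `((t_i + ε_i - x) / 𝐯_i)_i`. -/
def quot (t : ι → ℂ) (x : ℂ) (v : Cfg n) : Cfg n :=
  fun p => coeff p.2.val (pointSub t x p.1 * (block v p.1)⁻¹)

theorem block_quot (t : ι → ℂ) (x : ℂ) (v : Cfg n) (i : ι) :
    PSCongr (n i) (block (quot t x v) i) (pointSub t x i * (block v i)⁻¹) :=
  block_ofCoeff (fun i => pointSub t x i * (block v i)⁻¹) i

theorem mob_eq (t : ι → ℂ) (x s : ℂ) (v : Cfg n) : mob t x s v = shift s (-quot t x v) := by
  funext p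
  simp only [mob, shift, quot, map_sub, coeff_C, Pi.neg_apply]
  ring

theorem block_neg (u : Cfg n) (i : ι) : block (-u) i = -block u i := by
  ext j; simp only [coeff_block, map_neg]; split_ifs <;> simp

theorem moved_eq (hn : ∀ i, 1 ≤ n i) (t : ι → ℂ) (x s : ℂ) (u : Cfg n) :
    moved t x s u = quot t x (shift s (-u)) := by
  funext p
  rw [moved, quot, block_shift hn, block_neg, lineSub, neg_add_eq_sub]

theorem cc_quot (hn : ∀ i, 1 ≤ n i) (t : ι → ℂ) (x : ℂ) (v : Cfg n) (i : ι) :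
    cc (quot t x v) i = (t i - x) / cc v i := by
  rw [cc, (block_quot t x v i).constantCoeff_eq (hn i)]
  simp [cc, pointSub, div_eq_mul_inv]

theorem quot_quot (hn : ∀ i, 1 ≤ n i) (t : ι → ℂ) (hx : ∀ i, x ≠ t i) {v : Cfg n}
    (hv : ∀ i, cc v i ≠ 0) : quot t x (quot t x v) = v := by
  funext p
  have h := ((PSCongr.refl (pointSub t x p.1)).mul ((block_quot t x v p.1).inv (hn p.1))).coeff_eq
    p.2.2
  rw [quot, h, ← coeff_block_fin v p]
  congr 1
  have h0 : constantCoeff (pointSub t x p.1) ≠ 0 := by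
    rw [constantCoeff_pointSub]; exact sub_ne_zero.2 (hx p.1).symm
  have h1 : (block v p.1)⁻¹⁻¹ = block v p.1 := by
    refine ((PowerSeries.eq_inv_iff_mul_eq_one ?_).2 (mul_inv_self _ (hv p.1))).symm
    rw [constantCoeff_inv]
    exact inv_ne_zero (hv p.1)
  rw [PowerSeries.mul_inv_rev, h1, mul_left_comm, mul_inv_self _ h0, mul_one]

theorem PSCongr.prod_unitWeight (hn : ∀ i, 1 ≤ n i) (c : ι → ℕ → ℂ) {a b : ι → ℂ⟦X⟧}
    (h : ∀ i, PSCongr (n i) (a i) (b i)) :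
    ∏ i, unitWeight (n i) (c i) (a i) = ∏ i, unitWeight (n i) (c i) (b i) :=
  prod_congr rfl fun i _ => unitWeight_congr (hn i) _ (h i)

/-- Multiplicativity of the unit characters: the quotient tuple times v is the constant tuple (t_i +
ε_i - x). -/
theorem kerWeight_quot_mul (hn : ∀ i, 1 ≤ n i) (t : ι → ℂ)
    (hc : ∀ i, ∃ k : ℤ, (c i 0).im = k) (hx : ∀ i, x ≠ t i) {v : Cfg n} (hv : ∀ i, cc v i ≠ 0) :
    kerWeight c (quot t x v) * kerWeight c v = ∏ i, unitWeight (n i) (c i) (pointSub t x i) := by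
  rw [kerWeight, kerWeight, PSCongr.prod_unitWeight hn c (block_quot t x v), ← prod_mul_distrib]
  refine prod_congr rfl fun i _ => ?_
  have h0 : constantCoeff (pointSub t x i) ≠ 0 := by
    rw [constantCoeff_pointSub]; exact sub_ne_zero.2 (hx i).symm
  rw [← unitWeight_mul (hn i) _ (hc i) (by
    rw [map_mul, constantCoeff_inv]
    exact mul_ne_zero h0 (inv_ne_zero (hv i))) (hv i), mul_assoc,
    inv_mul_self _ (hv i), mul_one]

theorem kerWeight_neg_mul (c : ι → ℕ → ℂ) (v : Cfg n) :
    kerWeight (-c) v * kerWeight c v = (((∏ i, ‖cc v i‖ ^ (4 * n i))⁻¹ : ℝ) : ℂ) := by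
  rw [kerWeight, kerWeight, ← prod_mul_distrib, ← prod_inv_distrib, ofReal_prod]
  exact prod_congr rfl fun i _ => unitWeight_neg_mul _ _ _

/-! ### Measurability -/

/-- All coefficients depend measurably on the parameter. -/
def PSMeasurable {E : Type*} [MeasurableSpace E] (P : E → ℂ⟦X⟧) : Prop :=
  ∀ j, Measurable fun e => coeff j (P e)

section
variable {E : Type*} [MeasurableSpace E] {P Q : E → ℂ⟦X⟧}

theorem PSMeasurable.mul (hP : PSMeasurable P) (hQ : PSMeasurable Q) :
    PSMeasurable fun e => P e * Q e := fun j => by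
  simp only [coeff_mul]
  exact Finset.measurable_fun_sum _ fun q _ => (hP q.1).mul (hQ q.2)

theorem PSMeasurable.inv (hP : PSMeasurable P) : PSMeasurable fun e => (P e)⁻¹ := fun j => by
  induction j using Nat.strong_induction_on with
  | _ j ih =>
    rw [show (fun e => coeff j (P e)⁻¹) = _ from
      funext fun e => coeff_inv j (P e)]
    have h0 : Measurable fun e => constantCoeff (P e) := by
      simpa only [coeff_zero_apply] using hP 0
    replace h0 : Measurable fun e => (constantCoeff (P e))⁻¹ := h0.inv
    split_ifs
    · exact h0
    · refine h0.neg.mul (Finset.measurable_fun_sum _ fun q _ => ?_)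
      split_ifs with h
      · exact (hP q.1).mul (ih q.2 h)
      · exact measurable_const

theorem PSMeasurable.unitWeight (hP : PSMeasurable P) (m : ℕ) (c : ℕ → ℂ) :
    Measurable fun e => unitWeight m c (P e) := by
  have h0 : Measurable fun e => constantCoeff (P e) := by
    simpa only [coeff_zero_apply] using hP 0
  have hd : PSMeasurable fun e => derivative ℂ (P e) := fun j => by
    simp only [coeff_derivative]
    exact (hP _).mul_const _
  have hlog : ∀ j, Measurable fun e => logCoeff
      (log (constantCoeff (P e))) (P e) j := by
    intro j
    rcases eq_or_ne j 0 with rfl | hj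
    · simpa [logCoeff] using h0.clog
    · simp only [logCoeff, hj, if_false, coeff_logTail _ hj]
      exact ((hd.mul hP.inv) (j - 1)).div_const _
  unfold WildHecke.unitWeight chi
  refine (Complex.measurable_ofReal.comp (h0.norm.pow_const _).inv).mul
    (Measurable.cexp (Measurable.const_mul (Complex.measurable_ofReal.comp
      (Complex.measurable_re.comp (Finset.measurable_fun_sum _ fun j _ => (hlog j).const_mul _))) _))

end

theorem psMeasurable_block (i : ι) : PSMeasurable fun v : Cfg n => block v i := fun j => by
  simp only [coeff_block]
  split_ifs
  · exact measurable_pi_apply _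
  · exact measurable_const

theorem PSMeasurable.comp {E F : Type*} [MeasurableSpace E] [MeasurableSpace F] {P : F → ℂ⟦X⟧}
    (hP : PSMeasurable P) {g : E → F} (hg : Measurable g) : PSMeasurable fun e => P (g e) :=
  fun j => (hP j).comp hg

theorem psMeasurable_pointSub (t : ι → ℂ) (i : ι) : PSMeasurable fun x => pointSub t x i :=
  fun j => by
    simp only [pointSub, map_add, coeff_C]
    split_ifs <;> fun_prop

theorem measurable_kerWeight (c : ι → ℕ → ℂ) : Measurable (kerWeight (n := n) c) :=
  Finset.measurable_fun_prod _ fun i _ => (psMeasurable_block i).unitWeight _ _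

theorem measurable_quot (t : ι → ℂ) : Measurable fun y : ℂ × Cfg n => quot t y.1 y.2 :=
  measurable_pi_lambda _ fun p => (((psMeasurable_pointSub t p.1).comp measurable_fst).mul
    ((psMeasurable_block p.1).comp measurable_snd).inv) _

theorem psMeasurable_const {E : Type*} [MeasurableSpace E] (a : ℂ⟦X⟧) :
    PSMeasurable fun _ : E => a := fun _ => measurable_const

theorem measurable_quot_right (t : ι → ℂ) (x : ℂ) : Measurable (quot (n := n) t x) :=
  measurable_pi_lambda _ fun p =>
    ((psMeasurable_const (pointSub t x p.1)).mul (psMeasurable_block p.1).inv) _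

theorem continuous_shift_uncurry : Continuous fun y : ℂ × Cfg n => shift y.1 y.2 := by
  refine continuous_pi fun p => ?_
  simp only [shift]
  split_ifs <;> fun_prop

theorem measurable_mob (t : ι → ℂ) : Measurable fun y : ℂ × ℂ × Cfg n => mob t y.1 y.2.1 y.2.2 := by
  simp only [mob_eq]
  exact continuous_shift_uncurry.measurable.comp
    ((measurable_fst.comp measurable_snd).prodMk ((measurable_quot t).comp
      (measurable_fst.prodMk (measurable_snd.comp measurable_snd))).neg)

theorem measurable_cc (hn : ∀ i, 1 ≤ n i) (i : ι) : Measurable fun v : Cfg n => cc v i :=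
  (continuous_cc hn i).measurable

/-! ### Changes of variables -/

/-- Multiplication of the blocks by given power series. -/
def mulBlock (κ : ι → ℂ⟦X⟧) : Cfg n →ₗ[ℂ] Cfg n where
  toFun h p := coeff p.2.val (κ p.1 * block h p.1)
  map_add' u v := by
    funext p
    have : block (u + v) p.1 = block u p.1 + block v p.1 := by
      ext j; simp only [coeff_block, map_add]; split_ifs <;> simp
    simp only [this, mul_add, map_add, Pi.add_apply]
  map_smul' z u := by
    funext p
    have : block (z • u) p.1 = C z * block u p.1 := by
      ext j; rw [coeff_C_mul_eq]; simp only [coeff_block]; split_ifs <;> simp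
    rw [this, mul_left_comm, coeff_C_mul_eq]; rfl

/-- Multiplication by a power series is triangular in the powers of ε_i with constant diagonal. A
lexicographic order on the coordinates makes the whole matrix lower triangular; entries between
different blocks are zero anyway. -/
theorem det_mulBlock (κ : ι → ℂ⟦X⟧) :
    LinearMap.det (mulBlock (n := n) κ) = ∏ i, constantCoeff (κ i) ^ n i := by
  let e : Coord n → ℕ ×ₗ ℕ := fun p => toLex ((Fintype.equivFin ι p.1).val, p.2.val)
  have he : Injective e := by
    rintro ⟨i, p⟩ ⟨k, q⟩ h
    have h' := Prod.mk.inj (toLex.injective h)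
    have h1 : i = k := (Fintype.equivFin ι).injective (Fin.ext h'.1)
    subst h1
    exact congrArg (Sigma.mk i) (Fin.ext h'.2)
  let _ : LinearOrder (Coord n) := LinearOrder.lift' e he
  have hM : ∀ p q : Coord n, LinearMap.toMatrix' (mulBlock (n := n) κ) p q =
      if q.1 = p.1 then coeff p.2.val (κ p.1 * X ^ q.2.val) else 0 := by
    rintro ⟨i, p⟩ ⟨k, q⟩
    rw [LinearMap.toMatrix'_apply]
    simp only [mulBlock, LinearMap.coe_mk, AddHom.coe_mk, block_single]
    split_ifs <;> simp
  have h := Matrix.det_of_isLowerTriangular (LinearMap.toMatrix' (mulBlock (n := n) κ)) (by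
    intro p q hpq
    have hpq' : e p < e q := hpq
    rw [hM]
    split_ifs with h
    · rw [coeff_mul_X_pow', if_neg]
      rw [Prod.Lex.toLex_lt_toLex] at hpq'
      rcases hpq' with h1 | h1
      · simp only [h] at h1; omega
      · have := h1.2; simp only at this; omega
    · rfl)
  rw [← LinearMap.det_toMatrix']
  refine Eq.trans (by congr) (h.trans ?_)
  rw [Fintype.prod_sigma]
  refine prod_congr rfl fun i _ => ?_
  simp [hM, coeff_mul_X_pow']

theorem det_mulBlock_real (κ : ι → ℂ⟦X⟧) :
    |LinearMap.det ((mulBlock (n := n) κ).restrictScalars ℝ)| =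
      ∏ i, ‖constantCoeff (κ i)‖ ^ (2 * n i) := by
  rw [LinearMap.det_restrictScalars, det_mulBlock, Algebra.norm_complex_apply,
    Complex.normSq_eq_norm_sq, norm_prod, abs_of_nonneg (by positivity), ← prod_pow]
  refine prod_congr rfl fun i _ => ?_
  rw [norm_pow, ← pow_mul, mul_comm]

/-- The set of tuples with all blocks invertible. -/
def unitSet (n : ι → ℕ) : Set (Cfg n) := {v | ∀ i, cc v i ≠ 0}

theorem measurableSet_unitSet (hn : ∀ i, 1 ≤ n i) : MeasurableSet (unitSet n) := by
  rw [unitSet, Set.ofPred_forall]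
  exact MeasurableSet.iInter fun i => (measurable_cc hn i (measurableSet_singleton 0)).compl

/-- The zero set of a nonzero linear function is a null set. -/
theorem ae_linear_ne_zero (L : Cfg n →ₗ[ℂ] ℂ) (hL : L ≠ 0) : ∀ᵐ v : Cfg n, L v ≠ 0 := by
  have h := Measure.addHaar_submodule (volume : Measure (Cfg n))
    (LinearMap.ker (L.restrictScalars ℝ)) (by
      intro h
      refine hL (LinearMap.ext fun v => ?_)
      have : v ∈ LinearMap.ker (L.restrictScalars ℝ) := h ▸ Submodule.mem_top
      simpa using this)
  rw [ae_iff]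
  refine (measure_mono_null ?_ h)
  intro v hv
  simpa using hv

theorem ae_mem_unitSet (hn : ∀ i, 1 ≤ n i) : ∀ᵐ v : Cfg n, v ∈ unitSet n := by
  have h : ∀ i, ∀ᵐ v : Cfg n, cc v i ≠ 0 := by
    intro i
    have := ae_linear_ne_zero (LinearMap.proj (⟨i, ⟨0, hn i⟩⟩ : Coord n)) (by
      intro h
      have := LinearMap.congr_fun h (fun _ => (1 : ℂ))
      simp at this)
    filter_upwards [this] with v hv
    rw [cc_eq hn]; exact hv
  filter_upwards [ae_all_iff.2 h] with v hv using hv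

theorem quot_hasFDerivAt (t : ι → ℂ) (x : ℂ) {v : Cfg n} (hv : v ∈ unitSet n) :
    HasFDerivAt (quot t x) (((mulBlock fun i => -(pointSub t x i * (block v i)⁻¹ ^ 2)).restrictScalars
      ℝ).toContinuousLinearMap) v := by
  have h : HasFDerivAt (quot t x)
      ((mulBlock fun i => -(pointSub t x i * (block v i)⁻¹ ^ 2)).toContinuousLinearMap) v := by
    refine hasFDerivAt_pi'.2 fun p => ?_
    obtain ⟨L, h1, h2⟩ := ((hasPSDerivAt_const (pointSub t x p.1) v).mul
      ((hasPSDerivAt_block v p.1).inv (hv p.1))) p.2.val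
    convert! h2 using 1
    ext y
    rw [h1]
    simp only [mulBlock, ContinuousLinearMap.comp_apply, ContinuousLinearMap.proj_apply,
      LinearMap.coe_toContinuousLinearMap', LinearMap.coe_mk, AddHom.coe_mk]
    congr 1; ring
  exact h.restrictScalars ℝ

/-- The Jacobian of the quotient map. -/
def jac (t : ι → ℂ) (x : ℂ) (v : Cfg n) : ℝ :=
  (∏ i, ‖t i - x‖ ^ (2 * n i)) * (∏ i, ‖cc v i‖ ^ (4 * n i))⁻¹

theorem det_quot (t : ι → ℂ) (x : ℂ) (v : Cfg n) :
    |(((mulBlock (n := n) fun i => -(pointSub t x i * (block v i)⁻¹ ^ 2)).restrictScalars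
      ℝ).toContinuousLinearMap).det| = jac t x v := by
  rw [LinearMap.det_toContinuousLinearMap, det_mulBlock_real, jac, ← prod_inv_distrib,
    ← prod_mul_distrib]
  refine prod_congr rfl fun i _ => ?_
  rw [map_neg, norm_neg, map_mul, map_pow, constantCoeff_inv, constantCoeff_pointSub,
    norm_mul, mul_pow, norm_pow, norm_inv, ← pow_mul, inv_pow]
  congr 3
  ring

theorem quot_image (hn : ∀ i, 1 ≤ n i) (t : ι → ℂ) (hx : ∀ i, x ≠ t i) :
    quot t x '' unitSet n = unitSet n := by
  have hm : ∀ v ∈ unitSet n, quot t x v ∈ unitSet n := fun v hv i => by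
    rw [cc_quot hn]; exact div_ne_zero (sub_ne_zero.2 (hx i).symm) (hv i)
  refine Set.Subset.antisymm (Set.image_subset_iff.2 hm) fun v hv => ?_
  exact ⟨quot t x v, hm v hv, quot_quot hn t hx hv⟩

theorem quot_injOn (hn : ∀ i, 1 ≤ n i) (t : ι → ℂ) (hx : ∀ i, x ≠ t i) :
    InjOn (quot t x) (unitSet n) := fun u hu v hv h => by
  rw [← quot_quot hn t hx hu, h, quot_quot hn t hx hv]

theorem lintegral_quot (hn : ∀ i, 1 ≤ n i) (t : ι → ℂ) (hx : ∀ i, x ≠ t i)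
    (g : Cfg n → ENNReal) : ∫⁻ v, ofReal (jac t x v) * g (quot t x v) = ∫⁻ v, g v := by
  have hU : (volume : Measure (Cfg n)).restrict (unitSet n) = volume :=
    Measure.restrict_eq_self_of_ae_mem (ae_mem_unitSet hn)
  have h := lintegral_image_eq_lintegral_abs_det_fderiv_mul volume (measurableSet_unitSet hn)
    (fun v hv => (quot_hasFDerivAt t x hv).hasFDerivWithinAt) (quot_injOn hn t hx) g
  rw [quot_image hn t hx, hU] at h
  simp only [det_quot] at h
  exact h.symm

theorem integral_quot (hn : ∀ i, 1 ≤ n i) (t : ι → ℂ) (hx : ∀ i, x ≠ t i) (g : Cfg n → ℂ) :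
    ∫ v, (jac t x v : ℂ) * g (quot t x v) = ∫ v, g v := by
  have hU : (volume : Measure (Cfg n)).restrict (unitSet n) = volume :=
    Measure.restrict_eq_self_of_ae_mem (ae_mem_unitSet hn)
  have h := integral_image_eq_integral_abs_det_fderiv_smul volume (measurableSet_unitSet hn)
    (fun v hv => (quot_hasFDerivAt t x hv).hasFDerivWithinAt) (quot_injOn hn t hx) g
  rw [quot_image hn t hx, hU] at h
  simp only [det_quot, real_smul] at h
  exact h.symm

theorem mulBlock_C (z : ℂ) : (mulBlock (fun _ => C z) : Cfg n →ₗ[ℂ] Cfg n) = z • LinearMap.id := by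
  refine LinearMap.ext fun v => funext fun p => ?_
  simp only [mulBlock, LinearMap.coe_mk, AddHom.coe_mk, coeff_C_mul_eq, coeff_block_fin,
    LinearMap.smul_apply, LinearMap.id_apply, Pi.smul_apply, smul_eq_mul]

theorem map_smul_volume (hz : z ≠ 0) : Measure.map (fun v : Cfg n => z • v) volume =
      ofReal ((‖z‖ ^ (2 * ∑ i, n i))⁻¹) • (volume : Measure (Cfg n)) := by
  have hd : |LinearMap.det ((mulBlock (n := n) fun _ => C z).restrictScalars ℝ)| =
      ‖z‖ ^ (2 * ∑ i, n i) := by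
    rw [det_mulBlock_real, mul_sum, ← prod_pow_eq_pow_sum]
    simp
  have h0 : LinearMap.det ((mulBlock (n := n) fun _ => C z).restrictScalars ℝ) ≠ 0 := by
    rw [← abs_pos, hd]; positivity
  have h := Measure.map_linearMap_addHaar_eq_smul_addHaar (volume : Measure (Cfg n)) h0
  rw [abs_inv, hd] at h
  rw [← h, mulBlock_C]
  rfl

theorem lintegral_smul (z : ℂ) (hz : z ≠ 0) (g : Cfg n → ENNReal) :
    ∫⁻ v, g (z • v) = ofReal ((‖z‖ ^ (2 * ∑ i, n i))⁻¹) * ∫⁻ v, g v := by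
  rw [← smul_eq_mul, ← lintegral_smul_measure, ← map_smul_volume hz]
  exact (lintegral_map_equiv g (Homeomorph.smulOfNeZero z hz).toMeasurableEquiv).symm

theorem integral_smul_cfg (z : ℂ) (hz : z ≠ 0) (g : Cfg n → ℂ) :
    ∫ v, g (z • v) = (((‖z‖ ^ (2 * ∑ i, n i))⁻¹ : ℝ) : ℂ) * ∫ v, g v := by
  have h := MeasureTheory.integral_map_equiv (Homeomorph.smulOfNeZero z hz).toMeasurableEquiv g
    (μ := (volume : Measure (Cfg n)))
  have h2 : Measure.map (Homeomorph.smulOfNeZero z hz).toMeasurableEquiv volume =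
      ofReal ((‖z‖ ^ (2 * ∑ i, n i))⁻¹) • (volume : Measure (Cfg n)) := map_smul_volume hz
  rw [h2, integral_smul_measure, toReal_ofReal (by positivity), real_smul] at h
  exact h.symm

theorem shift_eq_add (b : ℂ) (v : Cfg n) : shift b v = v + shift b 0 := by
  funext p; simp [shift]

theorem lintegral_shift (b : ℂ) (g : Cfg n → ENNReal) : ∫⁻ v, g (shift b v) = ∫⁻ v, g v := by
  rw [show (fun v => g (shift b v)) = fun v => g (v + shift b 0) from
    funext fun v => by rw [← shift_eq_add]]
  exact lintegral_add_right_eq_self g _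

theorem integral_shift (b : ℂ) (g : Cfg n → ℂ) : ∫ v, g (shift b v) = ∫ v, g v := by
  rw [show (fun v => g (shift b v)) = fun v => g (v + shift b 0) from
    funext fun v => by rw [← shift_eq_add]]
  exact integral_add_right_eq_self g _

theorem lintegral_shift_neg (s : ℂ) (g : Cfg n → ENNReal) : ∫⁻ u, g (shift s (-u)) = ∫⁻ v, g v := by
  rw [lintegral_neg_eq_self (fun u => g (shift s u)), lintegral_shift]

theorem integral_shift_neg (s : ℂ) (g : Cfg n → ℂ) : ∫ u, g (shift s (-u)) = ∫ v, g v := by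
  rw [integral_neg_eq_self (fun u => g (shift s u)), integral_shift]

/-! ### An integral over the complex plane with three singular points -/

theorem lintegral_norm_inv_ball (ρ : ℝ) (hρ : 0 < ρ) :
    ∫⁻ q : ℂ, ofReal ((Iio ρ).indicator (fun y => y⁻¹) ‖q‖) = ofReal (2 * π * ρ) := by
  have e : EqOn (fun y : ℝ => y ^ (Module.finrank ℝ ℂ - 1) • (Iio ρ).indicator (fun y => y⁻¹) y)
      ((Iio ρ).indicator fun _ => 1) (Ioi 0) := by
    intro y hy
    have hy' : y ≠ 0 := ne_of_gt hy
    by_cases h : y < ρ <;> simp [finrank_real_complex, h, hy']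
  have hint : Integrable fun q : ℂ => (Iio ρ).indicator (fun y => y⁻¹) ‖q‖ := by
    rw [integrable_fun_norm_addHaar (volume : Measure ℂ) (f := (Iio ρ).indicator fun y => y⁻¹),
      integrableOn_congr_fun e measurableSet_Ioi, integrableOn_indicator_iff measurableSet_Iio]
    exact integrableOn_const (by simp [Set.Iio_inter_Ioi])
  rw [← ofReal_integral_eq_lintegral_ofReal hint (Eventually.of_forall fun q => by
    simp only [Set.indicator]; split_ifs <;> simp),
    integral_fun_norm_addHaar (volume : Measure ℂ) ((Iio ρ).indicator fun y => y⁻¹),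
    setIntegral_congr_fun measurableSet_Ioi e, setIntegral_indicator measurableSet_Iio]
  have hb : (volume : Measure ℂ).real (ball 0 1) = π := by
    simp [Measure.real, volume_ball]
  rw [hb, finrank_real_complex, Set.Ioi_inter_Iio, setIntegral_const,
    Real.volume_real_Ioo_of_le hρ.le]
  congr 1
  simp only [nsmul_eq_mul, smul_eq_mul, sub_zero, mul_one]
  push_cast; ring

/-- A radial majorant of the three-point kernel. -/
def majorant (d y : ℝ) : ℝ := if y < d then (d ^ 2)⁻¹ * y⁻¹ else (y ^ 3)⁻¹

theorem lintegral_majorant_lt_top {d : ℝ} (hd : 0 < d) : ∫⁻ q : ℂ, ofReal (majorant d ‖q‖) < ⊤ := by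
  have hint : Integrable fun q : ℂ => majorant d ‖q‖ := by
    rw [integrable_fun_norm_addHaar (volume : Measure ℂ) (f := majorant d),
      finrank_real_complex, ← Set.Ioo_union_Ici_eq_Ioi hd]
    refine IntegrableOn.union ?_ ?_
    · rw [integrableOn_congr_fun (g := fun _ => (d ^ 2)⁻¹) ?_ measurableSet_Ioo]
      · exact integrableOn_const (by simp)
      · intro y hy
        have := hy.1.ne'
        simp only [majorant, hy.2, if_true, smul_eq_mul]
        field_simp
        norm_num
    · rw [integrableOn_Ici_iff_integrableOn_Ioi]
      rw [integrableOn_congr_fun (g := fun y => y ^ (-2 : ℝ)) ?_ measurableSet_Ioi]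
      · exact integrableOn_Ioi_rpow_of_lt (by norm_num) hd
      · intro y hy
        have h0 : 0 < y := hd.trans hy
        have : ¬ y < d := not_lt.2 (le_of_lt hy)
        simp only [majorant, this, if_false, smul_eq_mul]
        rw [rpow_neg h0.le, Real.rpow_ofNat]
        field_simp
        norm_num
  exact hint.lintegral_lt_top

theorem majorant_nonneg {d y : ℝ} (hy : 0 ≤ y) : 0 ≤ majorant d y := by
  unfold majorant; split_ifs <;> positivity

theorem inv_mul_le_majorant {d x y z : ℝ} (hd : 0 < d) (hx : 0 ≤ x) (hy : d ≤ y)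
    (hz : d ≤ z) (h : x ≤ y) (h' : x ≤ z) : (x * y * z)⁻¹ ≤ majorant d x := by
  have hy0 : 0 < y := hd.trans_le hy
  have hz0 : 0 < z := hd.trans_le hz
  rcases hx.eq_or_lt with rfl | hx
  · simpa using majorant_nonneg le_rfl
  unfold majorant
  split_ifs with hxd
  · rw [← mul_inv]
    refine inv_anti₀ (by positivity) ?_
    nlinarith [mul_le_mul hy hz hd.le hy0.le]
  · refine inv_anti₀ (by positivity) ?_
    nlinarith [mul_le_mul h h' hx.le hy0.le]

/-- At the nearest of the three points the other two distances are at least d and at least the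
smallest one. This gives an integrable simple pole near that point and decay like the inverse cube
far away. -/
theorem inv_mul_le_sum_majorant {d x y z : ℝ} (hd : 0 < d) (hx : 0 ≤ x) (hy : 0 ≤ y)
    (hz : 0 ≤ z) (hxy : 2 * d ≤ x + y) (hyz : 2 * d ≤ y + z) (hxz : 2 * d ≤ x + z) :
    (x * y * z)⁻¹ ≤ majorant d x + majorant d y + majorant d z := by
  have h1 := majorant_nonneg (d := d) hx
  have h2 := majorant_nonneg (d := d) hy
  have h3 := majorant_nonneg (d := d) hz
  rcases le_total x y with a | a
  · rcases le_total x z with b | b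
    · linarith [inv_mul_le_majorant hd hx (by linarith) (by linarith) a b]
    · have := inv_mul_le_majorant hd hz (x := z) (y := x) (z := y)
        (by linarith) (by linarith) b (b.trans a)
      rw [show x * y * z = z * x * y by ring]; linarith
  · rcases le_total y z with b | b
    · have := inv_mul_le_majorant hd hy (x := y) (y := x) (z := z)
        (by linarith) (by linarith) a b
      rw [show x * y * z = y * x * z by ring]; linarith
    · have := inv_mul_le_majorant hd hz (x := z) (y := x) (z := y)
        (by linarith) (by linarith) (b.trans a) b
      rw [show x * y * z = z * x * y by ring]; linarith

/-- The integral of `1 / (|q| |q - 1| |q - a|)` over `Q`. -/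
def theta (Q : Set ℂ) (a : ℂ) : ENNReal :=
  ∫⁻ q, Q.indicator (fun q => ofReal (‖q‖ * ‖q - 1‖ * ‖q - a‖)⁻¹) q

theorem lintegral_ofReal_norm_sub (g : ℝ → ℝ) (a : ℂ) :
    ∫⁻ q : ℂ, ofReal (g ‖q - a‖) = ∫⁻ q : ℂ, ofReal (g ‖q‖) :=
  lintegral_sub_right_eq_self (fun q : ℂ => ofReal (g ‖q‖)) a

theorem measurable_majorant (d : ℝ) : Measurable (majorant d) :=
  Measurable.ite measurableSet_Iio (by fun_prop) (by fun_prop)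

theorem theta_le_of_separated {d : ℝ} (hd : 0 < d) (hd1 : 2 * d ≤ 1) {a : ℂ} (ha : 2 * d ≤ ‖a‖)
    (ha1 : 2 * d ≤ ‖a - 1‖) (Q : Set ℂ) : theta Q a ≤ 3 * ∫⁻ q : ℂ, ofReal (majorant d ‖q‖) := by
  have hm := measurable_majorant d
  calc theta Q a ≤ ∫⁻ q : ℂ, (ofReal (majorant d ‖q‖) +
        ofReal (majorant d ‖q - 1‖) + ofReal (majorant d ‖q - a‖)) := by
        refine lintegral_mono fun q => (Set.indicator_le_self _ _ q).trans ?_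
        rw [← ofReal_add (majorant_nonneg (norm_nonneg _))
          (majorant_nonneg (norm_nonneg _)), ← ofReal_add (add_nonneg
          (majorant_nonneg (norm_nonneg _)) (majorant_nonneg (norm_nonneg _)))
          (majorant_nonneg (norm_nonneg _))]
        refine ofReal_le_ofReal (inv_mul_le_sum_majorant hd (norm_nonneg _)
          (norm_nonneg _) (norm_nonneg _) ?_ ?_ ?_)
        · have := norm_sub_le q (q - 1)
          rw [sub_sub_cancel, norm_one] at this; linarith
        · have := norm_sub_le (q - 1) (q - a)
          rw [sub_sub_sub_cancel_left] at this; linarith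
        · have := norm_sub_le q (q - a)
          rw [sub_sub_cancel] at this; linarith
    _ = _ := by
        rw [lintegral_add_right _ (by fun_prop), lintegral_add_right _ (by fun_prop),
          lintegral_ofReal_norm_sub, lintegral_ofReal_norm_sub]
        ring

/-- As a → 1, the shells |a - 1| ≪ |q - 1| ≪ 1 can contribute a logarithm, and Q leaves them out.
For |q - 1| ≥ ε the points 1 and a act as one. For |q - 1| ≤ L |a - 1| the factor 1/|q| is at most
2, and two simple poles remain on discs of radius comparable to |a - 1|. -/
theorem theta_le_of_near {ε L : ℝ} (hε : 0 < ε) (hL : 0 ≤ L) {a : ℂ} (ha : a ≠ 1)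
    (haε : 2 * ‖a - 1‖ ≤ ε) (haL : 2 * (L * ‖a - 1‖) ≤ 1) {Q : Set ℂ}
    (hQ : ∀ q ∈ Q, ε ≤ ‖q - 1‖ ∨ ‖q - 1‖ ≤ L * ‖a - 1‖) :
    theta Q a ≤ 4 * (∫⁻ q : ℂ, ofReal (majorant ε ‖q‖)) + ofReal (16 * π * (L + 2)) := by
  set δ := ‖a - 1‖ with hδ
  have hδ0 : 0 < δ := norm_pos_iff.2 (sub_ne_zero.2 ha)
  set N : ℝ → ℝ := (Iio ((L + 2) * δ)).indicator fun y => y⁻¹ with hN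
  have hN0 : ∀ y, 0 ≤ y → 0 ≤ N y := by
    intro y hy; simp only [hN, Set.indicator]; split_ifs <;> positivity
  have hNm : Measurable N := Measurable.indicator (by fun_prop) measurableSet_Iio
  have hm := measurable_majorant ε
  calc theta Q a ≤ ∫⁻ q : ℂ, (2 * (ofReal (majorant ε ‖q‖) +
        ofReal (majorant ε ‖q - 1‖)) + ofReal (4 / δ) *
        (ofReal (N ‖q - 1‖) + ofReal (N ‖q - a‖))) := by
        refine lintegral_mono fun q => ?_
        by_cases hq : q ∈ Q
        swap
        · simp [hq]
        have hx := norm_nonneg q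
        have hy := norm_nonneg (q - 1)
        have hz := norm_nonneg (q - a)
        have t1 : ‖q - 1‖ ≤ ‖q - a‖ + δ := by
          have := norm_add_le (q - a) (a - 1); rwa [sub_add_sub_cancel] at this
        have t2 : δ ≤ ‖q - 1‖ + ‖q - a‖ := by
          have := norm_sub_le (q - 1) (q - a); rwa [sub_sub_sub_cancel_left] at this
        have t3 : ‖q - a‖ ≤ ‖q - 1‖ + δ := by
          have := norm_sub_le (q - 1) (a - 1); rwa [sub_sub_sub_cancel_right] at this
        have t4 : 1 ≤ ‖q‖ + ‖q - 1‖ := by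
          have := norm_sub_le q (q - 1); rwa [sub_sub_cancel, norm_one] at this
        rw [indicator_of_mem hq, show (2 : ENNReal) = ofReal 2 by simp,
          ← ofReal_add (majorant_nonneg hx) (majorant_nonneg hy),
          ← ofReal_mul (by norm_num), ← ofReal_add (hN0 _ hy) (hN0 _ hz),
          ← ofReal_mul (by positivity),
          ← ofReal_add (mul_nonneg (by norm_num) (add_nonneg (majorant_nonneg hx)
            (majorant_nonneg hy))) (mul_nonneg (by positivity)
            (add_nonneg (hN0 _ hy) (hN0 _ hz)))]
        refine ofReal_le_ofReal ?_
        have hQq := hQ q hq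
        generalize ‖q‖ = x at *
        generalize ‖q - 1‖ = y at *
        generalize ‖q - a‖ = z at *
        have r1 := majorant_nonneg (d := ε) hx
        have r2 := majorant_nonneg (d := ε) hy
        have n1 := mul_nonneg (show 0 ≤ 4 / δ by positivity) (add_nonneg (hN0 _ hy) (hN0 _ hz))
        rcases hQq with h | h
        · have hy0 : 0 < y := hε.trans_le h
          have hz2 : y / 2 ≤ z := by linarith
          have e1 : (x * y * z)⁻¹ ≤ 2 * (x * y * y)⁻¹ := by
            rcases hx.eq_or_lt with rfl | hx
            · simp
            rw [show 2 * (x * y * y)⁻¹ = (x * y * (y / 2))⁻¹ by field_simp]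
            exact inv_anti₀ (by positivity) (by gcongr)
          have e2 : (x * y * y)⁻¹ ≤ majorant ε x + majorant ε y := by
            rcases le_total x y with hxy | hxy
            · linarith [inv_mul_le_majorant hε hx h h hxy hxy]
            · have := inv_mul_le_majorant hε hy (x := y) (y := x) (z := y)
                (h.trans hxy) h hxy le_rfl
              rw [show x * y * y = y * x * y by ring]; linarith
          linarith
        · have hx2 : 1 / 2 ≤ x := by linarith
          have e1 : (x * y * z)⁻¹ ≤ 2 * (y⁻¹ * z⁻¹) := by
            rw [mul_assoc, mul_inv, mul_inv]
            refine mul_le_mul_of_nonneg_right ?_ (by positivity)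
            rw [show (2 : ℝ) = (1 / 2)⁻¹ by norm_num]
            exact inv_anti₀ (by norm_num) hx2
          have hNy : N y = y⁻¹ := indicator_of_mem (s := Iio _) (Set.mem_Iio.2 (by nlinarith)) _
          have hNz : N z = z⁻¹ := indicator_of_mem (s := Iio _) (Set.mem_Iio.2 (by nlinarith)) _
          -- Since δ ≤ y + z, one of the two distances is at least δ/2, so the product of poles is
          -- bounded by a multiple of their sum.
          have e2 : y⁻¹ * z⁻¹ ≤ 2 / δ * (y⁻¹ + z⁻¹) := by
            have hyi : 0 ≤ y⁻¹ := by positivity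
            have hzi : 0 ≤ z⁻¹ := by positivity
            have hk : 0 ≤ 2 / δ := by positivity
            rcases le_total (δ / 2) y with h3 | h3
            · have : y⁻¹ ≤ 2 / δ := by
                rw [show 2 / δ = (δ / 2)⁻¹ by field_simp]; exact inv_anti₀ (by positivity) h3
              nlinarith [mul_le_mul_of_nonneg_right this hzi, mul_nonneg hk hyi]
            · have : z⁻¹ ≤ 2 / δ := by
                rw [show 2 / δ = (δ / 2)⁻¹ by field_simp]
                exact inv_anti₀ (by positivity) (by linarith)
              nlinarith [mul_le_mul_of_nonneg_left this hyi, mul_nonneg hk hzi]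
          rw [hNy, hNz]
          have : 4 / δ = 2 * (2 / δ) := by ring
          rw [this]; linarith
    _ = _ := by
        rw [lintegral_add_right _ (by fun_prop), lintegral_const_mul _ (by fun_prop),
          lintegral_const_mul _ (by fun_prop), lintegral_add_right _ (by fun_prop),
          lintegral_add_right _ (by fun_prop),
          lintegral_ofReal_norm_sub, lintegral_ofReal_norm_sub, lintegral_ofReal_norm_sub,
          hN, lintegral_norm_inv_ball _ (by positivity), ← ofReal_add (by positivity)
          (by positivity), ← ofReal_mul (by positivity)]
        congr 1
        · ring
        · congr 1; field_simp; ring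

/-! ### Möbius transformations -/

theorem abs_det_mul_complex (w : ℂ) :
    |((toSpanSingleton ℂ w).restrictScalars ℝ).det| = ‖w‖ ^ 2 := by
  have : (((toSpanSingleton ℂ w).restrictScalars ℝ : ℂ →L[ℝ] ℂ) : ℂ →ₗ[ℝ] ℂ) =
      ((toSpanSingleton ℂ w : ℂ →L[ℂ] ℂ) : ℂ →ₗ[ℂ] ℂ).restrictScalars ℝ := rfl
  rw [ContinuousLinearMap.det, this, LinearMap.det_restrictScalars, LinearMap.det_ring,
    Algebra.norm_complex_apply, Complex.normSq_eq_norm_sq, abs_of_nonneg (by positivity)]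
  simp

/-- Change of variables on the complement of the pole. Only this inequality is needed, so the image
need not be identified. -/
theorem lintegral_mobius_le {α β δ : ℂ} (h : α * δ - β ≠ 0) (g : ℂ → ENNReal) :
    ∫⁻ b : ℂ, ofReal (‖α * δ - β‖ ^ 2 / ‖b + δ‖ ^ 4) * g ((α * b + β) / (b + δ)) ≤ ∫⁻ p, g p := by
  set S : Set ℂ := {-δ}ᶜ with hS
  have hS0 : ∀ b ∈ S, b + δ ≠ 0 := fun b hb h => hb (eq_neg_of_add_eq_zero_left h)
  have hd : ∀ b ∈ S, HasFDerivWithinAt (fun b : ℂ => (α * b + β) / (b + δ))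
      ((toSpanSingleton ℂ ((α * δ - β) / (b + δ) ^ 2)).restrictScalars ℝ) S b := by
    intro b hb
    have h1 : HasDerivAt (fun b : ℂ => (α * b + β) / (b + δ)) ((α * δ - β) / (b + δ) ^ 2) b := by
      refine ((((hasDerivAt_id b).const_mul α).add_const β).div ((hasDerivAt_id b).add_const δ)
        (hS0 b hb)).congr_deriv ?_
      simp only [id]; ring
    exact (h1.hasFDerivAt.restrictScalars ℝ).hasFDerivWithinAt
  have hi : InjOn (fun b : ℂ => (α * b + β) / (b + δ)) S := by
    intro b hb b' hb' e
    have e' := (div_eq_div_iff (hS0 b hb) (hS0 b' hb')).1 e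
    have : (α * δ - β) * (b - b') = 0 := by linear_combination e'
    exact sub_eq_zero.1 ((mul_eq_zero.1 this).resolve_left h)
  have hU : (volume : Measure ℂ).restrict S = volume := Measure.restrict_eq_self_of_ae_mem (by
      rw [ae_iff]
      simp [hS])
  have h2 := lintegral_image_eq_lintegral_abs_det_fderiv_mul volume
    (measurableSet_singleton (-δ)).compl hd hi g
  rw [← hS, hU] at h2
  simp only [abs_det_mul_complex, norm_div, div_pow, norm_pow, ← pow_mul] at h2
  rw [show (2 * 2 : ℕ) = 4 from rfl] at h2
  rw [← h2]
  exact setLIntegral_le_lintegral _ _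

/-- The weight `|y - z| / (|y| |z| |y - a z|)`. -/
def omega (a y z : ℂ) : ℝ := ‖y - z‖ * (‖y‖ * ‖z‖ * ‖y - a * z‖)⁻¹

/-- With q = (b + y)/(b + z), the points 0, 1, ∞ and a are the vanishing of y + b, of y - z, of z +
b and of (y + b) - a (z + b). The weight `omega` is the three-point density multiplied by the
Jacobian of this map. -/
theorem lintegral_omega_le (a : ℂ) (Q : Set ℂ) {y : ℂ} (h : y ≠ z) :
    ∫⁻ b : ℂ, ofReal (omega a (b + y) (b + z)) * Q.indicator 1 ((b + y) / (b + z)) ≤ theta Q a := by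
  refine le_trans (le_of_eq ?_) (lintegral_mobius_le (α := 1) (β := y) (δ := z)
    (by rw [one_mul, sub_ne_zero]; exact h.symm) _)
  refine lintegral_congr_ae ?_
  have : ∀ᵐ b : ℂ, b ≠ -z := by rw [ae_iff]; simp
  filter_upwards [this] with b hb
  have hz : b + z ≠ 0 := fun h => hb (eq_neg_of_add_eq_zero_left h)
  rw [one_mul, one_mul]
  by_cases hq : (b + y) / (b + z) ∈ Q
  swap
  · simp [hq]
  rw [indicator_of_mem hq, indicator_of_mem hq, Pi.one_apply, mul_one, ← ofReal_mul (by positivity)]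
  congr 1
  have e1 : (b + y) / (b + z) - 1 = (y - z) / (b + z) := by field_simp; ring
  have e2 : (b + y) / (b + z) - a = (b + y - a * (b + z)) / (b + z) := by field_simp
  rw [e1, e2, omega, add_sub_add_left_eq_sub, norm_div, norm_div, norm_div, norm_sub_rev z y]
  have hz' : ‖b + z‖ ≠ 0 := norm_ne_zero_iff.2 hz
  have hn : ‖y - z‖ ≠ 0 := norm_ne_zero_iff.2 (sub_ne_zero.2 h)
  generalize ‖b + z‖ = D at *
  generalize ‖y - z‖ = N at *
  simp only [div_eq_mul_inv, mul_inv, inv_inv]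
  generalize ‖b + y‖⁻¹ = X
  generalize ‖b + y - a * (b + z)‖⁻¹ = Z
  field_simp

/-- Here q is replaced by a/q, a substitution that preserves the three-point density. This form
suits tuples v, the previous one their quotients (t + ε - x)/v. -/
theorem lintegral_omega_le' {a : ℂ} (ha : a ≠ 0) (Q : Set ℂ) {y : ℂ} (h : y ≠ z) :
    ∫⁻ b : ℂ, ofReal (omega a (b + y) (b + z)) * Q.indicator 1 (a * (b + z) / (b + y)) ≤
      theta Q a := by
  refine le_trans (le_of_eq ?_) (lintegral_mobius_le (α := a) (β := a * z) (δ := y)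
    (by rw [← mul_sub]; exact mul_ne_zero ha (sub_ne_zero.2 h)) _)
  refine lintegral_congr_ae ?_
  have : ∀ᵐ b : ℂ, b ≠ -y := by rw [ae_iff]; simp
  filter_upwards [this] with b hb
  have hy : b + y ≠ 0 := fun h => hb (eq_neg_of_add_eq_zero_left h)
  rw [← mul_add, ← mul_sub]
  by_cases hq : a * (b + z) / (b + y) ∈ Q
  swap
  · simp [hq]
  rw [indicator_of_mem hq, indicator_of_mem hq, Pi.one_apply, mul_one, ← ofReal_mul (by positivity)]
  congr 1
  have e1 : a * (b + z) / (b + y) - 1 = -((b + y - a * (b + z)) / (b + y)) := by field_simp; ring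
  have e2 : a * (b + z) / (b + y) - a = -(a * (y - z) / (b + y)) := by field_simp; ring
  rw [e1, e2, omega, add_sub_add_left_eq_sub, norm_neg, norm_neg, norm_div, norm_div, norm_div,
    norm_mul, norm_mul]
  have hy' : ‖b + y‖ ≠ 0 := norm_ne_zero_iff.2 hy
  have hn : ‖y - z‖ ≠ 0 := norm_ne_zero_iff.2 (sub_ne_zero.2 h)
  have ha' : ‖a‖ ≠ 0 := norm_ne_zero_iff.2 ha
  generalize ‖b + y‖ = D at *
  generalize ‖y - z‖ = N at *
  generalize ‖a‖ = A at *
  simp only [div_eq_mul_inv, mul_inv, inv_inv]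
  generalize ‖b + z‖⁻¹ = X
  generalize ‖b + y - a * (b + z)‖⁻¹ = Z
  field_simp

/-! ### Distance to the diagonal -/

/-- The size of a tuple normalized by translation. -/
def spread (k : ι) (v : Cfg n) : ℝ := ‖shift (-cc v k) v‖

theorem shift_shift (b b' : ℂ) (v : Cfg n) : shift b (shift b' v) = shift (b + b') v := by
  funext p; simp only [shift]; split_ifs <;> ring

theorem shift_zero (v : Cfg n) : shift 0 v = v := by funext p; simp [shift]

theorem shift_smul (z b : ℂ) (v : Cfg n) : shift (z * b) (z • v) = z • shift b v := by
  funext p; simp only [shift, Pi.smul_apply, smul_eq_mul]; split_ifs <;> ring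

theorem neg_shift (b : ℂ) (v : Cfg n) : -shift b v = shift (-b) (-v) := by
  funext p; simp only [shift, Pi.neg_apply]; split_ifs <;> ring

theorem block_smul (z : ℂ) (u : Cfg n) (i : ι) : block (z • u) i = C z * block u i := by
  ext j; rw [coeff_C_mul_eq]; simp only [coeff_block]; split_ifs <;> simp

theorem cc_smul (z : ℂ) (v : Cfg n) (i : ι) : cc (z • v) i = z * cc v i := by
  simp [cc, block_smul]

theorem cc_neg (v : Cfg n) (i : ι) : cc (-v) i = -cc v i := by simp [cc, block_neg]

theorem spread_nonneg (k : ι) (v : Cfg n) : 0 ≤ spread k v := norm_nonneg _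

theorem spread_shift (hn : ∀ i, 1 ≤ n i) (k : ι) (b : ℂ) (v : Cfg n) :
    spread k (shift b v) = spread k v := by
  rw [spread, spread, cc_shift hn, shift_shift]; congr 2; ring

theorem spread_smul (k : ι) (z : ℂ) (v : Cfg n) : spread k (z • v) = ‖z‖ * spread k v := by
  rw [spread, spread, cc_smul, ← mul_neg, shift_smul, norm_smul]

theorem spread_neg (k : ι) (v : Cfg n) : spread k (-v) = spread k v := by
  rw [spread, spread, cc_neg, ← neg_shift, norm_neg]

theorem continuous_spread (hn : ∀ i, 1 ≤ n i) (k : ι) : Continuous fun v : Cfg n => spread k v :=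
  (continuous_shift_uncurry.comp ((continuous_cc hn k).neg.prodMk continuous_id)).norm

theorem spread_eq_zero_iff (hn : ∀ i, 1 ≤ n i) (k : ι) (v : Cfg n) :
    spread k v = 0 ↔ v ∈ diagonal n := by
  rw [spread, norm_eq_zero, diagonal, Set.mem_range]
  constructor
  · intro h
    exact ⟨cc v k, by rw [← h, shift_shift, add_neg_cancel, shift_zero]⟩
  · rintro ⟨b, rfl⟩
    have : cc (0 : Cfg n) k = 0 := by rw [cc_eq hn]; rfl
    rw [shift_shift, cc_shift hn, this, zero_add, neg_add_cancel, shift_zero]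

/-- A compact exhaustion of the complement of the diagonal. -/
def annulus (n : ι → ℕ) (k : ι) (r R : ℝ) : Set (Cfg n) :=
  {v | (r ≤ spread k v ∧ spread k v ≤ R) ∧ ‖cc v k‖ ≤ R}

theorem isClosed_annulus (hn : ∀ i, 1 ≤ n i) (k : ι) (r R : ℝ) : IsClosed (annulus n k r R) :=
  ((isClosed_le continuous_const (continuous_spread hn k)).inter
    (isClosed_le (continuous_spread hn k) continuous_const)).inter
    (isClosed_le (continuous_cc hn k).norm continuous_const)

theorem norm_shift_zero_le (b : ℂ) : ‖(shift b 0 : Cfg n)‖ ≤ ‖b‖ := by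
  refine (pi_norm_le_iff_of_nonneg (norm_nonneg b)).2 fun p => ?_
  simp only [shift, Pi.zero_apply, zero_add]
  split_ifs <;> simp

theorem norm_le_spread (k : ι) (v : Cfg n) : ‖v‖ ≤ spread k v + ‖cc v k‖ := by
  have h : v = shift (-cc v k) v + shift (cc v k) 0 := by
    rw [← shift_eq_add, shift_shift, add_neg_cancel, shift_zero]
  calc ‖v‖ = ‖shift (-cc v k) v + shift (cc v k) 0‖ := by rw [← h]
    _ ≤ _ := (norm_add_le _ _).trans (add_le_add le_rfl (norm_shift_zero_le _))

theorem isCompact_annulus (hn : ∀ i, 1 ≤ n i) (k : ι) (r R : ℝ) : IsCompact (annulus n k r R) := by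
  refine Metric.isCompact_of_isClosed_isBounded (isClosed_annulus hn k r R)
    ((Metric.isBounded_closedBall (x := (0 : Cfg n)) (r := R + R)).subset fun v hv => ?_)
  rw [mem_closedBall_zero_iff]
  exact (norm_le_spread k v).trans (add_le_add hv.1.2 hv.2)

theorem annulus_subset (hn : ∀ i, 1 ≤ n i) (k : ι) (hr : 0 < r) (R : ℝ) :
    annulus n k r R ⊆ (diagonal n)ᶜ := fun v hv hd => by
  have := (spread_eq_zero_iff hn k v).2 hd
  linarith [hv.1.1]

theorem exists_annulus (hn : ∀ i, 1 ≤ n i) (k : ι) {K : Set (Cfg n)} (hK : IsCompact K)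
    (hd : K ⊆ (diagonal n)ᶜ) : ∃ r R : ℝ, 0 < r ∧ 0 < R ∧ K ⊆ annulus n k r R := by
  rcases K.eq_empty_or_nonempty with rfl | hne
  · exact ⟨1, 1, one_pos, one_pos, Set.empty_subset _⟩
  obtain ⟨v0, h0, hmin⟩ := hK.exists_isMinOn hne (continuous_spread hn k).continuousOn
  obtain ⟨v1, h1, hmax⟩ := hK.exists_isMaxOn hne (continuous_spread hn k).continuousOn
  obtain ⟨v2, h2, hmax2⟩ := hK.exists_isMaxOn hne (continuous_cc hn k).norm.continuousOn
  have hpos : 0 < spread k v0 := lt_of_le_of_ne (spread_nonneg k v0)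
    fun h => hd h0 ((spread_eq_zero_iff hn k v0).1 h.symm)
  refine ⟨spread k v0, spread k v1 + ‖cc v2 k‖, hpos, ?_, fun v hv => ⟨⟨hmin hv, ?_⟩, ?_⟩⟩
  · have : spread k v0 ≤ spread k v1 := hmin h1
    linarith [norm_nonneg (cc v2 k)]
  · have : spread k v ≤ spread k v1 := hmax hv
    linarith [norm_nonneg (cc v2 k)]
  · have : ‖cc v k‖ ≤ ‖cc v2 k‖ := hmax2 hv
    linarith [spread_nonneg k v1]

/-! ### Averaging over dilations -/

/-- The mass of an annulus for the dilation invariant measure. -/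
def dilMass (r R ν : ℝ) : ENNReal :=
  ∫⁻ z : ℂ, ofReal ((‖z‖ ^ 2)⁻¹) * (Icc r R).indicator 1 (‖z‖ * ν)

/-- The measure |z|⁻² d²z on the plane is invariant under dilations. -/
theorem dilMass_eq (r R : ℝ) {ν : ℝ} (hν : 0 < ν) : dilMass r R ν = dilMass r R 1 := by
  have h := Measure.map_addHaar_smul (volume : Measure ℂ) hν.ne'
  have h2 := lintegral_map_equiv (fun z : ℂ => ofReal ((‖z‖ ^ 2)⁻¹) *
    (Icc r R).indicator 1 (‖z‖ * 1)) (Homeomorph.smulOfNeZero ν hν.ne').toMeasurableEquiv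
    (μ := (volume : Measure ℂ))
  have h3 : Measure.map (Homeomorph.smulOfNeZero ν hν.ne' : ℂ ≃ₜ ℂ).toMeasurableEquiv volume =
    Measure.map (ν • ·) (volume : Measure ℂ) := rfl
  rw [h3, h, lintegral_smul_measure] at h2
  have h4 : ∀ z : ℂ, ofReal ((‖ν • z‖ ^ 2)⁻¹) * (Icc r R).indicator 1 (‖ν • z‖ * 1) =
      ofReal ((ν ^ 2)⁻¹) * (ofReal ((‖z‖ ^ 2)⁻¹) * (Icc r R).indicator 1 (‖z‖ * ν)) := by
    intro z
    rw [norm_smul, norm_of_nonneg hν.le, mul_pow, mul_inv,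
      ofReal_mul (by positivity), mul_one, mul_comm ν, mul_assoc]
  have h5 : ∫⁻ z : ℂ, ofReal ((‖ν • z‖ ^ 2)⁻¹) * (Icc r R).indicator 1 (‖ν • z‖ * 1) = _ := h2.symm
  simp only [h4] at h5
  rw [lintegral_const_mul' _ _ ofReal_ne_top, finrank_real_complex,
    abs_of_pos (by positivity), smul_eq_mul] at h5
  exact (ENNReal.mul_right_inj (by simpa using by positivity) ofReal_ne_top).1 h5

theorem dilMass_zero (hr : 0 < r) (R : ℝ) : dilMass r R 0 = 0 := by
  simp [dilMass, not_le.2 hr]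

theorem measurable_indicator_one {E : Type*} [MeasurableSpace E] {S : Set E}
    (hS : MeasurableSet S) : Measurable (S.indicator (1 : E → ENNReal)) :=
  measurable_one.indicator hS

theorem dilMass_one_lt_top (hr : 0 < r) (R : ℝ) : dilMass r R 1 < ⊤ := by
  have h : dilMass r R 1 ≤ ∫⁻ z in closedBall (0 : ℂ) R, ofReal ((r ^ 2)⁻¹) := by
    rw [← lintegral_indicator isClosed_closedBall.measurableSet]
    refine lintegral_mono fun z => ?_
    by_cases hz : r ≤ ‖z‖ ∧ ‖z‖ ≤ R
    · rw [indicator_of_mem (by simpa using hz), indicator_of_mem (by simpa using hz.2)]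
      simp only [Pi.one_apply, mul_one]
      exact ofReal_le_ofReal (inv_anti₀ (by positivity) (by gcongr; exact hz.1))
    · rw [Set.indicator_of_notMem (by simpa using hz)]; simp
  refine h.trans_lt ?_
  rw [setLIntegral_const]
  exact mul_lt_top ofReal_lt_top measure_closedBall_lt_top

theorem dilMass_one_ne_zero (hr : 0 < r) (hrR : r < R) : dilMass r R 1 ≠ 0 := by
  rw [dilMass, Ne, lintegral_eq_zero_iff' (by
    have := measurable_indicator_one (measurableSet_Icc (a := r) (b := R))
    fun_prop)]
  intro h
  have hU : IsOpen {z : ℂ | r < ‖z‖ ∧ ‖z‖ < R} :=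
    (isOpen_lt continuous_const continuous_norm).inter (isOpen_lt continuous_norm continuous_const)
  have h0 : volume {z : ℂ | r < ‖z‖ ∧ ‖z‖ < R} = 0 := by
    refine measure_mono_null (fun z hz => ?_) (ae_iff.1 h)
    have hz0 : 0 < ‖z‖ := hr.trans hz.1
    change ¬ofReal ((‖z‖ ^ 2)⁻¹) * (Icc r R).indicator 1 (‖z‖ * 1) = 0
    rw [mul_one, indicator_of_mem (Set.mem_Icc.2 ⟨hz.1.le, hz.2.le⟩)]
    simp only [Pi.one_apply, mul_one, ENNReal.ofReal_eq_zero, not_le]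
    positivity
  have h1 := (hU.measure_eq_zero_iff (volume : Measure ℂ)).1 h0
  have : (((r + R) / 2 : ℝ) : ℂ) ∈ {z : ℂ | r < ‖z‖ ∧ ‖z‖ < R} := by
    change r < ‖(((r + R) / 2 : ℝ) : ℂ)‖ ∧ ‖(((r + R) / 2 : ℝ) : ℂ)‖ < R
    rw [norm_real, norm_of_nonneg (by linarith)]
    constructor <;> linarith
  rw [h1] at this
  exact this

/-! ### Integrability of the kernel -/

theorem ae_cc_ne (hn : ∀ i, 1 ≤ n i) (hik : i ≠ k) (a : ℂ) : ∀ᵐ v : Cfg n, cc v i ≠ a * cc v k := by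
  have := ae_linear_ne_zero (n := n) (LinearMap.proj (⟨i, ⟨0, hn i⟩⟩ : Coord n) -
    a • LinearMap.proj (⟨k, ⟨0, hn k⟩⟩ : Coord n)) (by
      intro h
      have := LinearMap.congr_fun h (Pi.single ⟨i, ⟨0, hn i⟩⟩ (1 : ℂ))
      have hne : (⟨k, ⟨0, hn k⟩⟩ : Coord n) ≠ ⟨i, ⟨0, hn i⟩⟩ := fun h => hik (congrArg Sigma.fst h).symm
      simp [Pi.single_eq_of_ne hne] at this)
  filter_upwards [this] with v hv h
  rw [cc_eq hn, cc_eq hn] at h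
  apply hv
  simp [h]

theorem quot_smul (t : ι → ℂ) (x z : ℂ) (v : Cfg n) : quot t x (z⁻¹ • v) = z • quot t x v := by
  funext p
  have h : (C z⁻¹ * block v p.1)⁻¹ = C z * (block v p.1)⁻¹ := by
    rw [PowerSeries.mul_inv_rev, C_inv, inv_inv, mul_comm]
  rw [quot, block_smul, h, mul_left_comm, coeff_C_mul_eq]
  rfl

theorem omega_smul (hz : z ≠ 0) (a y w : ℂ) :
    omega a (z⁻¹ * y) (z⁻¹ * w) = ‖z‖ ^ 2 * omega a y w := by
  have h1 : z⁻¹ * y - a * (z⁻¹ * w) = z⁻¹ * (y - a * w) := by ring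
  have hz' : ‖z‖ ≠ 0 := norm_ne_zero_iff.2 hz
  rw [omega, omega, h1, ← mul_sub, norm_mul, norm_mul, norm_mul, norm_mul, norm_inv]
  simp only [mul_inv, inv_inv]
  field_simp

/-- Homogeneity and translation invariance of the modulus of a half-density. -/
structure IsHalfDensityNorm (F : Cfg n → ENNReal) : Prop where
  measurable : Measurable F
  shift_eq : ∀ b u, F (shift b u) = F u
  smul_sq : ∀ (z : ℂ) (u : Cfg n), z ≠ 0 → ofReal (‖z‖ ^ (2 * ∑ i, n i)) * F (z • u) ^ 2 =
    ofReal (‖z‖ ^ 2) * F u ^ 2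

theorem measurable_omega (a : ℂ) : Measurable fun y : ℂ × ℂ => omega a y.1 y.2 := by
  unfold omega; fun_prop

/-- The weight `ω(v_i, v_k)`, restricted to `a v_k / v_i ∈ Q`. -/
def pairWeight (a : ℂ) (Q : Set ℂ) (i k : ι) (v : Cfg n) : ENNReal :=
  ofReal (omega a (cc v i) (cc v k)) * Q.indicator 1 (a * cc v k / cc v i)

theorem measurable_pairWeight (hn : ∀ i, 1 ≤ n i) (a : ℂ) {Q : Set ℂ} (hQ : MeasurableSet Q)
    (i k : ι) : Measurable (pairWeight (n := n) a Q i k) := by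
  have h1 := measurable_cc hn i
  have h2 := measurable_cc hn k
  exact (ENNReal.measurable_ofReal.comp ((measurable_omega a).comp (h1.prodMk h2))).mul
    ((measurable_indicator_one hQ).comp ((h2.const_mul a).div h1))

/-- H is multiplied by the constant mass of the window r ≤ |z| S(v) ≤ R in z. Exchanging integrals
allows `key` to be applied for each z, and the z-integral is then undone with S'. Only an inequality
results because the mass is zero where S' vanishes. -/
theorem lintegral_le_of_dilation (hr : 0 < r) (hrR : r < R) {H G : Cfg n → ENNReal}
    (hH : Measurable H) (hG : Measurable G) {S S' : Cfg n → ℝ} (hS : Measurable S)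
    (hS' : Measurable S') (hpos : ∀ᵐ v, 0 < S v) (hpos' : ∀ v, 0 ≤ S' v)
    (key : ∀ z : ℂ, z ≠ 0 → ∫⁻ v, H v * (Icc r R).indicator 1 (‖z‖ * S v) = ∫⁻ v, G v * (Icc r R).indicator 1 (‖z‖ * S' v)) :
    ∫⁻ v, H v ≤ ∫⁻ v, G v := by
  have hI := measurable_indicator_one (measurableSet_Icc (a := r) (b := R))
  have hz0 : ∀ᵐ z : ℂ, z ≠ 0 := by rw [ae_iff]; simp
  have hc0 : dilMass r R 1 ≠ 0 := dilMass_one_ne_zero hr hrR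
  have hct : dilMass r R 1 ≠ ⊤ := (dilMass_one_lt_top hr R).ne
  have hswap : ∀ {H : Cfg n → ENNReal} {S : Cfg n → ℝ}, Measurable H → Measurable S →
      ∫⁻ v, H v * dilMass r R (S v) = ∫⁻ z : ℂ, ofReal ((‖z‖ ^ 2)⁻¹) *
        ∫⁻ v, H v * (Icc r R).indicator 1 (‖z‖ * S v) := by
    intro H S hH hS
    calc _ = ∫⁻ v, ∫⁻ z : ℂ, ofReal ((‖z‖ ^ 2)⁻¹) *
          (H v * (Icc r R).indicator 1 (‖z‖ * S v)) := by
          refine lintegral_congr fun v => ?_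
          rw [dilMass, ← lintegral_const_mul _ (by fun_prop)]
          exact lintegral_congr fun z => by ring
      _ = ∫⁻ z : ℂ, ∫⁻ v, ofReal ((‖z‖ ^ 2)⁻¹) * (H v * (Icc r R).indicator 1 (‖z‖ * S v)) := by
          refine lintegral_lintegral_swap (Measurable.aemeasurable ?_)
          simp only [uncurry_def]
          fun_prop
      _ = _ := lintegral_congr fun z => lintegral_const_mul' _ _ ofReal_ne_top
  refine (ENNReal.mul_le_mul_iff_right hc0 hct).1 ?_
  calc dilMass r R 1 * ∫⁻ v, H v = ∫⁻ v, H v * dilMass r R (S v) := by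
        rw [← lintegral_const_mul' _ _ hct]
        refine lintegral_congr_ae ?_
        filter_upwards [hpos] with v hv
        rw [dilMass_eq r R hv, mul_comm]
    _ = ∫⁻ v, G v * dilMass r R (S' v) := by
        rw [hswap hH hS, hswap hG hS']
        refine lintegral_congr_ae ?_
        filter_upwards [hz0] with z hz
        rw [key z hz]
    _ ≤ ∫⁻ v, dilMass r R 1 * G v := by
        refine lintegral_mono fun v => ?_
        rw [mul_comm (dilMass r R 1)]
        refine mul_le_mul_right ?_ _
        rcases (hpos' v).eq_or_lt with h | h
        · rw [← h, dilMass_zero hr]; exact zero_le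
        · rw [dilMass_eq r R h]
    _ = _ := lintegral_const_mul' _ _ hct

/-- The measure F² ω dv is invariant under dilations, while v and (t + ε - x)/v scale inversely.
Dilating by z therefore exchanges the two windows. -/
theorem lintegral_dilation_key (t : ι → ℂ) (x a : ℂ) (Q : Set ℂ) (i k : ι) (r R : ℝ)
    {F : Cfg n → ENNReal} (hF : IsHalfDensityNorm F) (hz : z ≠ 0) :
    ∫⁻ v, F v ^ 2 * pairWeight a Q i k v * (Icc r R).indicator 1 (spread k (quot t x v)) *
        (Icc r R).indicator 1 (‖z‖ * spread k v) =
      ∫⁻ v, F v ^ 2 * pairWeight a Q i k v * (Icc r R).indicator 1 (spread k v) *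
        (Icc r R).indicator 1 (‖z‖ * spread k (quot t x v)) := by
  have hzn : 0 < ‖z‖ := norm_pos_iff.2 hz
  have h1 := lintegral_smul (n := n) z hz fun v =>
    F (z⁻¹ • v) ^ 2 * pairWeight a Q i k (z⁻¹ • v) *
      (Icc r R).indicator 1 (spread k (quot t x (z⁻¹ • v))) * (Icc r R).indicator 1 (spread k v)
  simp only [inv_smul_smul₀ hz, spread_smul] at h1
  rw [h1, ← lintegral_const_mul' _ _ ofReal_ne_top]
  refine lintegral_congr fun v => ?_
  have e1 := hF.smul_sq z⁻¹ v (inv_ne_zero hz)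
  rw [norm_inv, inv_pow, inv_pow] at e1
  have e2 : pairWeight a Q i k (z⁻¹ • v) = ofReal (‖z‖ ^ 2) * pairWeight a Q i k v := by
    rw [pairWeight, pairWeight, cc_smul, cc_smul, omega_smul hz, ofReal_mul (by positivity),
      mul_assoc, mul_left_comm a, mul_div_mul_left _ _ (inv_ne_zero hz)]
  rw [e2, quot_smul t x z, spread_smul]
  have e3 : ofReal ((‖z‖ ^ 2)⁻¹) * ofReal (‖z‖ ^ 2) = 1 := by
    rw [← ofReal_mul (by positivity), inv_mul_cancel₀ (by positivity), ENNReal.ofReal_one]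
  generalize (Icc r R).indicator (1 : ℝ → ENNReal) (‖z‖ * spread k (quot t x v)) = X
  generalize (Icc r R).indicator (1 : ℝ → ENNReal) (spread k v) = Y
  calc _ = (ofReal ((‖z‖ ^ (2 * ∑ i, n i))⁻¹) * F (z⁻¹ • v) ^ 2) *
        (ofReal (‖z‖ ^ 2) * pairWeight a Q i k v * X * Y) := by ring
    _ = (ofReal ((‖z‖ ^ 2)⁻¹) * ofReal (‖z‖ ^ 2)) * (F v ^ 2 *
        pairWeight a Q i k v * X * Y) := by rw [e1]; ring
    _ = _ := by rw [e3]; ring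

/-- The window on (t + ε - x)/v is traded for the same window on v, where local square integrability
of F can be used. -/
theorem lintegral_dilation (hn : ∀ i, 1 ≤ n i) (t : ι → ℂ) (x a : ℂ) {Q : Set ℂ}
    (hQ : MeasurableSet Q) (hik : i ≠ k) (hr : 0 < r) (hrR : r < R)
    {F : Cfg n → ENNReal} (hF : IsHalfDensityNorm F) :
    ∫⁻ v, F v ^ 2 * pairWeight a Q i k v * (Icc r R).indicator 1 (spread k (quot t x v)) ≤
      ∫⁻ v, F v ^ 2 * pairWeight a Q i k v * (Icc r R).indicator 1 (spread k v) := by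
  have hI := measurable_indicator_one (measurableSet_Icc (a := r) (b := R))
  have hP := measurable_pairWeight (n := n) hn a hQ i k
  have hS := (continuous_spread hn k).measurable
  have hSq : Measurable fun v : Cfg n => spread k (quot t x v) :=
    hS.comp (measurable_quot_right t x)
  have hFm := hF.measurable
  have hpos : ∀ᵐ v : Cfg n, 0 < spread k v := by
    filter_upwards [ae_cc_ne hn hik 1] with v hv
    refine lt_of_le_of_ne (spread_nonneg k v) fun h => hv ?_
    obtain ⟨b, rfl⟩ := (spread_eq_zero_iff hn k v).1 h.symm
    have : ∀ i, cc (0 : Cfg n) i = 0 := fun i => by rw [cc_eq hn]; rfl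
    rw [cc_shift hn, cc_shift hn, this, this, one_mul]
  have hI1 : Measurable fun v : Cfg n =>
      (Icc r R).indicator (1 : ℝ → ENNReal) (spread k (quot t x v)) := hI.comp hSq
  have hI2 : Measurable fun v : Cfg n =>
      (Icc r R).indicator (1 : ℝ → ENNReal) (spread k v) := hI.comp hS
  have hFP : Measurable fun v : Cfg n => F v ^ 2 * pairWeight a Q i k v := (hFm.pow_const 2).mul hP
  refine lintegral_le_of_dilation (S := fun v => spread k v) (S' := fun v => spread k (quot t x v))
    hr hrR (hFP.mul hI1) (hFP.mul hI2) hS hSq hpos (fun v => spread_nonneg k _) ?_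
  intro z hz
  exact lintegral_dilation_key t x a Q i k r R hF hz

theorem pairWeight_shift (hn : ∀ i, 1 ≤ n i) (a : ℂ) (Q : Set ℂ) (i k : ι) (b : ℂ) (v : Cfg n) :
    pairWeight a Q i k (shift b v) = ofReal (omega a (b + cc v i) (b + cc v k)) *
      Q.indicator 1 (a * (b + cc v k) / (b + cc v i)) := by
  rw [pairWeight, cc_shift hn, cc_shift hn, add_comm b, add_comm b]

theorem indicator_annulus (k : ι) (r R : ℝ) (v : Cfg n) :
    (annulus n k r R).indicator (1 : Cfg n → ENNReal) v = (Icc r R).indicator 1 (spread k v) *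
        (closedBall (0 : ℂ) R).indicator 1 (cc v k) := by
  by_cases h1 : r ≤ spread k v ∧ spread k v ≤ R <;> by_cases h2 : ‖cc v k‖ ≤ R <;>
    simp [Set.indicator, annulus, h1, h2]

/-- A constant is written as the integral over b of the indicator of |v_k - b| ≤ R, and v is then
translated by b. The invariant F² does not move, the pair weight does, and its translation average
is bounded by `theta`. The two cutoffs together form a compact annulus. -/
theorem lintegral_translation (hn : ∀ i, 1 ≤ n i) {a : ℂ} (ha : a ≠ 0) {Q : Set ℂ}
    (hQ : MeasurableSet Q) (hik : i ≠ k) (r R : ℝ)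
    {F : Cfg n → ENNReal} (hF : IsHalfDensityNorm F) : volume (closedBall (0 : ℂ) R) *
      ∫⁻ v, F v ^ 2 * pairWeight a Q i k v * (Icc r R).indicator 1 (spread k v) ≤
      theta Q a * ∫⁻ v in annulus n k r R, F v ^ 2 := by
  have hI := measurable_indicator_one (measurableSet_Icc (a := r) (b := R))
  have hB := measurable_indicator_one
    (isClosed_closedBall (x := (0 : ℂ)) (ε := R)).measurableSet
  have hP := measurable_pairWeight (n := n) hn a hQ i k
  have hS := (continuous_spread hn k).measurable
  have hc := measurable_cc hn k
  have hFm := hF.measurable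
  have hsh : Measurable fun y : ℂ × Cfg n => shift y.1 y.2 := continuous_shift_uncurry.measurable
  have hvol : ∀ y : ℂ, ∫⁻ b : ℂ, (closedBall (0 : ℂ) R).indicator (1 : ℂ → ENNReal) (y - b) =
      volume (closedBall (0 : ℂ) R) := by
    intro y
    rw [lintegral_sub_left_eq_self (fun b => (closedBall (0 : ℂ) R).indicator 1 b) y,
      lintegral_indicator_one isClosed_closedBall.measurableSet]
  calc volume (closedBall (0 : ℂ) R) *
      ∫⁻ v, F v ^ 2 * pairWeight a Q i k v * (Icc r R).indicator 1 (spread k v)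
      = ∫⁻ v, ∫⁻ b : ℂ, F v ^ 2 * pairWeight a Q i k v * (Icc r R).indicator 1 (spread k v) *
          (closedBall (0 : ℂ) R).indicator 1 (cc v k - b) := by
        rw [← lintegral_const_mul' _ _ measure_closedBall_lt_top.ne]
        refine lintegral_congr fun v => ?_
        rw [lintegral_const_mul _ (by fun_prop), hvol, mul_comm]
    _ = ∫⁻ b : ℂ, ∫⁻ v, F v ^ 2 * pairWeight a Q i k v * (Icc r R).indicator 1 (spread k v) *
          (closedBall (0 : ℂ) R).indicator 1 (cc v k - b) := by
        refine lintegral_lintegral_swap (Measurable.aemeasurable ?_)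
        simp only [uncurry_def]
        fun_prop
    _ = ∫⁻ b : ℂ, ∫⁻ w : Cfg n, F w ^ 2 * (annulus n k r R).indicator 1 w *
          pairWeight a Q i k (shift b w) := by
        refine lintegral_congr fun b => ?_
        rw [← lintegral_shift b]
        refine lintegral_congr fun w => ?_
        rw [hF.shift_eq, spread_shift hn, cc_shift hn, add_sub_cancel_right, indicator_annulus]
        ring
    _ = ∫⁻ w : Cfg n, ∫⁻ b : ℂ, F w ^ 2 * (annulus n k r R).indicator 1 w *
          pairWeight a Q i k (shift b w) := by
        have hA := measurable_indicator_one (isClosed_annulus hn k r R).measurableSet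
        have hPs : Measurable fun y : ℂ × Cfg n => pairWeight a Q i k (shift y.1 y.2) := hP.comp hsh
        refine lintegral_lintegral_swap (Measurable.aemeasurable ?_)
        simp only [uncurry_def]
        fun_prop
    _ ≤ ∫⁻ w : Cfg n, theta Q a * (F w ^ 2 * (annulus n k r R).indicator 1 w) := by
        refine lintegral_mono_ae ?_
        filter_upwards [ae_cc_ne hn hik 1] with w hw
        have hPs : Measurable fun b : ℂ => pairWeight a Q i k (shift b w) :=
          hP.comp (continuous_shift w).measurable
        rw [lintegral_const_mul _ hPs, mul_comm]
        refine mul_le_mul_left ?_ _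
        simp only [pairWeight_shift hn]
        exact lintegral_omega_le' ha Q (by simpa using hw)
    _ = _ := by
        have hA := measurable_indicator_one (isClosed_annulus hn k r R).measurableSet
        rw [lintegral_const_mul _ (by fun_prop),
          ← lintegral_indicator (isClosed_annulus hn k r R).measurableSet]
        congr 1
        refine lintegral_congr fun w => ?_
        by_cases hw : w ∈ annulus n k r R <;> simp [hw]

theorem lintegral_indicator_annulus_mob (hn : ∀ i, 1 ≤ n i) (t : ι → ℂ) (x : ℂ) (k : ι) (r R : ℝ)
    (v : Cfg n) : ∫⁻ s : ℂ, (annulus n k r R).indicator (1 : Cfg n → ENNReal) (mob t x s v) =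
      (Icc r R).indicator 1 (spread k (quot t x v)) * volume (closedBall (0 : ℂ) R) := by
  have e : ∀ s, (annulus n k r R).indicator (1 : Cfg n → ENNReal) (mob t x s v) =
      (Icc r R).indicator 1 (spread k (quot t x v)) *
        (closedBall (0 : ℂ) R).indicator 1 (s - cc (quot t x v) k) := by
    intro s
    rw [indicator_annulus, mob_eq, spread_shift hn, spread_neg, cc_shift hn, cc_neg, neg_add_eq_sub]
  have hB := measurable_indicator_one
    (isClosed_closedBall (x := (0 : ℂ)) (ε := R)).measurableSet
  simp only [e]
  rw [lintegral_const_mul _ (by fun_prop),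
    lintegral_sub_right_eq_self (fun b => (closedBall (0 : ℂ) R).indicator 1 b),
    lintegral_indicator_one isClosed_closedBall.measurableSet]

theorem measurable_mob_right (t : ι → ℂ) (x : ℂ) :
    Measurable fun y : ℂ × Cfg n => mob t x y.1 y.2 :=
  (measurable_mob t).comp (measurable_prodMk_left (x := x))

/-- The weight `∏ |v_i|^{-2 n_i}`. -/
def normWeight (v : Cfg n) : ℝ := (∏ i, ‖cc v i‖ ^ (2 * n i))⁻¹

theorem normWeight_nonneg (v : Cfg n) : 0 ≤ normWeight v := by unfold normWeight; positivity

/-- For fixed v the tuple `mob t x s v` is a translate by s of -(t + ε - x)/v. The s-integral thus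
leaves only the window on its spread and the area of a disc, and dilation and translation averaging
finish the bound. -/
theorem lintegral_kernel_left (hn : ∀ i, 1 ≤ n i) (t : ι → ℂ) (x : ℂ) {a : ℂ} (ha : a ≠ 0)
    {Q : Set ℂ} (hQ : MeasurableSet Q) (hik : i ≠ k) (hr : 0 < r)
    (hrR : r < R) {F : Cfg n → ENNReal} (hF : IsHalfDensityNorm F) :
    ∫⁻ s : ℂ, ∫⁻ v, F v ^ 2 * pairWeight a Q i k v * (annulus n k r R).indicator 1 (mob t x s v) ≤
      theta Q a * ∫⁻ v in annulus n k r R, F v ^ 2 := by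
  have hA := measurable_indicator_one (isClosed_annulus hn k r R).measurableSet
  have hP := measurable_pairWeight (n := n) hn a hQ i k
  have hFm := hF.measurable
  have hm := measurable_mob_right (n := n) t x
  calc _ = ∫⁻ v, ∫⁻ s : ℂ, F v ^ 2 * pairWeight a Q i k v *
        (annulus n k r R).indicator 1 (mob t x s v) := by
        refine lintegral_lintegral_swap (Measurable.aemeasurable ?_)
        have := hA.comp hm
        simp only [uncurry_def]
        exact (((hFm.comp measurable_snd).pow_const 2).mul (hP.comp measurable_snd)).mul this
    _ = ∫⁻ v, volume (closedBall (0 : ℂ) R) * (F v ^ 2 * pairWeight a Q i k v *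
          (Icc r R).indicator 1 (spread k (quot t x v))) := by
        refine lintegral_congr fun v => ?_
        have hs : Measurable fun s : ℂ =>
            (annulus n k r R).indicator (1 : Cfg n → ENNReal) (mob t x s v) :=
          hA.comp (hm.comp (measurable_id.prodMk measurable_const))
        rw [lintegral_const_mul _ hs, lintegral_indicator_annulus_mob hn]
        ring
    _ = volume (closedBall (0 : ℂ) R) * ∫⁻ v, F v ^ 2 * pairWeight a Q i k v *
          (Icc r R).indicator 1 (spread k (quot t x v)) :=
        lintegral_const_mul' _ _ measure_closedBall_lt_top.ne
    _ ≤ volume (closedBall (0 : ℂ) R) * ∫⁻ v, F v ^ 2 * pairWeight a Q i k v *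
          (Icc r R).indicator 1 (spread k v) :=
        mul_le_mul_right (lintegral_dilation hn t x a hQ hik hr hrR hF) _
    _ ≤ _ := lintegral_translation hn ha hQ hik r R hF

theorem shift_neg_shift_neg (s : ℂ) (u : Cfg n) : shift s (-shift s (-u)) = u := by
  rw [neg_shift, shift_shift, neg_neg, add_neg_cancel, shift_zero]

/-- `Q.indicator 1 (y_i / y_k)` times `ω(y_i, y_k)`. -/
def pairWeight' (a : ℂ) (Q : Set ℂ) (i k : ι) (y : Cfg n) : ENNReal :=
  ofReal (omega a (cc y i) (cc y k)) * Q.indicator 1 (cc y i / cc y k)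

theorem measurable_pairWeight' (hn : ∀ i, 1 ≤ n i) (a : ℂ) {Q : Set ℂ} (hQ : MeasurableSet Q)
    (i k : ι) : Measurable (pairWeight' (n := n) a Q i k) := by
  have h1 := measurable_cc hn i
  have h2 := measurable_cc hn k
  exact (ENNReal.measurable_ofReal.comp ((measurable_omega a).comp (h1.prodMk h2))).mul
    ((measurable_indicator_one hQ).comp (h1.div h2))

theorem lintegral_pairWeight'_le (hn : ∀ i, 1 ≤ n i) (a : ℂ) {Q : Set ℂ} (hQ : MeasurableSet Q)
    (hik : i ≠ k) (r R : ℝ) :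
    ∫⁻ s : ℂ, ∫⁻ y, pairWeight' a Q i k y * (annulus n k r R).indicator 1 (shift s (-y)) ≤
      theta Q a * volume (annulus n k r R) := by
  have hA := measurable_indicator_one (isClosed_annulus hn k r R).measurableSet
  have hP := measurable_pairWeight' (n := n) hn a hQ i k
  have hsn : Measurable fun y : ℂ × Cfg n => shift y.1 (-y.2) :=
    continuous_shift_uncurry.measurable.comp (measurable_fst.prodMk measurable_snd.neg)
  calc _ = ∫⁻ s : ℂ, ∫⁻ u, pairWeight' a Q i k (shift s (-u)) * (annulus n k r R).indicator 1 u := by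
        refine lintegral_congr fun s => ?_
        rw [← lintegral_shift_neg s]
        simp only [shift_neg_shift_neg]
    _ = ∫⁻ u, ∫⁻ s : ℂ, pairWeight' a Q i k (shift s (-u)) * (annulus n k r R).indicator 1 u := by
        refine lintegral_lintegral_swap (Measurable.aemeasurable ?_)
        simp only [uncurry_def]
        exact (hP.comp hsn).mul (hA.comp measurable_snd)
    _ ≤ ∫⁻ u, theta Q a * (annulus n k r R).indicator 1 u := by
        refine lintegral_mono_ae ?_
        filter_upwards [ae_cc_ne hn hik 1] with u hu
        have hs : Measurable fun s : ℂ => pairWeight' a Q i k (shift s (-u)) :=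
          hP.comp (hsn.comp (measurable_id.prodMk measurable_const))
        rw [lintegral_mul_const _ hs]
        refine mul_le_mul_left ?_ _
        have h := lintegral_omega_le a Q (y := -cc u i) (z := -cc u k)
          (by simpa using hu)
        simpa only [pairWeight', cc_shift hn, cc_neg, add_comm] using h
    _ = _ := by
        rw [lintegral_const_mul _ hA, lintegral_indicator_one (isClosed_annulus hn k r R).measurableSet]

/-- Passing to (t + ε - x)/v inverts the weight up to a constant. This duality is what allows one
weight to serve both halves of the estimate. -/
theorem omega_quot {a y τ τ' : ℂ} (hy : y ≠ 0) (hz : z ≠ 0) (hτ : τ ≠ 0) (hτ' : τ' ≠ 0)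
    (ha : a = τ / τ') (hyz : y ≠ z) : (omega a y z)⁻¹ = ‖τ‖ ^ 2 * omega a (τ / y) (τ' / z) := by
  have e1 : τ / y - τ' / z = -(τ' * (y - a * z) / (y * z)) := by rw [ha]; field_simp; ring
  have e2 : τ / y - a * (τ' / z) = -(τ * (y - z) / (y * z)) := by rw [ha]; field_simp; ring
  rw [omega, omega, e1, e2]
  simp only [div_eq_mul_inv, norm_neg, norm_mul, norm_inv, mul_inv, inv_inv]
  have h1 : ‖y‖ ≠ 0 := norm_ne_zero_iff.2 hy
  have h2 : ‖z‖ ≠ 0 := norm_ne_zero_iff.2 hz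
  have h3 : ‖τ‖ ≠ 0 := norm_ne_zero_iff.2 hτ
  have h4 : ‖τ'‖ ≠ 0 := norm_ne_zero_iff.2 hτ'
  have h5 : ‖y - z‖ ≠ 0 := norm_ne_zero_iff.2 (sub_ne_zero.2 hyz)
  field_simp

/-- In the variable y = (t + ε - x)/v the squared kernel weight is absorbed by the Jacobian and 1/ω
becomes a multiple of ω(y). What remains is a translation average over the annulus. -/
theorem lintegral_kernel_right (hn : ∀ i, 1 ≤ n i) (t : ι → ℂ) (hx : ∀ i, x ≠ t i) {a : ℂ}
    (ha : a = (t i - x) / (t k - x)) {Q : Set ℂ} (hQ : MeasurableSet Q) (hik : i ≠ k) (r R : ℝ) :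
    ∫⁻ s : ℂ, ∫⁻ v, ofReal (normWeight v ^ 2 * (omega a (cc v i) (cc v k))⁻¹) *
      Q.indicator 1 (a * cc v k / cc v i) * (annulus n k r R).indicator 1 (mob t x s v) ≤
      ofReal ((∏ j, ‖t j - x‖ ^ (2 * n j))⁻¹ * ‖t i - x‖ ^ 2) *
        (theta Q a * volume (annulus n k r R)) := by
  have hτ : ∀ i, t i - x ≠ 0 := fun i => sub_ne_zero.2 (hx i).symm
  set C : ℝ := (∏ j, ‖t j - x‖ ^ (2 * n j))⁻¹ * ‖t i - x‖ ^ 2 with hC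
  have hPpos : 0 < ∏ j, ‖t j - x‖ ^ (2 * n j) :=
    prod_pos fun j _ => pow_pos (norm_pos_iff.2 (hτ j)) _
  refine le_trans (le_of_eq ?_) (mul_le_mul_right (lintegral_pairWeight'_le hn a hQ hik r R) _)
  rw [← lintegral_const_mul' _ _ ofReal_ne_top]
  refine lintegral_congr fun s => ?_
  rw [← lintegral_const_mul' _ _ ofReal_ne_top, ← lintegral_quot hn t hx
    fun y => ofReal C * (pairWeight' a Q i k y * (annulus n k r R).indicator 1 (shift s (-y)))]
  refine lintegral_congr_ae ?_
  filter_upwards [ae_mem_unitSet hn, ae_cc_ne hn hik 1] with v hv hv2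
  rw [one_mul] at hv2
  rw [omega_quot (hv i) (hv k) (hτ i) (hτ k) ha hv2, pairWeight', cc_quot hn, cc_quot hn, mob_eq]
  have e1 : a * cc v k / cc v i = (t i - x) / cc v i / ((t k - x) / cc v k) := by
    have := hτ k
    have := hv i
    have := hv k
    rw [ha]; field_simp
  rw [e1]
  have e2 : normWeight v ^ 2 * (‖t i - x‖ ^ 2 * omega a ((t i - x) / cc v i) ((t k - x) / cc v k)) =
      jac t x v * C * omega a ((t i - x) / cc v i) ((t k - x) / cc v k) := by
    have e3 : normWeight v ^ 2 = (∏ i, ‖cc v i‖ ^ (4 * n i))⁻¹ := by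
      rw [normWeight, inv_pow, ← prod_pow]
      congr 1
      exact prod_congr rfl fun j _ => by rw [← pow_mul]; congr 1; ring
    rw [e3, jac, hC]
    field_simp
  have hj : 0 ≤ jac t x v := by unfold jac; positivity
  have hC0 : 0 ≤ C := by rw [hC]; positivity
  rw [e2, ofReal_mul (mul_nonneg hj hC0), ofReal_mul hj]
  ring

theorem mul_le_sq_add_sq {f p κ : ℝ} (hf : 0 ≤ f) (hp : 0 ≤ p) (hκ : 0 < κ) :
    f * p ≤ κ * f ^ 2 + κ⁻¹ * p ^ 2 := by
  have h : κ * f ^ 2 + κ⁻¹ * p ^ 2 = κ * (f - κ⁻¹ * p) ^ 2 + 2 * (f * p) := by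
    field_simp; ring
  have := mul_nonneg hκ.le (sq_nonneg (f - κ⁻¹ * p))
  nlinarith [mul_nonneg hf hp]

/-- The scale of the Hecke kernel. -/
def kerScale (n : ι → ℕ) (t : ι → ℂ) (i : ι) (x : ℂ) : ℝ := (∏ j, ‖t j - x‖ ^ n j)⁻¹ * ‖t i - x‖

/-- A Schur test in pointwise form: f p ≤ λω f² + (λω)⁻¹ p², where p is the kernel weight. The scale
λ = `kerScale` makes the constants of the two halves coincide, and its decay as x → ∞ is used later.
-/
theorem lintegral_kernel_le (hn : ∀ i, 1 ≤ n i) (hx : ∀ i, x ≠ t i) {a : ℂ}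
    (ha : a = (t i - x) / (t k - x)) {Q : Set ℂ} (hQ : MeasurableSet Q) (hik : i ≠ k) (hr : 0 < r)
    (hrR : r < R) {F : Cfg n → ENNReal} (hF : IsHalfDensityNorm F) (hFt : ∀ v, F v ≠ ⊤) :
    ∫⁻ s : ℂ, ∫⁻ v, F v * ofReal (normWeight v) *
      Q.indicator 1 (a * cc v k / cc v i) * (annulus n k r R).indicator 1 (mob t x s v) ≤
      ofReal (kerScale n t i x) * (theta Q a *
        ((∫⁻ v in annulus n k r R, F v ^ 2) + volume (annulus n k r R))) := by
  have hτ : ∀ i, t i - x ≠ 0 := fun i => sub_ne_zero.2 (hx i).symm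
  have ha0 : a ≠ 0 := ha ▸ div_ne_zero (hτ i) (hτ k)
  set lam : ℝ := kerScale n t i x with hlam
  have hPpos : 0 < ∏ j, ‖t j - x‖ ^ n j := prod_pos fun j _ => pow_pos (norm_pos_iff.2 (hτ j)) _
  have hpos : 0 < lam := mul_pos (inv_pos.2 hPpos) (norm_pos_iff.2 (hτ i))
  have hA := measurable_indicator_one (isClosed_annulus hn k r R).measurableSet
  have hm := measurable_mob_right (n := n) t x
  have h1 := lintegral_kernel_left hn t x ha0 hQ hik hr hrR hF
  have h2 := lintegral_kernel_right hn t hx ha hQ hik r R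
  have hmeas : Measurable fun y : ℂ × Cfg n => F y.2 ^ 2 * pairWeight a Q i k y.2 *
      (annulus n k r R).indicator 1 (mob t x y.1 y.2) :=
    (((hF.measurable.comp measurable_snd).pow_const 2).mul
      ((measurable_pairWeight hn a hQ i k).comp measurable_snd)).mul (hA.comp hm)
  calc _ ≤ ∫⁻ s : ℂ, ∫⁻ v, (ofReal lam * (F v ^ 2 * pairWeight a Q i k v *
          (annulus n k r R).indicator 1 (mob t x s v)) + ofReal lam⁻¹ *
          (ofReal (normWeight v ^ 2 * (omega a (cc v i) (cc v k))⁻¹) *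
      Q.indicator 1 (a * cc v k / cc v i) * (annulus n k r R).indicator 1 (mob t x s v))) := by
        refine lintegral_mono fun s => lintegral_mono_ae ?_
        filter_upwards [ae_mem_unitSet hn, ae_cc_ne hn hik 1, ae_cc_ne hn hik a] with v hv h3 h4
        rw [one_mul] at h3
        have hω : 0 < omega a (cc v i) (cc v k) := by
          have := norm_pos_iff.2 (hv i)
          have := norm_pos_iff.2 (hv k)
          have := norm_pos_iff.2 (sub_ne_zero.2 h3)
          have := norm_pos_iff.2 (sub_ne_zero.2 h4)
          unfold omega; positivity
        have hκ := mul_pos hpos hω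
        obtain ⟨f, hf0, hf⟩ : ∃ f : ℝ, 0 ≤ f ∧ F v = ofReal f :=
          ⟨(F v).toReal, ENNReal.toReal_nonneg, (ENNReal.ofReal_toReal (hFt v)).symm⟩
        have h5 := mul_le_sq_add_sq hf0 (normWeight_nonneg v) hκ
        have h6 : F v * ofReal (normWeight v) ≤ ofReal lam *
            (F v ^ 2 * ofReal (omega a (cc v i) (cc v k))) + ofReal lam⁻¹ *
            ofReal (normWeight v ^ 2 * (omega a (cc v i) (cc v k))⁻¹) := by
          rw [hf, ← ofReal_pow hf0, ← ofReal_mul hf0,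
            ← ofReal_mul (by positivity), ← ofReal_mul hpos.le,
            ← ofReal_mul (by positivity), ← ofReal_add (by positivity)
            (by have := normWeight_nonneg v; positivity)]
          refine ofReal_le_ofReal (h5.trans (le_of_eq ?_))
          rw [mul_inv]; ring
        calc _ ≤ (ofReal lam *
            (F v ^ 2 * ofReal (omega a (cc v i) (cc v k))) + ofReal lam⁻¹ *
            ofReal (normWeight v ^ 2 * (omega a (cc v i) (cc v k))⁻¹)) *
            Q.indicator 1 (a * cc v k / cc v i) * (annulus n k r R).indicator 1 (mob t x s v) := by
              gcongr
          _ = _ := by rw [pairWeight]; ring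
    _ = ofReal lam * (∫⁻ s : ℂ, ∫⁻ v, F v ^ 2 * pairWeight a Q i k v *
          (annulus n k r R).indicator 1 (mob t x s v)) + ofReal lam⁻¹ *
          ∫⁻ s : ℂ, ∫⁻ v, (ofReal (normWeight v ^ 2 * (omega a (cc v i) (cc v k))⁻¹) *
      Q.indicator 1 (a * cc v k / cc v i) * (annulus n k r R).indicator 1 (mob t x s v)) := by
        rw [← lintegral_const_mul' _ _ ofReal_ne_top, ← lintegral_const_mul' _ _ ofReal_ne_top,
          ← lintegral_add_left (hmeas.lintegral_prod_right'.const_mul _)]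
        refine lintegral_congr fun s => ?_
        rw [← lintegral_const_mul' _ _ ofReal_ne_top, ← lintegral_const_mul' _ _ ofReal_ne_top,
          ← lintegral_add_left]
        exact (hmeas.comp (measurable_const.prodMk measurable_id)).const_mul _
    _ ≤ ofReal lam * (theta Q a * ∫⁻ v in annulus n k r R, F v ^ 2) + ofReal lam⁻¹ *
          (ofReal ((∏ j, ‖t j - x‖ ^ (2 * n j))⁻¹ * ‖t i - x‖ ^ 2) *
        (theta Q a * volume (annulus n k r R))) := by gcongr
    _ = _ := by
        have e : ofReal lam⁻¹ * ofReal ((∏ j, ‖t j - x‖ ^ (2 * n j))⁻¹ * ‖t i - x‖ ^ 2) =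
            ofReal lam := by
          rw [← ofReal_mul (by positivity)]
          congr 1
          have h7 : (∏ j, ‖t j - x‖ ^ (2 * n j))⁻¹ * ‖t i - x‖ ^ 2 = lam ^ 2 := by
            rw [hlam, kerScale, mul_pow, inv_pow, ← prod_pow]
            congr 2
            exact prod_congr rfl fun j _ => by rw [← pow_mul]; congr 1; ring
          rw [h7]; field_simp
        rw [← mul_assoc (ofReal lam⁻¹), e]
        ring

/-! ### Pairing half-densities with the kernel -/

/-- Continuous functions with compact support off the diagonal. -/
structure IsTest (f : Cfg n → ℂ) : Prop where
  continuous : Continuous f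
  hasCompactSupport : HasCompactSupport f
  subset : tsupport f ⊆ (diagonal n)ᶜ

theorem MemH.isHalfDensityNorm (hψ : MemH ψ) : IsHalfDensityNorm fun v => ‖ψ v‖ₑ where
  measurable := hψ.measurable.enorm
  shift_eq b u := by rw [hψ.shift_eq]
  smul_sq z u hz := by
    have hz' : 0 < ‖z‖ := norm_pos_iff.2 hz
    have e : ∀ w, ‖ψ w‖ₑ ^ 2 = ofReal (‖ψ w‖ ^ 2) := fun w => by
      rw [ofReal_pow (norm_nonneg _), ofReal_norm]
    rw [e, e, ← ofReal_mul (by positivity), ← ofReal_mul (by positivity),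
      hψ.smul_eq z u hz, norm_mul, norm_real, norm_of_nonneg (by positivity)]
    congr 1
    set N := ∑ i, n i
    have h1 : ‖z‖ ^ (-((N : ℤ) - 1)) = ‖z‖ / ‖z‖ ^ N := by
      rw [neg_sub, zpow_sub₀ hz'.ne', zpow_one, zpow_natCast]
    rw [h1, pow_mul]
    field_simp
    rw [← pow_mul, ← pow_mul, mul_comm 2 N]

theorem MemH.lintegral_sq_lt_top (hψ : MemH ψ) {K : Set (Cfg n)}
    (hK : IsCompact K) (hd : K ⊆ (diagonal n)ᶜ) : ∫⁻ v in K, ‖ψ v‖ₑ ^ 2 < ⊤ := by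
  have := (hψ.memLp K hK hd).2
  rw [eLpNorm_lt_top_iff_lintegral_rpow_enorm_lt_top (by norm_num) (by norm_num)] at this
  simpa using this

theorem MemH.integrableOn (hψ : MemH ψ) {K : Set (Cfg n)}
    (hK : IsCompact K) (hd : K ⊆ (diagonal n)ᶜ) : IntegrableOn ψ K := by
  have : IsFiniteMeasure ((volume : Measure (Cfg n)).restrict K) :=
    ⟨by rw [Measure.restrict_apply_univ]; exact hK.measure_lt_top⟩
  exact (hψ.memLp K hK hd).integrable (by norm_num)

theorem IsTest.integrable_mul (hψ : MemH ψ) (hf : IsTest f) : Integrable fun v => ψ v * f v := by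
  have h1 : IntegrableOn (fun v => ψ v * f v) (tsupport f) :=
    (hψ.integrableOn hf.hasCompactSupport hf.subset).mul_continuousOn hf.continuous.continuousOn
      hf.hasCompactSupport
  exact (integrableOn_iff_integrable_of_support_subset fun v hv =>
    subset_tsupport f fun h => hv (by simp [h])).1 h1

theorem IsTest.exists_bound (hf : IsTest f) : ∃ M : ℝ, 0 ≤ M ∧
    ∀ w, ‖f w‖ₑ ≤ ofReal M * (tsupport f).indicator 1 w := by
  obtain ⟨M, hM⟩ := hf.hasCompactSupport.exists_bound_of_continuous hf.continuous
  refine ⟨max M 0, le_max_right _ _, fun w => ?_⟩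
  by_cases hw : w ∈ tsupport f
  · rw [indicator_of_mem hw, Pi.one_apply, mul_one, ← ofReal_norm]
    exact ofReal_le_ofReal ((hM w).trans (le_max_left _ _))
  · rw [image_eq_zero_of_notMem_tsupport hw]; simp

/-- On a compact set avoiding the marked points, the ratio a = (t_i - x)/(t_k - x) stays away from 0
and from 1, the latter because t_i ≠ t_k. The three singular points remain uniformly separated. -/
theorem exists_kernel_bound (hn : ∀ i, 1 ≤ n i) (hik : i ≠ k) (ht : Injective t) (hψ : MemH ψ)
    {K : Set (Cfg n)} (hK : IsCompact K) (hd : K ⊆ (diagonal n)ᶜ) {L : Set ℂ} (hL : IsCompact L)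
    (hLt : ∀ x ∈ L, ∀ i, x ≠ t i) :
    ∃ C : ENNReal, C < ⊤ ∧ ∀ x ∈ L, ∫⁻ s : ℂ, ∫⁻ v, ‖ψ v‖ₑ * ofReal (normWeight v) *
      K.indicator 1 (mob t x s v) ≤ C := by
  obtain ⟨r, R, hr, hR, hKa⟩ := exists_annulus hn k hK hd
  have hKa' : K ⊆ annulus n k r (max R (r + 1)) := by
    intro v hv
    obtain ⟨⟨h1, h2⟩, h3⟩ := hKa hv
    exact ⟨⟨h1, h2.trans (le_max_left _ _)⟩, h3.trans (le_max_left _ _)⟩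
  have hrR : r < max R (r + 1) := lt_of_lt_of_le (by linarith) (le_max_right _ _)
  generalize max R (r + 1) = R' at hKa' hrR
  rcases L.eq_empty_or_nonempty with rfl | hne
  · exact ⟨0, by simp, by simp⟩
  have hτ : ∀ x ∈ L, ∀ i, t i - x ≠ 0 := fun x hx i => sub_ne_zero.2 (hLt x hx i).symm
  have ha : ContinuousOn (fun x => (t i - x) / (t k - x)) L :=
    (by fun_prop : Continuous fun x => t i - x).continuousOn.div
      (by fun_prop : Continuous fun x => t k - x).continuousOn fun x hx => hτ x hx k
  have hS : ContinuousOn (kerScale n t i) L := by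
    refine ContinuousOn.mul (ContinuousOn.inv₀ (by fun_prop) fun x hx => ?_) (by fun_prop)
    exact Finset.prod_ne_zero_iff.2 fun j _ => pow_ne_zero _ (norm_ne_zero_iff.2 (hτ x hx j))
  obtain ⟨x1, hx1, hm1⟩ := hL.exists_isMinOn hne ha.norm
  obtain ⟨x2, hx2, hm2⟩ := hL.exists_isMinOn hne (ha.sub (continuousOn_const (c := (1 : ℂ)))).norm
  obtain ⟨x3, hx3, hm3⟩ := hL.exists_isMaxOn hne hS
  have p1 : 0 < ‖(t i - x1) / (t k - x1)‖ := norm_pos_iff.2 (div_ne_zero (hτ _ hx1 _) (hτ _ hx1 _))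
  have p2 : 0 < ‖(t i - x2) / (t k - x2) - 1‖ := by
    refine norm_pos_iff.2 (sub_ne_zero.2 fun h => hik (ht ?_))
    rw [div_eq_one_iff_eq (hτ _ hx2 _)] at h
    exact sub_left_injective h
  -- Half the smallest of the distances 1, min |a| and min |a - 1| over the compact set.
  set d := min (1 / 2) (min (‖(t i - x1) / (t k - x1)‖ / 2) (‖(t i - x2) / (t k - x2) - 1‖ / 2))
    with hdd
  have hd0 : 0 < d := by rw [hdd]; refine lt_min (by norm_num) (lt_min ?_ ?_) <;> linarith
  have hd1 : d ≤ 1 / 2 := min_le_left _ _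
  have hd2 : d ≤ ‖(t i - x1) / (t k - x1)‖ / 2 := (min_le_right _ _).trans (min_le_left _ _)
  have hd3 : d ≤ ‖(t i - x2) / (t k - x2) - 1‖ / 2 := (min_le_right _ _).trans (min_le_right _ _)
  refine ⟨ofReal (kerScale n t i x3) * ((3 * ∫⁻ q : ℂ, ofReal (majorant d ‖q‖)) *
      ((∫⁻ v in annulus n k r R', ‖ψ v‖ₑ ^ 2) + volume (annulus n k r R'))), ?_, fun x hx => ?_⟩
  · have hc := isCompact_annulus hn k r R'
    refine mul_lt_top ofReal_lt_top (mul_lt_top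
      (mul_lt_top (by norm_num) (lintegral_majorant_lt_top hd0))
      (add_lt_top.2 ⟨hψ.lintegral_sq_lt_top hc (annulus_subset hn k hr R'), hc.measure_lt_top⟩))
  · have h1 : 2 * d ≤ ‖(t i - x) / (t k - x)‖ := by
      have : ‖(t i - x1) / (t k - x1)‖ ≤ ‖(t i - x) / (t k - x)‖ := hm1 hx
      linarith
    have h2 : 2 * d ≤ ‖(t i - x) / (t k - x) - 1‖ := by
      have : ‖(t i - x2) / (t k - x2) - 1‖ ≤ ‖(t i - x) / (t k - x) - 1‖ := hm2 hx
      linarith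
    have h3 : kerScale n t i x ≤ kerScale n t i x3 := hm3 hx
    have h4 := lintegral_kernel_le hn (hLt x hx) rfl MeasurableSet.univ hik hr hrR
      hψ.isHalfDensityNorm (fun v => enorm_ne_top)
    refine le_trans ?_ (h4.trans ?_)
    · refine lintegral_mono fun s => lintegral_mono fun v => ?_
      simp only [Set.indicator_univ, Pi.one_apply, mul_one]
      exact mul_le_mul_right (Set.indicator_le_indicator_of_subset hKa' (fun _ => zero_le) _) _
    · exact mul_le_mul' (ofReal_le_ofReal h3) (mul_le_mul_left
        (theta_le_of_separated hd0 (by linarith) h1 h2 _) _)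

theorem norm_kerWeight' (c : ι → ℕ → ℂ) (v : Cfg n) : ‖kerWeight c v‖ = normWeight v :=
  norm_kerWeight c v

/-- The integrand of the pairing. -/
def pairFun (t : ι → ℂ) (c : ι → ℕ → ℂ) (ψ f : Cfg n → ℂ) (x : ℂ) (y : ℂ × Cfg n) : ℂ :=
  ψ y.2 * (kerWeight c y.2 * f (mob t x y.1 y.2))

/-- The pairing of `ψ` with the kernel. -/
def pairing (t : ι → ℂ) (c : ι → ℕ → ℂ) (ψ f : Cfg n → ℂ) (x : ℂ) : ℂ :=
  ∫ y : ℂ × Cfg n, pairFun t c ψ f x y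

theorem measurable_pairFun (t : ι → ℂ) (c : ι → ℕ → ℂ) (hψ : Measurable ψ)
    (hf : Measurable f) : Measurable fun p : ℂ × ℂ × Cfg n => pairFun t c ψ f p.1 p.2 :=
  (hψ.comp (measurable_snd.comp measurable_snd)).mul
    (((measurable_kerWeight c).comp (measurable_snd.comp measurable_snd)).mul
      (hf.comp (measurable_mob t)))

theorem measurable_pairFun_right (t : ι → ℂ) (c : ι → ℕ → ℂ)
    (hψ : Measurable ψ) (hf : Measurable f) (x : ℂ) : Measurable (pairFun t c ψ f x) :=
  (measurable_pairFun t c hψ hf).comp (measurable_prodMk_left (x := x))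

theorem exists_pairFun_bound (hn : ∀ i, 1 ≤ n i) (hik : i ≠ k) (ht : Injective t) (c : ι → ℕ → ℂ)
    (hψ : MemH ψ) (hf : IsTest f) {L : Set ℂ} (hL : IsCompact L) (hLt : ∀ x ∈ L, ∀ i, x ≠ t i) :
    ∃ C : ENNReal, C < ⊤ ∧ ∀ x ∈ L, ∫⁻ y, ‖pairFun t c ψ f x y‖ₑ ≤ C := by
  obtain ⟨C, hC, hb⟩ := exists_kernel_bound hn hik ht hψ hf.hasCompactSupport hf.subset hL hLt
  obtain ⟨M, hM, hfM⟩ := hf.exists_bound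
  refine ⟨ofReal M * C, mul_lt_top ofReal_lt_top hC, fun x hx => ?_⟩
  have hm := measurable_pairFun_right t c hψ.measurable hf.continuous.measurable x
  refine le_trans ?_ (mul_le_mul_right (hb x hx) _)
  rw [Measure.volume_eq_prod, lintegral_prod _ hm.enorm.aemeasurable,
    ← lintegral_const_mul' _ _ ofReal_ne_top]
  refine lintegral_mono fun s => ?_
  rw [← lintegral_const_mul' _ _ ofReal_ne_top]
  refine lintegral_mono fun v => ?_
  simp only [pairFun]
  rw [enorm_mul, enorm_mul, ← ofReal_norm (kerWeight c v), norm_kerWeight']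
  calc _ ≤ ‖ψ v‖ₑ * (ofReal (normWeight v) *
        (ofReal M * (tsupport f).indicator 1 (mob t x s v))) := by
        gcongr; exact hfM _
    _ = _ := by ring

theorem integrable_pairFun (hn : ∀ i, 1 ≤ n i) (hik : i ≠ k) (ht : Injective t) (c : ι → ℕ → ℂ)
    (hψ : MemH ψ) (hf : IsTest f) (hx : ∀ i, x ≠ t i) : Integrable (pairFun t c ψ f x) := by
  obtain ⟨C, hC, hb⟩ := exists_pairFun_bound hn hik ht c hψ hf (isCompact_singleton (x := x))
    (by simpa using hx)
  exact ⟨(measurable_pairFun_right t c hψ.measurable hf.continuous.measurable x).aestronglyMeasurable,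
    (hb x rfl).trans_lt hC⟩

theorem measurable_pairing (t : ι → ℂ) (c : ι → ℕ → ℂ) (hψ : Measurable ψ)
    (hf : Measurable f) : Measurable (pairing t c ψ f) :=
  ((measurable_pairFun t c hψ hf).stronglyMeasurable.integral_prod_right').measurable

theorem exists_pairing_bound (hn : ∀ i, 1 ≤ n i) (hik : i ≠ k) (ht : Injective t) (c : ι → ℕ → ℂ)
    (hψ : MemH ψ) (hf : IsTest f) {L : Set ℂ} (hL : IsCompact L) (hLt : ∀ x ∈ L, ∀ i, x ≠ t i) :
    ∃ C : ℝ, ∀ x ∈ L, ‖pairing t c ψ f x‖ ≤ C := by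
  obtain ⟨C, hC, hb⟩ := exists_pairFun_bound hn hik ht c hψ hf hL hLt
  refine ⟨C.toReal, fun x hx => ?_⟩
  have h := (enorm_integral_le_lintegral_enorm (pairFun t c ψ f x)).trans (hb x hx)
  rw [← toReal_enorm]
  exact toReal_mono hC.ne h

/-- The integrand of the pairing after a translation. -/
theorem pairFun_shift (hψ : MemH ψ) (t : ι → ℂ) (c : ι → ℕ → ℂ) (f : Cfg n → ℂ)
    (x b : ℂ) (y : ℂ × Cfg n) : pairFun t c ψ f x (y + (0, shift b 0)) =
      ψ y.2 * (kerWeight c (shift b y.2) * f (mob t x y.1 (shift b y.2))) := by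
  simp only [pairFun, Prod.fst_add, Prod.snd_add, add_zero]
  rw [← shift_eq_add, hψ.shift_eq]

instance : (volume : Measure (ℂ × Cfg n)).IsAddRightInvariant := by
  rw [Measure.volume_eq_prod]; infer_instance

/-! ### The pairing of an eigenfunction -/

theorem block_lineSub (s : ℂ) (u : Cfg n) (hn : ∀ i, 1 ≤ n i) (i : ι) :
    block (shift s (-u)) i = lineSub s u i := by
  rw [block_shift hn, block_neg, lineSub, neg_add_eq_sub]

/-- This is the variable v = s - u. Where some block of v is not invertible both integrands are
zero, by the convention for division by zero. -/
theorem modHecke_eq (hn : ∀ i, 1 ≤ n i) (t : ι → ℂ) (c : ι → ℕ → ℂ) (x : ℂ) (ψ : Cfg n → ℂ)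
    (u : Cfg n) : modHecke t c x ψ u =
      ∫ s : ℂ, ψ (quot t x (shift s (-u))) * kerWeight c (shift s (-u)) := by
  refine integral_congr_ae (Eventually.of_forall fun s => ?_)
  simp only
  rw [moved_eq hn]
  congr 1
  simp only [← block_lineSub s u hn]
  by_cases h : ∀ i, constantCoeff (block (shift s (-u)) i) ≠ 0
  · rw [kerWeight, exp_sum]
    simp only [unitWeight]
    rw [prod_mul_distrib, div_eq_mul_inv, mul_comm, ← ofReal_prod,
      prod_inv_distrib, Complex.ofReal_inv]
    congr 1
    exact prod_congr rfl fun i _ => by rw [chi_epsLog _ (h i)]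
  · push Not at h
    obtain ⟨i, hi⟩ := h
    rw [kerWeight_eq_zero hn c (i := i) hi, Finset.prod_eq_zero (mem_univ i), ofReal_zero, div_zero]
    rw [hi, norm_zero, zero_pow (by have := hn i; omega)]

theorem jac_mul_kerWeight_quot (hn : ∀ i, 1 ≤ n i)
    (hc : ∀ i, ∃ k : ℤ, (c i 0).im = k) (hx : ∀ i, x ≠ t i) {v : Cfg n}
    (hv : ∀ i, cc v i ≠ 0) : (jac t x v : ℂ) * kerWeight c (quot t x v) =
      ((∏ i, unitWeight (n i) (c i) (pointSub t x i)) *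
        ((∏ i, ‖t i - x‖ ^ (2 * n i) : ℝ) : ℂ)) * kerWeight (-c) v := by
  rw [← kerWeight_quot_mul hn t hc hx hv, jac, Complex.ofReal_mul, ← kerWeight_neg_mul c]
  ring

theorem quot_mem_of_mem (hn : ∀ i, 1 ≤ n i) (ψ φ : Cfg n → ℂ) (hc : ∀ i, ∃ k : ℤ, (c i 0).im = k)
    (hx : ∀ i, x ≠ t i) (s : ℂ) {v : Cfg n} (hv : ∀ i, cc v i ≠ 0) :
    (jac t x v : ℂ) * (ψ (quot t x (quot t x v)) * kerWeight c (quot t x v) *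
      φ (shift s (-quot t x v))) = ((∏ i, unitWeight (n i) (c i) (pointSub t x i)) *
        ((∏ i, ‖t i - x‖ ^ (2 * n i) : ℝ) : ℂ)) * pairFun t (-c) ψ φ x (s, v) := by
  rw [quot_quot hn t hx hv, pairFun, ← mob_eq]
  linear_combination ψ v * φ (mob t x s v) * jac_mul_kerWeight_quot hn hc hx hv

/-- Fubini, the reflection u ↦ s - u and the involution v ↦ (t + ε - x)/v move the operator from ψ
to φ. The Jacobian times K_c of the quotient is a constant times K_{-c}, so transposing reverses c.
-/
theorem integral_modHecke_mul (hn : ∀ i, 1 ≤ n i) (hik : i ≠ k) (ht : Injective t)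
    (hc : ∀ i, ∃ k : ℤ, (c i 0).im = k) (hψ : MemH ψ) (hφ : IsTest φ) (hx : ∀ i, x ≠ t i) :
    ∫ u, modHecke t c x ψ u * φ u = ((∏ i, unitWeight (n i) (c i) (pointSub t x i)) *
        ((∏ i, ‖t i - x‖ ^ (2 * n i) : ℝ) : ℂ)) * pairing t (-c) ψ φ x := by
  set P : ℂ := (∏ i, unitWeight (n i) (c i) (pointSub t x i)) *
        ((∏ i, ‖t i - x‖ ^ (2 * n i) : ℝ) : ℂ) with hP
  have hint := integrable_pairFun hn hik ht (-c) hψ hφ hx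
  have hφm := hφ.continuous.measurable
  have hsn : Measurable fun y : ℂ × Cfg n => shift y.1 (-y.2) :=
    continuous_shift_uncurry.measurable.comp (measurable_fst.prodMk measurable_snd.neg)
  have hw : Measurable fun w : Cfg n => ψ (quot t x w) * kerWeight c w :=
    (hψ.measurable.comp (measurable_quot_right t x)).mul (measurable_kerWeight c)
  have hm : Measurable fun y : ℂ × Cfg n => ψ (quot t x (shift y.1 (-y.2))) *
      kerWeight c (shift y.1 (-y.2)) * φ y.2 := (hw.comp hsn).mul (hφm.comp measurable_snd)
  -- Fubini needs integrability before the change of variables. The same substitution for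
  -- nonnegative integrals deduces it from the integrability of `pairFun`.
  have hI : Integrable (fun y : ℂ × Cfg n => ψ (quot t x (shift y.1 (-y.2))) *
      kerWeight c (shift y.1 (-y.2)) * φ y.2) := by
    refine ⟨hm.aestronglyMeasurable, ?_⟩
    have h1 := (hint.const_mul P).2
    refine lt_of_eq_of_lt ?_ h1
    unfold HasFiniteIntegral at *
    rw [Measure.volume_eq_prod, lintegral_prod _ hm.enorm.aemeasurable,
      lintegral_prod _ (((measurable_pairFun_right t (-c) hψ.measurable hφm x).const_mul
        P).enorm.aemeasurable)]
    refine lintegral_congr fun s => ?_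
    rw [← lintegral_shift_neg s]
    simp only [shift_neg_shift_neg]
    rw [← lintegral_quot hn t hx]
    refine lintegral_congr_ae ?_
    filter_upwards [ae_mem_unitSet hn] with v hv
    rw [← quot_mem_of_mem hn ψ φ hc hx s hv, enorm_mul (jac t x v : ℂ), ← ofReal_norm (jac t x v : ℂ),
      norm_real, norm_of_nonneg (by unfold jac; positivity)]
  calc _ = ∫ u, ∫ s : ℂ, ψ (quot t x (shift s (-u))) * kerWeight c (shift s (-u)) * φ u := by
        refine integral_congr_ae (Eventually.of_forall fun u => ?_)
        simp only
        rw [modHecke_eq hn, integral_mul_const]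
    _ = ∫ s : ℂ, ∫ u, ψ (quot t x (shift s (-u))) * kerWeight c (shift s (-u)) * φ u :=
        (integral_integral_swap hI).symm
    _ = ∫ s : ℂ, ∫ v, P * pairFun t (-c) ψ φ x (s, v) := by
        refine integral_congr_ae (Eventually.of_forall fun s => ?_)
        simp only
        rw [← integral_shift_neg s]
        simp only [shift_neg_shift_neg]
        rw [← integral_quot hn t hx]
        refine integral_congr_ae ?_
        filter_upwards [ae_mem_unitSet hn] with v hv
        exact quot_mem_of_mem hn ψ φ hc hx s hv
    _ = _ := by
        have h := integral_integral (f := fun s v => P * pairFun t (-c) ψ φ x (s, v))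
          (hint.const_mul P)
        rw [h, integral_const_mul]
        rfl

/-- The product of branches of `∏ |t_i - x|^{n_i} exp(-½ χ_i(log(t_i + ε_i - x)))`. -/
def branchProd (n : ι → ℕ) (t : ι → ℂ) (c : ι → ℕ → ℂ) (ℓ : ι → ℂ) (x : ℂ) : ℂ :=
  ∏ i, branchExp (-(1 / 2)) (n i) (c i) (ℓ i) (pointSub t x i)

theorem branchExp_neg_half (m : ℕ) (c : ℕ → ℂ) (ℓ : ℂ) (a : ℂ⟦X⟧) : branchExp (-(1 / 2)) m c ℓ a =
      ((‖exp ℓ‖ ^ m : ℝ) : ℂ) * exp (-(1 / 2) * chi m c (logCoeff ℓ a)) := by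
  have h : ‖exp ℓ‖ ^ m = Real.exp (-(1 / 2) * (-(2 * m) * ℓ.re)) := by
    rw [norm_exp, ← Real.exp_nat_mul]
    congr 1; ring
  rw [branchExp, exp_add, h, ofReal_exp]
  push_cast
  rfl

theorem prefactor_eq (t : ι → ℂ) (c : ι → ℕ → ℂ) {Λ : ι → ℂ → ℂ} (hx : ∀ i, x ≠ t i)
    (hΛ : ∀ i, exp (Λ i x) = t i - x) :
    prefactor n t c Λ x = branchProd n t c (fun i => Λ i x) x := by
  refine prod_congr rfl fun i _ => ?_
  rw [branchExp_neg_half, hΛ, chi_epsLog]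
  rw [constantCoeff_pointSub]
  exact sub_ne_zero.2 (hx i).symm

/-- In each factor, |τ|^n e^{-χ/2} · |τ|^{-2n} e^{χ} · |τ|^{2n} = |τ|^n e^{χ/2}: the constant from
the transposition converts the normalization for c into that for -c. -/
theorem prefactor_mul (hn : ∀ i, 1 ≤ n i) (hc : ∀ i, ∃ k : ℤ, (c i 0).im = k) {Λ : ι → ℂ → ℂ}
    (hx : ∀ i, x ≠ t i) (hΛ : ∀ i, exp (Λ i x) = t i - x) :
    prefactor n t c Λ x * ((∏ i, unitWeight (n i) (c i) (pointSub t x i)) *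
        ((∏ i, ‖t i - x‖ ^ (2 * n i) : ℝ) : ℂ)) = branchProd n t (-c) (fun i => Λ i x) x := by
  rw [prefactor_eq t c hx hΛ, branchProd, branchProd, ofReal_prod,
    ← prod_mul_distrib, ← prod_mul_distrib]
  refine prod_congr rfl fun i _ => ?_
  have h0 : ‖t i - x‖ ≠ 0 := norm_ne_zero_iff.2 (sub_ne_zero.2 (hx i).symm)
  rw [unitWeight_eq (hn i) (c i) (hc i) (ℓ := Λ i x) (by rw [hΛ, constantCoeff_pointSub]),
    branchExp_neg_half, branchExp_neg_half, Pi.neg_apply, chi_neg, hΛ, branchExp, exp_add,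
    ← ofReal_exp, one_mul, exp_mul_re_eq_norm_pow, hΛ, ofReal_one, one_mul]
  set X := chi (n i) (c i) (logCoeff (Λ i x) (pointSub t x i))
  have e : exp X = exp (-(1 / 2) * -X) * exp (-(1 / 2) * -X) := by
    rw [← exp_add]; congr 1; ring
  have e2 : exp (-(1 / 2) * X) * exp (-(1 / 2) * -X) = 1 := by
    rw [← exp_add, ← exp_zero]; congr 1; ring
  have h1 : ((‖t i - x‖ : ℝ) : ℂ) ≠ 0 := by exact_mod_cast h0
  push_cast
  rw [e]
  calc _ = (((‖t i - x‖ : ℝ) : ℂ) ^ n i * exp (-(1 / 2) * -X)) *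
        ((((‖t i - x‖ : ℝ) : ℂ) ^ (2 * n i))⁻¹ * ((‖t i - x‖ : ℝ) : ℂ) ^ (2 * n i)) *
        (exp (-(1 / 2) * X) * exp (-(1 / 2) * -X)) := by ring
    _ = _ := by rw [e2, inv_mul_cancel₀ (pow_ne_zero _ h1), mul_one, mul_one]

/-- The eigenvalue in terms of the pairing. -/
theorem eigenvalue_mul (hn : ∀ i, 1 ≤ n i) (hik : i ≠ k)
    (ht : Injective t) (hc : ∀ i, ∃ k : ℤ, (c i 0).im = k)
    {Λ : ι → ℂ → ℂ} (hΛ : ∀ i x, x ≠ t i → exp (Λ i x) = t i - x) {β : ℂ → ℂ}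
    (hψ : InEigenspace t c Λ β ψ) (hφ : IsTest φ) (hx : ∀ i, x ≠ t i) :
    β x * ∫ u, ψ u * φ u = branchProd n t (-c) (fun i => Λ i x) x * pairing t (-c) ψ φ x := by
  rw [← prefactor_mul hn hc hx fun i => hΛ i x (hx i), mul_assoc,
    ← integral_modHecke_mul hn hik ht hc hψ.1 hφ hx, ← integral_const_mul, ← integral_const_mul]
  refine integral_congr_ae ?_
  filter_upwards [hψ.2 x hx] with u hu
  rw [← mul_assoc, ← hu, hecke, mul_assoc]

/-- A change of logarithm by 2πi p shifts χ by -2πi p q with q = Im c_0. The half power turns this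
into (-1)^{p q}, which is the same sign for c and for -c. -/
theorem exists_sign (hm : 1 ≤ m) {c : ℕ → ℂ} (hc : ∃ k : ℤ, (c 0).im = k) {ℓ ℓ' : ℂ}
    (h : exp ℓ = exp ℓ') (a : ℂ⟦X⟧) : ∃ σ : ℂ, σ ^ 2 = 1 ∧
      branchExp (-(1 / 2)) m c ℓ a = σ * branchExp (-(1 / 2)) m c ℓ' a ∧
      branchExp (-(1 / 2)) m (-c) ℓ a = σ * branchExp (-(1 / 2)) m (-c) ℓ' a := by
  obtain ⟨p, hp⟩ := exp_eq_exp_iff_exists_int.1 h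
  obtain ⟨q, hq⟩ := hc
  have hchi : chi m c (logCoeff ℓ a) = chi m c (logCoeff ℓ' a) -
      (p * q : ℤ) * (2 * π * I) := by
    have hs : ∑ j ∈ range m, c j * logCoeff ℓ a j =
        c 0 * (p * (2 * π * I)) + ∑ j ∈ range m, c j * logCoeff ℓ' a j := by
      obtain ⟨m, rfl⟩ := Nat.exists_eq_add_of_le' hm
      rw [sum_range_succ', sum_range_succ']
      simp only [logCoeff, Nat.add_one_ne_zero, if_false, if_true, hp]
      ring
    have hre : (c 0 * (p * (2 * π * I))).re = -(p * q * (2 * π)) := by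
      simp [hq]; ring
    rw [chi, chi, hs, add_re, hre]
    push_cast; ring
  refine ⟨exp ((p * q : ℤ) * (π * I)), ?_, ?_, ?_⟩
  · rw [← Complex.exp_nat_mul, Complex.exp_eq_one_iff]
    exact ⟨p * q, by push_cast; ring⟩
  · rw [branchExp_neg_half, branchExp_neg_half, h, hchi,
      mul_left_comm (exp ((p * q : ℤ) * (π * I))), ← exp_add]
    congr 2; ring
  · rw [branchExp_neg_half, branchExp_neg_half, h, chi_neg, chi_neg, hchi,
      mul_left_comm (exp ((p * q : ℤ) * (π * I))), ← exp_add]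
    congr 1
    rw [exp_eq_exp_iff_exists_int]
    exact ⟨-(p * q), by push_cast; ring⟩

theorem exists_sign_branchProd (hn : ∀ i, 1 ≤ n i) (t : ι → ℂ) (hc : ∀ i, ∃ k : ℤ, (c i 0).im = k)
    {ℓ ℓ' : ι → ℂ} (h : ∀ i, exp (ℓ i) = exp (ℓ' i)) (x : ℂ) : ∃ σ : ℂ, σ ^ 2 = 1 ∧
      branchProd n t c ℓ x = σ * branchProd n t c ℓ' x ∧
      branchProd n t (-c) ℓ x = σ * branchProd n t (-c) ℓ' x := by
  choose σ h1 h2 h3 using fun i => exists_sign (hn i) (hc i) (h i) (pointSub t x i)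
  refine ⟨∏ i, σ i, ?_, ?_, ?_⟩
  · rw [← prod_pow]; exact Finset.prod_eq_one fun i _ => h1 i
  · rw [branchProd, branchProd, ← prod_mul_distrib]
    exact prod_congr rfl fun i _ => h2 i
  · rw [branchProd, branchProd, ← prod_mul_distrib]
    exact prod_congr rfl fun i _ => h3 i

theorem branchProd_ne_zero (t : ι → ℂ) (c : ι → ℕ → ℂ) (ℓ : ι → ℂ) (x : ℂ) :
    branchProd n t c ℓ x ≠ 0 := Finset.prod_ne_zero_iff.2 fun _ _ => exp_ne_zero _

/-! ### Smooth branches -/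

/-- Near x₀ the logarithm of t_i - x is taken as that of t_i - x₀ plus the principal logarithm of a
quotient near 1. One choice of these functions gives smooth branches for every c at once. -/
theorem exists_branch (n : ι → ℕ) (t : ι → ℂ) {x₀ : ℂ} (hx₀ : ∀ i, x₀ ≠ t i) :
    ∃ r > 0, ∃ ℓ : ι → ℂ → ℂ, (∀ y ∈ ball x₀ r, ∀ i, y ≠ t i) ∧
      (∀ y ∈ ball x₀ r, ∀ i, exp (ℓ i y) = t i - y) ∧ ∀ c : ι → ℕ → ℂ, ∀ y ∈ ball x₀ r,
        IsBranch n t c (fun x => branchProd n t c (fun i => ℓ i x) x) y ∧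
        ContDiffAt ℝ ∞ (fun x => branchProd n t c (fun i => ℓ i x) x) y := by
  have h0 : ∀ i, constantCoeff (pointSub t x₀ i) ≠ 0 := fun i => by
    rw [constantCoeff_pointSub]; exact sub_ne_zero.2 (hx₀ i).symm
  have hev : ∀ᶠ y in nhds x₀, ∀ i, (t i - y) / (t i - x₀) ∈ slitPlane := by
    refine Filter.eventually_all.2 fun i => ?_
    have := log_branch_eventually (hasPSDerivAt_pointSub t x₀ i) (h0 i)
    simpa only [constantCoeff_pointSub] using this
  obtain ⟨r, hr, hball⟩ := Metric.eventually_nhds_iff_ball.1 hev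
  have hne : ∀ y ∈ ball x₀ r, ∀ i, y ≠ t i := fun y hy i h => by
    have := hball y hy i
    rw [h, sub_self, zero_div] at this
    exact Complex.slitPlane_ne_zero this rfl
  set ℓ : ι → ℂ → ℂ := fun i y => log (t i - x₀) + log (constantCoeff (pointSub t y i) /
      constantCoeff (pointSub t x₀ i)) with hℓ
  have hd : ∀ y ∈ ball x₀ r, ∀ i, HasDerivAt (ℓ i)
      (constantCoeff (-C (1 : ℂ)) / constantCoeff (pointSub t y i)) y := fun y hy i =>
    log_branch_hasDerivAt (hasPSDerivAt_pointSub t y i) (h0 i)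
      (by simpa only [constantCoeff_pointSub] using hball y hy i) _
  have h0' : ∀ y ∈ ball x₀ r, ∀ i, constantCoeff (pointSub t y i) ≠ 0 :=
    fun y hy i => by rw [constantCoeff_pointSub]; exact sub_ne_zero.2 (hne y hy i).symm
  refine ⟨r, hr, ℓ, hne, fun y hy i => ?_, fun c y hy => ⟨?_, ?_⟩⟩
  · have h1 : t i - x₀ ≠ 0 := sub_ne_zero.2 (hx₀ i).symm
    have h2 : t i - y ≠ 0 := sub_ne_zero.2 (hne y hy i).symm
    simp only [hℓ, constantCoeff_pointSub]
    rw [exp_add, exp_log h1, exp_log (div_ne_zero h2 h1)]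
    field_simp
  · have h := HasDHolAt.prod univ (x := y)
      (f := fun i x => branchExp (-(1 / 2)) (n i) (c i) (ℓ i x) (pointSub t x i))
      (f' := fun i => 1 / 2 * dchi (n i) (c i) (pointSub t y i)⁻¹) (fun i _ => by
        have h := branchExp_hasDHolAt (-(1 / 2)) (n i) (c i) (hasPSDerivAt_pointSub t y i)
          (h0' y hy i) (hd y hy i)
        convert h using 2
        rw [map_one, neg_one_mul]
        simp only [dchi, map_neg, mul_neg, sum_neg_distrib]
        push_cast
        ring)
    exact h
  · refine contDiffAt_prod (t := univ) fun i _ => ?_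
    have hm := isOpen_ball.mem_nhds hy
    refine branchExp_contDiffAt (-(1 / 2)) (n i) (c i)
      (P := fun x => pointSub t x i) (P' := fun _ h => -C h)
      (Eventually.of_forall fun z => hasPSDerivAt_pointSub t z i) (h0' y hy i) ?_
    filter_upwards [hm] with z hz
    exact (hd z hz i).differentiableAt

section

/-! ### Families of test functions -/

/-- Smooth functions with compact support off the diagonal. -/
structure IsSmoothTest (f : Cfg n → ℂ) : Prop where
  contDiff : ContDiff ℝ ∞ f
  hasCompactSupport : HasCompactSupport f
  subset : tsupport f ⊆ (diagonal n)ᶜ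

theorem IsSmoothTest.isTest (hf : IsSmoothTest f) : IsTest f :=
  ⟨hf.contDiff.continuous, hf.hasCompactSupport, hf.subset⟩

theorem FirstOrder.support_act_subset (D : FirstOrder n) (f : Cfg n → ℂ) :
    support (D.act f) ⊆ tsupport f := by
  intro w hw
  by_contra h
  have h1 : f =ᶠ[nhds w] fun _ => 0 := notMem_tsupport_iff_eventuallyEq.1 h
  have h2 : ∀ p, dCoord p f w = 0 := by
    intro p
    simp [dCoord, h1.fderiv_eq]
  exact hw (by simp [FirstOrder.act, h2, h1.self_of_nhds])

theorem IsSmoothTest.act {D : FirstOrder n} (hD : D.IsSmooth)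
    (hf : IsSmoothTest f) : IsSmoothTest (D.act f) where
  contDiff := hD.act hf.contDiff
  hasCompactSupport := hf.hasCompactSupport.mono' (D.support_act_subset f)
  subset := (closure_minimal (D.support_act_subset f) (isClosed_tsupport f)).trans hf.subset

/-- Families of test functions depending on `x` through coefficients which are continuous off the
marked points. -/
inductive IsTestFamily (t : ι → ℂ) : (ℂ → Cfg n → ℂ) → Prop
  | smul {a : ℂ → ℂ} {f : Cfg n → ℂ} (ha : ContinuousOn a {x | ∀ i, x ≠ t i})
      (ham : Measurable a) (hf : IsTest f) : IsTestFamily t fun x u => a x * f u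
  | add {g h : ℂ → Cfg n → ℂ} (hg : IsTestFamily t g) (hh : IsTestFamily t h) :
      IsTestFamily t fun x u => g x u + h x u

theorem isTest_zero : IsTest (fun _ : Cfg n => (0 : ℂ)) where
  continuous := continuous_const
  hasCompactSupport := HasCompactSupport.zero
  subset := by
    have h : tsupport (fun _ : Cfg n => (0 : ℂ)) = ∅ := tsupport_eq_empty_iff.2 rfl
    rw [h]; exact Set.empty_subset _

theorem IsTest.isTestFamily (t : ι → ℂ) (hf : IsTest f) : IsTestFamily t fun _ => f := by
  simpa using IsTestFamily.smul (t := t) (a := fun _ => 1) continuousOn_const measurable_const hf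

theorem IsTestFamily.sum {κ : Type*} (s : Finset κ) {g : κ → ℂ → Cfg n → ℂ}
    (hg : ∀ k ∈ s, IsTestFamily t (g k)) : IsTestFamily t fun x u => ∑ k ∈ s, g k x u := by
  classical
  induction s using Finset.induction_on with
  | empty => simpa using (isTest_zero (n := n)).isTestFamily t
  | insert k s hk ih =>
    simp only [sum_insert hk]
    exact (hg k (mem_insert_self k s)).add
      (ih fun j hj => hg j (mem_insert_of_mem hj))

theorem IsTestFamily.mul_left {g : ℂ → Cfg n → ℂ} (hg : IsTestFamily t g) {a : ℂ → ℂ}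
    (ha : ContinuousOn a {x | ∀ i, x ≠ t i}) (ham : Measurable a) :
    IsTestFamily t fun x u => a x * g x u := by
  induction hg with
  | smul hb hbm hf =>
    simpa only [mul_assoc, Pi.mul_apply] using IsTestFamily.smul (ha.mul hb) (ham.mul hbm) hf
  | add _ _ h1 h2 => simpa only [mul_add] using h1.add h2

theorem continuousOn_div_pow (t : ι → ℂ) (i : ι) (m : ℕ) :
    ContinuousOn (fun x => 1 / (x - t i) ^ m) {x | ∀ i, x ≠ t i} :=
  continuousOn_const.div (by fun_prop) fun _ hx => pow_ne_zero _ (sub_ne_zero.2 (hx i))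

theorem measurable_div_pow (t : ι → ℂ) (i : ι) (m : ℕ) :
    Measurable fun x => 1 / (x - t i) ^ m := by fun_prop

theorem isTestFamily_genOp (t : ι → ℂ) {D : ι → ℕ → FirstOrder n} (hD : ∀ i a, (D i a).IsSmooth)
    (hφ : IsSmoothTest φ) : IsTestFamily t fun x => genOp t (fun i a => (D i a).act) x φ := by
  have : (fun x => genOp t (fun i a => (D i a).act) x φ) = fun x u => ∑ i,
      ∑ a ∈ range (n i), 1 / (x - t i) ^ (a + 1) * (D i a).act φ u := by
    funext x u
    refine sum_congr rfl fun i _ => sum_congr rfl fun a _ => ?_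
    rw [div_mul_eq_mul_div, one_mul]
  rw [this]
  exact IsTestFamily.sum _ fun i _ => IsTestFamily.sum _ fun a _ =>
    .smul (continuousOn_div_pow t i _) (measurable_div_pow t i _) (hφ.act (hD i a)).isTest

theorem isTestFamily_genOpDeriv (t : ι → ℂ) {D : ι → ℕ → FirstOrder n}
    (hD : ∀ i a, (D i a).IsSmooth) (hφ : IsSmoothTest φ) :
    IsTestFamily t fun x => genOpDeriv t (fun i a => (D i a).act) x φ := by
  have : (fun x => genOpDeriv t (fun i a => (D i a).act) x φ) = fun x u => ∑ i,
      ∑ a ∈ range (n i), (-((a : ℂ) + 1)) * (1 / (x - t i) ^ (a + 2) * (D i a).act φ u) := by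
    funext x u
    rw [genOpDeriv, ← sum_neg_distrib]
    refine sum_congr rfl fun i _ => ?_
    rw [← sum_neg_distrib]
    refine sum_congr rfl fun a _ => ?_
    ring
  rw [this]
  exact IsTestFamily.sum _ fun i _ => IsTestFamily.sum _ fun a _ =>
    (IsTestFamily.smul (continuousOn_div_pow t i _) (measurable_div_pow t i _)
      (hφ.act (hD i a)).isTest).mul_left continuousOn_const measurable_const

theorem isTestFamily_genOp_genOp (t : ι → ℂ) {D D' : ι → ℕ → FirstOrder n}
    (hD : ∀ i a, (D i a).IsSmooth) (hD' : ∀ i a, (D' i a).IsSmooth) (hφ : IsSmoothTest φ) :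
    IsTestFamily t fun x => genOp t (fun i a => (D i a).act) x
      (genOp t (fun i a => (D' i a).act) x φ) := by
  have : (fun x => genOp t (fun i a => (D i a).act) x (genOp t (fun i a => (D' i a).act) x φ)) =
      fun x u => ∑ k, ∑ b ∈ range (n k), 1 / (x - t k) ^ (b + 1) *
        genOp t (fun i a => (D i a).act) x ((D' k b).act φ) u := by
    funext x u
    rw [genOp_genOp' t x D hD' hφ.contDiff]
    refine sum_congr rfl fun i _ => sum_congr rfl fun a _ => ?_
    rw [div_mul_eq_mul_div, one_mul]
  rw [this]
  exact IsTestFamily.sum _ fun i _ => IsTestFamily.sum _ fun a _ =>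
    (isTestFamily_genOp t hD (hφ.act (hD' i a))).mul_left
      (continuousOn_div_pow t i _) (measurable_div_pow t i _)

/-- The weak equation is tested with G(x) φ, which varies with x. As a finite sum of rational
functions times fixed test functions it inherits all bounds from fixed test functions. -/
theorem isTestFamily_gaudinGen (t : ι → ℂ) (c : ι → ℕ → ℂ)
    (hφ : IsSmoothTest φ) : IsTestFamily t fun x => gaudinGen t c x φ :=
  ((isTestFamily_genOp_genOp t (opF_isSmooth c) (opE_isSmooth c) hφ).add
    ((isTestFamily_genOp_genOp t (opH_isSmooth c) (opH_isSmooth c) hφ).mul_left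
      (a := fun _ => 1 / 4) continuousOn_const measurable_const)).add
    ((isTestFamily_genOpDeriv t (opH_isSmooth c) hφ).mul_left
      (a := fun _ => 1 / 2) continuousOn_const measurable_const)

theorem IsTestFamily.continuousOn_kernel {g : ℂ → Cfg n → ℂ} (hg : IsTestFamily t g)
    (hn : ∀ i, 1 ≤ n i) (hc : ∀ i, ∃ k : ℤ, (c i 0).im = k) (s : ℂ) (v : Cfg n) :
    ContinuousOn (fun q : ℂ × ℂ => kerWeight c (shift q.2 v) *
      g q.1 (mob t q.1 s (shift q.2 v))) {q | ∀ i, q.1 ≠ t i} := by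
  induction hg with
  | @smul a f ha _ hf =>
    have h1 : ContinuousOn (fun q : ℂ × ℂ => a q.1) {q | ∀ i, q.1 ≠ t i} :=
      ha.comp continuous_fst.continuousOn fun q hq => hq
    have h2 : ContinuousOn (fun q : ℂ × ℂ => kerWeight c (shift q.2 v) *
        f (mob t q.1 s (shift q.2 v))) {q | ∀ i, q.1 ≠ t i} := by
      intro q hq
      have hcont : ContinuousAt (fun q : ℂ × ℂ => (q.1, s, shift q.2 v)) q :=
        (continuous_fst.prodMk (continuous_const.prodMk
          ((continuous_shift v).comp continuous_snd))).continuousAt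
      exact (ContinuousAt.comp (f := fun q : ℂ × ℂ => (q.1, s, shift q.2 v))
        (kernel_continuousAt hn t hc hq s (shift q.2 v) hf.continuous hf.hasCompactSupport)
          hcont).continuousWithinAt
    exact (h1.mul h2).congr fun q _ => by simp only [Pi.mul_apply]; ring
  | add _ _ h1 h2 => exact (h1.add h2).congr fun q _ => by simp only [Pi.add_apply]; ring

theorem IsTestFamily.measurable {g : ℂ → Cfg n → ℂ} (hg : IsTestFamily t g) :
    Measurable fun p : ℂ × Cfg n => g p.1 p.2 := by
  induction hg with
  | smul _ ham hf =>
    exact (ham.comp measurable_fst).mul (hf.continuous.measurable.comp measurable_snd)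
  | add _ _ h1 h2 => exact h1.add h2

theorem IsTestFamily.measurable_pairFun {g : ℂ → Cfg n → ℂ} (hg : IsTestFamily t g)
    (c : ι → ℕ → ℂ) (hψ : Measurable ψ) :
    Measurable fun p : ℂ × ℂ × Cfg n => pairFun t c ψ (g p.1) p.1 p.2 :=
  (hψ.comp (measurable_snd.comp measurable_snd)).mul
    (((measurable_kerWeight c).comp (measurable_snd.comp measurable_snd)).mul
      (hg.measurable.comp (measurable_fst.prodMk (measurable_mob t))))

theorem IsTestFamily.exists_pairFun_bound {g : ℂ → Cfg n → ℂ} (hg : IsTestFamily t g)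
    (hn : ∀ i, 1 ≤ n i) (hik : i ≠ k) (ht : Injective t) (c : ι → ℕ → ℂ) (hψ : MemH ψ) {L : Set ℂ}
    (hL : IsCompact L) (hLt : ∀ x ∈ L, ∀ i, x ≠ t i) :
    ∃ C : ENNReal, C < ⊤ ∧ ∀ x ∈ L, ∫⁻ y, ‖pairFun t c ψ (g x) x y‖ₑ ≤ C := by
  induction hg with
  | @smul a f ha _ hf =>
    obtain ⟨C, hC, hb⟩ := WildHecke.exists_pairFun_bound hn hik ht c hψ hf hL hLt
    obtain ⟨M, hM⟩ := hL.exists_bound_of_continuousOn (ha.mono hLt)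
    refine ⟨ofReal M * C, mul_lt_top ofReal_lt_top hC, fun x hx => ?_⟩
    have e : ∀ y, ‖pairFun t c ψ (fun u => a x * f u) x y‖ₑ =
        ‖a x‖ₑ * ‖pairFun t c ψ f x y‖ₑ := fun y => by
      rw [← enorm_mul]; congr 1; simp only [pairFun]; ring
    simp only [e]
    rw [lintegral_const_mul' _ _ enorm_ne_top, ← ofReal_norm]
    exact mul_le_mul' (ofReal_le_ofReal (hM x hx)) (hb x hx)
  | @add g h hg hh h1 h2 =>
    obtain ⟨C, hC, hb⟩ := h1
    obtain ⟨C', hC', hb'⟩ := h2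
    refine ⟨C + C', add_lt_top.2 ⟨hC, hC'⟩, fun x hx => ?_⟩
    refine le_trans ?_ (add_le_add (hb x hx) (hb' x hx))
    have hm : Measurable (pairFun t c ψ (g x) x) :=
      (hg.measurable_pairFun c hψ.measurable).comp (measurable_prodMk_left (x := x))
    rw [← lintegral_add_left hm.enorm]
    refine lintegral_mono fun y => ?_
    have e : pairFun t c ψ (fun u => g x u + h x u) x y =
        pairFun t c ψ (g x) x y + pairFun t c ψ (h x) x y := by simp only [pairFun]; ring
    simp only [e]
    exact enorm_add_le _ _

/-! ### Smearing over the base point x and over translations b -/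

section Smear

variable {t : ι → ℂ} {g : ℂ → Cfg n → ℂ}

/-- The inner integral is unchanged by the translation, so the bound that is uniform for x in L
reduces everything to the integrability of κ and η. -/
theorem IsTestFamily.integrable_smear (hg : IsTestFamily t g) (hn : ∀ i, 1 ≤ n i) (hik : i ≠ k)
    (ht : Injective t) (c : ι → ℕ → ℂ) (hψ : MemH ψ) {L : Set ℂ} (hL : IsCompact L)
    (hLt : ∀ x ∈ L, ∀ i, x ≠ t i) {κ η : ℂ → ℂ} (hκ : Integrable κ) (hκL : ∀ x, x ∉ L → κ x = 0)
    (hη : Integrable η) : Integrable fun p : (ℂ × ℂ) × (ℂ × Cfg n) =>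
      κ p.1.1 * η p.1.2 * pairFun t c ψ (g p.1.1) p.1.1 (p.2 + (0, shift p.1.2 0)) := by
  obtain ⟨C, hC, hb⟩ := hg.exists_pairFun_bound hn hik ht c hψ hL hLt
  have hm1 : Measurable fun p : (ℂ × ℂ) × (ℂ × Cfg n) =>
      pairFun t c ψ (g p.1.1) p.1.1 (p.2 + (0, shift p.1.2 0)) := by
    have h2 : Measurable fun p : (ℂ × ℂ) × (ℂ × Cfg n) =>
        ((p.1.1, p.2 + (0, shift p.1.2 0)) : ℂ × ℂ × Cfg n) :=
      (measurable_fst.comp measurable_fst).prodMk (measurable_snd.add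
        (measurable_const.prodMk ((continuous_shift (n := n) 0).measurable.comp
          (measurable_snd.comp measurable_fst))))
    exact (hg.measurable_pairFun c hψ.measurable).comp h2
  have hm : AEStronglyMeasurable (fun p : (ℂ × ℂ) × (ℂ × Cfg n) =>
      κ p.1.1 * η p.1.2 * pairFun t c ψ (g p.1.1) p.1.1 (p.2 + (0, shift p.1.2 0)))
      (volume : Measure ((ℂ × ℂ) × (ℂ × Cfg n))) :=
    ((hκ.mul_prod hη).1.comp_fst).mul hm1.aestronglyMeasurable
  refine ⟨hm, ?_⟩
  have hκη : ∫⁻ q : ℂ × ℂ, ‖κ q.1 * η q.2‖ₑ < ⊤ := (hκ.mul_prod hη).2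
  refine lt_of_le_of_lt ?_ (mul_lt_top hκη hC)
  rw [Measure.volume_eq_prod, lintegral_prod _ hm.enorm, ← lintegral_mul_const' _ _ hC.ne]
  refine lintegral_mono fun q => ?_
  by_cases hq : q.1 ∈ L
  · simp only [enorm_mul (κ q.1 * η q.2)]
    rw [lintegral_const_mul' _ _ enorm_ne_top]
    refine mul_le_mul_right ?_ _
    rw [lintegral_add_right_eq_self (fun y => ‖pairFun t c ψ (g q.1) q.1 y‖ₑ)]
    exact hb _ hq
  · simp [hκL _ hq]

/-- After exchanging integrals the translation by b is absorbed and ∫ η splits off. The extra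
average over b serves to integrate by parts in b while s and v are fixed. -/
theorem IsTestFamily.integral_smear (hg : IsTestFamily t g) (hn : ∀ i, 1 ≤ n i)
    (hik : i ≠ k) (ht : Injective t) (c : ι → ℕ → ℂ) (hψ : MemH ψ)
    {L : Set ℂ} (hL : IsCompact L) (hLt : ∀ x ∈ L, ∀ i, x ≠ t i) {κ η : ℂ → ℂ}
    (hκ : Integrable κ) (hκL : ∀ x, x ∉ L → κ x = 0) (hη : Integrable η) :
    ∫ y : ℂ × Cfg n, ∫ q : ℂ × ℂ, κ q.1 * η q.2 * pairFun t c ψ (g q.1) q.1 (y + (0, shift q.2 0)) =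
      (∫ x, κ x * pairing t c ψ (g x) x) * ∫ b, η b := by
  have hI := hg.integrable_smear hn hik ht c hψ hL hLt hκ hκL hη
  rw [← integral_integral_swap (f := fun (q : ℂ × ℂ) (y : ℂ × Cfg n) =>
    κ q.1 * η q.2 * pairFun t c ψ (g q.1) q.1 (y + (0, shift q.2 0))) hI, Measure.volume_eq_prod,
    ← integral_prod_mul (fun x => κ x * pairing t c ψ (g x) x) η]
  refine integral_congr_ae (Eventually.of_forall fun q => ?_)
  simp only
  rw [integral_const_mul, integral_add_right_eq_self (fun y => pairFun t c ψ (g q.1) q.1 y), pairing]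
  ring

end Smear

theorem integrable_smear_right (hn : ∀ i, 1 ≤ n i) (hik : i ≠ k)
    (ht : Injective t) (c : ι → ℕ → ℂ) (hψ : MemH ψ) (hf : IsTest f)
    (hx : ∀ i, x ≠ t i) {η : ℂ → ℂ} (hη : Integrable η) :
    Integrable fun p : ℂ × (ℂ × Cfg n) => η p.1 * pairFun t c ψ f x (p.2 + (0, shift p.1 0)) := by
  have h := (integrable_pairFun hn hik ht c hψ hf hx)
  have hm1 : Measurable fun p : ℂ × (ℂ × Cfg n) =>
      pairFun t c ψ f x (p.2 + (0, shift p.1 0)) := by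
    have h2 : Measurable fun p : ℂ × (ℂ × Cfg n) => p.2 + (0, shift p.1 0) :=
      measurable_snd.add (measurable_const.prodMk ((continuous_shift (n := n) 0).measurable.comp
        measurable_fst))
    exact (measurable_pairFun_right t c hψ.measurable hf.continuous.measurable x).comp h2
  have hm : AEStronglyMeasurable (fun p : ℂ × (ℂ × Cfg n) =>
      η p.1 * pairFun t c ψ f x (p.2 + (0, shift p.1 0))) (volume : Measure (ℂ × (ℂ × Cfg n))) :=
    hη.1.comp_fst.mul hm1.aestronglyMeasurable
  refine ⟨hm, ?_⟩
  refine lt_of_le_of_lt ?_ (mul_lt_top hη.2 h.2)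
  rw [Measure.volume_eq_prod, lintegral_prod _ hm.enorm, ← lintegral_mul_const' _ _ h.2.ne]
  refine lintegral_mono fun q => ?_
  simp only [enorm_mul (η q)]
  rw [lintegral_const_mul' _ _ enorm_ne_top,
    lintegral_add_right_eq_self (fun y => ‖pairFun t c ψ f x y‖ₑ)]

theorem integral_smear_right (hn : ∀ i, 1 ≤ n i) (hik : i ≠ k) (ht : Injective t) (c : ι → ℕ → ℂ)
    (hψ : MemH ψ) (hf : IsTest f) (hx : ∀ i, x ≠ t i) {η : ℂ → ℂ} (hη : Integrable η) :
    ∫ y : ℂ × Cfg n, ∫ b, η b * pairFun t c ψ f x (y + (0, shift b 0)) =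
      pairing t c ψ f x * ∫ b, η b := by
  have hI := integrable_smear_right hn hik ht c hψ hf hx hη
  rw [← integral_integral_swap (f := fun (b : ℂ) (y : ℂ × Cfg n) =>
    η b * pairFun t c ψ f x (y + (0, shift b 0))) hI, ← integral_const_mul]
  refine integral_congr_ae (Eventually.of_forall fun q => ?_)
  simp only
  rw [integral_const_mul, integral_add_right_eq_self (fun y => pairFun t c ψ f x y), pairing]
  ring

end

/-! ### The weak form of the oper equation -/

theorem contDiff_dHol {f : ℂ → ℂ} {m k : ℕ∞ω} (hf : ContDiff ℝ m f) (hk : k + 1 ≤ m) :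
    ContDiff ℝ k (dHol f) := by
  have h := hf.fderiv_right hk
  unfold dHol
  exact contDiff_const.mul ((h.clm_apply contDiff_const).sub
    (contDiff_const.mul (h.clm_apply contDiff_const)))

theorem HasCompactSupport.dHol {f : ℂ → ℂ} (hf : HasCompactSupport f) :
    HasCompactSupport (dHol f) := by
  refine (hf.fderiv ℝ).mono fun x hx => ?_
  contrapose! hx
  rw [notMem_support] at hx ⊢
  simp [WildHecke.dHol, hx]

theorem integral_mul_dHol {η K : ℂ → ℂ} (hη : ContDiff ℝ 1 η) (hη' : HasCompactSupport η)
    (hK : ContDiff ℝ 1 K) : ∫ b, η b * dHol K b = -∫ b, dHol η b * K b := by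
  have hηf := (hη.continuous_fderiv one_ne_zero)
  have hKf := (hK.continuous_fderiv one_ne_zero)
  have i1 : ∀ w, Integrable fun b => fderiv ℝ η b w * K b := fun w =>
    ((hηf.clm_apply continuous_const).mul hK.continuous).integrable_of_hasCompactSupport
      (((hη'.fderiv ℝ).mono fun x hx => by
        contrapose! hx; rw [notMem_support] at hx ⊢; simp [hx]).mul_right)
  have i2 : ∀ w, Integrable fun b => η b * fderiv ℝ K b w := fun w =>
    (hη.continuous.mul (hKf.clm_apply continuous_const)).integrable_of_hasCompactSupport
      hη'.mul_right
  have i3 : Integrable fun b => η b * K b :=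
    (hη.continuous.mul hK.continuous).integrable_of_hasCompactSupport hη'.mul_right
  have key : ∀ w, ∫ b, η b * fderiv ℝ K b w = -∫ b, fderiv ℝ η b w * K b := fun w =>
    integral_mul_fderiv_eq_neg_fderiv_mul_of_integrable (i1 w) (i2 w) i3
      (fun x _ => (hη.differentiable one_ne_zero) x) (fun x _ => (hK.differentiable one_ne_zero) x)
  calc ∫ b, η b * dHol K b = ∫ b, ((1 / 2) * (η b * fderiv ℝ K b 1) -
        (1 / 2 * I) * (η b * fderiv ℝ K b I)) := by
        congr 1; funext b; simp only [dHol]; ring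
    _ = (1 / 2) * (-∫ b, fderiv ℝ η b 1 * K b) - (1 / 2 * I) * (-∫ b, fderiv ℝ η b I * K b) := by
        rw [integral_sub ((i2 _).const_mul _) ((i2 _).const_mul _), integral_const_mul,
          integral_const_mul, key, key]
    _ = -∫ b, ((1 / 2) * (fderiv ℝ η b 1 * K b) - (1 / 2 * I) * (fderiv ℝ η b I * K b)) := by
        rw [integral_sub ((i1 _).const_mul _) ((i1 _).const_mul _), integral_const_mul,
          integral_const_mul]
        ring
    _ = _ := by congr 2; funext b; simp only [dHol]; ring

theorem integral_dHol_eq_zero {η : ℂ → ℂ} (hη : ContDiff ℝ 1 η) (hη' : HasCompactSupport η) :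
    ∫ b, dHol η b = 0 := by
  have h := integral_mul_dHol hη hη' (contDiff_const (c := (1 : ℂ)))
  have h0 : ∀ b, dHol (fun _ : ℂ => (1 : ℂ)) b = 0 := fun b => by simp [dHol]
  simp only [h0, mul_zero, integral_zero, mul_one] at h
  exact neg_eq_zero.1 h.symm

theorem dHol_congr {f g : ℂ → ℂ} (h : f =ᶠ[nhds x] g) : dHol f =ᶠ[nhds x] dHol g := by
  filter_upwards [h.eventuallyEq_nhds] with y hy
  rw [dHol, dHol, hy.fderiv_eq]

theorem integrable_mul_continuousOn {κ η : ℂ → ℂ} {L S : Set ℂ} (hκ : Integrable κ)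
    (hκL : ∀ x, x ∉ L → κ x = 0) (hη : Integrable η) (hηS : ∀ x, x ∉ S → η x = 0)
    (hL : IsCompact L) (hS : IsCompact S) {D : ℂ × ℂ → ℂ} (hD : ContinuousOn D (L ×ˢ S)) :
    Integrable fun q : ℂ × ℂ => κ q.1 * η q.2 * D q := by
  have h1 : IntegrableOn (fun q : ℂ × ℂ => κ q.1 * η q.2 * D q) (L ×ˢ S) :=
    (hκ.mul_prod hη).integrableOn.mul_continuousOn hD (hL.prod hS)
  refine (integrableOn_iff_integrable_of_support_subset fun q hq => ?_).1 h1
  by_contra h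
  apply hq
  by_cases h' : q.1 ∈ L
  · simp [hηS q.2 fun h2 => h ⟨h', h2⟩]
  · simp [hκL q.1 h']

/-- A disc with a smooth branch. -/
structure IsBranchDisc (n : ι → ℕ) (t : ι → ℂ) (c : ι → ℕ → ℂ) (A : ℂ → ℂ) (x₀ : ℂ) (r : ℝ) :
    Prop where
  ne : ∀ y ∈ ball x₀ r, ∀ i, y ≠ t i
  isBranch : ∀ y ∈ ball x₀ r, IsBranch n t c A y
  contDiffAt : ∀ y ∈ ball x₀ r, ContDiffAt ℝ ∞ A y

/-- The pairs of functions `κ`, `κ₂` with `∫ κ ∂² f = ε f(x₁) + ∫ κ₂ f`. -/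
structure IsParametrix (κ κ₂ : ℂ → ℂ) (ε x₁ x₀ : ℂ) (r : ℝ) : Prop where
  integrable : Integrable κ
  integrable₂ : Integrable κ₂
  eq_zero : ∀ x, x ∉ closedBall x₀ r → κ x = 0
  eq_zero₂ : ∀ x, x ∉ closedBall x₀ r → κ₂ x = 0
  mem : x₁ ∈ closedBall x₀ r
  eq : ∀ f : ℂ → ℂ, ContDiff ℝ ∞ f → HasCompactSupport f →
    ∫ x, κ x * dHol (dHol f) x = ε * f x₁ + ∫ x, κ₂ x * f x

theorem contDiff_bump_mul {a : ℂ} (θ : ContDiffBump a) (hR : θ.rOut < R) {k : ℕ∞ω}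
    (hk : k ≤ ∞) {f : ℂ → ℂ} (hf : ∀ y ∈ ball a R, ContDiffAt ℝ k f y) :
    ContDiff ℝ k (fun y => ((θ y : ℝ) : ℂ) * f y) ∧
      HasCompactSupport fun y => ((θ y : ℝ) : ℂ) * f y := by
  have hθs : ContDiff ℝ k fun y => ((θ y : ℝ) : ℂ) := (ofRealCLM.contDiff.comp θ.contDiff).of_le hk
  have hsupp : tsupport (fun y => ((θ y : ℝ) : ℂ) * f y) ⊆ closedBall a θ.rOut := by
    refine closure_minimal (fun y hy => ?_) isClosed_closedBall
    have h1 : y ∈ support θ := fun h0 => hy (by simp [h0])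
    rw [θ.support_eq] at h1
    exact Metric.ball_subset_closedBall h1
  refine ⟨contDiff_iff_contDiffAt.2 fun x => ?_, HasCompactSupport.of_support_subset_isCompact
    (isCompact_closedBall _ _) ((subset_tsupport _).trans hsupp)⟩
  by_cases hx : x ∈ ball a R
  · exact hθs.contDiffAt.mul (hf x hx)
  · have : x ∉ tsupport (fun y => ((θ y : ℝ) : ℂ) * f y) := fun h' =>
      hx (closedBall_subset_ball hR (hsupp h'))
    exact contDiffAt_const.congr_of_eventuallyEq (notMem_tsupport_iff_eventuallyEq.1 this)

/-- Both kernels vanish off the smaller closed disc, so f may be multiplied by a bump function equal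
to 1 in a neighbourhood of that disc. -/
theorem IsParametrix.eq_of_contDiffAt {κ κ₂ : ℂ → ℂ} {ε x₁ x₀ : ℂ} {r' : ℝ}
    (h : IsParametrix κ κ₂ ε x₁ x₀ r') (hr' : 0 < r') (hr : r' < r) {f : ℂ → ℂ}
    (hf : ∀ y ∈ ball x₀ r, ContDiffAt ℝ ∞ f y) :
    ∫ x, κ x * dHol (dHol f) x = ε * f x₁ + ∫ x, κ₂ x * f x := by
  let θ : ContDiffBump x₀ := ⟨(2 * r' + r) / 3, (r' + 2 * r) / 3, by linarith, by linarith⟩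
  have hθ1 : ∀ x ∈ closedBall x₀ r', (fun y => ((θ y : ℝ) : ℂ)) =ᶠ[nhds x] fun _ => 1 := by
    intro x hx
    have hx' : x ∈ ball x₀ ((2 * r' + r) / 3) := closedBall_subset_ball (by linarith) hx
    filter_upwards [isOpen_ball.mem_nhds hx'] with y hy
    rw [θ.one_of_mem_closedBall (Metric.ball_subset_closedBall hy), ofReal_one]
  obtain ⟨hF, hFc⟩ := contDiff_bump_mul θ (R := r) (by change (r' + 2 * r) / 3 < r; linarith) le_rfl hf
  have hFf : ∀ x ∈ closedBall x₀ r', (fun y => ((θ y : ℝ) : ℂ) * f y) =ᶠ[nhds x] f := by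
    intro x hx
    filter_upwards [hθ1 x hx] with y hy
    rw [hy, one_mul]
  have h1 := h.eq _ hF hFc
  have e1 : ∀ x, κ x * dHol (dHol fun y => ((θ y : ℝ) : ℂ) * f y) x = κ x * dHol (dHol f) x := by
    intro x
    by_cases hx : x ∈ closedBall x₀ r'
    · rw [(dHol_congr (dHol_congr (hFf x hx))).self_of_nhds]
    · rw [h.eq_zero x hx, zero_mul, zero_mul]
  have e2 : ∀ x, κ₂ x * (((θ x : ℝ) : ℂ) * f x) = κ₂ x * f x := by
    intro x
    by_cases hx : x ∈ closedBall x₀ r'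
    · exact congrArg (κ₂ x * ·) (hFf x hx).self_of_nhds
    · rw [h.eq_zero₂ x hx, zero_mul, zero_mul]
  simp only [e1, e2] at h1
  rw [h1]
  exact congrArg (fun z => ε * z + _) (hFf x₁ h.mem).self_of_nhds

section

variable {t : ι → ℂ} {c : ι → ℕ → ℂ} {A : ℂ → ℂ} {x₀ : ℂ} {r r' : ℝ} {κ κ₂ : ℂ → ℂ} {ε x₁ : ℂ}

theorem IsBranchDisc.integrable_mul (hA : IsBranchDisc n t c A x₀ r) (hr : r' < r)
    {κ : ℂ → ℂ} (hκ : Integrable κ) (hκ0 : ∀ x, x ∉ closedBall x₀ r' → κ x = 0) :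
    Integrable fun x => κ x * A x := by
  have hAc : ContinuousOn A (closedBall x₀ r') := fun x hx =>
    (hA.contDiffAt x (closedBall_subset_ball hr hx)).continuousAt.continuousWithinAt
  refine (integrableOn_iff_integrable_of_support_subset fun x hx => ?_).1
    (hκ.integrableOn.mul_continuousOn hAc (isCompact_closedBall x₀ r'))
  by_contra h
  exact hx (by simp [hκ0 x h])

/-- The derivative of the kernel of `e(x)` along translations. -/
def transTerm (t : ι → ℂ) (c : ι → ℕ → ℂ) (φ : Cfg n → ℂ) (s : ℂ) (v : Cfg n) (q : ℂ × ℂ) : ℂ :=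
  dHol (fun y => kerWeight c (shift y v) *
    genOp t (fun i a => (opE c i a).act) q.1 φ (mob t q.1 s (shift y v))) q.2

theorem transTerm_eq (hn : ∀ i, 1 ≤ n i) (hc : ∀ i, ∃ k : ℤ, (c i 0).im = k)
    (hφ : IsSmoothTest φ) (s : ℂ) (v : Cfg n) {q : ℂ × ℂ} (hq : ∀ i, q.1 ≠ t i) :
    transTerm t c φ s v q = kerWeight c (shift q.2 v) * (genOp t (fun i a => (opF c i a).act) q.1
        (genOp t (fun i a => (opE c i a).act) q.1 φ) (mob t q.1 s (shift q.2 v)) +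
      s * genOp t (fun i a => (opH c i a).act) q.1
        (genOp t (fun i a => (opE c i a).act) q.1 φ) (mob t q.1 s (shift q.2 v)) -
      s ^ 2 * genOp t (fun i a => (opE c i a).act) q.1
        (genOp t (fun i a => (opE c i a).act) q.1 φ) (mob t q.1 s (shift q.2 v))) := by
  refine hasDHolAt_kernel_shift hn t hc hq s v q.2 ?_ ?_
  · exact ContDiff.sum fun i _ => ContDiff.sum fun a _ =>
      ((opE_isSmooth c i a).act hφ.contDiff).div_const _
  · refine hφ.hasCompactSupport.mono' fun w hw => ?_
    by_contra h
    exact hw (genOp_zero_of_notMem_tsupport t _ q.1 h)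

theorem continuousOn_transTerm (hn : ∀ i, 1 ≤ n i) (hc : ∀ i, ∃ k : ℤ, (c i 0).im = k)
    (hφ : IsSmoothTest φ) (s : ℂ) (v : Cfg n) :
    ContinuousOn (transTerm t c φ s v) {q | ∀ i, q.1 ≠ t i} := by
  have h1 := (isTestFamily_genOp_genOp t (opF_isSmooth c) (opE_isSmooth c) hφ).continuousOn_kernel
    hn hc s v
  have h2 := (isTestFamily_genOp_genOp t (opH_isSmooth c) (opE_isSmooth c) hφ).continuousOn_kernel
    hn hc s v
  have h3 := (isTestFamily_genOp_genOp t (opE_isSmooth c) (opE_isSmooth c) hφ).continuousOn_kernel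
    hn hc s v
  refine ((h1.add (h2.const_smul s)).sub (h3.const_smul (s ^ 2))).congr fun q hq => ?_
  rw [transTerm_eq hn hc hφ s v hq]
  simp only [Pi.add_apply, Pi.sub_apply, Pi.smul_apply, smul_eq_mul]
  ring

/-- For fixed s, b and v the function A φ(w) is smooth in x, so the parametrix identity applies
directly. The merely measurable ψ enters only afterwards. -/
theorem pointwise_equation (hn : ∀ i, 1 ≤ n i) (hc : ∀ i, ∃ k : ℤ, (c i 0).im = k)
    (hφ : IsSmoothTest φ) (hA : IsBranchDisc n t c A x₀ r) (hr' : 0 < r')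
    (hr : r' < r) (hκ : IsParametrix κ κ₂ ε x₁ x₀ r') (s b : ℂ) (v : Cfg n) :
    ∫ x, κ x * A x * (kerWeight c (shift b v) * gaudinGen t c x φ (mob t x s (shift b v)) -
        transTerm t c φ s v (x, b)) =
      ε * A x₁ * (kerWeight c (shift b v) * φ (mob t x₁ s (shift b v))) +
        ∫ x, κ₂ x * A x * (kerWeight c (shift b v) * φ (mob t x s (shift b v))) := by
  have h := hκ.eq_of_contDiffAt hr' hr (f := fun y => A y * φ (mob t y s (shift b v)))
    (fun y hy => (hA.contDiffAt y hy).mul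
      (hφ.contDiff.comp (mob_contDiff_x t s (shift b v))).contDiffAt)
  have h' := congrArg (fun z => kerWeight c (shift b v) * z) h
  simp only [mul_add, ← integral_const_mul] at h'
  convert h' using 1
  · congr 1; funext x
    by_cases hx : x ∈ closedBall x₀ r'
    · have hxb := closedBall_subset_ball hr hx
      rw [kernel_equation hn t c s (shift b v) hφ.contDiff (A := A) (x := x) ?_,
        transTerm_eq hn hc hφ s v (hA.ne x hxb)]
      · ring
      · filter_upwards [isOpen_ball.mem_nhds hxb] with y hy
        exact ⟨hA.ne y hy, hA.isBranch y hy⟩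
    · rw [hκ.eq_zero x hx]; ring
  · congr 1
    · ring
    · congr 1; funext x; ring

/-- Integrating by parts in b moves the translation derivative onto η. It is done for fixed s and v,
where the kernel is smooth with respect to b. -/
theorem smeared_equation (hn : ∀ i, 1 ≤ n i) (hc : ∀ i, ∃ k : ℤ, (c i 0).im = k)
    (hφ : IsSmoothTest φ) (hA : IsBranchDisc n t c A x₀ r) (hr' : 0 < r')
    (hr : r' < r) (hκ : IsParametrix κ κ₂ ε x₁ x₀ r') {η : ℂ → ℂ} (hη : ContDiff ℝ ∞ η)
    (hη' : HasCompactSupport η) (s : ℂ) (v : Cfg n) : (∫ q : ℂ × ℂ, κ q.1 * A q.1 * η q.2 *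
        (kerWeight c (shift q.2 v) * gaudinGen t c q.1 φ (mob t q.1 s (shift q.2 v)))) +
      (∫ q : ℂ × ℂ, κ q.1 * A q.1 * dHol η q.2 * (kerWeight c (shift q.2 v) *
        genOp t (fun i a => (opE c i a).act) q.1 φ (mob t q.1 s (shift q.2 v)))) =
      ε * A x₁ * (∫ b, η b * (kerWeight c (shift b v) * φ (mob t x₁ s (shift b v)))) +
      ∫ q : ℂ × ℂ, κ₂ q.1 * A q.1 * η q.2 *
        (kerWeight c (shift q.2 v) * φ (mob t q.1 s (shift q.2 v))) := by
  have hL := isCompact_closedBall x₀ r'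
  have hLt : ∀ x ∈ closedBall x₀ r', ∀ i, x ≠ t i := fun x hx =>
    hA.ne x (closedBall_subset_ball hr hx)
  have hsub : closedBall x₀ r' ×ˢ tsupport η ⊆ {q : ℂ × ℂ | ∀ i, q.1 ≠ t i} :=
    fun q hq => hLt q.1 hq.1
  have hη1 : ContDiff ℝ 1 η := hη.of_le (by exact_mod_cast le_top)
  have hκA := hA.integrable_mul hr hκ.integrable hκ.eq_zero
  have hκA2 := hA.integrable_mul hr hκ.integrable₂ hκ.eq_zero₂
  have z1 : ∀ x, x ∉ closedBall x₀ r' → κ x * A x = 0 := fun x hx => by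
    rw [hκ.eq_zero x hx, zero_mul]
  have z2 : ∀ x, x ∉ closedBall x₀ r' → κ₂ x * A x = 0 := fun x hx => by
    rw [hκ.eq_zero₂ x hx, zero_mul]
  have ηi : Integrable η := hη.continuous.integrable_of_hasCompactSupport hη'
  have ηz : ∀ x, x ∉ tsupport η → η x = 0 := fun x hx => image_eq_zero_of_notMem_tsupport hx
  have dηc : Continuous (dHol η) := (contDiff_dHol (k := 0) hη1 (by norm_num)).continuous
  have dηi : Integrable (dHol η) := dηc.integrable_of_hasCompactSupport (HasCompactSupport.dHol hη')
  have dηz : ∀ x, x ∉ tsupport η → dHol η x = 0 := fun x hx => by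
    have : fderiv ℝ η x = 0 := by
      by_contra h
      exact hx (support_fderiv_subset ℝ h)
    simp [dHol, this]
  have I1 : Integrable fun q : ℂ × ℂ => κ q.1 * A q.1 * η q.2 *
      (kerWeight c (shift q.2 v) * gaudinGen t c q.1 φ (mob t q.1 s (shift q.2 v))) :=
    integrable_mul_continuousOn hκA z1 ηi ηz hL hη'
      (((isTestFamily_gaudinGen t c hφ).continuousOn_kernel hn hc s v).mono hsub)
  have I2 : Integrable fun q : ℂ × ℂ => κ q.1 * A q.1 * η q.2 * transTerm t c φ s v q :=
    integrable_mul_continuousOn hκA z1 ηi ηz hL hη'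
      ((continuousOn_transTerm hn hc hφ s v).mono hsub)
  have I3 : Integrable fun q : ℂ × ℂ => κ₂ q.1 * A q.1 * η q.2 *
      (kerWeight c (shift q.2 v) * φ (mob t q.1 s (shift q.2 v))) :=
    integrable_mul_continuousOn hκA2 z2 ηi ηz hL hη'
      (((hφ.isTest.isTestFamily t).continuousOn_kernel hn hc s v).mono hsub)
  have I4 : Integrable fun q : ℂ × ℂ => κ q.1 * A q.1 * dHol η q.2 * (kerWeight c (shift q.2 v) *
      genOp t (fun i a => (opE c i a).act) q.1 φ (mob t q.1 s (shift q.2 v))) :=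
    integrable_mul_continuousOn hκA z1 dηi dηz hL hη'
      (((isTestFamily_genOp t (opE_isSmooth c) hφ).continuousOn_kernel hn hc s v).mono hsub)
  have e2 : ∫ q : ℂ × ℂ, κ q.1 * A q.1 * η q.2 * transTerm t c φ s v q =
      -∫ q : ℂ × ℂ, κ q.1 * A q.1 * dHol η q.2 * (kerWeight c (shift q.2 v) *
        genOp t (fun i a => (opE c i a).act) q.1 φ (mob t q.1 s (shift q.2 v))) := by
    rw [Measure.volume_eq_prod, integral_prod _ I2, integral_prod _ I4, ← integral_neg]
    refine integral_congr_ae (Eventually.of_forall fun x => ?_)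
    simp only [mul_assoc, integral_const_mul]
    by_cases hx : x ∈ closedBall x₀ r'
    · have hK : ContDiff ℝ 1 fun y => kerWeight c (shift y v) *
          genOp t (fun i a => (opE c i a).act) x φ (mob t x s (shift y v)) := by
        refine (kernel_shift_contDiff hn t hc (hLt x hx) s v ?_ ?_).of_le (by exact_mod_cast le_top)
        · exact ContDiff.sum fun i _ => ContDiff.sum fun a _ =>
            ((opE_isSmooth c i a).act hφ.contDiff).div_const _
        · refine hφ.hasCompactSupport.mono' fun w hw => ?_
          by_contra h
          exact hw (genOp_zero_of_notMem_tsupport t _ x h)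
      have := integral_mul_dHol hη1 hη' hK
      simp only [transTerm]
      rw [this]; ring
    · rw [hκ.eq_zero x hx]; ring
  have J1 := integral_prod_symm _ (I1.sub I2)
  have J3 := integral_prod_symm _ I3
  rw [← Measure.volume_eq_prod] at J1 J3
  have hI0 : Integrable fun b => η b * (kerWeight c (shift b v) * φ (mob t x₁ s (shift b v))) := by
    have := kernel_shift_contDiff hn t hc (hLt x₁ hκ.mem) s v hφ.contDiff hφ.hasCompactSupport
    exact (hη.continuous.mul this.continuous).integrable_of_hasCompactSupport hη'.mul_right
  have I3' := I3.integral_prod_right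
  rw [← sub_neg_eq_add, ← e2, ← integral_sub I1 I2, J3]
  simp only [Pi.sub_apply] at J1
  rw [J1, ← integral_const_mul, ← integral_add (hI0.const_mul _) I3']
  refine integral_congr_ae (Eventually.of_forall fun b => ?_)
  have h := congrArg (fun z => η b * z) (pointwise_equation hn hc hφ hA hr' hr hκ s b v)
  simp only [mul_add, ← integral_const_mul] at h
  simp only
  convert h using 1
  · congr 1; funext x; ring
  · congr 1
    · ring
    · congr 1; funext x; ring

/-- Pairing the smeared identity with ψ and absorbing the translations leaves the factor ∫ η, which
is nonzero and cancels; the translation term carries ∫ ∂η instead. -/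
theorem weak_equation (hn : ∀ i, 1 ≤ n i) (hik : i ≠ k) (ht : Injective t)
    (hc : ∀ i, ∃ k : ℤ, (c i 0).im = k) (hψ : MemH ψ) (hφ : IsSmoothTest φ)
    (hA : IsBranchDisc n t c A x₀ r) (hr' : 0 < r') (hr : r' < r)
    (hκ : IsParametrix κ κ₂ ε x₁ x₀ r') : ∫ x, κ x * (A x * pairing t c ψ (gaudinGen t c x φ) x) =
      ε * (A x₁ * pairing t c ψ φ x₁) + ∫ x, κ₂ x * (A x * pairing t c ψ φ x) := by
  let θ : ContDiffBump (0 : ℂ) := ⟨1, 2, one_pos, one_lt_two⟩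
  set η : ℂ → ℂ := fun b => ((θ b : ℝ) : ℂ) with hηdef
  have hη : ContDiff ℝ ∞ η := ofRealCLM.contDiff.comp θ.contDiff
  have hη' : HasCompactSupport η := θ.hasCompactSupport.comp_left (g := fun y : ℝ => (y : ℂ)) rfl
  have hη0 : ∫ b, η b ≠ 0 := by
    have h : ∫ b, η b = ((∫ b, θ b : ℝ) : ℂ) := integral_ofReal
    rw [h]
    exact_mod_cast θ.integral_pos.ne'
  have hη1 : ContDiff ℝ 1 η := hη.of_le (by exact_mod_cast le_top)
  have ηi : Integrable η := hη.continuous.integrable_of_hasCompactSupport hη'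
  have dηi : Integrable (dHol η) :=
    (contDiff_dHol (k := 0) hη1 (by norm_num)).continuous.integrable_of_hasCompactSupport
      (HasCompactSupport.dHol hη')
  have hL := isCompact_closedBall x₀ r'
  have hLt : ∀ x ∈ closedBall x₀ r', ∀ i, x ≠ t i := fun x hx =>
    hA.ne x (closedBall_subset_ball hr hx)
  have hκA := hA.integrable_mul hr hκ.integrable hκ.eq_zero
  have hκA2 := hA.integrable_mul hr hκ.integrable₂ hκ.eq_zero₂
  have z1 : ∀ x, x ∉ closedBall x₀ r' → κ x * A x = 0 := fun x hx => by
    rw [hκ.eq_zero x hx, zero_mul]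
  have z2 : ∀ x, x ∉ closedBall x₀ r' → κ₂ x * A x = 0 := fun x hx => by
    rw [hκ.eq_zero₂ x hx, zero_mul]
  have f1 := isTestFamily_gaudinGen t c hφ
  have f2 := isTestFamily_genOp t (opE_isSmooth c) hφ
  have f3 := hφ.isTest.isTestFamily t
  have S1 := f1.integral_smear hn hik ht c hψ hL hLt hκA z1 ηi
  have S2 := f2.integral_smear hn hik ht c hψ hL hLt hκA z1 dηi
  have S3 := f3.integral_smear hn hik ht c hψ hL hLt hκA2 z2 ηi
  have S4 := integral_smear_right hn hik ht c hψ hφ.isTest (hLt x₁ hκ.mem) ηi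
  have T1 := (f1.integrable_smear hn hik ht c hψ hL hLt hκA z1 ηi).integral_prod_right
  have T2 := (f2.integrable_smear hn hik ht c hψ hL hLt hκA z1 dηi).integral_prod_right
  have T3 := (f3.integrable_smear hn hik ht c hψ hL hLt hκA2 z2 ηi).integral_prod_right
  have T4 := (integrable_smear_right hn hik ht c hψ hφ.isTest (hLt x₁ hκ.mem) ηi).integral_prod_right
  -- The translation term drops out here: translation invariance of ψ leaves it multiplied by the
  -- integral of a derivative of a compactly supported function.
  rw [integral_dHol_eq_zero hη1 hη', mul_zero] at S2
  have key := integral_congr_ae (μ := (volume : Measure (ℂ × Cfg n)))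
    (Eventually.of_forall fun y =>
      congrArg (fun z => ψ y.2 * z) (smeared_equation hn hc hφ hA hr' hr hκ hη hη' y.1 y.2))
  simp only [mul_add, ← integral_const_mul] at key
  have U1 : ∀ y : ℂ × Cfg n, ∫ q : ℂ × ℂ, ψ y.2 * (κ q.1 * A q.1 * η q.2 *
      (kerWeight c (shift q.2 y.2) * gaudinGen t c q.1 φ (mob t q.1 y.1 (shift q.2 y.2)))) =
      ∫ q : ℂ × ℂ, κ q.1 * A q.1 * η q.2 *
        pairFun t c ψ (gaudinGen t c q.1 φ) q.1 (y + (0, shift q.2 0)) := fun y => by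
    simp only [pairFun_shift hψ]
    congr 1; funext q; ring
  have U2 : ∀ y : ℂ × Cfg n, ∫ q : ℂ × ℂ, ψ y.2 * (κ q.1 * A q.1 * dHol η q.2 *
      (kerWeight c (shift q.2 y.2) *
        genOp t (fun i a => (opE c i a).act) q.1 φ (mob t q.1 y.1 (shift q.2 y.2)))) =
      ∫ q : ℂ × ℂ, κ q.1 * A q.1 * dHol η q.2 *
        pairFun t c ψ (genOp t (fun i a => (opE c i a).act) q.1 φ) q.1 (y + (0, shift q.2 0)) :=
    fun y => by
      simp only [pairFun_shift hψ]
      congr 1; funext q; ring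
  have U3 : ∀ y : ℂ × Cfg n, ∫ q : ℂ × ℂ, ψ y.2 * (κ₂ q.1 * A q.1 * η q.2 *
      (kerWeight c (shift q.2 y.2) * φ (mob t q.1 y.1 (shift q.2 y.2)))) =
      ∫ q : ℂ × ℂ, κ₂ q.1 * A q.1 * η q.2 *
        pairFun t c ψ φ q.1 (y + (0, shift q.2 0)) := fun y => by
    simp only [pairFun_shift hψ]
    congr 1; funext q; ring
  have U4 : ∀ y : ℂ × Cfg n, ∫ b, ψ y.2 * (ε * A x₁ * (η b *
      (kerWeight c (shift b y.2) * φ (mob t x₁ y.1 (shift b y.2))))) =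
      ε * A x₁ * ∫ b, η b * pairFun t c ψ φ x₁ (y + (0, shift b 0)) := fun y => by
    simp only [pairFun_shift hψ]
    rw [← integral_const_mul]
    congr 1; funext q; ring
  simp only [U1, U2, U3, U4] at key
  rw [integral_add T1 T2, integral_add (T4.const_mul _) T3, S1, S2, S3, integral_const_mul, S4] at key
  refine mul_right_cancel₀ hη0 ?_
  simp only [← mul_assoc] at key ⊢
  linear_combination key

end

section

/-! ### A parametrix of `∂²` -/

open Filter Topology ComplexConjugate

/-- `|z|² + h²`. -/
def regDen (h : ℝ) (z : ℂ) : ℂ := z * conj z + (h : ℂ) ^ 2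

theorem regDen_eq (h : ℝ) (z : ℂ) : regDen h z = ((‖z‖ ^ 2 + h ^ 2 : ℝ) : ℂ) := by
  rw [regDen, Complex.mul_conj']; push_cast; rfl

theorem norm_regDen (h : ℝ) (z : ℂ) : ‖regDen h z‖ = ‖z‖ ^ 2 + h ^ 2 := by
  rw [regDen_eq, norm_real, norm_of_nonneg (by positivity)]

theorem regDen_ne_zero {h : ℝ} (hz : h ≠ 0 ∨ z ≠ 0) : regDen h z ≠ 0 := by
  rw [← norm_ne_zero_iff, norm_regDen]
  rcases hz with hz | hz
  · have := sq_pos_of_ne_zero hz; positivity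
  · have := norm_pos_iff.2 hz; positivity

/-- A regularization of `z / z̄`. -/
def regKer (h : ℝ) (z : ℂ) : ℂ := z ^ 2 * (regDen h z)⁻¹

/-- The derivative of `regKer` with respect to `z`. -/
def regKerHol (h : ℝ) (z : ℂ) : ℂ := (2 * z * regDen h z - z ^ 2 * conj z) * ((regDen h z)⁻¹) ^ 2

/-- The derivative of `regKer` with respect to `z̄`. -/
def regKerAnti (h : ℝ) (z : ℂ) : ℂ := -z ^ 3 * ((regDen h z)⁻¹) ^ 2

/-- The real derivative of `regKer`. -/
def regKerDeriv (h : ℝ) (z : ℂ) : ℂ →L[ℝ] ℂ :=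
  regKerHol h z • ContinuousLinearMap.id ℝ ℂ + regKerAnti h z • (conjCLE : ℂ →L[ℝ] ℂ)

theorem dHol_eq_of_hasFDerivAt {f : ℂ → ℂ} {α β : ℂ} (h : HasFDerivAt f
    (α • ContinuousLinearMap.id ℝ ℂ + β • (conjCLE : ℂ →L[ℝ] ℂ)) z) : dHol f z = α := by
  rw [dHol, h.fderiv]
  simp only [_root_.add_apply, _root_.smul_apply, ContinuousLinearMap.id_apply,
    ContinuousLinearEquiv.coe_coe, conjCLE_apply, map_one, Complex.conj_I, smul_eq_mul]
  linear_combination (-(1 / 2) * α + 1 / 2 * β) * I_mul_I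

theorem contDiff_regDen (h : ℝ) : ContDiff ℝ ∞ (regDen h) :=
  (contDiff_id.mul conjCLE.contDiff).add contDiff_const

theorem hasFDerivAt_regDen (h : ℝ) (z : ℂ) : HasFDerivAt (regDen h)
    (conj z • ContinuousLinearMap.id ℝ ℂ + z • (conjCLE : ℂ →L[ℝ] ℂ)) z := by
  have h1 : HasFDerivAt (fun z : ℂ => z) (ContinuousLinearMap.id ℝ ℂ) z := hasFDerivAt_id z
  have h2 : HasFDerivAt (fun z : ℂ => conj z) (conjCLE : ℂ →L[ℝ] ℂ) z := conjCLE.hasFDerivAt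
  refine ((h1.mul h2).add_const ((h : ℂ) ^ 2)).congr_fderiv ?_
  rw [add_comm]

theorem HasFDerivAt.complex_inv {f : ℂ → ℂ} {f' : ℂ →L[ℝ] ℂ} (hf : HasFDerivAt f f' z)
    (h0 : f z ≠ 0) : HasFDerivAt (fun z => (f z)⁻¹) (-((f z)⁻¹ ^ 2) • f') z := by
  have h1 : HasFDerivAt (fun z : ℂ => z⁻¹) _ (f z) :=
    ((hasDerivAt_inv h0).hasFDerivAt).restrictScalars ℝ
  refine (h1.comp z hf).congr_fderiv ?_
  refine ContinuousLinearMap.ext fun w => ?_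
  simp
  ring

theorem hasFDerivAt_regKer {h : ℝ} (hz : h ≠ 0 ∨ z ≠ 0) :
    HasFDerivAt (regKer h) (regKerDeriv h z) z := by
  have h0 := regDen_ne_zero hz
  have h1 : HasFDerivAt (fun z : ℂ => z) (ContinuousLinearMap.id ℝ ℂ) z := hasFDerivAt_id z
  have h2 : HasFDerivAt (fun z : ℂ => z * z) _ z := h1.mul h1
  have h3 := h2.mul (HasFDerivAt.complex_inv (hasFDerivAt_regDen h z) h0)
  have e : regKer h = fun z => z * z * (regDen h z)⁻¹ := by funext z; rw [regKer, sq]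
  rw [e]
  refine h3.congr_fderiv (ContinuousLinearMap.ext fun w => ?_)
  simp only [regKerDeriv, regKerHol, regKerAnti, _root_.add_apply, _root_.smul_apply,
    ContinuousLinearMap.id_apply, ContinuousLinearEquiv.coe_coe, conjCLE_apply, smul_eq_mul]
  field_simp
  ring

theorem dHol_regKer {h : ℝ} (hz : h ≠ 0 ∨ z ≠ 0) : dHol (regKer h) z = regKerHol h z :=
  dHol_eq_of_hasFDerivAt (hasFDerivAt_regKer hz)

/-- The second derivative is h⁻² times a fixed integrable profile in z/h, hence an approximate
multiple of the delta function. In this sense z / conj z is a fundamental solution of ∂² up to a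
constant. -/
theorem dHol_regKerHol {h : ℝ} (hz : h ≠ 0 ∨ z ≠ 0) :
    dHol (regKerHol h) z = 2 * (h : ℂ) ^ 4 * ((regDen h z)⁻¹) ^ 3 := by
  have h0 := regDen_ne_zero hz
  have h1 : HasFDerivAt (fun z : ℂ => z) (ContinuousLinearMap.id ℝ ℂ) z := hasFDerivAt_id z
  have hc : HasFDerivAt (fun z : ℂ => conj z) (conjCLE : ℂ →L[ℝ] ℂ) z := conjCLE.hasFDerivAt
  have hd := hasFDerivAt_regDen h z
  have hi := HasFDerivAt.complex_inv hd h0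
  have h3 := (((h1.const_mul 2).mul hd).sub ((h1.mul h1).mul hc)).mul (hi.mul hi)
  have e : regKerHol h = fun z => (2 * z * regDen h z - z * z * conj z) *
      ((regDen h z)⁻¹ * (regDen h z)⁻¹) := by funext z; rw [regKerHol, sq, sq]
  rw [e]
  have h4 := h3.fderiv
  rw [dHol, show (fun z => (2 * z * regDen h z - z * z * conj z) *
      ((regDen h z)⁻¹ * (regDen h z)⁻¹)) = ((fun y => 2 * y) * regDen h -
        ((fun z => z) * fun z => z) * fun z => conj z) *
        ((fun z => (regDen h z)⁻¹) * fun z => (regDen h z)⁻¹) from rfl, h4]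
  simp only [_root_.add_apply, _root_.smul_apply, _root_.sub_apply,
    ContinuousLinearMap.id_apply, ContinuousLinearEquiv.coe_coe, conjCLE_apply, smul_eq_mul,
    Pi.mul_apply, Pi.sub_apply, map_one, Complex.conj_I]
  have hI := I_mul_I
  have hh : (h : ℂ) ^ 2 = regDen h z - z * conj z := by rw [regDen]; ring
  have hh4 : (h : ℂ) ^ 4 = (regDen h z - z * conj z) ^ 2 := by rw [← hh]; ring
  rw [hh4]
  generalize regDen h z = D at *
  generalize (conj z : ℂ) = w at *
  field_simp
  ring_nf
  simp only [I_sq]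
  ring

theorem norm_regKer_le (h : ℝ) (z : ℂ) : ‖regKer h z‖ ≤ 1 := by
  rw [regKer, norm_mul, norm_inv, norm_regDen, norm_pow, ← div_eq_mul_inv]
  exact div_le_one_of_le₀ (by nlinarith [sq_nonneg h]) (by positivity)

theorem norm_regKerHol_le (h : ℝ) (hz : z ≠ 0) : ‖regKerHol h z‖ ≤ 3 * ‖z‖⁻¹ := by
  have hz' := norm_pos_iff.2 hz
  have hD : ‖z‖ ^ 2 ≤ ‖z‖ ^ 2 + h ^ 2 := by nlinarith [sq_nonneg h]
  have h1 : ‖2 * z * regDen h z - z ^ 2 * conj z‖ ≤ 3 * ‖z‖ * (‖z‖ ^ 2 + h ^ 2) := by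
    refine (norm_sub_le _ _).trans ?_
    rw [norm_mul, norm_mul, norm_mul, norm_pow, norm_conj, norm_regDen, norm_ofNat]
    nlinarith
  rw [regKerHol, norm_mul, norm_pow, norm_inv, norm_regDen]
  calc _ ≤ 3 * ‖z‖ * (‖z‖ ^ 2 + h ^ 2) * ((‖z‖ ^ 2 + h ^ 2)⁻¹) ^ 2 := by gcongr
    _ = 3 * ‖z‖ * (‖z‖ ^ 2 + h ^ 2)⁻¹ := by field_simp
    _ ≤ 3 * ‖z‖ * (‖z‖ ^ 2)⁻¹ := by gcongr
    _ = _ := by field_simp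

theorem norm_regKerAnti_le (h : ℝ) (hz : z ≠ 0) : ‖regKerAnti h z‖ ≤ ‖z‖⁻¹ := by
  have hz' := norm_pos_iff.2 hz
  have hD : ‖z‖ ^ 2 ≤ ‖z‖ ^ 2 + h ^ 2 := by nlinarith [sq_nonneg h]
  rw [regKerAnti, norm_mul, norm_pow, norm_inv, norm_regDen, norm_neg, norm_pow]
  calc _ ≤ ‖z‖ ^ 3 * ((‖z‖ ^ 2)⁻¹) ^ 2 := by gcongr
    _ = _ := by field_simp

/-- The bound is independent of h and |z|⁻¹ is locally integrable in the plane, which permits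
dominated convergence as h → 0. -/
theorem norm_regKerDeriv_le (h : ℝ) (hz : z ≠ 0) : ‖regKerDeriv h z‖ ≤ 4 * ‖z‖⁻¹ := by
  refine ContinuousLinearMap.opNorm_le_bound _ (by positivity) fun w => ?_
  simp only [regKerDeriv, _root_.add_apply, _root_.smul_apply,
    ContinuousLinearMap.id_apply, ContinuousLinearEquiv.coe_coe, conjCLE_apply, smul_eq_mul]
  refine (norm_add_le _ _).trans ?_
  rw [norm_mul, norm_mul, norm_conj, ← add_mul]
  gcongr
  linarith [norm_regKerHol_le h hz, norm_regKerAnti_le h hz]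

theorem continuousAt_regDen_inv (hz : z ≠ 0) : ContinuousAt (fun h : ℝ => (regDen h z)⁻¹) 0 := by
  refine ContinuousAt.inv₀ ?_ (regDen_ne_zero (Or.inr hz))
  unfold regDen
  fun_prop

theorem continuousAt_regKer (hz : z ≠ 0) : ContinuousAt (fun h : ℝ => regKer h z) 0 :=
  continuousAt_const.mul (continuousAt_regDen_inv hz)

theorem continuousAt_regKerHol (hz : z ≠ 0) : ContinuousAt (fun h : ℝ => regKerHol h z) 0 := by
  have h1 : ContinuousAt (fun h : ℝ => regDen h z) 0 := by unfold regDen; fun_prop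
  exact ((continuousAt_const.mul h1).sub continuousAt_const).mul ((continuousAt_regDen_inv hz).pow 2)

theorem continuousAt_regKerDeriv (hz : z ≠ 0) : ContinuousAt (fun h : ℝ => regKerDeriv h z) 0 :=
  ((continuousAt_regKerHol hz).smul continuousAt_const).add
    ((continuousAt_const.mul ((continuousAt_regDen_inv hz).pow 2)).smul continuousAt_const)

theorem measurable_regDen (h : ℝ) : Measurable (regDen h) := (contDiff_regDen h).continuous.measurable

theorem measurable_regKer (h : ℝ) : Measurable (regKer h) := by
  have := measurable_regDen h
  unfold regKer; fun_prop

theorem measurable_conj : Measurable fun z : ℂ => conj z := Complex.continuous_conj.measurable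

theorem measurable_regKerHol (h : ℝ) : Measurable (regKerHol h) := by
  have := measurable_regDen h
  have := measurable_conj
  unfold regKerHol; fun_prop

theorem stronglyMeasurable_regKerDeriv (h : ℝ) : StronglyMeasurable (regKerDeriv h) := by
  have h1 := measurable_regDen h
  have h2 : Measurable (regKerAnti h) := by unfold regKerAnti; fun_prop
  exact ((measurable_regKerHol h).stronglyMeasurable.smul_const _).add
    (h2.stronglyMeasurable.smul_const _)

variable (θ : ContDiffBump (0 : ℂ))

/-- The cut-off kernel. -/
def cutKer (h : ℝ) (z : ℂ) : ℂ := (θ z : ℂ) * regKer h z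

theorem contDiff_bump : ContDiff ℝ ∞ fun z => (θ z : ℂ) := ofRealCLM.contDiff.comp θ.contDiff

/-- The derivative of the cut-off kernel. -/
def cutKerDeriv (h : ℝ) (z : ℂ) : ℂ →L[ℝ] ℂ :=
  (θ z : ℂ) • regKerDeriv h z + regKer h z • fderiv ℝ (fun z => (θ z : ℂ)) z

theorem contDiff_regKer {h : ℝ} (hh : h ≠ 0) : ContDiff ℝ ∞ (regKer h) :=
  (contDiff_id.pow 2).mul ((contDiff_regDen h).inv fun _ => regDen_ne_zero (Or.inl hh))

theorem contDiff_cutKer {h : ℝ} (hh : h ≠ 0) :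
    ContDiff ℝ ∞ (cutKer θ h) := (contDiff_bump θ).mul (contDiff_regKer hh)

theorem hasCompactSupport_bump : HasCompactSupport fun z => (θ z : ℂ) :=
  θ.hasCompactSupport.comp_left (g := fun y : ℝ => (y : ℂ)) rfl

theorem hasCompactSupport_cutKer (h : ℝ) :
    HasCompactSupport (cutKer θ h) := (hasCompactSupport_bump θ).mul_right

theorem fderiv_cutKer {h : ℝ} (hz : h ≠ 0 ∨ z ≠ 0) : fderiv ℝ (cutKer θ h) z = cutKerDeriv θ h z :=
  ((((contDiff_bump θ).differentiable (by simp)) z).hasFDerivAt.mul (hasFDerivAt_regKer hz)).fderiv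

theorem bump_eq_zero (hz : θ.rOut < ‖z‖) : (fun z => (θ z : ℂ)) =ᶠ[𝓝 z] fun _ => 0 := by
  have : {y : ℂ | θ.rOut < ‖y‖} ∈ 𝓝 z := (isOpen_lt continuous_const continuous_norm).mem_nhds hz
  filter_upwards [this] with y hy
  have : θ y = 0 := by
    rw [← notMem_support, θ.support_eq]
    simpa using le_of_lt hy
  rw [this, ofReal_zero]

theorem norm_bump_le (z : ℂ) : ‖(θ z : ℂ)‖ ≤ 1 := by
  rw [norm_real, norm_of_nonneg θ.nonneg]; exact θ.le_one

theorem integrable_indicator_inv_norm (C r : ℝ) :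
    Integrable ((closedBall (0 : ℂ) r).indicator fun z => 4 * ‖z‖⁻¹ + C) := by
  have h1 : Integrable fun q : ℂ => majorant (|r| + 1) ‖q‖ := by
    refine ⟨((measurable_majorant _).comp measurable_norm).aestronglyMeasurable, ?_⟩
    have := lintegral_majorant_lt_top (d := |r| + 1) (by positivity)
    refine lt_of_le_of_lt (le_of_eq (lintegral_congr fun q => ?_)) this
    rw [← ofReal_norm, norm_of_nonneg (majorant_nonneg (norm_nonneg _))]
  have h2 : IntegrableOn (fun z : ℂ => 4 * ‖z‖⁻¹ + C) (closedBall 0 r) := by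
    refine IntegrableOn.add ?_ (integrableOn_const (by exact measure_closedBall_lt_top.ne))
    refine ((h1.const_mul (4 * (|r| + 1) ^ 2)).integrableOn (s := closedBall 0 r)).congr_fun
      (fun z hz => ?_) isClosed_closedBall.measurableSet
    have hz' : ‖z‖ < |r| + 1 := by
      have : ‖z‖ ≤ r := by simpa using hz
      linarith [le_abs_self r]
    have : |r| + 1 ≠ 0 := by positivity
    simp only [majorant, if_pos hz']
    field_simp
  exact h2.integrable_indicator isClosed_closedBall.measurableSet

theorem exists_cutKerDeriv_bound : ∃ g : ℂ → ℝ, Integrable g ∧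
    ∀ h z, z ≠ 0 → ‖cutKerDeriv θ h z‖ ≤ g z := by
  obtain ⟨C, hC⟩ := ((contDiff_bump θ).continuous_fderiv (by simp)).bounded_above_of_compact_support
    ((hasCompactSupport_bump θ).fderiv ℝ)
  refine ⟨_, integrable_indicator_inv_norm C θ.rOut, fun h z hz => ?_⟩
  by_cases hzr : θ.rOut < ‖z‖
  · have e := bump_eq_zero θ hzr
    have h1 : (θ z : ℂ) = 0 := e.self_of_nhds
    rw [Set.indicator_of_notMem (by simpa using hzr), cutKerDeriv, h1, e.fderiv_eq, fderiv_fun_const,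
      Pi.zero_apply, smul_zero, add_zero, norm_smul, norm_zero, zero_mul]
  · rw [indicator_of_mem (by simpa using hzr), cutKerDeriv]
    refine (norm_add_le _ _).trans (add_le_add ?_ ?_)
    · rw [norm_smul]
      calc _ ≤ 1 * (4 * ‖z‖⁻¹) := mul_le_mul (norm_bump_le θ z) (norm_regKerDeriv_le h hz)
            (norm_nonneg _) zero_le_one
        _ = _ := one_mul _
    · rw [norm_smul]
      calc _ ≤ 1 * C := mul_le_mul (norm_regKer_le h z) (hC z) (norm_nonneg _) zero_le_one
        _ = _ := one_mul _

theorem exists_cutKer_bound : ∃ g : ℂ → ℝ, Integrable g ∧ ∀ h z, ‖cutKer θ h z‖ ≤ g z := by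
  refine ⟨fun z => ‖(θ z : ℂ)‖, ((contDiff_bump θ).continuous.integrable_of_hasCompactSupport
    (hasCompactSupport_bump θ)).norm, fun h z => ?_⟩
  rw [cutKer, norm_mul]
  exact mul_le_of_le_one_right (norm_nonneg _) (norm_regKer_le h z)

theorem ae_ne_zero : ∀ᵐ z : ℂ, z ≠ 0 := by rw [ae_iff]; simp

/-- Dominated convergence gives convergence of the kernels in L¹, and convolution with a bounded
function is controlled uniformly by the L¹ norm. -/
theorem tendstoUniformly_convolution {E F : Type*} [NormedAddCommGroup E] [NormedSpace ℝ E]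
    [NormedAddCommGroup F] [NormedSpace ℝ F] (L : E →L[ℝ] ℂ →L[ℝ] F) {A : ℕ → ℂ → E} {A₀ : ℂ → E}
    {g : ℂ → ℝ} (hg : Integrable g) (hA : ∀ m, AEStronglyMeasurable (A m))
    (hA₀ : AEStronglyMeasurable A₀) (hb : ∀ m, ∀ᵐ z, ‖A m z‖ ≤ g z) (hb₀ : ∀ᵐ z, ‖A₀ z‖ ≤ g z)
    (hlim : ∀ᵐ z, Tendsto (fun m => A m z) atTop (𝓝 (A₀ z))) {f : ℂ → ℂ}
    (hf : AEStronglyMeasurable f) {B : ℝ} (hB : ∀ z, ‖f z‖ ≤ B) :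
    TendstoUniformly (fun m => convolution (A m) f L volume) (convolution A₀ f L volume) atTop := by
  have hI : ∀ {X : ℂ → E}, AEStronglyMeasurable X → (∀ᵐ z, ‖X z‖ ≤ g z) → ∀ x,
      Integrable fun y => L (X y) (f (x - y)) := by
    intro X hX hXb x
    refine (hg.const_mul (‖L‖ * B)).mono' ?_ ?_
    · exact L.aestronglyMeasurable_comp₂ hX
        (hf.comp_quasiMeasurePreserving (quasiMeasurePreserving_sub_left volume x))
    · filter_upwards [hXb] with y hy
      have hB0 : 0 ≤ B := (norm_nonneg _).trans (hB 0)
      calc _ ≤ ‖L‖ * ‖X y‖ * ‖f (x - y)‖ := L.le_opNorm₂ _ _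
        _ ≤ ‖L‖ * g y * B := by
          have hg0 : 0 ≤ g y := (norm_nonneg _).trans hy
          gcongr
          exact hB _
        _ = _ := by ring
  have hconv : Tendsto (fun m => ∫ z, ‖A m z - A₀ z‖) atTop (𝓝 0) := by
    have := tendsto_integral_of_dominated_convergence (F := fun m z => ‖A m z - A₀ z‖)
      (f := fun _ => (0 : ℝ)) (fun z => 2 * g z) (fun m => ((hA m).sub hA₀).norm)
      (hg.const_mul 2) (fun m => by
        filter_upwards [hb m, hb₀] with z h1 h2
        rw [norm_norm]
        linarith [norm_sub_le (A m z) (A₀ z)]) (by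
        filter_upwards [hlim] with z hz
        exact tendsto_iff_norm_sub_tendsto_zero.1 hz)
    simpa using this
  rw [Metric.tendstoUniformly_iff]
  intro ε hε
  have h2 : Tendsto (fun m => ‖L‖ * B * ∫ z, ‖A m z - A₀ z‖) atTop (𝓝 0) := by
    simpa using hconv.const_mul (‖L‖ * B)
  filter_upwards [h2.eventually_lt_const hε] with m hm x
  refine lt_of_le_of_lt ?_ hm
  rw [dist_comm, dist_eq_norm, convolution_def, convolution_def, ← integral_sub (hI (hA m) (hb m) x)
    (hI hA₀ hb₀ x), ← integral_const_mul]
  have hd : Integrable fun z => ‖A m z - A₀ z‖ := by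
    refine (hg.const_mul 2).mono' ((hA m).sub hA₀).norm ?_
    filter_upwards [hb m, hb₀] with z h1 h2
    rw [norm_norm]
    linarith [norm_sub_le (A m z) (A₀ z)]
  refine norm_integral_le_of_norm_le (hd.const_mul _) (Eventually.of_forall fun y => ?_)
  rw [← _root_.sub_apply, ← map_sub]
  calc _ ≤ ‖L‖ * ‖A m y - A₀ y‖ * ‖f (x - y)‖ := L.le_opNorm₂ _ _
    _ ≤ ‖L‖ * ‖A m y - A₀ y‖ * B := by gcongr; exact hB _
    _ = _ := by ring

/-! ### Convolution with the parametrix gains one derivative -/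

/-- Convolution with the cut-off kernel. -/
def cutConv (h : ℝ) (f : ℂ → ℂ) : ℂ → ℂ :=
  convolution (cutKer θ h) f (ContinuousLinearMap.mul ℝ ℂ) volume

theorem measurable_cutKer (h : ℝ) : Measurable (cutKer θ h) :=
  (contDiff_bump θ).continuous.measurable.mul (measurable_regKer h)

theorem tendsto_cutKerDeriv (hz : z ≠ 0) :
    Tendsto (fun h => cutKerDeriv θ h z) (𝓝 0) (𝓝 (cutKerDeriv θ 0 z)) := by
  have h1 : Tendsto (fun h => (θ z : ℂ) • regKerDeriv h z) (𝓝 0)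
      (𝓝 ((θ z : ℂ) • regKerDeriv 0 z)) := (continuousAt_regKerDeriv hz).tendsto.const_smul _
  have h2 : Tendsto (fun h => regKer h z • fderiv ℝ (fun z => (θ z : ℂ)) z) (𝓝 0)
      (𝓝 (regKer 0 z • fderiv ℝ (fun z => (θ z : ℂ)) z)) :=
    (continuousAt_regKer hz).tendsto.smul_const _
  exact h1.add h2

theorem tendsto_cutKer (hz : z ≠ 0) : Tendsto (fun h => cutKer θ h z) (𝓝 0) (𝓝 (cutKer θ 0 z)) :=
  continuousAt_const.mul (continuousAt_regKer hz)

theorem aestronglyMeasurable_cutKerDeriv (h : ℝ) : AEStronglyMeasurable (cutKerDeriv θ h) :=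
  ((((contDiff_bump θ).continuous.stronglyMeasurable.smul (stronglyMeasurable_regKerDeriv h)).add
    ((measurable_regKer h).stronglyMeasurable.smul
      ((contDiff_bump θ).continuous_fderiv (by simp)).stronglyMeasurable))).aestronglyMeasurable

/-- The limiting kernel is not smooth at 0, but its derivative is O(1/|z|). The convolutions with
the kernels for h = 1/(m+1) and their derivatives converge uniformly, so the limit is C¹. This is
the gain of one derivative that starts the bootstrap. -/
theorem contDiff_one_cutConv {f : ℂ → ℂ} (hf : Integrable f) {B : ℝ}
    (hB : ∀ z, ‖f z‖ ≤ B) : ContDiff ℝ 1 (cutConv θ 0 f) := by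
  have hfl : LocallyIntegrable f := hf.locallyIntegrable
  let P := (ContinuousLinearMap.mul ℝ ℂ).precompL ℂ
  set a : ℕ → ℝ := fun m => 1 / ((m : ℝ) + 1) with ha
  have ha0 : ∀ m, a m ≠ 0 := fun m => by rw [ha]; positivity
  have halim : Tendsto a atTop (𝓝 0) := tendsto_one_div_add_atTop_nhds_zero_nat
  obtain ⟨g, hg, hgb⟩ := exists_cutKerDeriv_bound θ
  obtain ⟨g', hg', hgb'⟩ := exists_cutKer_bound θ
  have hU : TendstoUniformly (fun m => convolution (cutKerDeriv θ (a m)) f P volume)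
      (convolution (cutKerDeriv θ 0) f P volume) atTop := by
    refine tendstoUniformly_convolution P hg (fun m => aestronglyMeasurable_cutKerDeriv θ _)
      (aestronglyMeasurable_cutKerDeriv θ 0) (fun m => ?_) ?_ ?_ hf.1 hB
    · filter_upwards [ae_ne_zero] with z hz using hgb _ z hz
    · filter_upwards [ae_ne_zero] with z hz using hgb _ z hz
    · filter_upwards [ae_ne_zero] with z hz using (tendsto_cutKerDeriv θ hz).comp halim
  have hV : TendstoUniformly (fun m => cutConv θ (a m) f) (cutConv θ 0 f) atTop := by
    refine tendstoUniformly_convolution _ hg' (fun m => (measurable_cutKer θ _).aestronglyMeasurable)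
      (measurable_cutKer θ _).aestronglyMeasurable (fun m => ?_) ?_ ?_ hf.1 hB
    · exact Eventually.of_forall fun z => hgb' _ z
    · exact Eventually.of_forall fun z => hgb' _ z
    · filter_upwards [ae_ne_zero] with z hz using (tendsto_cutKer θ hz).comp halim
  have hd : ∀ m x, HasFDerivAt (cutConv θ (a m) f) (convolution (cutKerDeriv θ (a m)) f P volume x)
      x := by
    intro m x
    have h := (hasCompactSupport_cutKer θ (a m)).hasFDerivAt_convolution_left
      (ContinuousLinearMap.mul ℝ ℂ) ((contDiff_cutKer θ (ha0 m)).of_le (by exact_mod_cast le_top))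
      hfl x
    rwa [show fderiv ℝ (cutKer θ (a m)) = cutKerDeriv θ (a m) from
      funext fun z => fderiv_cutKer θ (Or.inl (ha0 m))] at h
  have hcont : ∀ m, Continuous (convolution (cutKerDeriv θ (a m)) f P volume) := by
    intro m
    have e : cutKerDeriv θ (a m) = fderiv ℝ (cutKer θ (a m)) :=
      (funext fun z => fderiv_cutKer θ (Or.inl (ha0 m))).symm
    rw [e]
    exact ((hasCompactSupport_cutKer θ (a m)).fderiv ℝ).continuous_convolution_left P
      ((contDiff_cutKer θ (ha0 m)).continuous_fderiv (by simp)) hfl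
  rw [contDiff_one_iff_hasFDerivAt]
  refine ⟨convolution (cutKerDeriv θ 0) f P volume, hU.continuous (Eventually.of_forall hcont).frequently, fun x => ?_⟩
  exact hasFDerivAt_of_tendstoUniformly hU hd
    (fun x => hV.tendsto_at x) x

theorem locallyIntegrable_cutKer (h : ℝ) : LocallyIntegrable (cutKer θ h) := by
  obtain ⟨g', hg', hgb'⟩ := exists_cutKer_bound θ
  exact (hg'.mono' (measurable_cutKer θ h).aestronglyMeasurable
    (Eventually.of_forall fun z => hgb' _ z)).locallyIntegrable

/-- Derivatives of the convolution can be put on f, so each induction step applies the previous case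
to a directional derivative of f; k = 0 is the gain of one derivative. -/
theorem contDiff_cutConv (k : ℕ) {f : ℂ → ℂ} (hf : ContDiff ℝ k f)
    (hf' : HasCompactSupport f) : ContDiff ℝ (k + 1) (cutConv θ 0 f) := by
  induction k generalizing f with
  | zero =>
    obtain ⟨B, hB⟩ := hf'.exists_bound_of_continuous hf.continuous
    simpa using contDiff_one_cutConv θ (hf.continuous.integrable_of_hasCompactSupport hf') hB
  | succ k ih =>
    have hf1 : ContDiff ℝ 1 f := hf.of_le (by exact_mod_cast Nat.le_add_left 1 k)
    have hd := fun x => hf'.hasFDerivAt_convolution_right (ContinuousLinearMap.mul ℝ ℂ)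
      (locallyIntegrable_cutKer θ 0) hf1 x
    push_cast
    rw [contDiff_succ_iff_fderiv_apply]
    refine ⟨fun x => (hd x).differentiableAt, fun h => by simp at h, fun w => ?_⟩
    have e : (fun x => fderiv ℝ (cutConv θ 0 f) x w) = cutConv θ 0 fun x => fderiv ℝ f x w := by
      funext x
      have h1 : fderiv ℝ (cutConv θ 0 f) x = _ := (hd x).fderiv
      rw [h1, convolution_precompR_apply]
      · rfl
      · exact locallyIntegrable_cutKer θ 0
      · exact hf'.fderiv ℝ
      · exact hf1.continuous_fderiv one_ne_zero
    rw [e]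
    refine ih ((hf.fderiv_right (m := k) (by exact_mod_cast le_rfl)).clm_apply contDiff_const) ?_
    refine (hf'.fderiv ℝ).mono fun x hx => ?_
    contrapose! hx
    rw [notMem_support] at hx ⊢
    simp [hx]

/-! ### Elliptic regularity -/

open Filter Topology ComplexConjugate

theorem one_add_one_le_infty : (1 : ℕ∞ω) + 1 ≤ ∞ := by
  rw [one_add_one_eq_two]
  exact WithTop.coe_le_coe.2 (le_top : (2 : ℕ∞) ≤ ⊤)

theorem dHol_mul {f g : ℂ → ℂ} (hf : DifferentiableAt ℝ f z) (hg : DifferentiableAt ℝ g z) :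
    dHol (fun z => f z * g z) z = dHol f z * g z + f z * dHol g z :=
  (HasDHolAt.mul ⟨hf, rfl⟩ ⟨hg, rfl⟩).eq

theorem dHol_add {f g : ℂ → ℂ} (hf : DifferentiableAt ℝ f z) (hg : DifferentiableAt ℝ g z) :
    dHol (fun z => f z + g z) z = dHol f z + dHol g z := (HasDHolAt.add ⟨hf, rfl⟩ ⟨hg, rfl⟩).eq

theorem dHol_comp_sub {f : ℂ → ℂ} (hf : ContDiff ℝ 1 f) (a : ℂ) :
    dHol (fun z => f (a - z)) = fun z => -dHol f (a - z) := by
  funext z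
  have h1 : HasFDerivAt (fun z : ℂ => a - z) (-ContinuousLinearMap.id ℝ ℂ) z :=
    (hasFDerivAt_id z).const_sub a
  have h2 : HasFDerivAt (fun z => f (a - z)) _ z :=
    ((hf.differentiable one_ne_zero) (a - z)).hasFDerivAt.comp z h1
  simp only [dHol, h2.fderiv, ContinuousLinearMap.comp_apply, _root_.neg_apply,
    ContinuousLinearMap.id_apply, map_neg]
  ring

theorem integral_mul_dHol_dHol {η f : ℂ → ℂ} (hη : ContDiff ℝ ∞ η) (hη' : HasCompactSupport η)
    (hf : ContDiff ℝ ∞ f) : ∫ b, η b * dHol (dHol f) b = ∫ b, dHol (dHol η) b * f b := by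
  have h1 : ∀ {g : ℂ → ℂ}, ContDiff ℝ ∞ g → ContDiff ℝ 1 g := fun hg =>
    hg.of_le (by exact_mod_cast le_top)
  have h2 : ∀ {g : ℂ → ℂ}, ContDiff ℝ ∞ g → ContDiff ℝ 1 (dHol g) := fun hg =>
    contDiff_dHol hg one_add_one_le_infty
  rw [integral_mul_dHol (h1 hη) hη' (h2 hf),
    integral_mul_dHol (h2 hη) (HasCompactSupport.dHol hη') (h1 hf), neg_neg]

/-- The smooth error of the parametrix, regularized. -/
def cutErr (h : ℝ) (z : ℂ) : ℂ :=
  2 * dHol (fun z => (θ z : ℂ)) z * regKerHol h z + dHol (dHol fun z => (θ z : ℂ)) z * regKer h z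

/-- Leibniz rule: when both derivatives fall on the kernel the delta family appears. All other terms
contain derivatives of the cutoff, which vanish near 0. -/
theorem dHol_dHol_cutKer {h : ℝ} (hh : h ≠ 0) (z : ℂ) : dHol (dHol (cutKer θ h)) z =
      (θ z : ℂ) * (2 * (h : ℂ) ^ 4 * ((regDen h z)⁻¹) ^ 3) + cutErr θ h z := by
  have hθ := contDiff_bump θ
  have hM := contDiff_regKer hh
  have hdθ : ContDiff ℝ 1 (dHol fun z => (θ z : ℂ)) := contDiff_dHol hθ one_add_one_le_infty
  have hdM : ContDiff ℝ 1 (dHol (regKer h)) := contDiff_dHol hM one_add_one_le_infty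
  have d1 : Differentiable ℝ fun z => (θ z : ℂ) := hθ.differentiable (by simp)
  have d2 : Differentiable ℝ (regKer h) := hM.differentiable (by simp)
  have d3 := hdθ.differentiable one_ne_zero
  have d4 := hdM.differentiable one_ne_zero
  have e1 : dHol (cutKer θ h) = fun z => dHol (fun z => (θ z : ℂ)) z * regKer h z +
      (θ z : ℂ) * dHol (regKer h) z := funext fun z => dHol_mul (d1 z) (d2 z)
  have e2 : dHol (regKer h) = regKerHol h := funext fun z => dHol_regKer (Or.inl hh)
  have e3 := dHol_add (f := fun z => dHol (fun z => (θ z : ℂ)) z * regKer h z)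
    (g := fun z => (θ z : ℂ) * dHol (regKer h) z) ((d3 z).mul (d2 z)) ((d1 z).mul (d4 z))
  rw [e1, e3, dHol_mul (d3 z) (d2 z),
    dHol_mul (d1 z) (d4 z), e2, dHol_regKerHol (Or.inl hh), cutErr]
  ring

theorem dHol_bump_eq_zero (hz : ‖z‖ < θ.rIn) : dHol (fun z => (θ z : ℂ)) =ᶠ[𝓝 z] fun _ => 0 := by
  have : {y : ℂ | ‖y‖ < θ.rIn} ∈ 𝓝 z := (isOpen_lt continuous_norm continuous_const).mem_nhds hz
  have h : (fun z => (θ z : ℂ)) =ᶠ[𝓝 z] fun _ => 1 := by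
    filter_upwards [this] with y hy
    rw [θ.one_of_mem_closedBall (by simpa using le_of_lt hy), ofReal_one]
  refine (dHol_congr h).trans (Eventually.of_forall fun y => ?_)
  simp [dHol]

theorem cutErr_eq_zero (h : ℝ) (hz : ‖z‖ < θ.rIn) : cutErr θ h =ᶠ[𝓝 z] fun _ => 0 := by
  have h1 := dHol_bump_eq_zero θ hz
  filter_upwards [h1.eventuallyEq_nhds] with y hy
  have e1 : dHol (dHol fun z => (θ z : ℂ)) y = 0 := by
    rw [(dHol_congr hy).self_of_nhds]; simp [dHol]
  rw [cutErr, hy.self_of_nhds, e1]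
  ring

theorem hasCompactSupport_cutErr (h : ℝ) : HasCompactSupport (cutErr θ h) := by
  have h1 := HasCompactSupport.dHol (hasCompactSupport_bump θ)
  exact ((h1.mul_left (f := fun _ => 2)).mul_right).add (HasCompactSupport.dHol h1).mul_right

/-- The singularity at 0 is harmless, because the cutoff is constant near 0 and the error vanishes
there. -/
theorem contDiff_cutErr : ContDiff ℝ ∞ (cutErr θ 0) := by
  rw [contDiff_iff_contDiffAt]
  intro z
  by_cases hz : z = 0
  · exact contDiffAt_const.congr_of_eventuallyEq (cutErr_eq_zero θ 0 (by simpa [hz] using θ.rIn_pos))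
  · have h1 : ContDiff ℝ ∞ (dHol fun z => (θ z : ℂ)) := contDiff_dHol (contDiff_bump θ) le_rfl
    have h2 : ContDiff ℝ ∞ (dHol (dHol fun z => (θ z : ℂ))) := contDiff_dHol h1 le_rfl
    have hi : ContDiffAt ℝ ∞ (fun z => (regDen 0 z)⁻¹) z :=
      (contDiff_regDen 0).contDiffAt.inv (regDen_ne_zero (Or.inr hz))
    have hc : ContDiff ℝ ∞ fun z : ℂ => conj z := conjCLE.contDiff
    have hz : ContDiff ℝ ∞ fun z : ℂ => z := contDiff_id
    exact ((contDiff_const.mul h1).contDiffAt.mul ((((contDiff_const.mul hz).mul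
      (contDiff_regDen 0)).sub ((hz.pow 2).mul hc)).contDiffAt.mul (hi.pow 2))).add
      (h2.contDiffAt.mul ((hz.pow 2).contDiffAt.mul hi))

theorem exists_cutErr_bound : ∃ g : ℂ → ℝ, Integrable g ∧ ∀ h z, ‖cutErr θ h z‖ ≤ g z := by
  have h1 : ContDiff ℝ ∞ (dHol fun z => (θ z : ℂ)) := contDiff_dHol (contDiff_bump θ) le_rfl
  have h2 : ContDiff ℝ ∞ (dHol (dHol fun z => (θ z : ℂ))) := contDiff_dHol h1 le_rfl
  have c1 := HasCompactSupport.dHol (hasCompactSupport_bump θ)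
  have i1 : Integrable (dHol fun z => (θ z : ℂ)) := h1.continuous.integrable_of_hasCompactSupport c1
  have i2 : Integrable (dHol (dHol fun z => (θ z : ℂ))) := h2.continuous.integrable_of_hasCompactSupport (HasCompactSupport.dHol c1)
  refine ⟨_, (i1.norm.const_mul (2 * (3 * θ.rIn⁻¹))).add i2.norm, fun h z => ?_⟩
  have hr := θ.rIn_pos
  by_cases hz : ‖z‖ < θ.rIn
  · rw [(cutErr_eq_zero θ h hz).self_of_nhds, norm_zero]
    simp only [Pi.add_apply]
    positivity
  · push Not at hz
    have hz0 : z ≠ 0 := norm_pos_iff.1 (hr.trans_le hz)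
    have h3 : ‖regKerHol h z‖ ≤ 3 * θ.rIn⁻¹ := (norm_regKerHol_le h hz0).trans (by gcongr)
    have h4 := norm_regKer_le h z
    refine (norm_add_le _ _).trans (add_le_add ?_ ?_)
    · rw [norm_mul, norm_mul, norm_ofNat]
      calc _ ≤ 2 * ‖dHol (fun z => (θ z : ℂ)) z‖ * (3 * θ.rIn⁻¹) := by gcongr
        _ = _ := by ring
    · rw [norm_mul]
      exact mul_le_of_le_one_right (norm_nonneg _) h4

theorem measurable_cutErr (h : ℝ) : Measurable (cutErr θ h) := by
  have h1 : ContDiff ℝ ∞ (dHol fun z => (θ z : ℂ)) := contDiff_dHol (contDiff_bump θ) le_rfl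
  have h2 : ContDiff ℝ ∞ (dHol (dHol fun z => (θ z : ℂ))) := contDiff_dHol h1 le_rfl
  exact ((h1.continuous.measurable.const_mul 2).mul (measurable_regKerHol h)).add
    (h2.continuous.measurable.mul (measurable_regKer h))

/-- The normalization of the approximate identity. -/
def deltaMass : ℂ := ∫ w : ℂ, ((2 * ((1 + ‖w‖ ^ 2) ^ 3)⁻¹ : ℝ) : ℂ)

theorem integrable_deltaKer : Integrable fun w : ℂ => 2 * ((1 + ‖w‖ ^ 2) ^ 3)⁻¹ := by
  have := integrable_rpow_neg_one_add_norm_sq (E := ℂ) (μ := volume) (r := 6)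
    (by rw [finrank_real_complex]; norm_num)
  refine (this.const_mul 2).congr (Eventually.of_forall fun w => ?_)
  have h0 : (0 : ℝ) ≤ 1 + ‖w‖ ^ 2 := by positivity
  simp only
  rw [show (-6 / 2 : ℝ) = -((3 : ℕ) : ℝ) by norm_num, rpow_neg h0, Real.rpow_natCast]

theorem deltaMass_ne_zero : deltaMass ≠ 0 := by
  have h : deltaMass = ((∫ w : ℂ, 2 * ((1 + ‖w‖ ^ 2) ^ 3)⁻¹ : ℝ) : ℂ) := integral_ofReal
  rw [h, Complex.ofReal_ne_zero]
  refine (integral_pos_of_integrable_nonneg_nonzero (x := (0 : ℂ)) ?_ integrable_deltaKer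
    (fun w => by positivity) (by simp)).ne'
  exact continuous_const.mul (Continuous.inv₀ (by fun_prop) fun w => by positivity)

theorem integral_delta (F : ℂ → ℂ) {h : ℝ} (hh : 0 < h) :
    ∫ z, F z * (2 * (h : ℂ) ^ 4 * ((regDen h z)⁻¹) ^ 3) =
      ∫ w : ℂ, F (h • w) * ((2 * ((1 + ‖w‖ ^ 2) ^ 3)⁻¹ : ℝ) : ℂ) := by
  have h1 := Measure.integral_comp_smul (volume : Measure ℂ)
    (fun z => F z * (2 * (h : ℂ) ^ 4 * ((regDen h z)⁻¹) ^ 3)) h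
  have hc : (h : ℂ) ≠ 0 := by exact_mod_cast hh.ne'
  have e : ∀ w : ℂ, F (h • w) * (2 * (h : ℂ) ^ 4 * ((regDen h (h • w))⁻¹) ^ 3) =
      ((h ^ 2)⁻¹ : ℝ) • (F (h • w) * ((2 * ((1 + ‖w‖ ^ 2) ^ 3)⁻¹ : ℝ) : ℂ)) := by
    intro w
    have hd : regDen h (h • w) = (h : ℂ) ^ 2 * ((1 + ‖w‖ ^ 2 : ℝ) : ℂ) := by
      rw [regDen_eq, norm_smul, norm_of_nonneg hh.le]; push_cast; ring
    have hw : ((1 + ‖w‖ ^ 2 : ℝ) : ℂ) ≠ 0 := by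
      exact_mod_cast (by positivity : (1 + ‖w‖ ^ 2 : ℝ) ≠ 0)
    rw [hd]
    generalize F (h • w) = y
    rw [real_smul]
    push_cast at hw ⊢
    field_simp
  simp only [e] at h1
  rw [integral_smul, finrank_real_complex, abs_of_pos (by positivity)] at h1
  exact (smul_right_injective ℂ (inv_ne_zero (pow_ne_zero 2 hh.ne')) h1).symm

/-- For h > 0 two integrations by parts give the identity with an approximate delta. Letting h → 0,
each of the three integrals converges by dominated convergence, the delta term after the rescaling z
= h w. -/
theorem parametrix_zero {f : ℂ → ℂ} (hf : ContDiff ℝ ∞ f) (hf' : HasCompactSupport f) :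
    ∫ z, cutKer θ 0 z * dHol (dHol f) z = deltaMass * f 0 + ∫ z, cutErr θ 0 z * f z := by
  set a : ℕ → ℝ := fun m => 1 / ((m : ℝ) + 1) with ha
  have ha0 : ∀ m, 0 < a m := fun m => by rw [ha]; positivity
  have halim : Tendsto a atTop (𝓝 0) := tendsto_one_div_add_atTop_nhds_zero_nat
  have hdf : ContDiff ℝ ∞ (dHol (dHol f)) := contDiff_dHol (contDiff_dHol hf (k := ∞) le_rfl) le_rfl
  obtain ⟨B, hB⟩ := hf'.exists_bound_of_continuous hf.continuous
  obtain ⟨B', hB'⟩ := (HasCompactSupport.dHol (HasCompactSupport.dHol hf')).exists_bound_of_continuous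
    hdf.continuous
  have hB0 : 0 ≤ B := (norm_nonneg _).trans (hB 0)
  obtain ⟨g, hg, hgb⟩ := exists_cutKer_bound θ
  obtain ⟨g', hg', hgb'⟩ := exists_cutErr_bound θ
  have L1 : Tendsto (fun m => ∫ z, cutKer θ (a m) z * dHol (dHol f) z) atTop
      (𝓝 (∫ z, cutKer θ 0 z * dHol (dHol f) z)) := by
    refine tendsto_integral_of_dominated_convergence (fun z => g z * B') (fun m =>
      ((measurable_cutKer θ _).mul hdf.continuous.measurable).aestronglyMeasurable)
      (hg.mul_const B') (fun m => Eventually.of_forall fun z => ?_) ?_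
    · rw [norm_mul]
      exact mul_le_mul (hgb _ z) (hB' z) (norm_nonneg _) ((norm_nonneg _).trans (hgb 0 z))
    · filter_upwards [ae_ne_zero] with z hz
      exact ((tendsto_cutKer θ hz).comp halim).mul_const _
  have L2 : Tendsto (fun m => ∫ z, cutErr θ (a m) z * f z) atTop
      (𝓝 (∫ z, cutErr θ 0 z * f z)) := by
    refine tendsto_integral_of_dominated_convergence (fun z => g' z * B) (fun m =>
      ((measurable_cutErr θ _).mul hf.continuous.measurable).aestronglyMeasurable)
      (hg'.mul_const B) (fun m => Eventually.of_forall fun z => ?_) ?_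
    · rw [norm_mul]
      exact mul_le_mul (hgb' _ z) (hB z) (norm_nonneg _) ((norm_nonneg _).trans (hgb' 0 z))
    · filter_upwards [ae_ne_zero] with z hz
      have : Tendsto (fun h => cutErr θ h z) (𝓝 0) (𝓝 (cutErr θ 0 z)) :=
        (continuousAt_const.mul (continuousAt_regKerHol hz)).add
          (continuousAt_const.mul (continuousAt_regKer hz))
      exact (this.comp halim).mul_const _
  have L3 : Tendsto (fun m => ∫ w : ℂ, (((θ (a m • w) : ℝ) : ℂ) * f (a m • w)) *
      ((2 * ((1 + ‖w‖ ^ 2) ^ 3)⁻¹ : ℝ) : ℂ)) atTop (𝓝 (deltaMass * f 0)) := by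
    have e : deltaMass * f 0 = ∫ w : ℂ, f 0 * ((2 * ((1 + ‖w‖ ^ 2) ^ 3)⁻¹ : ℝ) : ℂ) := by
      rw [integral_const_mul, deltaMass, mul_comm]
    have hc : Continuous fun z => (θ z : ℂ) * f z := (contDiff_bump θ).continuous.mul hf.continuous
    rw [e]
    refine tendsto_integral_of_dominated_convergence (fun w => B * (2 * ((1 + ‖w‖ ^ 2) ^ 3)⁻¹))
      (fun m => ?_) (integrable_deltaKer.const_mul B) (fun m => Eventually.of_forall fun w => ?_) ?_
    · have h1 : Continuous fun w : ℂ => ((θ (a m • w) : ℝ) : ℂ) * f (a m • w) :=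
        hc.comp (continuous_const_smul (a m))
      exact h1.aestronglyMeasurable.mul integrable_deltaKer.ofReal.1
    · rw [norm_mul, norm_mul, norm_real (2 * _), norm_of_nonneg (by positivity)]
      refine mul_le_mul_of_nonneg_right ?_ (by positivity)
      calc _ ≤ 1 * B := mul_le_mul (norm_bump_le θ _) (hB _) (norm_nonneg _) zero_le_one
        _ = B := one_mul B
    · refine Eventually.of_forall fun w => Tendsto.mul_const _ ?_
      have h1 : Tendsto (fun m => a m • w) atTop (𝓝 0) := by
        simpa using halim.smul_const w
      have h2 := (hc.tendsto 0).comp h1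
      have h3 : θ (0 : ℂ) = 1 := θ.one_of_mem_closedBall (by simpa using θ.rIn_pos.le)
      rw [h3, ofReal_one, one_mul] at h2
      exact h2
  have key : ∀ m, ∫ z, cutKer θ (a m) z * dHol (dHol f) z =
      (∫ w : ℂ, (((θ (a m • w) : ℝ) : ℂ) * f (a m • w)) *
        ((2 * ((1 + ‖w‖ ^ 2) ^ 3)⁻¹ : ℝ) : ℂ)) + ∫ z, cutErr θ (a m) z * f z := by
    intro m
    rw [integral_mul_dHol_dHol (contDiff_cutKer θ (ha0 m).ne') (hasCompactSupport_cutKer θ _) hf,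
      ← integral_delta (fun z => (θ z : ℂ) * f z) (ha0 m), ← integral_add]
    · congr 1; funext z
      rw [dHol_dHol_cutKer θ (ha0 m).ne']; ring
    · refine Continuous.integrable_of_hasCompactSupport ?_ (hf'.mul_left.mul_right)
      refine ((contDiff_bump θ).continuous.mul hf.continuous).mul (continuous_const.mul ?_)
      exact ((contDiff_regDen _).continuous.inv₀ fun z => regDen_ne_zero (Or.inl (ha0 m).ne')).pow 3
    · refine (hg'.mul_const B).mono'
        ((measurable_cutErr θ _).mul hf.continuous.measurable).aestronglyMeasurable
        (Eventually.of_forall fun z => ?_)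
      rw [norm_mul]
      exact mul_le_mul (hgb' _ z) (hB z) (norm_nonneg _) ((norm_nonneg _).trans (hgb' 0 z))
  exact tendsto_nhds_unique L1 ((L3.add L2).congr fun m => (key m).symm)

theorem cutKer_eq_zero (h : ℝ) (hz : θ.rOut < ‖z‖) : cutKer θ h z = 0 ∧ cutErr θ h z = 0 := by
  have e := bump_eq_zero θ hz
  have e0 : (θ z : ℂ) = 0 := e.self_of_nhds
  have hz' : dHol (fun _ : ℂ => (0 : ℂ)) = fun _ => 0 := by funext y; simp [dHol]
  have e1 := dHol_congr e
  rw [hz'] at e1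
  have e2 := dHol_congr e1
  rw [hz'] at e2
  refine ⟨by rw [cutKer, e0, zero_mul], ?_⟩
  rw [cutErr, e1.self_of_nhds, e2.self_of_nhds]
  ring

/-- The identity at the origin is applied to z ↦ f (x₁ - z). The reflection changes the sign of each
derivative, and the two signs cancel. -/
theorem isParametrix_cutKer {x₀ x₁ : ℂ} (h : closedBall x₁ θ.rOut ⊆ closedBall x₀ r) :
    IsParametrix (fun x => cutKer θ 0 (x₁ - x)) (fun x => cutErr θ 0 (x₁ - x)) deltaMass x₁ x₀ r := by
  obtain ⟨g, hg, hgb⟩ := exists_cutKer_bound θ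
  have hz : ∀ x, x ∉ closedBall x₀ r → θ.rOut < ‖x₁ - x‖ := fun x hx => by
    by_contra h'
    push Not at h'
    exact hx (h (by rwa [mem_closedBall, dist_comm, dist_eq_norm]))
  have hi : Integrable (cutKer θ 0) := hg.mono' (measurable_cutKer θ 0).aestronglyMeasurable
    (Eventually.of_forall fun z => hgb _ z)
  have hi2 : Integrable (cutErr θ 0) := (contDiff_cutErr θ).continuous.integrable_of_hasCompactSupport
    (hasCompactSupport_cutErr θ 0)
  refine ⟨hi.comp_sub_left x₁, hi2.comp_sub_left x₁, fun x hx => (cutKer_eq_zero θ 0 (hz x hx)).1,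
    fun x hx => (cutKer_eq_zero θ 0 (hz x hx)).2, h (by simp [θ.rOut_pos.le]), fun f hf hf' => ?_⟩
  have hF : ContDiff ℝ ∞ fun z => f (x₁ - z) := hf.comp (contDiff_const.sub contDiff_id)
  have hF' : HasCompactSupport fun z => f (x₁ - z) := hf'.comp_homeomorph (Homeomorph.subLeft x₁)
  have hp := parametrix_zero θ hF hF'
  have h1 : ContDiff ℝ 1 f := hf.of_le (by exact_mod_cast le_top)
  have h2 : ContDiff ℝ 1 (dHol f) := contDiff_dHol hf one_add_one_le_infty
  have e : dHol (dHol fun z => f (x₁ - z)) = fun z => dHol (dHol f) (x₁ - z) := by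
    rw [dHol_comp_sub h1]
    funext z
    have h3 := congrFun (dHol_comp_sub h2 x₁) z
    have h4 : DifferentiableAt ℝ (fun z => dHol f (x₁ - z)) z :=
      (h2.comp (contDiff_const.sub contDiff_id)).differentiable one_ne_zero z
    have h5 := (HasDHolAt.const_mul ⟨h4, h3⟩ (-1)).eq
    simpa using h5
  rw [e, sub_zero] at hp
  rw [← integral_sub_left_eq_self (fun x => cutKer θ 0 (x₁ - x) * dHol (dHol f) x) volume x₁,
    ← integral_sub_left_eq_self (fun x => cutErr θ 0 (x₁ - x) * f x) volume x₁]
  simpa only [sub_sub_cancel] using hp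

section

variable {x₀ : ℂ} {r : ℝ} {γ q : ℂ → ℂ}

/-- The weak form of `∂² γ = q γ` on a disc. -/
structure IsWeakSolution (x₀ : ℂ) (r : ℝ) (γ q : ℂ → ℂ) : Prop where
  integrableOn : ∀ r' < r, IntegrableOn γ (closedBall x₀ r')
  bounded : ∀ r' < r, ∃ M, ∀ x ∈ closedBall x₀ r', ‖γ x‖ ≤ M
  contDiffAt : ∀ y ∈ ball x₀ r, ContDiffAt ℝ ∞ q y
  eq : ∀ r', 0 < r' → r' < r → ∀ κ κ₂ ε x₁, IsParametrix κ κ₂ ε x₁ x₀ r' →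
    ∫ x, κ x * (q x * γ x) = ε * γ x₁ + ∫ x, κ₂ x * γ x

end

end

/-! ### Interior regularity of weak solutions -/

section

open Filter Topology ComplexConjugate

section

variable {x₀ : ℂ} {r : ℝ} {γ q : ℂ → ℂ}

theorem closedBall_subset_of_dist {x₁ : ℂ} {δ : ℝ} (h : dist x₁ x₀ + δ ≤ R) :
    closedBall x₁ δ ⊆ closedBall x₀ R := Metric.closedBall_subset_closedBall' (by linarith)

/-- The weak equation is tested with the parametrix centred at x. For x within δ of x₁ its support
lies where χ = 1, so χ can be inserted to turn both integrals into convolutions with globally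
defined, compactly supported functions. -/
theorem IsWeakSolution.representation (h : IsWeakSolution x₀ r γ q) {x₁ : ℂ} {δ : ℝ} (hδ : 0 < δ)
    (hr : dist x₁ x₀ + 4 * δ < r) (θ : ContDiffBump (0 : ℂ)) (hθ : θ.rOut = δ)
    (χ : ContDiffBump x₁) (hχ : χ.rIn = 2 * δ) (hx : x ∈ ball x₁ δ) :
    deltaMass * γ x = cutConv θ 0 (fun y => ((χ y : ℝ) : ℂ) * (q y * γ y)) x -
      convolution (cutErr θ 0) (fun y => ((χ y : ℝ) : ℂ) * γ y)
        (ContinuousLinearMap.mul ℝ ℂ) volume x := by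
  have hd : 0 ≤ dist x₁ x₀ := dist_nonneg
  have hx' : dist x x₁ < δ := hx
  have hxx : dist x x₀ ≤ dist x x₁ + dist x₁ x₀ := dist_triangle _ _ _
  have e := h.eq (dist x₁ x₀ + 2 * δ) (by linarith) (by linarith) _ _ _ _
    (isParametrix_cutKer θ (x₁ := x) (x₀ := x₀)
      (closedBall_subset_of_dist (by rw [hθ]; linarith)))
  have h1 : ∀ y, θ.rOut < ‖x - y‖ ∨ χ y = 1 := fun y => by
    rcases lt_or_ge θ.rOut ‖x - y‖ with hy | hy
    · exact Or.inl hy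
    · refine Or.inr (χ.one_of_mem_closedBall ?_)
      rw [hθ, ← dist_eq_norm, dist_comm] at hy
      rw [mem_closedBall, hχ]
      linarith [dist_triangle y x x₁]
  have e1 : cutConv θ 0 (fun y => ((χ y : ℝ) : ℂ) * (q y * γ y)) x =
      ∫ y, cutKer θ 0 (x - y) * (q y * γ y) := by
    rw [cutConv, convolution_eq_swap]
    congr 1; funext y
    rw [ContinuousLinearMap.mul_apply']
    rcases h1 y with hy | hy
    · rw [(cutKer_eq_zero θ 0 hy).1, zero_mul, zero_mul]
    · rw [hy, ofReal_one, one_mul]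
  have e2 : convolution (cutErr θ 0) (fun y => ((χ y : ℝ) : ℂ) * γ y)
      (ContinuousLinearMap.mul ℝ ℂ) volume x = ∫ y, cutErr θ 0 (x - y) * γ y := by
    rw [convolution_eq_swap]
    congr 1; funext y
    rw [ContinuousLinearMap.mul_apply']
    rcases h1 y with hy | hy
    · rw [(cutKer_eq_zero θ 0 hy).2, zero_mul, zero_mul]
    · rw [hy, ofReal_one, one_mul]
  rw [e1, e2, e, add_sub_cancel_right]

theorem IsWeakSolution.integrable_bump_mul (h : IsWeakSolution x₀ r γ q) {x₁ : ℂ}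
    (χ : ContDiffBump x₁) (hχ : dist x₁ x₀ + χ.rOut < r) {p : ℂ → ℂ}
    (hp : ∀ y ∈ ball x₀ r, ContDiffAt ℝ ∞ p y) :
    Integrable (fun y => ((χ y : ℝ) : ℂ) * (p y * γ y)) ∧
      ∃ B, ∀ y, ‖((χ y : ℝ) : ℂ) * (p y * γ y)‖ ≤ B := by
  set R := dist x₁ x₀ + χ.rOut with hR
  obtain ⟨hc, hs⟩ := contDiff_bump_mul χ (R := r - dist x₁ x₀) (by linarith) le_rfl (f := p)
    (fun y hy => hp y (by
      rw [mem_ball] at hy ⊢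
      linarith [dist_triangle y x₁ x₀]))
  obtain ⟨B, hB⟩ := hs.exists_bound_of_continuous hc.continuous
  obtain ⟨M, hM⟩ := h.bounded R hχ
  have hz : ∀ y, y ∉ closedBall x₀ R → χ y = 0 := fun y hy => by
    refine χ.zero_of_le_dist ?_
    rw [mem_closedBall, not_le] at hy
    linarith [dist_triangle y x₁ x₀]
  have hi : IntegrableOn (fun y => ((χ y : ℝ) : ℂ) * p y * γ y) (closedBall x₀ R) :=
    (h.integrableOn R hχ).bdd_mul hc.continuous.aestronglyMeasurable (Eventually.of_forall hB)
  simp only [← mul_assoc]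
  refine ⟨(integrableOn_iff_integrable_of_support_subset fun y hy => ?_).1 hi, B * |M|, fun y => ?_⟩
  · by_contra hy'
    exact hy (by simp [hz y hy'])
  · have hB0 := (norm_nonneg _).trans (hB y)
    by_cases hy : y ∈ closedBall x₀ R
    · rw [norm_mul]
      exact mul_le_mul (hB y) ((hM y hy).trans (le_abs_self M)) (norm_nonneg _) hB0
    · rw [hz y hy, ofReal_zero, zero_mul, zero_mul, norm_zero]
      positivity

theorem IsWeakSolution.contDiffAt_of_conv (h : IsWeakSolution x₀ r γ q) {x₁ : ℂ} {δ : ℝ}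
    (hδ : 0 < δ) (hr : dist x₁ x₀ + 4 * δ < r) (θ : ContDiffBump (0 : ℂ)) (hθ : θ.rOut = δ)
    (χ : ContDiffBump x₁) (hχ : χ.rIn = 2 * δ) (hχ' : χ.rOut = 3 * δ) {k : ℕ}
    (hF : ContDiff ℝ k (cutConv θ 0 fun y => ((χ y : ℝ) : ℂ) * (q y * γ y))) :
    ContDiffAt ℝ k γ x₁ := by
  have hΓ := (h.integrable_bump_mul χ (by linarith) (p := fun _ => 1)
    fun _ _ => contDiffAt_const).1
  simp only [one_mul] at hΓ
  have hE := (hasCompactSupport_cutErr θ 0).contDiff_convolution_left (ContinuousLinearMap.mul ℝ ℂ)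
    ((contDiff_cutErr θ).of_le (by exact_mod_cast le_top : (k : ℕ∞ω) ≤ ∞)) hΓ.locallyIntegrable
  have hD := ((hF.sub hE).contDiffAt (x := x₁)).const_smul deltaMass⁻¹
  refine hD.congr_of_eventuallyEq ?_
  filter_upwards [Metric.ball_mem_nhds x₁ hδ] with x hx
  have e := h.representation hδ hr θ hθ χ hχ hx
  exact (by rw [← e, smul_eq_mul, inv_mul_cancel_left₀ deltaMass_ne_zero] : γ x = deltaMass⁻¹ • (_ - _))

/-- Bootstrap on the representation: boundedness of γ gives C¹, and C^(k+1) for q γ gives C^(k+2)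
for its convolution. The error kernel is smooth and never limits regularity. The radii δ, 2δ, 3δ, 4δ
leave room for the kernel, the two radii of χ and the disc. -/
theorem IsWeakSolution.contDiffAt_nat (h : IsWeakSolution x₀ r γ q) (k : ℕ) :
    ∀ x₁ ∈ ball x₀ r, ContDiffAt ℝ (k + 1 : ℕ) γ x₁ := by
  have hex : ∀ x₁ ∈ ball x₀ r, ∃ δ > 0, dist x₁ x₀ + 4 * δ < r := fun x₁ hx₁ =>
    ⟨(r - dist x₁ x₀) / 5, by have := mem_ball.1 hx₁; linarith, by have := mem_ball.1 hx₁; linarith⟩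
  induction k with
  | zero =>
    intro x₁ hx₁
    obtain ⟨δ, hδ, hr⟩ := hex x₁ hx₁
    let χ : ContDiffBump x₁ := ⟨2 * δ, 3 * δ, by linarith, by linarith⟩
    obtain ⟨hi, B, hB⟩ := h.integrable_bump_mul χ
      (by change _ + 3 * δ < r; linarith) h.contDiffAt
    exact h.contDiffAt_of_conv hδ hr ⟨δ / 2, δ, by linarith, by linarith⟩ rfl χ rfl rfl
      (by simpa using contDiff_one_cutConv _ hi hB)
  | succ k ih =>
    intro x₁ hx₁
    obtain ⟨δ, hδ, hr⟩ := hex x₁ hx₁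
    let χ : ContDiffBump x₁ := ⟨2 * δ, 3 * δ, by linarith, by linarith⟩
    have hk : ((k + 1 : ℕ) : ℕ∞ω) ≤ ∞ := by exact_mod_cast le_top
    obtain ⟨hF, hF'⟩ := contDiff_bump_mul χ (R := 4 * δ) (by change 3 * δ < _; linarith)
      hk (f := fun y => q y * γ y) (fun y hy => by
        have hy' : y ∈ ball x₀ r := by
          rw [mem_ball] at hy ⊢
          linarith [dist_triangle y x₁ x₀]
        exact ((h.contDiffAt y hy').of_le hk).mul (ih y hy'))
    refine h.contDiffAt_of_conv hδ hr ⟨δ / 2, δ, by linarith, by linarith⟩ rfl χ rfl rfl ?_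
    exact_mod_cast contDiff_cutConv _ (k + 1) hF hF'

theorem ContDiffAt.dHol {f : ℂ → ℂ} (hf : ContDiffAt ℝ ∞ f x) : ContDiffAt ℝ ∞ (dHol f) x := by
  have h1 : ContDiffAt ℝ ∞ (fderiv ℝ f) x := hf.fderiv_right (by simp)
  exact contDiffAt_const.mul ((h1.clm_apply contDiffAt_const).sub
    (contDiffAt_const.mul (h1.clm_apply contDiffAt_const)))

/-- A continuous function is zero if it is orthogonal to smooth functions. -/
theorem eq_zero_of_integral_eq_zero {F : ℂ → ℂ} (hF : ContinuousOn F (ball x₀ r))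
    (h : ∀ r' η, 0 < r' → r' < r → IsParametrix η (dHol (dHol η)) 0 x₀ x₀ r' → (∀ f, ContinuousOn f (ball x₀ r) → Integrable fun y => η y * f y) → ∫ y, η y * F y = 0)
    (hx : x ∈ ball x₀ r) : F x = 0 := by
  have hae : ∀ᵐ y, y ∈ ball x₀ r → F y = 0 := by
    refine isOpen_ball.ae_eq_zero_of_integral_contDiff_smul_eq_zero
      (hF.locallyIntegrableOn measurableSet_ball) fun g hg hg' hgs => ?_
    obtain ⟨r', hr', hsub⟩ := exists_pos_lt_subset_ball (dist_nonneg.trans_lt hx)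
      (isClosed_tsupport g) hgs
    set η : ℂ → ℂ := fun y => ((g y : ℝ) : ℂ) with hη
    have hηs : ContDiff ℝ ∞ η := ofRealCLM.contDiff.comp hg
    have hηc : HasCompactSupport η := hg'.comp_left (g := fun y : ℝ => (y : ℂ)) rfl
    have hd2 : ContDiff ℝ ∞ (dHol (dHol η)) :=
      contDiff_dHol (contDiff_dHol hηs (k := ∞) le_rfl) le_rfl
    have hz : ∀ y, y ∉ closedBall x₀ r' → η =ᶠ[𝓝 y] fun _ => 0 := fun y hy => by
      filter_upwards [notMem_tsupport_iff_eventuallyEq.1 fun h' =>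
        hy (Metric.ball_subset_closedBall (hsub h'))] with z hz
      simp only [hη, hz, Pi.zero_apply, ofReal_zero]
    -- A smooth test function is a parametrix with ε = 0, by two integrations by parts. The weak
    -- equation thus contains ordinary testing as a special case.
    have hP : IsParametrix η (dHol (dHol η)) 0 x₀ x₀ r' := by
      refine ⟨hηs.continuous.integrable_of_hasCompactSupport hηc,
        hd2.continuous.integrable_of_hasCompactSupport (HasCompactSupport.dHol
          (HasCompactSupport.dHol hηc)), fun y hy => (hz y hy).self_of_nhds, fun y hy => ?_,
        Metric.mem_closedBall_self hr'.1.le, fun f hf _ => ?_⟩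
      · have h0 : WildHecke.dHol (fun _ : ℂ => (0 : ℂ)) = fun _ => 0 := by
          funext y; simp [WildHecke.dHol]
        have e1 := dHol_congr (hz y hy)
        rw [h0] at e1
        have e2 := dHol_congr e1
        rw [h0] at e2
        exact e2.self_of_nhds
      · rw [zero_mul, zero_add, integral_mul_dHol_dHol hηs hηc hf]
    simp only [real_smul]
    refine h r' η hr'.1 hr'.2 hP fun f hf => ?_
    refine (integrableOn_iff_integrable_of_support_subset (s := closedBall x₀ r')
      fun y hy => ?_).1 ((hηs.continuous.continuousOn.mul
        (hf.mono (closedBall_subset_ball hr'.2))).integrableOn_compact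
          (isCompact_closedBall _ _))
    by_contra hy'
    exact hy (by simp [(hz y hy').self_of_nhds])
  exact Measure.eqOn_open_of_ae_eq (μ := volume) ((ae_restrict_iff' measurableSet_ball).2 hae)
    isOpen_ball hF continuousOn_const hx

/-- Weak solutions are smooth. -/
theorem IsWeakSolution.regularity (h : IsWeakSolution x₀ r γ q) (hx : x ∈ ball x₀ r) :
    ContDiffAt ℝ ∞ γ x ∧ dHol (dHol γ) x = q x * γ x := by
  have hγ : ∀ y ∈ ball x₀ r, ContDiffAt ℝ ∞ γ y := fun y hy =>
    contDiffAt_infty.2 fun k => (h.contDiffAt_nat k y hy).of_le (by exact_mod_cast Nat.le_succ k)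
  have c1 : ContinuousOn (dHol (dHol γ)) (ball x₀ r) := fun y hy =>
    (ContDiffAt.dHol (ContDiffAt.dHol (hγ y hy))).continuousAt.continuousWithinAt
  have c2 : ContinuousOn (fun y => q y * γ y) (ball x₀ r) := fun y hy =>
    ((h.contDiffAt y hy).continuousAt.mul (hγ y hy).continuousAt).continuousWithinAt
  -- Smoothness being known, the weak equation with ε = 0 and two integrations by parts show that
  -- ∂²γ - q γ is orthogonal to all test functions on the disc.
  refine ⟨hγ x hx, sub_eq_zero.1 (eq_zero_of_integral_eq_zero
    (F := dHol (dHol γ) - fun y => q y * γ y) (c1.sub c2)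
    (fun r' η hr' hr'r hP hint => ?_) hx)⟩
  simp only [Pi.sub_apply, mul_sub]
  rw [integral_sub (hint _ c1) (hint _ c2), hP.eq_of_contDiffAt hr' hr'r hγ,
    h.eq r' hr' hr'r _ _ _ _ hP, sub_self]

end

end

section

/-! ### Asymptotics for `x → ∞` and nonvanishing -/

open Filter Topology

/-- The tuple `(𝐚_i / 𝐛_i)_i`. -/
def ratio (a b : Cfg n) : Cfg n := fun p => coeff p.2.val (block a p.1 * (block b p.1)⁻¹)

theorem block_ratio (a b : Cfg n) (i : ι) :
    PSCongr (n i) (block (ratio a b) i) (block a i * (block b i)⁻¹) :=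
  block_ofCoeff (fun i => block a i * (block b i)⁻¹) i

theorem block_add (a b : Cfg n) (i : ι) : block (a + b) i = block a i + block b i := by
  ext j; rw [map_add]; simp only [coeff_block]; split_ifs <;> simp

theorem ratio_continuousAt (a : Cfg n) {b : Cfg n} (hb : ∀ i, cc b i ≠ 0) :
    ContinuousAt (fun y : Cfg n × Cfg n => ratio y.1 y.2) (a, b) := by
  refine continuousAt_pi.2 fun p => ?_
  have h1 := HasPSDerivAt.comp (P := fun v : Cfg n => block v p.1)
    (g := fun y : Cfg n × Cfg n => y.1) (e := (a, b)) (hasPSDerivAt_block a p.1) hasFDerivAt_fst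
  have h2 := HasPSDerivAt.comp (P := fun v : Cfg n => block v p.1)
    (g := fun y : Cfg n × Cfg n => y.2) (e := (a, b)) (hasPSDerivAt_block b p.1) hasFDerivAt_snd
  exact (h1.mul (h2.inv (hb p.1))).continuousAt p.2.val

theorem measurable_ratio : Measurable fun y : Cfg n × Cfg n => ratio y.1 y.2 :=
  measurable_pi_lambda _ fun p => (((psMeasurable_block p.1).comp measurable_fst).mul
    ((psMeasurable_block p.1).comp measurable_snd).inv) _

/-- The tuple `(t_i + ε_i)_i`. -/
def markedCfg (n : ι → ℕ) (t : ι → ℂ) : Cfg n := fun p => coeff p.2.val (pointSub t 0 p.1)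

/-- The tuple `((𝐮_i + h (t_i + ε_i)) / (1 + σ 𝐮_i))_i`. -/
def flow (t : ι → ℂ) (y : ℂ × ℂ) (u : Cfg n) : Cfg n :=
  ratio (u + y.2 • markedCfg n t) (shift 1 (y.1 • u))

theorem block_marked (t : ι → ℂ) (z : ℂ) (u : Cfg n) (i : ι) :
    PSCongr (n i) (block (u + z • markedCfg n t) i)
      (block u i + C z * pointSub t 0 i) := by
  rw [block_add, block_smul]
  exact (PSCongr.refl _).add ((PSCongr.refl _).mul (block_ofCoeff (fun i => pointSub t 0 i) i))

theorem block_shift_smul (hn : ∀ i, 1 ≤ n i) (σ : ℂ) (u : Cfg n) (i : ι) :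
    block (shift 1 (σ • u)) i = C σ * block u i + 1 := by
  rw [block_shift hn, block_smul, map_one]

theorem block_flow (hn : ∀ i, 1 ≤ n i) (t : ι → ℂ) (y : ℂ × ℂ) (u : Cfg n) (i : ι) :
    PSCongr (n i) (block (flow t y u) i) ((block u i + C y.2 * pointSub t 0 i) *
      (C y.1 * block u i + 1)⁻¹) := by
  refine (block_ratio _ _ i).trans ?_
  rw [block_shift_smul hn]
  exact (block_marked t y.2 u i).mul (PSCongr.refl _)

theorem cfg_ext {u : Cfg n} {p : Coord n} {w : ℂ} {A : ℂ⟦X⟧} (hw : w = coeff p.2.val A)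
    (h : PSCongr (n p.1) A (block u p.1)) : w = u p := by
  rw [hw, h.coeff_eq p.2.2, coeff_block_fin]

/-- The map is the fractional linear transformation with matrix (1, h (t + ε); σ, 1). Changing the
signs of σ and h gives the inverse up to the scalar 1 - σ h (t + ε), assumed invertible. -/
theorem flow_flow (hn : ∀ i, 1 ≤ n i) (t : ι → ℂ) {y : ℂ × ℂ} {u : Cfg n}
    (hu : ∀ i, cc (shift 1 (y.1 • u)) i ≠ 0) (hy : ∀ i, 1 - y.1 * y.2 * t i ≠ 0) :
    flow t (-y) (flow t y u) = u := by
  funext p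
  refine cfg_ext rfl ?_
  set i := p.1
  have hA : constantCoeff (C y.1 * block u i + 1) ≠ 0 := by
    rw [← block_shift_smul hn]; exact hu i
  set U := block u i
  set W := (U + C y.2 * pointSub t 0 i) * (C y.1 * U + 1)⁻¹ with hW
  have hWA : W * (C y.1 * U + 1) = U + C y.2 * pointSub t 0 i := by
    rw [hW, mul_assoc, inv_mul_self _ hA, mul_one]
  have hf := block_flow hn t y u i
  have h1 : PSCongr (n i) (block (flow t y u + (-y).2 • markedCfg n t) i)
      (W + C (-y.2) * pointSub t 0 i) := (block_marked t _ _ i).trans (hf.add (PSCongr.refl _))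
  have h2 : PSCongr (n i) (block (shift 1 ((-y).1 • flow t y u)) i) (C (-y.1) * W + 1) := by
    rw [block_shift_smul hn]
    exact ((PSCongr.refl _).mul hf).add (PSCongr.refl _)
  refine (h1.mul (h2.inv (hn i))).trans ?_
  have e1 : W + C (-y.2) * pointSub t 0 i = U * (C (-y.1) * W + 1) := by
    rw [map_neg, map_neg]; linear_combination hWA
  have h0 : constantCoeff (C (-y.1) * W + 1) ≠ 0 := by
    intro h0
    have e2 : (C (-y.1) * W + 1) * (C y.1 * U + 1) = 1 - C y.1 * C y.2 * pointSub t 0 i := by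
      rw [map_neg]; linear_combination -C y.1 * hWA
    have e3 := congrArg constantCoeff e2
    rw [map_mul, h0, zero_mul] at e3
    exact hy i (by simpa [constantCoeff_pointSub] using e3.symm)
  rw [e1, mul_assoc, mul_inv_self _ h0, mul_one]
  exact PSCongr.refl _

/-- With v = -(x/s)(1 + u/s) one computes s - (t + ε - x)/v = (u + (s/x)(t + ε))/(1 + u/s). This is
close to u when s is large and s/x is small. -/
theorem mob_smul_shift (hn : ∀ i, 1 ≤ n i) (t : ι → ℂ) {s : ℂ} (hx : x ≠ 0) (hs : s ≠ 0)
    {u : Cfg n} (hu : ∀ i, cc (shift 1 (s⁻¹ • u)) i ≠ 0) :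
    mob t x s ((-(x / s)) • shift 1 (s⁻¹ • u)) = flow t (s⁻¹, s / x) u := by
  funext p
  refine cfg_ext rfl (PSCongr.symm ?_)
  refine (block_flow hn t _ u p.1).trans ?_
  have hA : constantCoeff (C s⁻¹ * block u p.1 + 1) ≠ 0 := by
    rw [← block_shift_smul hn]; exact hu p.1
  rw [block_smul, block_shift_smul hn]
  set A := C s⁻¹ * block u p.1 + 1 with hAd
  have hC : (C (-(x / s)) * A)⁻¹ = C (-(s / x)) * A⁻¹ := by
    have hz : constantCoeff (C (-(x / s)) * A) ≠ 0 := by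
      rw [map_mul, constantCoeff_C]
      exact mul_ne_zero (neg_ne_zero.2 (div_ne_zero hx hs)) hA
    rw [PowerSeries.inv_eq_iff_mul_eq_one hz]
    calc _ = C (-(s / x)) * C (-(x / s)) * (A⁻¹ * A) := by ring
      _ = 1 := by
        rw [inv_mul_self _ hA, ← map_mul, mul_one, neg_mul_neg, div_mul_div_comm,
          mul_comm s x, div_self (mul_ne_zero hx hs), map_one]
  have hU : block u p.1 = C s * A - C s := by
    rw [hAd, mul_add, ← mul_assoc, ← map_mul, mul_inv_cancel₀ hs, map_one]; ring
  have hP : pointSub t 0 p.1 = pointSub t x p.1 + C x := by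
    simp only [pointSub, map_sub, sub_zero]; ring
  have hx' : C (s / x) * C x = C s := by
    rw [← map_mul, div_mul_cancel₀ _ hx]
  have e : (block u p.1 + C (s / x) * pointSub t 0 p.1) * A⁻¹ =
      C s - pointSub t x p.1 * (C (-(x / s)) * A)⁻¹ := by
    rw [hC, hP, map_neg]
    linear_combination A⁻¹ * hU + C s * mul_inv_self _ hA + A⁻¹ * hx'
  rw [e]
  exact PSCongr.refl _

theorem kerWeight_smul (hn : ∀ i, 1 ≤ n i) (hc : ∀ i, ∃ k : ℤ, (c i 0).im = k)
    (hsum : ∑ i, c i 0 = 0) (hz : z ≠ 0) {v : Cfg n} (hv : ∀ i, cc v i ≠ 0) :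
    kerWeight c (z • v) = (((‖z‖ ^ (2 * ∑ i, n i))⁻¹ : ℝ) : ℂ) * kerWeight c v := by
  rw [← prod_unitWeight_C hn c hsum, kerWeight, kerWeight, ← prod_mul_distrib]
  refine prod_congr rfl fun i _ => ?_
  rw [block_smul, unitWeight_mul (hn i) (c i) (hc i) (by simpa using hz) (hv i)]

/-- The rescaled kernel. -/
def flowKer (t : ι → ℂ) (c : ι → ℕ → ℂ) (f : Cfg n → ℂ) (y : ℂ × ℂ) (u : Cfg n) : ℂ :=
  kerWeight c (shift 1 (y.1 • u)) * f (flow t y u)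

/-- The substitution v = -(x/s)(1 + u/s) is a dilation, a translation and a dilation. The function ψ
is homogeneous and translation invariant, and the weight is homogeneous because the c_0 sum to zero.
Collecting the powers of |x| and |s| leaves a density |s|⁻² in s. -/
theorem integral_pairFun_eq (hn : ∀ i, 1 ≤ n i) (t : ι → ℂ)
    (hc : ∀ i, ∃ k : ℤ, (c i 0).im = k) (hsum : ∑ i, c i 0 = 0) (hψ : MemH ψ)
    (f : Cfg n → ℂ) {s : ℂ} (hx : x ≠ 0) (hs : s ≠ 0) : ∫ v, pairFun t c ψ f x (s, v) =
      ((‖x‖ ^ (-(((∑ i, n i : ℕ) : ℤ) - 1)) * (‖s‖ ^ 2)⁻¹ : ℝ) : ℂ) *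
        ∫ u, ψ u * flowKer t c f (s⁻¹, s / x) u := by
  set N := ∑ i, n i with hN
  have hz : -(x / s) ≠ 0 := neg_ne_zero.2 (div_ne_zero hx hs)
  have hX := norm_pos_iff.2 hx
  have hS := norm_pos_iff.2 hs
  have hzn : ‖-(x / s)‖ = ‖x‖ / ‖s‖ := by rw [norm_neg, norm_div]
  have h1 := integral_smul_cfg (-(x / s)) hz fun v => pairFun t c ψ f x (s, v)
  have h2 := integral_shift (n := n) 1 fun v => pairFun t c ψ f x (s, (-(x / s)) • v)
  have h3 := integral_smul_cfg s⁻¹ (inv_ne_zero hs)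
    fun v => pairFun t c ψ f x (s, (-(x / s)) • shift 1 v)
  have e : ∀ u : Cfg n, pairFun t c ψ f x (s, (-(x / s)) • shift 1 (s⁻¹ • u)) =
      (((‖x‖ / ‖s‖) ^ (-((N : ℤ) - 1)) * (‖s‖⁻¹) ^ (-((N : ℤ) - 1)) *
        ((‖x‖ / ‖s‖) ^ (2 * N))⁻¹ : ℝ) : ℂ) * (ψ u * flowKer t c f (s⁻¹, s / x) u) := by
    intro u
    simp only [pairFun, flowKer]
    by_cases hu : ∀ i, cc (shift 1 (s⁻¹ • u)) i ≠ 0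
    · rw [mob_smul_shift hn t hx hs hu, kerWeight_smul hn hc hsum hz hu, hψ.smul_eq _ _ hz,
        hψ.shift_eq, hψ.smul_eq _ _ (inv_ne_zero hs), hzn, norm_inv, ← hN]
      push_cast
      ring
    -- Where a block is not invertible both weights vanish.
    · push Not at hu
      obtain ⟨i, hi⟩ := hu
      rw [kerWeight_eq_zero hn c hi, kerWeight_eq_zero hn c (i := i) (by rw [cc_smul, hi, mul_zero])]
      simp
  simp only [e, integral_const_mul] at h3
  rw [h2, h1, hzn, norm_inv] at h3
  have hP : ((‖x‖ / ‖s‖) ^ (2 * N) * (‖s‖⁻¹) ^ (2 * N) : ℝ) ≠ 0 := by positivity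
  have h4 : ∀ J I : ℂ, ((((‖x‖ / ‖s‖) ^ (-((N : ℤ) - 1)) * (‖s‖⁻¹) ^ (-((N : ℤ) - 1)) *
        ((‖x‖ / ‖s‖) ^ (2 * N))⁻¹ : ℝ) : ℂ) * I =
      ((((‖s‖⁻¹) ^ (2 * N))⁻¹ : ℝ) : ℂ) * (((((‖x‖ / ‖s‖) ^ (2 * N))⁻¹ : ℝ) : ℂ) * J)) →
      J = ((‖x‖ ^ (-((N : ℤ) - 1)) * (‖s‖ ^ 2)⁻¹ : ℝ) : ℂ) * I := by
    intro J I h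
    have hr : (‖x‖ / ‖s‖) ^ (-((N : ℤ) - 1)) * (‖s‖⁻¹) ^ (-((N : ℤ) - 1)) *
        ((‖x‖ / ‖s‖) ^ (2 * N))⁻¹ = ((‖s‖⁻¹) ^ (2 * N))⁻¹ * (((‖x‖ / ‖s‖) ^ (2 * N))⁻¹ *
          (‖x‖ ^ (-((N : ℤ) - 1)) * (‖s‖ ^ 2)⁻¹)) := by
      have hk : ∀ a : ℝ, 0 < a → a ^ (-((N : ℤ) - 1)) = a / a ^ N := fun a ha => by
        rw [neg_sub, zpow_sub₀ ha.ne', zpow_one, zpow_natCast]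
      rw [hk _ (by positivity), hk _ (by positivity), hk _ hX]
      field_simp
      ring
    have hne : ((((‖s‖⁻¹) ^ (2 * N))⁻¹ * ((‖x‖ / ‖s‖) ^ (2 * N))⁻¹ : ℝ) : ℂ) ≠ 0 := by
      exact_mod_cast (by positivity : (((‖s‖⁻¹) ^ (2 * N))⁻¹ * ((‖x‖ / ‖s‖) ^ (2 * N))⁻¹ : ℝ) ≠ 0)
    rw [hr] at h
    refine mul_left_cancel₀ hne ?_
    push_cast at h ⊢
    linear_combination -h
  exact h4 _ _ h3

/-- Near `0` the rescaled kernel is uniformly close to the evaluation, with uniform support. -/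
theorem exists_flowKer_close (hn : ∀ i, 1 ≤ n i) (k : ι) (t : ι → ℂ)
    (hc : ∀ i, ∃ k : ℤ, (c i 0).im = k) (hsum : ∑ i, c i 0 = 0) (hf : IsTest f) :
    ∃ K, IsCompact K ∧ K ⊆ (diagonal n)ᶜ ∧ (∀ u ∉ K, f u = 0) ∧ ∀ η > 0,
      ∀ᶠ y in 𝓝 (0 : ℂ × ℂ), (∀ u ∈ K, ‖flowKer t c f y u - f u‖ ≤ η) ∧
        ∀ u ∉ K, flowKer t c f y u = 0 := by
  have hcc : ∀ i, cc (shift 1 (0 : Cfg n)) i ≠ 0 := fun i => by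
    rw [cc_shift hn, cc_eq hn]; simp
  have hflow0 : ∀ u : Cfg n, flow t 0 u = u := fun u => funext fun p => by
    refine cfg_ext (A := block (flow t 0 u) p.1) (coeff_block_fin _ _).symm ?_
    refine (block_flow hn t 0 u p.1).trans ?_
    simpa using PSCongr.refl _
  have hW1 : kerWeight c (shift 1 (0 : Cfg n)) = 1 := by
    have h := prod_unitWeight_C hn c hsum 1
    rw [norm_one, one_pow, inv_one, ofReal_one] at h
    refine Eq.trans ?_ h
    refine prod_congr rfl fun i _ => ?_
    have h0 := block_shift_smul hn 0 (0 : Cfg n) i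
    rw [zero_smul] at h0
    rw [h0, map_zero, zero_mul, zero_add, map_one]
  have hdiag : IsClosed (diagonal n) := by
    have : diagonal n = {v | spread k v = 0} := Set.ext fun v => (spread_eq_zero_iff hn k v).symm
    rw [this]
    exact isClosed_eq (continuous_spread hn k) continuous_const
  have hsh : Continuous fun y : (ℂ × ℂ) × Cfg n => shift 1 (y.1.1 • y.2) :=
    continuous_shift_uncurry.comp (f := fun y : (ℂ × ℂ) × Cfg n => ((1 : ℂ), y.1.1 • y.2))
      (by fun_prop)
  have hcf : ∀ u : Cfg n, ContinuousAt (fun y : (ℂ × ℂ) × Cfg n => flow t y.1 y.2) (0, u) := by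
    intro u
    have hb : ContinuousAt (fun y : (ℂ × ℂ) × Cfg n =>
        (y.2 + y.1.2 • markedCfg n t, shift 1 (y.1.1 • y.2))) (0, u) :=
      ((by fun_prop : Continuous fun y : (ℂ × ℂ) × Cfg n => y.2 + y.1.2 • markedCfg n t).prodMk
        hsh).continuousAt
    exact ContinuousAt.comp (x := ((0 : ℂ × ℂ), u)) (g := fun y : Cfg n × Cfg n => ratio y.1 y.2)
      (f := fun y : (ℂ × ℂ) × Cfg n => (y.2 + y.1.2 • markedCfg n t, shift 1 (y.1.1 • y.2)))
      (ratio_continuousAt _ fun i => by simpa only [Prod.fst_zero, zero_smul] using hcc i) hb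
  have hcg : ∀ u : Cfg n, ContinuousAt (fun y : (ℂ × ℂ) × Cfg n => flowKer t c f y.1 y.2) (0, u) := by
    intro u
    have h1 : ContinuousAt (fun y : (ℂ × ℂ) × Cfg n => kerWeight c (shift 1 (y.1.1 • y.2))) (0, u) :=
      ContinuousAt.comp (x := ((0 : ℂ × ℂ), u)) (f := fun y : (ℂ × ℂ) × Cfg n => shift 1 (y.1.1 • y.2))
        (g := kerWeight c) (kerWeight_continuousAt hn hc fun i => by
          simpa only [Prod.fst_zero, zero_smul] using hcc i) hsh.continuousAt
    have h2 : ContinuousAt (fun y : (ℂ × ℂ) × Cfg n => f (flow t y.1 y.2)) (0, u) :=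
      hf.continuous.continuousAt.comp (hcf u)
    exact h1.mul h2
  obtain ⟨K, hK, hKi, hKd⟩ := exists_compact_between hf.hasCompactSupport
    hdiag.isOpen_compl hf.subset
  refine ⟨K, hK, hKd, fun u hu => image_eq_zero_of_notMem_tsupport fun h => hu
    (interior_subset (hKi h)), fun η hη => ?_⟩
  have e1 : ∀ᶠ y in 𝓝 (0 : ℂ × ℂ), ∀ u ∈ K, ‖flowKer t c f y u - f u‖ < η := by
    refine hK.eventually_forall_of_forall_eventually fun u _ => ?_
    have := ((hcg u).sub (hf.continuous.comp continuous_snd).continuousAt).norm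
    refine this.eventually_lt_const ?_
    simpa [flowKer, hflow0, hW1] using hη
  -- The inverse flow carries the support of f into K for small parameters. A point where the
  -- rescaled kernel is nonzero is the image of such a support point, so it lies in K.
  have e2 : ∀ᶠ y in 𝓝 (0 : ℂ × ℂ), ∀ w ∈ tsupport f, flow t (-y) w ∈ K := by
    refine IsCompact.eventually_forall_of_forall_eventually hf.hasCompactSupport fun w hw => ?_
    have h2 : ContinuousAt (fun y : (ℂ × ℂ) × Cfg n => flow t (-y.1) y.2) (0, w) :=
      ContinuousAt.comp (x := ((0 : ℂ × ℂ), w)) (g := fun y : (ℂ × ℂ) × Cfg n => flow t y.1 y.2)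
        (f := fun y : (ℂ × ℂ) × Cfg n => (-y.1, y.2)) (by simpa only [neg_zero] using hcf w)
        (continuous_fst.neg.prodMk continuous_snd).continuousAt
    refine h2.eventually_mem ?_
    simp only [neg_zero, hflow0]
    exact mem_interior_iff_mem_nhds.1 (hKi hw)
  have e3 : ∀ᶠ y in 𝓝 (0 : ℂ × ℂ), ∀ i, 1 - y.1 * y.2 * t i ≠ 0 := by
    refine eventually_all.2 fun i => ?_
    have : Continuous fun y : ℂ × ℂ => 1 - y.1 * y.2 * t i := by fun_prop
    exact this.continuousAt.eventually_ne (by simp)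
  filter_upwards [e1, e2, e3] with y h1 h2 h3
  refine ⟨fun u hu => (h1 u hu).le, fun u hu => ?_⟩
  by_contra hne
  have hu' : ∀ i, cc (shift 1 (y.1 • u)) i ≠ 0 := fun i hi =>
    hne (by rw [flowKer, kerWeight_eq_zero hn c hi, zero_mul])
  have hw : flow t y u ∈ tsupport f := subset_tsupport f fun h0 => hne (by rw [flowKer, h0, mul_zero])
  exact hu (by have := h2 _ hw; rwa [flow_flow hn t hu' h3] at this)

theorem measurable_flowKer (t : ι → ℂ) (c : ι → ℕ → ℂ) (hf : Measurable f)
    (y : ℂ × ℂ) : Measurable (flowKer t c f y) := by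
  have hs : Measurable fun u : Cfg n => shift 1 (y.1 • u) :=
    (continuous_shift_uncurry.comp (f := fun u : Cfg n => ((1 : ℂ), y.1 • u)) (by fun_prop)).measurable
  have hw : Measurable (flow t y) := measurable_ratio.comp
    (f := fun u : Cfg n => (u + y.2 • markedCfg n t, shift 1 (y.1 • u)))
    ((measurable_id.add_const _).prodMk hs)
  have h1 : Measurable fun u : Cfg n => kerWeight c (shift 1 (y.1 • u)) :=
    (measurable_kerWeight c).comp hs
  have h2 : Measurable fun u : Cfg n => f (flow t y u) := hf.comp hw
  exact h1.mul h2

theorem eventually_integral_flowKer (hn : ∀ i, 1 ≤ n i) (k : ι) (t : ι → ℂ)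
    (hc : ∀ i, ∃ k : ℤ, (c i 0).im = k) (hsum : ∑ i, c i 0 = 0) (hψ : MemH ψ) (hf : IsTest f)
    (h1 : ∫ u, ψ u * f u = 1) :
    ∀ᶠ y in 𝓝 (0 : ℂ × ℂ), 1 / 2 ≤ (∫ u, ψ u * flowKer t c f y u).re := by
  obtain ⟨K, hK, hKd, hfK, hclose⟩ := exists_flowKer_close hn k t hc hsum hf
  have hi := hψ.integrableOn hK hKd
  set M := ∫ u in K, ‖ψ u‖ with hM
  have hM0 : 0 ≤ M := integral_nonneg fun _ => norm_nonneg _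
  -- Chosen so that the error M η stays below 1/2, half of the limiting value 1.
  set η := (2 * (M + 1))⁻¹
  have hη : 0 < η := by positivity
  filter_upwards [hclose η hη] with y hy
  have hd : Integrable fun u => ψ u * (flowKer t c f y u - f u) := by
    refine (integrableOn_iff_integrable_of_support_subset fun u hu => ?_).1
      (hi.mul_bdd (c := η) ((measurable_flowKer t c hf.continuous.measurable y).sub
        hf.continuous.measurable).aestronglyMeasurable
        ((ae_restrict_iff' hK.measurableSet).2 (Eventually.of_forall hy.1)))
    by_contra h
    exact hu (by simp [hy.2 u h, hfK u h])
  have hb : ‖∫ u, ψ u * (flowKer t c f y u - f u)‖ ≤ M * η := by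
    rw [← setIntegral_eq_integral_of_forall_compl_eq_zero (s := K)
      fun u h => by simp [hy.2 u h, hfK u h], hM, ← integral_mul_const]
    refine norm_integral_le_of_norm_le (hi.norm.mul_const η)
      ((ae_restrict_iff' hK.measurableSet).2 (Eventually.of_forall fun u hu => ?_))
    rw [norm_mul]
    exact mul_le_mul_of_nonneg_left (hy.1 u hu) (norm_nonneg _)
  have e : ∫ u, ψ u * flowKer t c f y u = 1 + ∫ u, ψ u * (flowKer t c f y u - f u) := by
    rw [← h1, ← integral_add (hf.integrable_mul hψ) hd]
    congr 1; funext u; ring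
  have hMη : M * η ≤ 1 / 2 := by
    rw [← div_eq_mul_inv, div_le_div_iff₀ (by positivity) two_pos]; linarith
  rw [e, add_re, one_re]
  linarith [neg_le_of_abs_le ((Complex.abs_re_le_norm _).trans (hb.trans hMη))]

/-! ### Logarithmic growth of the pairing as x → ∞ -/

open Filter Topology

/-- The tuples whose two chosen constant terms coincide form a null set, so ψ is already nonzero on
its complement. Support in that complement bounds the difference of the constant terms from below,
which the estimate of the remainder requires. -/
theorem exists_isSmoothTest (hn : ∀ i, 1 ≤ n i) (hik : i ≠ k) (hψ : MemH ψ)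
    (h0 : ¬ ψ =ᵐ[volume] 0) : ∃ φ, IsSmoothTest φ ∧ (∀ w ∈ tsupport φ, cc w i ≠ cc w k) ∧
      ∫ u, ψ u * φ u = 1 := by
  by_contra! hcon
  have hU : IsOpen {w : Cfg n | cc w i ≠ cc w k} :=
    isOpen_ne_fun (continuous_cc hn i) (continuous_cc hn k)
  have hd : {w : Cfg n | cc w i ≠ cc w k} ⊆ (diagonal n)ᶜ := by
    rintro w hw ⟨b, rfl⟩
    refine hw ?_
    rw [cc_shift hn, cc_shift hn, cc_eq hn, cc_eq hn]; rfl
  have hloc : LocallyIntegrableOn ψ {w : Cfg n | cc w i ≠ cc w k} := by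
    refine (locallyIntegrableOn_iff hU.isLocallyClosed).2 fun K hKU hK => hψ.integrableOn hK (hKU.trans hd)
  refine h0 ?_
  have h1 := hU.ae_eq_zero_of_integral_contDiff_smul_eq_zero hloc fun g hg hg' hgs => by
    by_contra hne
    set I := ∫ u, g u • ψ u with hI
    have hs : tsupport (fun u => ((g u : ℝ) : ℂ) * I⁻¹) ⊆ tsupport g :=
      closure_mono fun u hu h => hu (by simp [h])
    refine hcon (fun u => ((g u : ℝ) : ℂ) * I⁻¹) ⟨(ofRealCLM.contDiff.comp hg).mul
      contDiff_const, hg'.mono fun u hu h => hu (by simp [h]), hs.trans (hgs.trans hd)⟩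
      (fun w hw => hgs (hs hw)) ?_
    rw [← inv_mul_cancel₀ hne, hI, ← integral_const_mul]
    congr 1; funext u; rw [real_smul]; ring
  filter_upwards [h1, ae_cc_ne hn hik 1] with w hw hw'
  exact hw (by simpa using hw')

theorem integral_annulus {a b : ℝ} (ha : 0 < a) (hab : a ≤ b) :
    ∫ s in {s : ℂ | a ≤ ‖s‖ ∧ ‖s‖ ≤ b}, (‖s‖ ^ 2)⁻¹ = 2 * π * Real.log (b / a) := by
  have hm : MeasurableSet {s : ℂ | a ≤ ‖s‖ ∧ ‖s‖ ≤ b} :=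
    ((isClosed_le continuous_const continuous_norm).inter
      (isClosed_le continuous_norm continuous_const)).measurableSet
  have e1 : ∀ s : ℂ, {s : ℂ | a ≤ ‖s‖ ∧ ‖s‖ ≤ b}.indicator (fun s => (‖s‖ ^ 2)⁻¹) s =
      (Icc a b).indicator (fun y => (y ^ 2)⁻¹) ‖s‖ := fun s => rfl
  have e2 : EqOn (fun y : ℝ => y ^ (Module.finrank ℝ ℂ - 1) •
      (Icc a b).indicator (fun y => (y ^ 2)⁻¹) y) ((Icc a b).indicator fun y => y⁻¹)
      (Ioi 0) := fun y hy => by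
    have hy' : y ≠ 0 := ne_of_gt hy
    simp only [finrank_real_complex, Set.indicator]
    split_ifs
    · rw [show 2 - 1 = 1 from rfl, pow_one, smul_eq_mul]; field_simp
    · simp
  have hb : (volume : Measure ℂ).real (ball 0 1) = π := by
    simp [Measure.real, volume_ball]
  rw [← integral_indicator hm]
  simp only [e1]
  rw [integral_fun_norm_addHaar (volume : Measure ℂ) ((Icc a b).indicator fun y => (y ^ 2)⁻¹),
    setIntegral_congr_fun measurableSet_Ioi e2, setIntegral_indicator measurableSet_Icc,
    Set.inter_eq_right.2 fun y hy => Set.mem_Ioi.2 (ha.trans_le hy.1), integral_Icc_eq_integral_Ioc,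
    ← intervalIntegral.integral_of_le hab, integral_inv_of_pos ha (ha.trans_le hab), hb,
    finrank_real_complex]
  simp only [nsmul_eq_mul, smul_eq_mul]
  push_cast; ring

theorem norm_cc_sub_le (hn : ∀ i, 1 ≤ n i) (i k : ι) (w : Cfg n) :
    ‖cc w i - cc w k‖ ≤ spread k w := by
  rw [sub_eq_add_neg, ← cc_shift hn]
  exact norm_cc_le hn _ i

/-- Far from the marked points every |t_j - X| is comparable to X. The Schur scale thus decays with
the same power X^{-(N-1)}, N = ∑ n_j, as the main term, without a logarithm. -/
theorem kerScale_le (t : ι → ℂ) (i : ι) {X : ℝ} (hX : 0 < X)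
    (ht : ∀ j, 2 * ‖t j‖ ≤ X) : kerScale n t i X ≤
      2 ^ (∑ j, n j) * 2 * X ^ (-(((∑ j, n j : ℕ) : ℤ) - 1)) := by
  have hl : ∀ j, X / 2 ≤ ‖t j - X‖ := fun j => by
    have := norm_sub_norm_le (X : ℂ) (t j)
    rw [norm_sub_rev, norm_real, norm_of_nonneg hX.le] at this
    linarith [ht j]
  have hu : ‖t i - X‖ ≤ 2 * X := by
    have := norm_sub_le (t i) (X : ℂ)
    rw [norm_real, norm_of_nonneg hX.le] at this
    linarith [ht i]
  have hp : (X / 2) ^ (∑ j, n j) ≤ ∏ j, ‖t j - X‖ ^ n j := by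
    rw [← prod_pow_eq_pow_sum]
    exact Finset.prod_le_prod (fun j _ => by positivity) fun j _ =>
      pow_le_pow_left₀ (by positivity) (hl j) _
  calc kerScale n t i X ≤ ((X / 2) ^ (∑ j, n j))⁻¹ * (2 * X) :=
        mul_le_mul (inv_anti₀ (by positivity) hp) hu (norm_nonneg _) (by positivity)
    _ = _ := by
      rw [neg_sub, zpow_sub₀ hX.ne', zpow_one, zpow_natCast, div_pow]
      field_simp

/-- The part of the pairing away from the region which is responsible for the divergence. -/
theorem exists_lintegral_compl_le (hn : ∀ i, 1 ≤ n i) (hik : i ≠ k) (ht : Injective t)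
    (c : ι → ℕ → ℂ) (hψ : MemH ψ) (hf : IsTest f) (hfU : ∀ w ∈ tsupport f, cc w i ≠ cc w k)
    {δ : ℝ} (hδ : 0 < δ) : ∃ C : ENNReal, C < ⊤ ∧ ∀ᶠ X : ℝ in atTop,
      ∫⁻ s in {s : ℂ | δ⁻¹ ≤ ‖s‖ ∧ ‖s‖ ≤ δ * X}ᶜ, ∫⁻ v, ‖pairFun t c ψ f X (s, v)‖ₑ ≤
        C * ofReal (X ^ (-(((∑ j, n j : ℕ) : ℤ) - 1))) := by
  obtain ⟨M, hM, hfM⟩ := hf.exists_bound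
  obtain ⟨r, R, hr, hR, hKa⟩ := exists_annulus hn k hf.hasCompactSupport hf.subset
  replace hKa : tsupport f ⊆ annulus n k r (R + r) := fun v hv =>
    ⟨⟨(hKa hv).1.1, (hKa hv).1.2.trans (by linarith)⟩, (hKa hv).2.trans (by linarith)⟩
  have hrR : r < R + r := by linarith
  generalize R + r = R' at hKa hrR
  have hR' : 0 < R' := hr.trans hrR
  obtain ⟨ρ, hρ, hρw⟩ : ∃ ρ > 0, ∀ w ∈ tsupport f, ρ ≤ ‖cc w i - cc w k‖ := by
    rcases (tsupport f).eq_empty_or_nonempty with he | hne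
    · exact ⟨1, one_pos, by simp [he]⟩
    · obtain ⟨w0, h0, hm⟩ := hf.hasCompactSupport.isCompact.exists_isMinOn hne
        ((continuous_cc hn i).sub (continuous_cc hn k)).norm.continuousOn
      exact ⟨_, norm_pos_iff.2 (sub_ne_zero.2 (hfU w0 h0)), fun w hw => hm hw⟩
  set Δ := ‖t i - t k‖ with hΔ
  have hΔ0 : 0 < Δ := norm_pos_iff.2 (sub_ne_zero.2 fun h => hik (ht h))
  -- The constants make q = a v_k / v_i lie in the set Q of `theta_le_of_near`: |s| < 1/δ will force
  -- |q - 1| ≥ ε, and |s| > δ X will force |q - 1| ≤ L |a - 1|.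
  set L := 4 * R' / (δ * Δ) with hL
  have hL0 : 0 < L := by positivity
  set ε := ρ / (δ⁻¹ + R') with hε
  have hε0 : 0 < ε := by positivity
  refine ⟨ofReal M * (ofReal (2 ^ (∑ j, n j) * 2) *
    ((4 * (∫⁻ q : ℂ, ofReal (majorant ε ‖q‖)) + ofReal (16 * π * (L + 2))) *
        ((∫⁻ v in annulus n k r R', ‖ψ v‖ₑ ^ 2) + volume (annulus n k r R')))), ?_, ?_⟩
  · have hc := isCompact_annulus hn k r R'
    refine mul_lt_top ofReal_lt_top (mul_lt_top ofReal_lt_top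
      (mul_lt_top (add_lt_top.2 ⟨mul_lt_top (by norm_num)
        (lintegral_majorant_lt_top hε0), ofReal_lt_top⟩)
      (add_lt_top.2 ⟨hψ.lintegral_sq_lt_top hc (annulus_subset hn k hr R'), hc.measure_lt_top⟩)))
  filter_upwards [eventually_all.2 fun j => eventually_ge_atTop (2 * ‖t j‖), eventually_gt_atTop 0,
    eventually_ge_atTop (2 * R' / δ), eventually_ge_atTop (4 * Δ / ε),
    eventually_ge_atTop (4 * L * Δ)] with X hXt hX0 hX1 hX2 hX3
  have hxt : ∀ j, X / 2 ≤ ‖t j - X‖ ∧ ‖t j - X‖ ≤ 2 * X := fun j => by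
    have h1 := norm_sub_norm_le (X : ℂ) (t j)
    have h2 := norm_sub_le (t j) (X : ℂ)
    rw [norm_sub_rev, norm_real, norm_of_nonneg hX0.le] at h1
    rw [norm_real, norm_of_nonneg hX0.le] at h2
    exact ⟨by linarith [hXt j], by linarith [hXt j]⟩
  have hne : ∀ j, t j - X ≠ 0 := fun j => norm_pos_iff.1 (by linarith [(hxt j).1])
  have hx : ∀ j, (X : ℂ) ≠ t j := fun j h => hne j (by rw [h, sub_self])
  set a : ℂ := (t i - X) / (t k - X) with ha
  have ha1 : ‖a - 1‖ = Δ / ‖t k - X‖ := by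
    rw [ha, div_sub_one (hne k), sub_sub_sub_cancel_right, norm_div]
  have hal : Δ / (2 * X) ≤ ‖a - 1‖ := by rw [ha1]; gcongr; exacts [norm_pos_iff.2 (hne k), (hxt k).2]
  have hau : ‖a - 1‖ ≤ 2 * Δ / X := by
    rw [ha1, div_le_div_iff₀ (norm_pos_iff.2 (hne k)) hX0]; nlinarith [(hxt k).1]
  have hne1 : a ≠ 1 := fun h => by
    rw [h, sub_self, norm_zero] at hal
    exact absurd hal (not_le.2 (by positivity))
  set Q : Set ℂ := {q | ε ≤ ‖q - 1‖ ∨ ‖q - 1‖ ≤ L * ‖a - 1‖} with hQ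
  have hQc : Continuous fun q : ℂ => ‖q - 1‖ := by fun_prop
  have hQm : MeasurableSet Q :=
    ((isClosed_le continuous_const hQc).union (isClosed_le hQc continuous_const)).measurableSet
  have hθ := theta_le_of_near hε0 hL0.le hne1
    (by rw [div_le_iff₀ hε0] at hX2
        calc _ ≤ 2 * (2 * Δ / X) := by gcongr
          _ ≤ ε := by rw [← mul_div_assoc, div_le_iff₀ hX0]; linarith)
    (by calc _ ≤ 2 * (L * (2 * Δ / X)) := by gcongr
          _ = 4 * L * Δ / X := by ring
          _ ≤ 1 := (div_le_one hX0).2 hX3) (Q := Q) fun q hq => hq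
  have hker := lintegral_kernel_le hn hx ha hQm hik hr hrR hψ.isHalfDensityNorm fun v => enorm_ne_top
  have hmain : ∀ s ∈ {s : ℂ | δ⁻¹ ≤ ‖s‖ ∧ ‖s‖ ≤ δ * X}ᶜ, ∀ v, ‖pairFun t c ψ f X (s, v)‖ₑ ≤
      ofReal M * (‖ψ v‖ₑ * ofReal (normWeight v) *
        Q.indicator 1 (a * cc v k / cc v i) * (annulus n k r R').indicator 1 (mob t X s v)) := by
    intro s hs v
    by_cases h0 : pairFun t c ψ f X (s, v) = 0
    · rw [h0, enorm_zero]; exact zero_le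
    simp only [pairFun, mul_eq_zero, not_or] at h0
    have hv : ∀ j, cc v j ≠ 0 := fun j hj => h0.2.1 (kerWeight_eq_zero hn c hj)
    have hw : mob t X s v ∈ tsupport f := subset_tsupport f h0.2.2
    have hwi := cc_mob hn t X s v i
    have hwk := cc_mob hn t X s v k
    have hq : a * cc v k / cc v i ∈ Q := by
      set w := mob t X s v
      have hsk : s - cc w k = (t k - X) / cc v k := by rw [hwk]; ring
      have hsk0 : s - cc w k ≠ 0 := hsk ▸ div_ne_zero (hne k) (hv k)
      -- In terms of w the ratio is (s - w_i)/(s - w_k), so |q - 1| = |w_i - w_k|/|s - w_k|. The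
      -- numerator is between ρ and R' on the support, hence the size of s decides in which part of
      -- Q the ratio lies.
      have e : a * cc v k / cc v i - 1 = (cc w k - cc w i) / (s - cc w k) := by
        have hsi : s - cc w i = (t i - X) / cc v i := by rw [hwi]; ring
        have : a * cc v k / cc v i = (s - cc w i) / (s - cc w k) := by
          have h1 := hne k; have h2 := hv k; have h3 := hv i
          rw [hsi, hsk, ha]; field_simp
        rw [this, div_sub_one hsk0]; congr 1; ring
      have hkR : ‖cc w k‖ ≤ R' := (hKa hw).2
      have hsp : ‖cc w k - cc w i‖ ≤ R' := by
        rw [norm_sub_rev]; exact (norm_cc_sub_le hn i k w).trans (hKa hw).1.2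
      have hρ' := hρw w hw
      rw [norm_sub_rev] at hρ'
      have hp := norm_pos_iff.2 hsk0
      change ε ≤ ‖_ - 1‖ ∨ ‖_ - 1‖ ≤ L * ‖a - 1‖
      rw [e, norm_div]
      rcases not_and_or.1 hs with h | h <;> rw [not_le] at h
      · left
        have : ‖s - cc w k‖ ≤ δ⁻¹ + R' := (norm_sub_le _ _).trans (add_le_add h.le hkR)
        exact div_le_div₀ (norm_nonneg _) hρ' hp this
      · right
        have h1 : δ * X / 2 ≤ ‖s - cc w k‖ := by
          rw [div_le_iff₀ hδ] at hX1
          linarith [norm_sub_norm_le s (cc w k)]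
        calc _ ≤ R' / (δ * X / 2) := div_le_div₀ hR'.le hsp (by positivity) h1
          _ = L * (Δ / (2 * X)) := by rw [hL]; field_simp; ring
          _ ≤ _ := by gcongr
    rw [indicator_of_mem hq, indicator_of_mem (hKa hw), Pi.one_apply, Pi.one_apply, pairFun,
      enorm_mul, enorm_mul, ← ofReal_norm (kerWeight c v), norm_kerWeight']
    have := hfM (mob t X s v)
    rw [indicator_of_mem hw, Pi.one_apply, mul_one] at this
    calc _ ≤ ‖ψ v‖ₑ * (ofReal (normWeight v) * ofReal M) := by gcongr
      _ = _ := by ring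
  have hm : MeasurableSet {s : ℂ | δ⁻¹ ≤ ‖s‖ ∧ ‖s‖ ≤ δ * X}ᶜ :=
    ((isClosed_le continuous_const continuous_norm).inter
      (isClosed_le continuous_norm continuous_const)).measurableSet.compl
  refine (setLIntegral_mono' hm fun s hs => lintegral_mono (hmain s hs)).trans
    ((setLIntegral_le_lintegral _ _).trans ?_)
  simp only [lintegral_const_mul' _ _ ofReal_ne_top]
  rw [mul_assoc]
  refine mul_le_mul_right (hker.trans ?_) _
  have hk := ofReal_le_ofReal (kerScale_le (n := n) t i hX0 hXt)
  rw [ofReal_mul (by positivity)] at hk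
  calc _ ≤ (_ * _) * _ := mul_le_mul' hk (mul_le_mul_left hθ _)
    _ = _ := by ring

/-- The pairing does not vanish identically. -/
theorem exists_pairing_ne_zero (hn : ∀ i, 1 ≤ n i) (hik : i ≠ k) (ht : Injective t)
    (hc : ∀ i, ∃ k : ℤ, (c i 0).im = k) (hsum : ∑ i, c i 0 = 0) (hψ : MemH ψ) (hf : IsTest f)
    (hfU : ∀ w ∈ tsupport f, cc w i ≠ cc w k) (h1 : ∫ u, ψ u * f u = 1) :
    ∃ x, (∀ i, x ≠ t i) ∧ pairing t c ψ f x ≠ 0 := by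
  by_contra! hcon
  obtain ⟨δ', hδ', hball⟩ := Metric.eventually_nhds_iff_ball.1
    (eventually_integral_flowKer hn k t hc hsum hψ hf h1)
  set δ := δ' / 2 with hδd
  have hδ : 0 < δ := by positivity
  obtain ⟨C, hC, hb⟩ := exists_lintegral_compl_le hn hik ht c hψ hf hfU hδ
  have hlog : Tendsto (fun X : ℝ => Real.log (δ ^ 2 * X)) atTop atTop :=
    Real.tendsto_log_atTop.comp (tendsto_id.const_mul_atTop (by positivity))
  -- X is taken so large that the main term π P log (δ² X) exceeds the remainder bound C P.
  obtain ⟨X, hbX, hX0, hXt, hXδ, hXlog⟩ := (hb.and ((eventually_gt_atTop 0).and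
    ((eventually_all.2 fun j => eventually_gt_atTop ‖t j‖).and ((eventually_ge_atTop (δ ^ 2)⁻¹).and
      (hlog.eventually_gt_atTop (C.toReal / π)))))).exists
  have hxt : ∀ j, (X : ℂ) ≠ t j := fun j h => by
    have := hXt j
    rw [← h, norm_real, norm_of_nonneg hX0.le] at this
    exact lt_irrefl _ this
  have hXc : (X : ℂ) ≠ 0 := by exact_mod_cast hX0.ne'
  set P : ℝ := X ^ (-(((∑ j, n j : ℕ) : ℤ) - 1)) with hP
  have hP0 : 0 < P := by positivity
  set G : Set ℂ := {s : ℂ | δ⁻¹ ≤ ‖s‖ ∧ ‖s‖ ≤ δ * X} with hG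
  have hGc : IsClosed G := (isClosed_le continuous_const continuous_norm).inter
    (isClosed_le continuous_norm continuous_const)
  set J : ℂ → ℂ := fun s => ∫ v, pairFun t c ψ f X (s, v) with hJ
  have hi := integrable_pairFun hn hik ht c hψ hf hxt
  rw [Measure.volume_eq_prod] at hi
  have hJi : Integrable J := hi.integral_prod_left
  have hJ0 : ∫ s, J s = 0 := by
    rw [← hcon X hxt, pairing, Measure.volume_eq_prod, integral_prod _ hi]
  have hsplit := integral_add_compl hGc.measurableSet hJi
  rw [hJ0] at hsplit
  have hbad : ‖∫ s in Gᶜ, J s‖ ≤ C.toReal * P := by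
    have h2 : ‖∫ s in Gᶜ, J s‖ₑ ≤ C * ofReal P :=
      (enorm_integral_le_lintegral_enorm _).trans ((lintegral_mono fun s =>
        enorm_integral_le_lintegral_enorm _).trans hbX)
    have h3 := toReal_mono (mul_lt_top hC ofReal_lt_top).ne h2
    rwa [toReal_enorm, ENNReal.toReal_mul, toReal_ofReal hP0.le] at h3
  -- On this annulus both 1/s and s/X are below δ', so the rescaled integral has real part at least
  -- 1/2, half of ∫ ψ f = 1.
  have hgood : ∀ s ∈ G, P / 2 * (‖s‖ ^ 2)⁻¹ ≤ (J s).re := fun s hs => by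
    have hs0 : 0 < ‖s‖ := (inv_pos.2 hδ).trans_le hs.1
    have hI := hball (s⁻¹, s / X) (by
      rw [mem_ball, dist_zero_right, Prod.norm_mk, max_lt_iff, norm_inv, norm_div,
        norm_real, norm_of_nonneg hX0.le]
      exact ⟨(inv_le_of_inv_le₀ hδ hs.1).trans_lt (by linarith),
        ((div_le_iff₀ hX0).2 hs.2).trans_lt (by linarith)⟩)
    rw [hJ]
    simp only
    rw [integral_pairFun_eq hn t hc hsum hψ f hXc (norm_pos_iff.1 hs0), re_ofReal_mul,
      norm_real, norm_of_nonneg hX0.le, ← hP]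
    calc _ = P * (‖s‖ ^ 2)⁻¹ * (1 / 2) := by ring
      _ ≤ _ := by gcongr
  have hGK : IsCompact G := Metric.isCompact_of_isClosed_isBounded hGc
    ((Metric.isBounded_closedBall (x := (0 : ℂ)) (r := δ * X)).subset fun s hs => by
      simpa using hs.2)
  have hre : (∫ s in G, J s).re = ∫ s in G, (J s).re := (integral_re hJi.integrableOn).symm
  have hlow : P / 2 * (2 * π * Real.log (δ * X / δ⁻¹)) ≤ (∫ s in G, J s).re := by
    have hle : δ⁻¹ ≤ δ * X := by
      calc δ⁻¹ = δ * (δ ^ 2)⁻¹ := by field_simp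
        _ ≤ _ := by gcongr
    rw [← integral_annulus (inv_pos.2 hδ) hle, ← integral_const_mul, hre]
    refine setIntegral_mono_on ?_ hJi.integrableOn.re hGc.measurableSet hgood
    refine ContinuousOn.integrableOn_compact hGK fun s hs => ?_
    have hs0 : ‖s‖ ^ 2 ≠ 0 := pow_ne_zero 2 ((inv_pos.2 hδ).trans_le hs.1).ne'
    exact (continuousAt_const.mul ((continuous_norm.pow 2).continuousAt.inv₀ hs0)).continuousWithinAt
  have hfin : P / 2 * (2 * π * Real.log (δ * X / δ⁻¹)) ≤ C.toReal * P := by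
    refine hlow.trans ((Complex.re_le_norm _).trans ?_)
    rwa [eq_neg_of_add_eq_zero_left hsplit, norm_neg]
  have e : δ * X / δ⁻¹ = δ ^ 2 * X := by field_simp
  rw [e] at hfin
  rw [div_lt_iff₀ Real.pi_pos] at hXlog
  nlinarith [mul_lt_mul_of_pos_right hXlog hP0]

end

section

/-! ### Partial fractions -/

open Filter Topology

/-- Clearing denominators gives a polynomial identity at infinitely many points, and expansions in
powers of pairwise coprime factors are unique. The index m_i - 1 - j appears because a/(x -
t_i)^(j+1) is a (x - t_i)^(m_i-1-j)/(x - t_i)^(m_i). -/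
theorem partialFraction_eq_zero (ht : Injective t) {m : ι → ℕ} {a : ι → ℕ → ℂ} {x₀ : ℂ}
    {U : Set ℂ} (hU : U ∈ 𝓝 x₀) (hUt : ∀ x ∈ U, ∀ i, x ≠ t i)
    (h : ∀ x ∈ U, ∑ i, ∑ j ∈ range (m i), a i j / (x - t i) ^ (j + 1) = 0)
    (hj : j < m i) : a i j = 0 := by
  have key := Polynomial.quo_mul_prod_pow_add_sum_rem_mul_prod_pow_unique (s := univ)
    (g := fun i => Polynomial.X - Polynomial.C (t i)) (fun i _ => Polynomial.monic_X_sub_C _)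
    (fun i _ k _ hik => Polynomial.pairwise_coprime_X_sub_C ht hik) (n := m) (q₁ := 0) (q₂ := 0)
    (r₁ := fun i j => Polynomial.C (a i (m i - 1 - j))) (r₂ := fun _ _ => 0)
    (fun i _ j => by rw [Polynomial.degree_X_sub_C]; exact Polynomial.degree_C_lt)
    (fun i _ j => by rw [Polynomial.degree_X_sub_C]; simp)
    (Polynomial.eq_of_infinite_eval_eq _ _ ((infinite_of_mem_nhds x₀ hU).mono fun x hx => by
      have e : ∀ i, ∑ j : Fin (m i), a i (m i - 1 - j) * (x - t i) ^ (j : ℕ) *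
          ∏ k ∈ univ.erase i, (x - t k) ^ m k =
          (∏ k, (x - t k) ^ m k) * ∑ j ∈ range (m i), a i j / (x - t i) ^ (j + 1) := by
        intro i
        have hx0 : x - t i ≠ 0 := sub_ne_zero.2 (hUt x hx i)
        rw [← Finset.sum_range_reflect, Finset.sum_range, mul_sum]
        refine sum_congr rfl fun j _ => ?_
        have hp : (x - t i) ^ m i = (x - t i) ^ (j : ℕ) * (x - t i) ^ (m i - 1 - j + 1) := by
          rw [← pow_add]; congr 1; omega
        rw [← Finset.mul_prod_erase univ _ (mem_univ i), hp]
        field_simp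
      have h0 := h x hx
      simp only [Set.mem_ofPred_eq, Polynomial.eval_mul, Polynomial.eval_zero,
        Polynomial.eval_finsetSum, Polynomial.eval_prod, Polynomial.eval_pow, Polynomial.eval_sub,
        Polynomial.eval_X, Polynomial.eval_C, zero_mul, zero_add, e, ← mul_sum, h0, mul_zero,
        Finset.sum_const_zero]))
  have h2 := congrFun (key.2 i (mem_univ i)) ⟨m i - 1 - j, by omega⟩
  simpa [show m i - 1 - (m i - 1 - j) = j by omega] using h2

/-! ### Eigenfunctions -/

theorem IsSmoothTest.gaudin (hφ : IsSmoothTest φ) (i : ι) (j : ℕ) : IsTest (gaudin t c i j φ) := by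
  have hc : ∀ {D D' : FirstOrder n}, D.IsSmooth → D'.IsSmooth → Continuous (D.act (D'.act φ)) :=
    fun h h' => ((hφ.act h').act h).contDiff.continuous
  have hz : ∀ {D D' : FirstOrder n}, ∀ u ∉ tsupport φ, D.act (D'.act φ) u = 0 := fun {D D'} u hu => by
    by_contra h
    exact hu (closure_minimal (D'.support_act_subset φ) (isClosed_tsupport φ)
      (D.support_act_subset _ h))
  have hs : support (WildHecke.gaudin t c i j φ) ⊆ tsupport φ := by
    intro u hu
    by_contra h
    refine hu ?_
    simp [WildHecke.gaudin, gaudinOf, hz u h]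
  refine ⟨?_, hφ.hasCompactSupport.mono' hs,
    (closure_minimal hs (isClosed_tsupport φ)).trans hφ.subset⟩
  have hE := opE_isSmooth (n := n) c
  have hF := opF_isSmooth (n := n) c
  have hH := opH_isSmooth (n := n) c
  have h1 := fun i a k b => hc (hE i a) (hF k b)
  have h2 := fun i a k b => hc (hF i a) (hE k b)
  have h3 := fun i a k b => hc (hH i a) (hH k b)
  unfold WildHecke.gaudin gaudinOf
  refine (continuous_finsetSum _ fun a _ => continuous_finsetSum _ fun b _ => ?_).add
    (continuous_finsetSum _ fun k _ => continuous_finsetSum _ fun a _ =>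
      continuous_finsetSum _ fun b _ => ?_)
  · split_ifs
    · exact (continuous_const.mul ((h1 i a i b).add (h2 i b i a))).add
        (continuous_const.mul (h3 i a i b))
    · exact continuous_const
  · exact continuous_const.mul (((h1 i a k b).add (h2 i a k b)).add
      (continuous_const.mul (h3 i a k b)))

/-- The generating function of the numbers `∫ ψ G_i^{(j)} φ`. -/
def pairCoeff (t : ι → ℂ) (c : ι → ℕ → ℂ) (ψ φ : Cfg n → ℂ) (x : ℂ) : ℂ :=
  ∑ i, ∑ j ∈ range (2 * n i), (∫ u, ψ u * gaudin t c i j φ u) / (x - t i) ^ (j + 1)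

theorem integral_gaudinGen (hn : ∀ i, 1 ≤ n i) (ht : Injective t) (c : ι → ℕ → ℂ)
    (hψ : MemH ψ) (hφ : IsSmoothTest φ) (hx : ∀ i, x ≠ t i) :
    ∫ u, ψ u * gaudinGen t c x φ u = pairCoeff t c ψ φ x := by
  have hi := fun i j => (hφ.gaudin (t := t) (c := c) i j).integrable_mul hψ
  simp only [gaudinGen_eq_sum hn ht c hx hφ.contDiff, mul_sum, ← mul_div_assoc]
  rw [integral_finsetSum _ fun i _ => integrable_finsetSum _ fun j _ => (hi i j).div_const _]
  refine sum_congr rfl fun i _ => ?_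
  rw [integral_finsetSum _ fun j _ => (hi i j).div_const _]
  exact sum_congr rfl fun j _ => integral_div _ _

theorem contDiffAt_pairCoeff (c : ι → ℕ → ℂ) (ψ φ : Cfg n → ℂ) (hx : ∀ i, x ≠ t i) :
    ContDiffAt ℝ ∞ (pairCoeff t c ψ φ) x := by
  unfold pairCoeff
  refine ContDiffAt.sum fun i _ => ContDiffAt.sum fun j _ => ?_
  simp only [div_eq_mul_inv]
  exact contDiffAt_const.mul (((contDiffAt_id.sub contDiffAt_const).pow _).inv
    (pow_ne_zero _ (sub_ne_zero.2 (hx i))))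

theorem IsTestFamily.isTest {g : ℂ → Cfg n → ℂ} (hg : IsTestFamily t g) (x : ℂ) : IsTest (g x) := by
  induction hg with
  | smul _ _ hf => exact ⟨continuous_const.mul hf.continuous, hf.hasCompactSupport.mul_left,
      tsupport_mul_subset_right.trans hf.subset⟩
  | add _ _ h1 h2 => exact ⟨h1.continuous.add h2.continuous,
      h1.hasCompactSupport.add h2.hasCompactSupport,
      (tsupport_add _ _).trans (Set.union_subset h1.subset h2.subset)⟩

end

/-! ### The differential equation attached to an eigenvalue -/

section

open Filter Topology

theorem exists_int_neg (hc : ∀ i, ∃ k : ℤ, (c i 0).im = k) (i : ι) :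
    ∃ k : ℤ, ((-c) i 0).im = k := by
  obtain ⟨k, hk⟩ := hc i
  exact ⟨-k, by simp [hk]⟩

/-- Locally, the eigenvalue is up to sign a smooth solution of a second order equation. -/
theorem exists_local_solution (hn : ∀ i, 1 ≤ n i) (hik : i ≠ k)
    (ht : Injective t) (hc : ∀ i, ∃ k : ℤ, (c i 0).im = k)
    {Λ : ι → ℂ → ℂ} (hΛ : ∀ i x, x ≠ t i → exp (Λ i x) = t i - x) {β : ℂ → ℂ}
    {ψ₀ φ₀ : Cfg n → ℂ} (hψ₀ : InEigenspace t c Λ β ψ₀) (hφ₀ : IsSmoothTest φ₀)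
    (h1 : ∫ u, ψ₀ u * φ₀ u = 1) {x₀ : ℂ} (hx₀ : ∀ i, x₀ ≠ t i) :
    ∃ r > 0, ∃ γ B σ : ℂ → ℂ, (∀ y ∈ ball x₀ r, (∀ i, y ≠ t i) ∧ ContDiffAt ℝ ∞ γ y ∧
        dHol (dHol γ) y = pairCoeff t (-c) ψ₀ φ₀ y * γ y ∧ ContinuousAt B y ∧ B y ≠ 0 ∧
        σ y ^ 2 = 1 ∧ prefactor n t c Λ y = σ y * B y ∧ β y = σ y * γ y) ∧
      ∀ ψ φ : Cfg n → ℂ, InEigenspace t c Λ β ψ → IsSmoothTest φ → ∀ y ∈ ball x₀ r,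
        γ y * (pairCoeff t (-c) ψ φ y - pairCoeff t (-c) ψ₀ φ₀ y * ∫ u, ψ u * φ u) = 0 := by
  have hc' := exists_int_neg hc
  obtain ⟨r, hr, ℓ, hne, hexp, hbr⟩ := exists_branch n t hx₀
  set A : ℂ → ℂ := fun x => branchProd n t (-c) (fun i => ℓ i x) x
  set B : ℂ → ℂ := fun x => branchProd n t c (fun i => ℓ i x) x
  have hA : IsBranchDisc n t (-c) A x₀ r :=
    ⟨hne, fun y hy => (hbr (-c) y hy).1, fun y hy => (hbr (-c) y hy).2⟩
  have hσ : ∀ y ∈ ball x₀ r, ∃ s : ℂ, s ^ 2 = 1 ∧ branchProd n t c (fun i => Λ i y) y = s * B y ∧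
      branchProd n t (-c) (fun i => Λ i y) y = s * A y := fun y hy =>
    exists_sign_branchProd hn t hc (fun i => by rw [hΛ i y (hne y hy i), hexp y hy i]) y
  choose! σ hσ1 hσ2 hσ3 using hσ
  set γ : ℂ → ℂ := fun x => A x * pairing t (-c) ψ₀ φ₀ x with hγd
  -- The arbitrary logarithms Λ and the smooth local ones give prefactors differing by σ. As σ² = 1,
  -- the sign can be moved to the side of the eigenvalue.
  have hR0 : ∀ y ∈ ball x₀ r, ∀ ψ f : Cfg n → ℂ, InEigenspace t c Λ β ψ → IsTest f →
      A y * pairing t (-c) ψ f y = σ y * β y * ∫ u, ψ u * f u := fun y hy ψ f hψ hf => by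
    rw [mul_assoc, eigenvalue_mul hn hik ht hc hΛ hψ hf (hne y hy), hσ3 y hy, ← mul_assoc,
      ← mul_assoc, ← pow_two, hσ1 y hy, one_mul]
  have hγ : ∀ y ∈ ball x₀ r, γ y = σ y * β y := fun y hy => by
    rw [hγd]; simp only; rw [hR0 y hy ψ₀ φ₀ hψ₀ hφ₀.isTest, h1, mul_one]
  have hR : ∀ y ∈ ball x₀ r, ∀ ψ f : Cfg n → ℂ, InEigenspace t c Λ β ψ → IsTest f →
      A y * pairing t (-c) ψ f y = γ y * ∫ u, ψ u * f u := fun y hy ψ f hψ hf => by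
    rw [hR0 y hy ψ f hψ hf, hγ y hy]
  -- The eigenvalue identity is used with the test function G(x) φ at each x. The pairing with it
  -- becomes γ(x) ∫ ψ G(x) φ, and the weak equation closes up on γ alone.
  have hweak : ∀ ψ φ : Cfg n → ℂ, InEigenspace t c Λ β ψ → IsSmoothTest φ → ∀ r', 0 < r' → r' < r →
      ∀ κ κ₂ ε x₁, IsParametrix κ κ₂ ε x₁ x₀ r' → ∫ x, κ x * (pairCoeff t (-c) ψ φ x * γ x) =
        (∫ u, ψ u * φ u) * (ε * γ x₁ + ∫ x, κ₂ x * γ x) := by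
    intro ψ φ hψ hφ r' hr' hr'r κ κ₂ ε x₁ hκ
    have hsub := closedBall_subset_ball (x := x₀) hr'r
    have hw := weak_equation hn hik ht hc' hψ.1 hφ hA hr' hr'r hκ
    have e1 : ∀ x, κ x * (A x * pairing t (-c) ψ (gaudinGen t (-c) x φ) x) =
        κ x * (pairCoeff t (-c) ψ φ x * γ x) := fun x => by
      by_cases hx : x ∈ closedBall x₀ r'
      · rw [hR x (hsub hx) ψ _ hψ ((isTestFamily_gaudinGen t (-c) hφ).isTest x),
          integral_gaudinGen hn ht (-c) hψ.1 hφ (hne x (hsub hx)), mul_comm (γ x)]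
      · rw [hκ.eq_zero x hx, zero_mul, zero_mul]
    have e2 : ∀ x, κ₂ x * (A x * pairing t (-c) ψ φ x) = (∫ u, ψ u * φ u) * (κ₂ x * γ x) :=
      fun x => by
        by_cases hx : x ∈ closedBall x₀ r'
        · rw [hR x (hsub hx) ψ _ hψ hφ.isTest]; ring
        · rw [hκ.eq_zero₂ x hx, zero_mul, zero_mul, mul_zero]
    simp only [e1, e2, integral_const_mul] at hw
    rw [hw, hR x₁ (hsub hκ.mem) ψ _ hψ hφ.isTest]
    ring
  have hq : ∀ ψ φ, ∀ y ∈ ball x₀ r, ContDiffAt ℝ ∞ (pairCoeff (n := n) t (-c) ψ φ) y :=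
    fun ψ φ y hy => contDiffAt_pairCoeff _ _ _ (hne y hy)
  have hAc : ∀ r' < r, ContinuousOn A (closedBall x₀ r') := fun r' hr' y hy =>
    (hA.contDiffAt y (closedBall_subset_ball hr' hy)).continuousAt.continuousWithinAt
  have hpb : ∀ r' < r, ∃ C : ℝ, ∀ x ∈ closedBall x₀ r', ‖pairing t (-c) ψ₀ φ₀ x‖ ≤ C :=
    fun r' hr' => exists_pairing_bound hn hik ht (-c) hψ₀.1 hφ₀.isTest (isCompact_closedBall x₀ r')
      fun x hx => hne x (closedBall_subset_ball hr' hx)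
  have hsol : IsWeakSolution x₀ r γ (pairCoeff t (-c) ψ₀ φ₀) := by
    refine ⟨fun r' hr' => ?_, fun r' hr' => ?_, hq ψ₀ φ₀, fun r' hr' hr'r κ κ₂ ε x₁ hκ => by
      rw [hweak ψ₀ φ₀ hψ₀ hφ₀ r' hr' hr'r κ κ₂ ε x₁ hκ, h1, one_mul]⟩
    · obtain ⟨C, hC⟩ := hpb r' hr'
      have hi : IntegrableOn (pairing t (-c) ψ₀ φ₀) (closedBall x₀ r') :=
        Measure.integrableOn_of_bounded (isCompact_closedBall x₀ r').measure_lt_top.ne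
          (measurable_pairing t (-c) hψ₀.1.measurable
            hφ₀.contDiff.continuous.measurable).aestronglyMeasurable
          ((ae_restrict_iff' measurableSet_closedBall).2 (Eventually.of_forall hC))
      exact hi.continuousOn_mul (hAc r' hr') (isCompact_closedBall x₀ r')
    · obtain ⟨C, hC⟩ := hpb r' hr'
      obtain ⟨M, hM⟩ := (isCompact_closedBall x₀ r').exists_bound_of_continuousOn (hAc r' hr')
      refine ⟨M * C, fun x hx => ?_⟩
      rw [norm_mul]
      exact mul_le_mul (hM x hx) (hC x hx) (norm_nonneg _) ((norm_nonneg _).trans (hM x hx))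
  refine ⟨r, hr, γ, B, σ, fun y hy => ⟨hne y hy, (hsol.regularity hy).1, (hsol.regularity hy).2,
    (hbr c y hy).2.continuousAt, branchProd_ne_zero _ _ _ _, hσ1 y hy, ?_, ?_⟩,
    fun ψ φ hψ hφ y hy => ?_⟩
  · rw [prefactor_eq t c (hne y hy) fun i => hΛ i y (hne y hy i), hσ2 y hy]
  · rw [hγ y hy, ← mul_assoc, ← pow_two, hσ1 y hy, one_mul]
  · set N := ∫ u, ψ u * φ u
    have c0 : ∀ ψ φ, ContinuousOn (fun y => pairCoeff (n := n) t (-c) ψ φ y * γ y)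
        (ball x₀ r) := fun ψ φ y hy =>
      ((hq ψ φ y hy).continuousAt.mul (hsol.regularity hy).1.continuousAt).continuousWithinAt
    -- For (ψ, φ) and for (ψ₀, φ₀) the weak equations have the same right side up to the factor N =
    -- ∫ ψ φ. Their difference is orthogonal to every test function.
    have h2 := eq_zero_of_integral_eq_zero (F := fun y => pairCoeff t (-c) ψ φ y * γ y -
      N * (pairCoeff t (-c) ψ₀ φ₀ y * γ y)) ((c0 ψ φ).sub ((c0 ψ₀ φ₀).const_smul N))
      (fun r' η hr' hr'r hP hint => by
        have i2 := (hint _ (c0 ψ₀ φ₀)).const_mul N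
        simp only [mul_sub, mul_left_comm _ N]
        rw [integral_sub (hint _ (c0 ψ φ)) i2, integral_const_mul,
          hweak ψ φ hψ hφ r' hr' hr'r _ _ _ _ hP, hweak ψ₀ φ₀ hψ₀ hφ₀ r' hr' hr'r _ _ _ _ hP, h1,
          one_mul, sub_self]) hy
    linear_combination h2

theorem dHol_const_mul {f : ℂ → ℂ} (a : ℂ) (hf : DifferentiableAt ℝ f z) :
    dHol (fun y => a * f y) z = a * dHol f z := (HasDHolAt.const_mul ⟨hf, rfl⟩ a).eq

end

end WildHecke

end

/-! ### The main theorem -/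

open WildHecke

theorem mainTheorem4 {ι : Type*} [Fintype ι] [DecidableEq ι]
    (n : ι → ℕ) (hn : ∀ i, 1 ≤ n i) (hcard : 2 ≤ Fintype.card ι)
    (t : ι → ℂ) (ht : Function.Injective t) (c : ι → ℕ → ℂ)
    (hc_int : ∀ i, ∃ k : ℤ, (c i 0).im = (k : ℝ)) (hc_sum : ∑ i, c i 0 = 0)
    (hc_top : ∀ i, 2 ≤ n i → c i (n i - 1) ≠ 0) : ∃ l : ι → ℕ → ℂ,
      -- `G(x)` is the generating function of the operators `G_i^{(j)}`
      (∀ φ : WildHecke.Cfg n → ℂ, ContDiff ℝ ∞ φ → ∀ x : ℂ, (∀ i, x ≠ t i) → ∀ u,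
        WildHecke.gaudinGen t c x φ u = ∑ i, ∑ j ∈ Finset.range (2 * n i),
            WildHecke.gaudin t c i j φ u / (x - t i) ^ (j + 1)) ∧
      -- `G_i^{(j)}` acts by the number `l_i^{(j)}` for `n_i ≤ j < 2 n_i`, by zero for `j ≥ 2 n_i`
      (∀ i j, n i ≤ j → j < 2 * n i → ∀ φ : WildHecke.Cfg n → ℂ, ContDiff ℝ ∞ φ →
        ∀ u, WildHecke.gaudin t c i j φ u = l i j * φ u) ∧
      (∀ i j, 2 * n i ≤ j → ∀ φ : WildHecke.Cfg n → ℂ, ContDiff ℝ ∞ φ →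
        ∀ u, WildHecke.gaudin t c i j φ u = 0) ∧
      -- at a glued point the oper has a pole of order exactly `2 n_i ≥ 4`
      (∀ i, 2 ≤ n i → l i (2 * n i - 1) ≠ 0) ∧
      -- for every choice of the logarithms of `t_i - x` and every joint eigenvalue
      ∀ Λ : ι → ℂ → ℂ, (∀ i x, x ≠ t i → Complex.exp (Λ i x) = t i - x) →
      ∀ β : ℂ → ℂ, WildHecke.IsJointEigenvalue n t c Λ β → ∃ μ : ι → ℕ → ℂ,
          (∀ ψ : WildHecke.Cfg n → ℂ, WildHecke.InEigenspace t c Λ β ψ →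
            ∀ i j, j < n i → WildHecke.DistribEigen t c i j ψ (μ i j)) ∧
          -- wherever the normalizing factor of `H_x` is a continuous branch
          ∀ D : Set ℂ, IsOpen D → (∀ x ∈ D, ∀ i, x ≠ t i) →
            ContinuousOn (WildHecke.prefactor n t c Λ) D →
            ContDiffOn ℝ ∞ β D ∧ ∀ x ∈ D, WildHecke.oper n t l μ β x = 0 := by
  refine ⟨gaudinScalar n c, fun φ hφ x hx u => gaudinGen_eq_sum hn ht c hx hφ u,
    fun i j hj _ φ hφ u => gaudin_eq_scalar hn t c hj hφ u, fun i j hj φ hφ u => by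
      rw [gaudin_eq_scalar hn t c (by have := hn i; omega) hφ u,
        gaudinScalar_eq_zero c hj, zero_mul],
    fun i hi => gaudinScalar_top hi (hc_top i hi), fun Λ hΛ β hβ => ?_⟩
  obtain ⟨ψ₀, hψ₀, hne₀⟩ := hβ
  obtain ⟨i₀, k₀, hik⟩ := Fintype.one_lt_card_iff.1 (by omega : 1 < Fintype.card ι)
  obtain ⟨φ₀, hφ₀, hφU, h1⟩ := exists_isSmoothTest hn hik hψ₀.1 hne₀
  set q := pairCoeff t (-c) ψ₀ φ₀ with hq
  -- The eigenvalue of G_i^{(j)} is read off from a single normalized pair. The sign of c is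
  -- reversed because the operator acts on the test function.
  set μ : ι → ℕ → ℂ := fun i j => ∫ u, ψ₀ u * gaudin t (-c) i j φ₀ u with hμ
  have hloc := fun x₀ (hx₀ : ∀ i, x₀ ≠ t i) =>
    exists_local_solution hn hik ht hc_int hΛ hψ₀ hφ₀ h1 hx₀
  refine ⟨μ, fun ψ hψ i j hj φ hφ hφc hφs => ?_, fun D hD hDt hpre => ?_⟩
  · obtain ⟨x₁, hx₁, hp⟩ := exists_pairing_ne_zero hn hik ht
      (exists_int_neg hc_int) (c := -c) (by simp [hc_sum]) hψ₀.1 hφ₀.isTest hφU h1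
    obtain ⟨r, hr, γ, B, σ, hγ, hrel⟩ := hloc x₁ hx₁
    have hm := Metric.mem_ball_self (x := x₁) hr
    have hβ := eigenvalue_mul hn hik ht hc_int hΛ hψ₀ hφ₀.isTest hx₁
    obtain ⟨-, hγ1, -, -, -, -, -, hγ2⟩ := hγ x₁ hm
    have hγ0 : γ x₁ ≠ 0 := fun h => by
      rw [h1, hγ2, h, mul_zero, zero_mul] at hβ
      exact mul_ne_zero (branchProd_ne_zero _ _ _ _) hp hβ.symm
    -- The pairing is nonzero at x₁, hence γ is nonzero on a neighbourhood and may be cancelled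
    -- there.
    have hU : {y | γ y ≠ 0} ∩ Metric.ball x₁ r ∈ nhds x₁ :=
      Filter.inter_mem (hγ1.continuousAt.eventually_ne hγ0) (Metric.ball_mem_nhds x₁ hr)
    -- After cancelling γ, a rational function with poles at the t_i vanishes on an open set, so its
    -- coefficients vanish one by one.
    have key := partialFraction_eq_zero ht (m := fun i => 2 * n i)
      (a := fun i j => (∫ u, ψ u * gaudin t (-c) i j φ u) - μ i j * ∫ u, ψ u * φ u) hU
      (fun x hx => (hγ x hx.2).1) (fun x hx => by
        have h := (mul_eq_zero.1 (hrel ψ φ hψ ⟨hφ, hφc, hφs⟩ x hx.2)).resolve_left hx.1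
        rw [← h, pairCoeff, pairCoeff, Finset.sum_mul, ← Finset.sum_sub_distrib]
        refine Finset.sum_congr rfl fun i _ => ?_
        rw [Finset.sum_mul, ← Finset.sum_sub_distrib]
        exact Finset.sum_congr rfl fun j _ => by ring) (i := i) (j := j) (by omega)
    simp only [gaudinTranspose_eq t c i j hφ]
    exact sub_eq_zero.1 key
  -- For j ≥ n_i the operator for -c is the same scalar as for c, and ∫ ψ₀ φ₀ = 1; so the upper part
  -- of q is the one prescribed by l.
  · have hμl : ∀ i j, n i ≤ j → μ i j = gaudinScalar n c i j := fun i j hj => by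
      simp only [hμ, gaudin_eq_scalar hn t (-c) hj hφ₀.contDiff, gaudinScalar_neg hn c hj]
      have e : ∀ u, ψ₀ u * (gaudinScalar n c i j * φ₀ u) =
          gaudinScalar n c i j * (ψ₀ u * φ₀ u) := fun u => by ring
      simp only [e]
      rw [integral_const_mul, h1, mul_one]
    have main : ∀ x ∈ D, ContDiffAt ℝ ∞ β x ∧ oper n t (gaudinScalar n c) μ β x = 0 := by
      intro x hx
      obtain ⟨r, hr, γ, B, σ, hγ, -⟩ := hloc x (hDt x hx)
      have hm := Metric.mem_ball_self (x := x) hr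
      obtain ⟨hxt, hγ1, hγ2, hB, hB0, hσ1, hσ2, hσ3⟩ := hγ x hm
      -- The sign is the quotient of the given prefactor by the smooth branch B. Here the assumed
      -- continuity of the normalizing factor is used.
      have hσc : ContinuousAt σ x := by
        refine ((hpre.continuousAt (hD.mem_nhds hx)).div hB hB0).congr ?_
        filter_upwards [Metric.ball_mem_nhds x hr] with y hy
        obtain ⟨-, -, -, -, hy0, -, hy2, -⟩ := hγ y hy
        rw [Pi.div_apply, hy2, mul_div_cancel_right₀ _ hy0]
      have hσx : σ x ≠ 0 := fun h => by simp [h] at hσ1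
      -- A continuous function with σ² = 1 is locally constant: (σ y + σ x)(σ y - σ x) = 0 and the
      -- first factor is nonzero near x. So β is a constant multiple of γ nearby.
      have hβγ : β =ᶠ[nhds x] fun y => σ x * γ y := by
        have h2 : ∀ᶠ y in nhds x, σ y + σ x ≠ 0 :=
          (hσc.add continuousAt_const).eventually_ne (by simpa [← two_mul] using hσx)
        filter_upwards [Metric.ball_mem_nhds x hr, h2] with y hy hy2
        obtain ⟨-, -, -, -, -, hy1, -, hy3⟩ := hγ y hy
        have : (σ y + σ x) * (σ y - σ x) = 0 := by linear_combination hy1 - hσ1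
        rw [hy3, sub_eq_zero.1 ((mul_eq_zero.1 this).resolve_left hy2)]
      have hβs : ContDiffAt ℝ ∞ β x := (contDiffAt_const.mul hγ1).congr_of_eventuallyEq hβγ
      refine ⟨hβs, ?_⟩
      have hd1 : dHol β =ᶠ[nhds x] fun y => σ x * dHol γ y := by
        refine (dHol_congr hβγ).trans ?_
        filter_upwards [Metric.ball_mem_nhds x hr] with y hy
        exact dHol_const_mul _ ((hγ y hy).2.1.differentiableAt (by simp))
      have hd2 : dHol (dHol β) x = σ x * (q x * γ x) := by
        rw [(dHol_congr hd1).self_of_nhds, dHol_const_mul _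
          ((ContDiffAt.dHol hγ1).differentiableAt (by simp)), hγ2]
      have hqx : q x = (∑ i, ∑ j ∈ Finset.Ico (n i) (2 * n i),
          gaudinScalar n c i j / (x - t i) ^ (j + 1)) +
          ∑ i, ∑ j ∈ Finset.range (n i), μ i j / (x - t i) ^ (j + 1) := by
        rw [hq, pairCoeff, ← Finset.sum_add_distrib]
        refine Finset.sum_congr rfl fun i _ => ?_
        rw [← Finset.sum_range_add_sum_Ico _ (by omega : n i ≤ 2 * n i), add_comm]
        congr 1
        refine Finset.sum_congr rfl fun j hj => ?_
        rw [← hμl i j (Finset.mem_Ico.1 hj).1]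
      rw [oper, hd2, hσ3, hqx]
      ring
    exact ⟨fun x hx => (main x hx).1.contDiffWithinAt, fun x hx => (main x hx).2⟩
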